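/- **Setting.** Let $n\ge 2$, let $\Omega\subset\mathbb R^n$ be a bounded domain (open, connected, nonempty) with smooth boundary and unit outer normal $n(x)$, let $\varphi$ be a smooth real function and $Y$ a smooth field of skew-symmetric $n\times n$ matrices (both defined on $\mathbb R^n$), let $F(x,\theta)=-\nabla\varphi(x)+Y(x)\theta$, and let $\tau>\max\{\max_{\overline\Omega}\varphi,0\}$. Put $p(x)=\sqrt{2(\tau-\varphi(x))}$, $$S^\tau\Omega=\{(x,\theta): x\in\Omega,\ \theta\ne0,\ \tfrac12|\theta|^2+\varphi(x)=\tau\},$$ and define $S^\tau\overline\Omega$ and $\partial S^\tau\Omega$ in the same way with $x\in\overline\Omega$, resp. $x\in\partial\Omega$. Let $S^\tau\overline\Omega^2$ be the set of $(x,\theta,\theta')$ with $(x,\theta),(x,\theta')\in S^\tau\overline\Omega$, and $\partial_\pm S^\tau\Omega=\{(x,\theta)\in\partial S^\tau\Omega:\pm n(x)\cdot\theta>0\}$. The fibre $S_x^\tau$ over $x$ is the sphere of radius $p(x)$, with surface measure $d\theta$; $L^2(S^\tau\Omega)$ is taken with respect to $d\theta\,dx$, and $d\xi=|n(x)\cdot\theta|\,d\mu(x)\,d\theta$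 on $\partial_\pm S^\tau\Omega$, where $\mu$ is surface measure on $\partial\Omega$. All functions take values in $\mathbb K=\mathbb R$ or $\mathbb K=\mathbb C$, and the spaces of continuous functions carry the supremum norm. For $(x,\theta)\in S^\tau\overline\Omega$ let $\gamma_{x,\theta}$ be the solution of $\ddot\gamma=F(\gamma,\dot\gamma)$, $\gamma(0)=x$, $\dot\gamma(0)=\theta$, and let $\ell_-(x,\theta)\le 0\le\ell_+(x,\theta)$ be the infimum and the supremum of the times $t$ such that $\gamma_{x,\theta}$ stays in $\overline\Omega$ between the times $0$ and $t$. Assume that * the trajectories are non-trapping: $\ell_\pm(x,\theta)$ is finite for every $(x,\theta)\in S^\tau\overline\Omega$; * $\partial\Omega$ is strictly convex with respect to $F$: for all $(x,\theta)\in\partial S^\tau\Omega$ with $n(x)\cdot\theta=0$ there is $\delta>0$ with $\gamma_{x,\theta}(t)\notin\overline\Omega$ for $0<|t|<\delta$. For $\sigma\in C(S^\tau\overline\Omega)$ and $k\in C(S^\tau\overline\Omega^2)$ let $K u(x,\theta)=\int_{S_x^\tau}k(x,\theta,\theta')u(x,\theta')\,d\theta'$. For $f\in L^2(S^\tau\Omega)$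 consider the problem $$\theta\cdot\nabla_xu+F\cdot\nabla_\theta u+\sigma u=Ku+f\ \text{ in }S^\tau\Omega,\qquad u=0\ \text{ on }\partial_-S^\tau\Omega. \tag{P}$$ A solution is a $u\in L^2(S^\tau\Omega)$ with a representative that, along almost every trajectory $t\mapsto(\gamma_{x,\theta}(t),\dot\gamma_{x,\theta}(t))$, $\ell_-<t<\ell_+$, is locally absolutely continuous with derivative $Ku+f-\sigma u$, and whose limit along the trajectory issued from $z$ is $0$ for $d\xi$-almost every $z\in\partial_-S^\tau\Omega$. Its boundary value $u|_{\partial_+S^\tau\Omega}$ is the $d\xi$-a.e. limit of that representative along the trajectory as it reaches the point of $\partial_+S^\tau\Omega$. **Theorem (well-posedness).** There is an open and dense set $\mathscr U\subset C(S^\tau\overline\Omega)\times C(S^\tau\overline\Omega^2)$, containing a neighbourhood of $(0,0)$, such that for every $(\sigma,k)\in\mathscr U$: 1. for every $f\in L^2(S^\tau\Omega)$ the problem (P) has a unique solution $u\in L^2(S^\tau\Omega)$; 2. the measurement map $\mathcal A f:=u|_{\partial_+S^\tau\Omega}$ is a well-defined bounded linear operator $\mathcal A:L^2(S^\tau\Omega)\to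 L^2(\partial_+S^\tau\Omega,d\xi)$. -/

import Mathlib

open MeasureTheory Filter Topology Set Metric
open scoped ContDiff

noncomputable section

/-- Euclidean space `ℝⁿ`. -/
abbrev RSpace (n : ℕ) : Type := EuclideanSpace ℝ (Fin n)

/-- A bounded domain `Ω ⊆ ℝⁿ` with smooth boundary, described by a smooth defining function `ρ`,
together with a smooth potential `φ`, a smooth field `Y` of skew-symmetric matrices and an energy
level `τ > max {max φ, 0}`.  The fields `φ` and `Y` are defined on all of `ℝⁿ`; only
their values near the closure of `Ω` matter. -/
structure TransportSetting (n : ℕ) where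
  Ω : Set (RSpace n)
  isConnected : IsConnected Ω
  isBounded : Bornology.IsBounded Ω
  ρ : RSpace n → ℝ
  ρ_smooth : ContDiff ℝ ∞ ρ
  Ω_eq : Ω = {x | ρ x < 0}
  ρ_regular : ∀ x, ρ x = 0 → gradient ρ x ≠ 0
  φ : RSpace n → ℝ
  φ_smooth : ContDiff ℝ ∞ φ
  Y : RSpace n → (RSpace n →L[ℝ] RSpace n)
  Y_smooth : ContDiff ℝ ∞ Y
  Y_skew : ∀ x v w, inner ℝ (Y x v) w = -inner ℝ v (Y x w)
  τ : ℝ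
  τ_pos : 0 < τ
  φ_lt : ∀ x ∈ closure Ω, φ x < τ

/-- Extension by zero of a function defined on a subset. -/
def extendByZero {X R : Type*} [Zero R] {s : Set X} (c : s → R) : X → R :=
  Function.extend Subtype.val c 0

namespace TransportSetting

variable {n : ℕ} (S : TransportSetting n)

/-- The unit outer normal `n(x)` at a boundary point `x`. -/
def normal (x : RSpace n) : RSpace n := ‖gradient S.ρ x‖⁻¹ • gradient S.ρ x

/-- The speed `p(x) = √(2(τ - φ(x)))`. -/
def speed (x : RSpace n) : ℝ := Real.sqrt (2 * (S.τ - S.φ x))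

/-- The energy `H(x,θ) = |θ|²/2 + φ(x)`. -/
def energy (z : RSpace n × RSpace n) : ℝ := ‖z.2‖ ^ 2 / 2 + S.φ z.1

/-- The bundle `S^τ A` of phase points of energy `τ` over a set `A` of positions. -/
def bundle (A : Set (RSpace n)) : Set (RSpace n × RSpace n) :=
  {z | z.1 ∈ A ∧ z.2 ≠ 0 ∧ S.energy z = S.τ}

/-- The bundle over the closure of the domain. -/
def closedBundle : Set (RSpace n × RSpace n) := S.bundle (closure S.Ω)

/-- The set of all `(x,θ,θ')` with `x` in the closure of the domain and `θ, θ'` in the fibre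
at `x`. -/
def closedBundle₂ : Set (RSpace n × RSpace n × RSpace n) :=
  {q | (q.1, q.2.1) ∈ S.closedBundle ∧ (q.1, q.2.2) ∈ S.closedBundle}

/-- Outgoing boundary `∂₊`. -/
def outgoingSet : Set (RSpace n × RSpace n) :=
  {z ∈ S.bundle (frontier S.Ω) | 0 < inner ℝ (S.normal z.1) z.2}

/-- Incoming boundary `∂₋`. -/
def incomingSet : Set (RSpace n × RSpace n) :=
  {z ∈ S.bundle (frontier S.Ω) | inner ℝ (S.normal z.1) z.2 < 0}

/-! ### The dynamics -/

/-- The external force `F(x,θ) = -∇φ(x) + Y(x)θ`. -/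
def force (z : RSpace n × RSpace n) : RSpace n := -gradient S.φ z.1 + S.Y z.1 z.2

/-- The vector field `(x,θ) ↦ (θ, F(x,θ))`, i.e. the operator `θ·∇ₓ + F·∇_θ`. -/
def field (z : RSpace n × RSpace n) : RSpace n × RSpace n := (z.2, S.force z)

/-- `c` is a trajectory issued from `z` at time `0` and defined on the interval between `0`
and `t` (`t` may be negative). -/
def IsTrajectory (z : RSpace n × RSpace n) (t : ℝ) (c : ℝ → RSpace n × RSpace n) : Prop :=
  c 0 = z ∧ IsIntegralCurveOn c (fun _ => S.field) (uIcc 0 t)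

open Classical in
/-- The flow: `S.flow z t = (γ_z(t), γ̇_z(t))` whenever the trajectory issued from `z` exists up to
time `t` (it is then unique); outside the interval of existence the value is the
irrelevant `z`. -/
def flow (z : RSpace n × RSpace n) (t : ℝ) : RSpace n × RSpace n :=
  if h : ∃ c, S.IsTrajectory z t c then h.choose t else z

/-- The set of times `t` such that the trajectory issued from `z` exists and stays in the closure
of the domain between the times `0` and `t`. -/
def residence (z : RSpace n × RSpace n) : Set ℝ :=
  {t | ∃ c, S.IsTrajectory z t c ∧ ∀ s ∈ uIcc 0 t, (c s).1 ∈ closure S.Ω}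

/-- The forward travel time `ℓ₊`. -/
def exitTime (z : RSpace n × RSpace n) : ℝ := sSup (S.residence z)

/-- The backward travel time `ℓ₋` (a nonpositive number). -/
def entryTime (z : RSpace n × RSpace n) : ℝ := sInf (S.residence z)

/-- Non-trapping: all travel times `ℓ₊`, `ℓ₋` are finite. -/
def NonTrapping : Prop :=
  ∀ z ∈ S.closedBundle, BddAbove (S.residence z) ∧ BddBelow (S.residence z)

/-- Strict convexity of the boundary with respect to the external force. -/
def StrictlyConvexBoundary : Prop :=
  ∀ z ∈ S.bundle (frontier S.Ω), inner ℝ (S.normal z.1) z.2 = 0 →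
    ∃ δ > 0, ∀ t ∈ Ioo (-δ) δ, t ≠ 0 → (S.flow z t).1 ∉ closure S.Ω

/-! ### Measures -/

/-- The surface measure `dθ` on the fibre at `x`, the sphere of radius `p(x)`. -/
def fiberMeasure (x : RSpace n) : Measure (RSpace n) :=
  ENNReal.ofReal (S.speed x ^ (n - 1)) •
    (volume : Measure (RSpace n)).toSphere.map
      (fun v : sphere (0 : RSpace n) 1 => S.speed x • (v : RSpace n))

/-- The measure `dθ dm(x)`, for a measure `m` in the position variable: the image of
`p(x)ⁿ⁻¹ dm(x) dv` under `(x,v) ↦ (x, p(x)v)`, `v` in the unit sphere. -/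
def phaseMeasure (m : Measure (RSpace n)) : Measure (RSpace n × RSpace n) :=
  ((m.prod (volume : Measure (RSpace n)).toSphere).withDensity
      (fun q => ENNReal.ofReal (S.speed q.1 ^ (n - 1)))).map
    (fun q => (q.1, S.speed q.1 • (q.2 : RSpace n)))

/-- The measure `dθ dx` on the bundle over the domain. -/
def bulk : Measure (RSpace n × RSpace n) := S.phaseMeasure (volume.restrict S.Ω)

/-- The measure `dξ = |n(x)·θ| dθ dμ(x)` on the bundle over the boundary, with `dμ` the surface
measure of the boundary. -/
def ξ : Measure (RSpace n × RSpace n) :=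
  (S.phaseMeasure ((Measure.euclideanHausdorffMeasure (n - 1)).restrict
      (frontier S.Ω))).withDensity
    (fun z => ENNReal.ofReal |inner ℝ (S.normal z.1) z.2|)

/-- `dξ` on the outgoing boundary. -/
def ξOut : Measure (RSpace n × RSpace n) := S.ξ.restrict S.outgoingSet

/-- `dξ` on the incoming boundary. -/
def ξIn : Measure (RSpace n × RSpace n) := S.ξ.restrict S.incomingSet

/-! ### The transport problem -/

variable {𝕜 : Type*} [RCLike 𝕜]

/-- The scattering operator `K(w)(x,θ) = ∫ k(x,θ,θ') w(x,θ') dθ'`. -/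
def scattering (k : C(S.closedBundle₂, 𝕜)) (w : RSpace n × RSpace n → 𝕜)
    (z : RSpace n × RSpace n) : 𝕜 :=
  ∫ η, extendByZero k (z.1, z.2, η) * w (z.1, η) ∂S.fiberMeasure z.1

/-- `θ·∇ₓw + F·∇_θ w = h` in the bundle over the domain: along almost every trajectory, as long as
it runs inside the domain, `w` is locally absolutely continuous with derivative `h`. -/
def HasTransportDeriv (w h : RSpace n × RSpace n → 𝕜) : Prop :=
  ∀ᵐ z ∂S.bulk, ∀ a ∈ Ioo (S.entryTime z) (S.exitTime z),
    ∀ b ∈ Ioo (S.entryTime z) (S.exitTime z),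
      IntervalIntegrable (fun t => h (S.flow z t)) volume a b ∧
        w (S.flow z b) - w (S.flow z a) = ∫ t in a..b, h (S.flow z t)

/-- `w = g` on the outgoing boundary, as a limit along trajectories. -/
def HasOutgoingTrace (w g : RSpace n × RSpace n → 𝕜) : Prop :=
  ∀ᵐ z ∂S.ξOut, Tendsto (fun t => w (S.flow z t)) (𝓝[<] 0) (𝓝 (g z))

/-- `w = g` on the incoming boundary, as a limit along trajectories. -/
def HasIncomingTrace (w g : RSpace n × RSpace n → 𝕜) : Prop :=
  ∀ᵐ z ∂S.ξIn, Tendsto (fun t => w (S.flow z t)) (𝓝[>] 0) (𝓝 (g z))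

/-- The function `w` satisfies `θ·∇ₓw + F·∇_θ w + σw = K(w) + f` in the bundle over the domain and
`w = 0` on the incoming boundary. -/
structure SolvesTransport (σ : C(S.closedBundle, 𝕜)) (k : C(S.closedBundle₂, 𝕜))
    (f w : RSpace n × RSpace n → 𝕜) : Prop where
  equation : S.HasTransportDeriv w (fun z => S.scattering k w z + f z - extendByZero σ z * w z)
  incoming : S.HasIncomingTrace w 0

/-- `u ∈ L²` is a solution of the transport problem with source `f ∈ L²` and zero incoming data:
it has a representative that satisfies the equation and the boundary condition. -/
def IsSolution (σ : C(S.closedBundle, 𝕜)) (k : C(S.closedBundle₂, 𝕜))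
    (f u : Lp 𝕜 2 S.bulk) : Prop :=
  ∃ w : RSpace n × RSpace n → 𝕜, w =ᵐ[S.bulk] u ∧ S.SolvesTransport σ k f w

/-- `g` is the measurement produced by the source `f`: the outgoing boundary value of an `L²`
solution with source `f`. -/
def IsMeasurement (σ : C(S.closedBundle, 𝕜)) (k : C(S.closedBundle₂, 𝕜))
    (f : Lp 𝕜 2 S.bulk) (g : Lp 𝕜 2 S.ξOut) : Prop :=
  ∃ w : RSpace n × RSpace n → 𝕜, MemLp w 2 S.bulk ∧ S.SolvesTransport σ k f w ∧
    S.HasOutgoingTrace w g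

end TransportSetting

end

/-! Let `R` denote integration along the trajectory from the entry point up to the given phase
point. A solution vanishes at the entry point, so (P) is equivalent to the fixed point equation `u =
R (K u - M u + f)` in L², where `M` is multiplication by σ (`isSolution_iff`). Everything depends on
the invertibility of `1 - R (K - M)`. This operator is a continuous function of (σ, k), since `K`
and `M` are bounded linear in k and σ. The pairs for which it is a unit therefore form an open set,
and this set contains the origin, where the operator is `1`.

Density rests on two facts. First, `1 + R M` is always invertible (`isUnit_one_add_orbitOp_mul`):
`R` is of Volterra type, and conjugation by the exponential of `l` times the entry time commutes
with `M` and reduces the norm of `R` to O(1/l). Second, `R K` is compact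
(`exists_tendsto_orbitOp_scattering`). Hence `1 - R (l K - M) = (1 + R M) (1 - l G)` with `G`
compact. The nonzero eigenvalues of `G` do not accumulate at 1, so real `l` arbitrarily close to 1
give a unit (`exists_isUnit_one_sub_smul`), and k need only be replaced by l k.

Compactness of `R K` is a velocity averaging effect: scattering sees only integrals over fibres. If
two times on a trajectory differ by more than `δ` and less than a fixed `r`, then the later
position, as a function of the earlier direction and of the elapsed time, is a change of variables
with Lipschitz inverse (`exists_expMap_antilipschitz`). The contributions of two separated time
windows therefore pair like an operator with bounded kernel (`exists_norm_inner_le`), and the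
pairing tends to zero along orthonormal sequences. When `[0, r]` is cut into N windows only the at
most 3N neighbouring pairs survive, each of size O(1/N²). Longer times are reached by transport
along the flow. Compactness is expressed throughout as convergence to zero along orthonormal
sequences.

The measure theory uses only Lipschitz bounds for the flow; neither Liouville's theorem nor
Santaló's formula is invoked. Sets in the energy surface are thickened to truncated cones, on which
the radially extended flow is Lipschitz for Lebesgue measure; so the flow distorts `bulk` by a
bounded factor (`exists_bulk_preimage_le`). One inequality of Santaló's formula
(`orbitBound_boundary`) gives meaning to `R` at boundary points and makes the measurement bounded in
L². The converse transfer of null sets (`ae_entry`) carries the incoming boundary condition to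
almost every trajectory and gives uniqueness. Strict convexity enters by forcing trajectories to
meet the boundary only at their ends, and there transversally. -/

section FunctionalAnalysis

/-! ### Compactness through orthonormal sequences -/

variable {𝕜 H : Type*} [RCLike 𝕜] [NormedAddCommGroup H] [InnerProductSpace 𝕜 H]

/-- An operator that tends to zero along every orthonormal sequence is small on the orthogonal
complement of a finite-dimensional subspace. -/
theorem exists_finiteDimensional_norm_le_on_orthogonal (G : H →L[𝕜] H)
    (hG : ∀ e : ℕ → H, Orthonormal 𝕜 e → Tendsto (fun i => G (e i)) atTop (𝓝 0))
    {ε : ℝ} (hε : 0 < ε) :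
    ∃ V : Submodule 𝕜 H, FiniteDimensional 𝕜 V ∧ ∀ x ∈ Vᗮ, ‖G x‖ ≤ ε * ‖x‖ := by
  classical
  by_contra! hcon
  -- Were the bound false on every such complement, a unit vector with `ε < ‖G y‖` could be found
  -- orthogonal to any finite set of earlier ones. The resulting orthonormal sequence contradicts
  -- `hG`.
  have step : ∀ s : Finset H, (∀ x ∈ s, ‖x‖ = 1 ∧ ε < ‖G x‖) →
      ∃ y, (‖y‖ = 1 ∧ ε < ‖G y‖) ∧ ∀ x ∈ s, inner 𝕜 x y = 0 := by
    intro s _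
    obtain ⟨x, hx, hGx⟩ := hcon (Submodule.span 𝕜 (s : Set H))
      (FiniteDimensional.span_of_finite 𝕜 s.finite_toSet)
    have hx0 : 0 < ‖x‖ := by
      rw [norm_pos_iff]
      rintro rfl
      simp at hGx
    refine ⟨((‖x‖⁻¹ : ℝ) : 𝕜) • x, ⟨?_, ?_⟩, fun z hz => ?_⟩
    · rw [norm_smul, RCLike.norm_ofReal, abs_of_pos (inv_pos.2 hx0), inv_mul_cancel₀ hx0.ne']
    · rw [map_smul, norm_smul, RCLike.norm_ofReal, abs_of_pos (inv_pos.2 hx0),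
        ← div_eq_inv_mul, lt_div_iff₀ hx0]
      exact hGx
    · rw [inner_smul_right, (Submodule.mem_orthogonal _ _).1 hx z (Submodule.subset_span hz),
        mul_zero]
  obtain ⟨e, he, hr⟩ := exists_seq_of_forall_finset_exists
    (fun x : H => ‖x‖ = 1 ∧ ε < ‖G x‖) (fun x y => inner 𝕜 x y = 0) step
  have hon : Orthonormal 𝕜 e := by
    refine ⟨fun i => (he i).1, fun i j hij => ?_⟩
    rcases lt_or_gt_of_ne hij with h | h
    · exact hr i j h
    · exact inner_eq_zero_symm.1 (hr j i h)
  have h0 := (hG e hon).norm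
  rw [norm_zero] at h0
  obtain ⟨i, hi⟩ := (h0.eventually (gt_mem_nhds hε)).exists
  exact absurd hi (not_lt.2 (he i).2.le)

/-- Composing `G` with the projection onto the finite-dimensional space of the preceding lemma
changes it by at most `ε` in norm. Thus `G` is a norm limit of finite rank operators. -/
theorem isCompactOperator_of_tendsto_orthonormal [CompleteSpace H] (G : H →L[𝕜] H)
    (hG : ∀ e : ℕ → H, Orthonormal 𝕜 e → Tendsto (fun i => G (e i)) atTop (𝓝 0)) :
    IsCompactOperator G := by
  have hseq : ∀ k : ℕ, ∃ L : H →L[𝕜] H, IsCompactOperator L ∧ ‖L - G‖ ≤ 1 / ((k : ℝ) + 1) := by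
    intro k
    obtain ⟨V, hV, hle⟩ := exists_finiteDimensional_norm_le_on_orthogonal G hG
      (ε := 1 / ((k : ℝ) + 1)) (by positivity)
    have : ProperSpace V := FiniteDimensional.proper 𝕜 V
    have : LocallyCompactSpace V := inferInstance
    refine ⟨G ∘L V.starProjection, ?_, ?_⟩
    · have h1 : IsCompactOperator (V.orthogonalProjectionOnto : H →L[𝕜] V) :=
        isCompactOperator_of_locallyCompactSpace_dom V.orthogonalProjectionOnto
      exact h1.clm_comp (G ∘L V.subtypeL)
    · refine ContinuousLinearMap.opNorm_le_bound _ (by positivity) fun x => ?_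
      have h2 : (G ∘L V.starProjection - G) x = -G (x - V.starProjection x) := by
        simp [map_sub]
      rw [h2, norm_neg]
      refine (hle _ (V.sub_starProjection_mem_orthogonal x)).trans ?_
      have h3 : ‖x - V.starProjection x‖ ≤ ‖x‖ := by
        have := Submodule.norm_starProjection_apply_le Vᗮ x
        rwa [Submodule.starProjection_orthogonal_val] at this
      gcongr
  choose L hL hLG using hseq
  refine isCompactOperator_of_tendsto (l := atTop) (F := L) (f := G) ?_ (Eventually.of_forall hL)
  rw [tendsto_iff_norm_sub_tendsto_zero]
  exact squeeze_zero (fun _ => norm_nonneg _) hLG tendsto_one_div_add_atTop_nhds_zero_nat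

/-- The diagonal entries of an operator in the orthonormalization of a sequence of eigenvectors
are the eigenvalues. -/
theorem inner_gramSchmidtNormed_eigenvectors (G : H →L[𝕜] H) (μ : ℕ → 𝕜) (e : ℕ → H)
    (he : ∀ i, G (e i) = μ i • e i) (hli : LinearIndependent 𝕜 e) (k : ℕ) :
    inner 𝕜 (InnerProductSpace.gramSchmidtNormed 𝕜 e k)
      (G (InnerProductSpace.gramSchmidtNormed 𝕜 e k)) = μ k := by
  set f := InnerProductSpace.gramSchmidtNormed 𝕜 e with hf
  have hon : Orthonormal 𝕜 f := InnerProductSpace.gramSchmidtNormed_orthonormal hli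
  -- `G` is triangular on the flag spanned by the eigenvectors: `G - μ k` lowers the k-th step to
  -- the span of the earlier vectors, to which the k-th Gram–Schmidt vector is orthogonal.
  have key : ∀ x ∈ Submodule.span 𝕜 (e '' Iic k),
      G x - μ k • x ∈ Submodule.span 𝕜 (e '' Iio k) := by
    intro x hx
    induction hx using Submodule.span_induction with
    | mem x hx =>
      obtain ⟨j, hj, rfl⟩ := hx
      rw [he, ← sub_smul]
      rcases (mem_Iic.1 hj).lt_or_eq with h | h
      · exact Submodule.smul_mem _ _ (Submodule.subset_span ⟨j, h, rfl⟩)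
      · simp [h]
    | zero => simp
    | add x y _ _ hx hy =>
      have : G (x + y) - μ k • (x + y) = (G x - μ k • x) + (G y - μ k • y) := by
        rw [map_add, smul_add]; abel
      rw [this]
      exact Submodule.add_mem _ hx hy
    | smul a x _ hx =>
      have : G (a • x) - μ k • (a • x) = a • (G x - μ k • x) := by
        rw [map_smul, smul_sub, smul_comm]
      rw [this]
      exact Submodule.smul_mem _ _ hx
  have hfk : f k ∈ Submodule.span 𝕜 (e '' Iic k) := by
    rw [← InnerProductSpace.span_gramSchmidt_Iic 𝕜 e k,
      ← InnerProductSpace.span_gramSchmidtNormed]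
    exact Submodule.subset_span ⟨k, mem_Iic.2 le_rfl, rfl⟩
  have horth : ∀ y ∈ Submodule.span 𝕜 (e '' Iio k), inner 𝕜 (f k) y = 0 := by
    intro y hy
    rw [← InnerProductSpace.span_gramSchmidt_Iio 𝕜 e k,
      ← InnerProductSpace.span_gramSchmidtNormed] at hy
    induction hy using Submodule.span_induction with
    | mem x hx =>
      obtain ⟨j, hj, rfl⟩ := hx
      exact hon.2 (ne_of_gt (mem_Iio.1 hj))
    | zero => simp
    | add x y _ _ hx hy => rw [inner_add_right, hx, hy, add_zero]
    | smul a x _ hx => rw [inner_smul_right, hx, mul_zero]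
  have h := horth _ (key _ hfk)
  rw [inner_sub_right, inner_smul_right, inner_self_eq_norm_sq_to_K, hon.1 k, sub_eq_zero] at h
  simpa using h

/-- If `G` tends to zero along every orthonormal sequence, then `1 - lG` is invertible for real `l`
arbitrarily close to `1`. -/
theorem exists_isUnit_one_sub_smul [CompleteSpace H] (G : H →L[𝕜] H)
    (hG : ∀ e : ℕ → H, Orthonormal 𝕜 e → Tendsto (fun i => G (e i)) atTop (𝓝 0))
    {ε : ℝ} (hε : 0 < ε) :
    ∃ l : ℝ, |l - 1| < ε ∧ IsUnit (1 - (l : 𝕜) • G) := by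
  by_contra! hcon
  have hc := isCompactOperator_of_tendsto_orthonormal G hG
  -- Infinitely many distinct values in (1, 3/2], all within `ε` of 1. If none of them works, the
  -- Fredholm alternative makes every `1 / l k` an eigenvalue of `G`.
  set l : ℕ → ℝ := fun k => 1 + min ε 1 / ((k : ℝ) + 2) with hl
  have hm : 0 < min ε 1 := lt_min hε one_pos
  have hl1 : ∀ k, 1 < l k := fun k => by
    have : 0 < min ε 1 / ((k : ℝ) + 2) := by positivity
    simp only [hl]; linarith
  have hl2 : ∀ k, l k - 1 ≤ min ε 1 / 2 := fun k => by
    simp only [hl, add_sub_cancel_left]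
    gcongr
    have : (0 : ℝ) ≤ k := k.cast_nonneg
    linarith
  have hl0 : ∀ k, ((l k : ℝ) : 𝕜) ≠ 0 := fun k => by
    rw [Ne, RCLike.ofReal_eq_zero]
    linarith [hl1 k]
  have heig : ∀ k, Module.End.HasEigenvalue (G : Module.End 𝕜 H) ((l k : 𝕜)⁻¹) := by
    intro k
    refine (hc.hasEigenvalue_or_mem_resolventSet (inv_ne_zero (hl0 k))).resolve_right fun h => ?_
    refine hcon (l k) ?_ ?_
    · rw [abs_of_pos (by linarith [hl1 k])]
      have := hl2 k
      have := min_le_left ε 1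
      linarith
    · rw [spectrum.mem_resolventSet_iff] at h
      have h2 : (1 - (l k : 𝕜) • G) =
          (l k : 𝕜) • (algebraMap 𝕜 (H →L[𝕜] H) ((l k : 𝕜)⁻¹) - G) := by
        rw [smul_sub, Algebra.algebraMap_eq_smul_one, smul_smul, mul_inv_cancel₀ (hl0 k), one_smul]
      rw [h2]
      rw [Algebra.smul_def]
      exact ((IsUnit.mk0 _ (hl0 k)).map _).mul h
  choose e he using fun k => (heig k).exists_hasEigenvector
  have hinj : Function.Injective fun k => ((l k : ℝ) : 𝕜)⁻¹ := by
    intro i j hij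
    have h1 : l i = l j := RCLike.ofReal_inj.1 (inv_injective hij)
    simp only [hl, add_right_inj] at h1
    rw [div_eq_div_iff (by positivity) (by positivity)] at h1
    have h2 := mul_left_cancel₀ hm.ne' h1
    exact_mod_cast (by linarith : (i : ℝ) = j)
  have hli := Module.End.eigenvectors_linearIndependent' _ _ hinj e he
  -- The orthonormalized eigenvectors carry the diagonal entries `1 / l k ≥ 2/3`, whereas `G` tends
  -- to zero along them.
  have hdiag := inner_gramSchmidtNormed_eigenvectors G _ e (fun i => (he i).apply_eq_smul) hli
  have hon := InnerProductSpace.gramSchmidtNormed_orthonormal hli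
  have h0 := (hG _ hon).norm
  rw [norm_zero] at h0
  obtain ⟨k, hk⟩ := (h0.eventually (gt_mem_nhds (show (0 : ℝ) < 1 / 2 by norm_num))).exists
  have h3 := norm_inner_le_norm (𝕜 := 𝕜) (InnerProductSpace.gramSchmidtNormed 𝕜 e k)
    (G (InnerProductSpace.gramSchmidtNormed 𝕜 e k))
  rw [hdiag k, hon.1 k, one_mul, norm_inv, RCLike.norm_ofReal,
    abs_of_pos (by linarith [hl1 k])] at h3
  have h4 : l k ≤ 3 / 2 := by
    have := hl2 k
    have := min_le_right ε 1
    linarith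
  have h5 : (3 / 2 : ℝ)⁻¹ ≤ (l k)⁻¹ := inv_anti₀ (by linarith [hl1 k]) h4
  norm_num at h5
  linarith

end FunctionalAnalysis

/-! ### Operators on L² spaces -/

section LpOperators

variable {𝕜 : Type*} [RCLike 𝕜] {X Y : Type*} [MeasurableSpace X] [MeasurableSpace Y]
  {μ : Measure X} {ν : Measure Y}

/-- An almost everywhere linear, bounded operation on representatives defines a bounded operator
between `L²` spaces. -/
theorem exists_clm_of_eLpNorm_le (T : Lp 𝕜 2 μ → Y → 𝕜) (hmeas : ∀ u, AEStronglyMeasurable (T u) ν)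
    (hadd : ∀ u v, T (u + v) =ᵐ[ν] T u + T v) (hsmul : ∀ (a : 𝕜) u, T (a • u) =ᵐ[ν] a • T u)
    {C : ℝ} (hC : 0 ≤ C) (hb : ∀ u, eLpNorm (T u) 2 ν ≤ ENNReal.ofReal C * eLpNorm u 2 μ) :
    ∃ A : Lp 𝕜 2 μ →L[𝕜] Lp 𝕜 2 ν, (∀ u, A u =ᵐ[ν] T u) ∧ ‖A‖ ≤ C := by
  have hmem : ∀ u, MemLp (T u) 2 ν := fun u =>
    ⟨hmeas u, (hb u).trans_lt (ENNReal.mul_lt_top ENNReal.ofReal_lt_top (Lp.eLpNorm_lt_top u))⟩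
  let A : Lp 𝕜 2 μ →ₗ[𝕜] Lp 𝕜 2 ν :=
    { toFun := fun u => (hmem u).toLp (T u)
      map_add' := fun u v => by
        rw [← MemLp.toLp_add]
        exact (MemLp.toLp_eq_toLp_iff _ _).2 (hadd u v)
      map_smul' := fun a u => by
        rw [RingHom.id_apply, ← MemLp.toLp_const_smul]
        exact (MemLp.toLp_eq_toLp_iff _ _).2 (hsmul a u) }
  have hA : ∀ u, ‖A u‖ ≤ C * ‖u‖ := fun u => by
    change ‖(hmem u).toLp (T u)‖ ≤ _
    rw [Lp.norm_toLp, Lp.norm_def, ← ENNReal.toReal_ofReal hC, ← ENNReal.toReal_mul]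
    exact ENNReal.toReal_mono (ENNReal.mul_ne_top ENNReal.ofReal_ne_top (Lp.eLpNorm_ne_top u))
      (by simpa only [ENNReal.toReal_ofReal hC] using hb u)
  exact ⟨A.mkContinuous C hA, fun u => (hmem u).coeFn_toLp,
    LinearMap.mkContinuous_norm_le _ hC _⟩

theorem eLpNorm_two_sq {E : Type*} [NormedAddCommGroup E] (f : X → E) :
    eLpNorm f 2 μ ^ 2 = ∫⁻ x, ‖f x‖ₑ ^ 2 ∂μ := by
  have := eLpNorm_nnreal_pow_eq_lintegral (μ := μ) (f := f) (p := 2) (by norm_num)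
  simpa using this

/-- The pointwise bound dual to an `L¹` bound. -/
theorem ae_norm_le_of_norm_inner_le [IsFiniteMeasure μ] (f : Lp 𝕜 2 μ) {C : ℝ}
    (hf : ∀ h : Lp 𝕜 2 μ, ‖inner 𝕜 h f‖ ≤ C * ∫ x, ‖h x‖ ∂μ) : ∀ᵐ x ∂μ, ‖f x‖ ≤ C := by
  have hfi : Integrable (fun x => ‖f x‖) μ := ((Lp.memLp f).integrable one_le_two).norm
  refine ae_le_of_forall_setIntegral_le hfi (integrable_const C) fun A hA _ => ?_
  -- The test function is the conjugating phase `f / |f|` cut off to `A`: its pairing with `f` is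
  -- the integral of `|f|` over `A`, and its L¹ norm is at most the measure of `A`.
  have hmeas : StronglyMeasurable (A.indicator fun x => ((‖f x‖⁻¹ : ℝ) : 𝕜) * f x) :=
    ((RCLike.continuous_ofReal.comp_stronglyMeasurable
      (Lp.stronglyMeasurable f).norm.inv₀).mul (Lp.stronglyMeasurable f)).indicator hA
  have hle : ∀ x, ‖A.indicator (fun x => ((‖f x‖⁻¹ : ℝ) : 𝕜) * f x) x‖ ≤
      A.indicator (fun _ => (1 : ℝ)) x := by
    intro x
    by_cases hx : x ∈ A
    · rw [indicator_of_mem hx, indicator_of_mem hx, norm_mul, RCLike.norm_ofReal, abs_inv, abs_norm]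
      exact inv_mul_le_one
    · simp [hx]
  have hmem : MemLp (A.indicator fun x => ((‖f x‖⁻¹ : ℝ) : 𝕜) * f x) 2 μ :=
    MemLp.of_bound hmeas.aestronglyMeasurable 1 (Eventually.of_forall fun x =>
      (hle x).trans (indicator_le_self' (fun _ _ => zero_le_one) x))
  have h1 := hf (hmem.toLp _)
  have h2 : inner 𝕜 (hmem.toLp _) f = ((∫ x in A, ‖f x‖ ∂μ : ℝ) : 𝕜) := by
    rw [L2.inner_def, ← integral_ofReal, ← integral_indicator hA]
    refine integral_congr_ae ?_
    filter_upwards [hmem.coeFn_toLp] with x hx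
    rw [hx]
    by_cases hxA : x ∈ A
    · rw [indicator_of_mem hxA, indicator_of_mem hxA, ← smul_eq_mul, inner_smul_left,
        inner_self_eq_norm_sq_to_K, RCLike.conj_ofReal]
      by_cases h0 : ‖f x‖ = 0
      · simp [h0]
      · norm_cast
        field_simp
    · simp [hxA]
  have h3 : ∫ x, ‖(hmem.toLp _) x‖ ∂μ ≤ μ.real A := by
    have h4 : ∫ x, A.indicator (fun _ => (1 : ℝ)) x ∂μ = μ.real A := by
      rw [integral_indicator hA]; simp
    rw [← h4]
    refine integral_mono_ae ((Lp.memLp _).integrable one_le_two).norm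
      ((integrable_const _).indicator hA) ?_
    filter_upwards [hmem.coeFn_toLp] with x hx
    rw [hx]
    exact hle x
  -- No sign of `C` is assumed. Testing with the constant 1 forces `C ≥ 0` unless the measure
  -- vanishes.
  have hC : 0 ≤ C ∨ μ.real A = 0 := by
    by_contra! hcon
    have h5 : MemLp (fun _ : X => (1 : 𝕜)) 2 μ := memLp_const _
    have h6 := (norm_nonneg _).trans (hf (h5.toLp _))
    have h7 : ∫ x, ‖(h5.toLp _) x‖ ∂μ = μ.real univ := by
      rw [integral_congr_ae (g := fun _ => (1 : ℝ))]
      · simp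
      · filter_upwards [h5.coeFn_toLp] with x hx
        rw [hx]; simp
    rw [h7] at h6
    have h8 : 0 < μ.real univ :=
      (lt_of_le_of_ne measureReal_nonneg hcon.2.symm).trans_le (measureReal_mono (subset_univ A))
    nlinarith [hcon.1]
  rw [h2, RCLike.norm_ofReal, abs_of_nonneg (integral_nonneg fun _ => norm_nonneg _)] at h1
  rw [setIntegral_const, smul_eq_mul, mul_comm]
  rcases hC with hC | hC
  · exact h1.trans (mul_le_mul_of_nonneg_left h3 hC)
  · have : μ A = 0 := by
      rw [Measure.real, ENNReal.toReal_eq_zero_iff] at hC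
      exact hC.resolve_right (measure_ne_top _ _)
    rw [hC, mul_zero, Measure.restrict_eq_zero.2 this]
    simp

/-- An operator on `L²` of a finite measure that maps into bounded functions tends to zero along
orthonormal sequences. -/
theorem tendsto_orthonormal_of_ae_bound [IsFiniteMeasure μ] (T : Lp 𝕜 2 μ →L[𝕜] Lp 𝕜 2 μ)
    {C : ℝ} (hT : ∀ u, ∀ᵐ x ∂μ, ‖T u x‖ ≤ C * ‖u‖) (e : ℕ → Lp 𝕜 2 μ)
    (he : Orthonormal 𝕜 e) : Tendsto (fun i => T (e i)) atTop (𝓝 0) := by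
  -- At a fixed point `x` the functional `c ↦ ∑ cᵢ (T eᵢ)(x)` has norm at most `C`; evaluating it at
  -- the conjugates of the `(T eᵢ)(x)` bounds the sum of squares. Integration in `x` then gives a
  -- Hilbert–Schmidt bound.
  have hpt : ∀ m : ℕ, ∀ᵐ x ∂μ, ∑ i : Fin m, ‖T (e i) x‖ ^ 2 ≤ C ^ 2 := by
    intro m
    have h1 : ∀ c : EuclideanSpace 𝕜 (Fin m), ∀ᵐ x ∂μ,
        ‖∑ i, c i * T (e i) x‖ ≤ C * ‖c‖ := by
      intro c
      have hn : ‖∑ i : Fin m, c i • e i‖ = ‖c‖ := by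
        have h2 : Orthonormal 𝕜 fun i : Fin m => e i := he.comp _ Fin.val_injective
        have h3 := h2.inner_sum (fun i => c i) (fun i => c i) Finset.univ
        rw [inner_self_eq_norm_sq_to_K] at h3
        have h4 : (‖∑ i : Fin m, c i • e i‖ : ℝ) ^ 2 = ‖c‖ ^ 2 := by
          rw [EuclideanSpace.norm_sq_eq]
          have : ((‖∑ i : Fin m, c i • e i‖ ^ 2 : ℝ) : 𝕜) = ((∑ i, ‖c i‖ ^ 2 : ℝ) : 𝕜) := by
            push_cast
            rw [h3]
            simp [RCLike.conj_mul]
          exact RCLike.ofReal_inj.1 this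
        exact (sq_eq_sq₀ (norm_nonneg _) (norm_nonneg _)).1 h4
      have h5 : T (∑ i : Fin m, c i • e i) =ᵐ[μ] fun x => ∑ i, c i * T (e i) x := by
        rw [map_sum]
        refine (Lp.coeFn_finsetSum _ _).trans ?_
        have : ∀ᵐ x ∂μ, ∀ i : Fin m, (T (c i • e i)) x = c i * T (e i) x := by
          rw [ae_all_iff]
          intro i
          rw [map_smul]
          filter_upwards [Lp.coeFn_smul (c i) (T (e i))] with x hx
          rw [hx]; rfl
        filter_upwards [this] with x hx
        simp only [Finset.sum_apply]
        exact Finset.sum_congr rfl fun i _ => hx i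
      filter_upwards [hT (∑ i : Fin m, c i • e i), h5] with x hx hx5
      rwa [hx5, hn] at hx
    -- The exceptional null set depends on `c`, so the bound is first secured on a countable dense
    -- set of coefficient vectors and then extended by continuity.
    obtain ⟨D, hDc, hDd⟩ := TopologicalSpace.exists_countable_dense (EuclideanSpace 𝕜 (Fin m))
    have h2 : ∀ᵐ x ∂μ, ∀ c ∈ D, ‖∑ i, c i * T (e i) x‖ ≤ C * ‖c‖ :=
      (ae_ball_iff hDc).2 fun c _ => h1 c
    filter_upwards [h2] with x hx
    have h3 : ∀ c : EuclideanSpace 𝕜 (Fin m), ‖∑ i, c i * T (e i) x‖ ≤ C * ‖c‖ := by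
      intro c
      have hcl : IsClosed {c : EuclideanSpace 𝕜 (Fin m) | ‖∑ i, c i * T (e i) x‖ ≤ C * ‖c‖} :=
        isClosed_le (by fun_prop) (by fun_prop)
      have : closure D ⊆ {c : EuclideanSpace 𝕜 (Fin m) | ‖∑ i, c i * T (e i) x‖ ≤ C * ‖c‖} :=
        hcl.closure_subset_iff.2 hx
      exact this (hDd c)
    set c : EuclideanSpace 𝕜 (Fin m) := WithLp.toLp 2 fun i => (starRingEnd 𝕜) (T (e i) x) with hc
    have h4 : ‖c‖ ^ 2 = ∑ i : Fin m, ‖T (e i) x‖ ^ 2 := by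
      rw [EuclideanSpace.norm_sq_eq]
      simp [hc]
    have h5 : ‖∑ i, c i * T (e i) x‖ = ‖c‖ ^ 2 := by
      rw [h4]
      have : ∑ i, c i * T (e i) x = ((∑ i : Fin m, ‖T (e i) x‖ ^ 2 : ℝ) : 𝕜) := by
        simp [hc, RCLike.conj_mul]
      rw [this, RCLike.norm_ofReal, abs_of_nonneg (Finset.sum_nonneg fun _ _ => sq_nonneg _)]
    have h6 := h3 c
    rw [h5] at h6
    rw [← h4]
    rcases (norm_nonneg c).eq_or_lt with h | h
    · rw [← h]; nlinarith
    · have : ‖c‖ ≤ C := by nlinarith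
      gcongr
  have hsum : ∀ m : ℕ, ∑ i ∈ Finset.range m, ‖T (e i)‖ ^ 2 ≤ C ^ 2 * μ.real univ := by
    intro m
    have hint : ∀ i, Integrable (fun x => ‖T (e i) x‖ ^ 2) μ := fun i =>
      (Lp.memLp (T (e i))).integrable_norm_pow two_ne_zero
    have hnorm : ∀ i, ‖T (e i)‖ ^ 2 = ∫ x, ‖T (e i) x‖ ^ 2 ∂μ := by
      intro i
      have h1 := L2.inner_def (𝕜 := 𝕜) (T (e i)) (T (e i))
      rw [inner_self_eq_norm_sq_to_K] at h1
      have h2 : ∫ x, inner 𝕜 (T (e i) x) (T (e i) x) ∂μ = ((∫ x, ‖T (e i) x‖ ^ 2 ∂μ : ℝ) : 𝕜) := by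
        rw [← integral_ofReal]
        refine integral_congr_ae (Eventually.of_forall fun x => ?_)
        simp only [inner_self_eq_norm_sq_to_K]
        push_cast
        rfl
      rw [h2] at h1
      exact_mod_cast h1
    rw [Finset.sum_congr rfl fun i _ => hnorm i, ← integral_finsetSum _ fun i _ => hint i]
    calc ∫ x, ∑ i ∈ Finset.range m, ‖T (e i) x‖ ^ 2 ∂μ ≤ ∫ _, C ^ 2 ∂μ := by
          refine integral_mono_ae (integrable_finsetSum _ fun i _ => hint i) (integrable_const _) ?_
          filter_upwards [hpt m] with x hx
          rwa [Fin.sum_univ_eq_sum_range (fun i => ‖T (e i) x‖ ^ 2)] at hx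
      _ = C ^ 2 * μ.real univ := by simp [mul_comm]
  have hs : Summable fun i => ‖T (e i)‖ ^ 2 :=
    summable_of_sum_range_le (fun _ => sq_nonneg _) hsum
  rw [tendsto_zero_iff_norm_tendsto_zero]
  have := hs.tendsto_atTop_zero.sqrt
  simpa using this

end LpOperators

/-! ### Lipschitz maps and Haar measures -/

section LipschitzMeasure

open scoped NNReal ENNReal

variable {F G : Type*} [NormedAddCommGroup F] [NormedSpace ℝ F] [FiniteDimensional ℝ F]
  [MeasurableSpace F] [BorelSpace F] [NormedAddCommGroup G] [NormedSpace ℝ G]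
  [FiniteDimensional ℝ G] [MeasurableSpace G] [BorelSpace G]

/-- A Lipschitz map between spaces of equal dimension increases Haar measures at most by a constant
factor. -/
theorem exists_measure_image_le_of_lipschitzOnWith (μ : Measure F) [μ.IsAddHaarMeasure]
    (ν : Measure G) [ν.IsAddHaarMeasure] (hd : Module.finrank ℝ F = Module.finrank ℝ G) (K : ℝ≥0) :
    ∃ C : ℝ≥0, ∀ (f : F → G) (s : Set F), LipschitzOnWith K f s → ν (f '' s) ≤ C * μ s := by
  -- Hausdorff measure in the common dimension is a Haar measure on both spaces, and it scales by `K
  -- ^ finrank` under Lipschitz maps. The Haar scalar factors translate this to `μ` and `ν`.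
  have : (Measure.hausdorffMeasure (Module.finrank ℝ F) : Measure G).IsAddHaarMeasure := by
    rw [hd]; infer_instance
  refine ⟨Measure.addHaarScalarFactor ν (Measure.hausdorffMeasure (Module.finrank ℝ F)) *
    K ^ Module.finrank ℝ F * Measure.addHaarScalarFactor
      (Measure.hausdorffMeasure (Module.finrank ℝ F)) μ, fun f s hf => ?_⟩
  have h1 := hf.hausdorffMeasure_image_le (d := Module.finrank ℝ F) (Nat.cast_nonneg _)
  have h0 : ν (f '' s) = Measure.addHaarScalarFactor ν
      (Measure.hausdorffMeasure (Module.finrank ℝ F)) *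
        (Measure.hausdorffMeasure (Module.finrank ℝ F) : Measure G) (f '' s) := by
    conv_lhs => rw [Measure.isAddLeftInvariant_eq_smul ν
      (Measure.hausdorffMeasure (Module.finrank ℝ F))]
    rfl
  rw [h0]
  have h2 : (Measure.hausdorffMeasure (Module.finrank ℝ F) : Measure F) s =
      Measure.addHaarScalarFactor (Measure.hausdorffMeasure (Module.finrank ℝ F)) μ * μ s := by
    conv_lhs => rw [Measure.isAddLeftInvariant_eq_smul
      (Measure.hausdorffMeasure (Module.finrank ℝ F) : Measure F) μ]
    rfl
  rw [h2] at h1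
  push_cast
  rw [ENNReal.rpow_natCast] at h1
  calc _ ≤ (Measure.addHaarScalarFactor ν (Measure.hausdorffMeasure (Module.finrank ℝ F)) : ℝ≥0∞) *
        (K ^ Module.finrank ℝ F * (Measure.addHaarScalarFactor
          (Measure.hausdorffMeasure (Module.finrank ℝ F)) μ * μ s)) := by
        gcongr
    _ = _ := by ring

/-- A map with Lipschitz inverse decreases Haar measures at most by a constant factor. -/
theorem exists_measure_inter_preimage_le_of_antilipschitzOn (μ : Measure F) [μ.IsAddHaarMeasure]
    (ν : Measure G) [ν.IsAddHaarMeasure] (hd : Module.finrank ℝ F = Module.finrank ℝ G) (K : ℝ≥0) :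
    ∃ C : ℝ≥0, ∀ (f : F → G) (s : Set F), (∀ x ∈ s, ∀ y ∈ s, dist x y ≤ K * dist (f x) (f y)) →
      ∀ B : Set G, μ (s ∩ f ⁻¹' B) ≤ C * ν B := by
  obtain ⟨C, hC⟩ := exists_measure_image_le_of_lipschitzOnWith ν μ hd.symm K
  refine ⟨C, fun f s hf B => ?_⟩
  rcases isEmpty_or_nonempty F with hF | hF
  · rw [Set.eq_empty_of_isEmpty (s ∩ f ⁻¹' B)]; simp
  have hinj : InjOn f s := fun x hx y hy hxy => by
    have := hf x hx y hy
    rw [hxy, dist_self, mul_zero] at this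
    exact dist_le_zero.1 this
  have hg : LipschitzOnWith K (Function.invFunOn f s) (f '' s ∩ B) := by
    refine LipschitzOnWith.of_dist_le_mul ?_
    rintro _ ⟨⟨x, hx, rfl⟩, -⟩ _ ⟨⟨y, hy, rfl⟩, -⟩
    rw [hinj.leftInvOn_invFunOn hx, hinj.leftInvOn_invFunOn hy]
    exact hf x hx y hy
  have hsub : s ∩ f ⁻¹' B ⊆ Function.invFunOn f s '' (f '' s ∩ B) := fun x hx =>
    ⟨f x, ⟨⟨x, hx.1, rfl⟩, hx.2⟩, hinj.leftInvOn_invFunOn hx.1⟩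
  exact (measure_mono hsub).trans ((hC _ _ hg).trans (by gcongr; exact inter_subset_right))

end LipschitzMeasure

/-! ### Polar coordinates -/

section Polar

open scoped ENNReal

variable {n : ℕ}

/-- Integration in polar coordinates. -/
theorem lintegral_polar (hn : n ≠ 0) {f : RSpace n → ℝ≥0∞} (hf : Measurable f) :
    ∫⁻ x, f x = ∫⁻ v, (∫⁻ r in Ioi (0 : ℝ),
      ENNReal.ofReal (r ^ (n - 1)) * f (r • (v : RSpace n)))
        ∂(volume : Measure (RSpace n)).toSphere := by
  have : NeZero n := ⟨hn⟩
  have : Nonempty (Fin n) := ⟨0⟩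
  have hmp := (volume : Measure (RSpace n)).measurePreserving_homeomorphUnitSphereProd
  have hd : Module.finrank ℝ (RSpace n) = n := by simp
  rw [hd] at hmp
  have hF : Measurable fun q : sphere (0 : RSpace n) 1 × Ioi (0 : ℝ) =>
      f ((q.2 : ℝ) • (q.1 : RSpace n)) := by
    apply hf.comp
    fun_prop
  have h1 : ∫⁻ x, f x = ∫⁻ x : ({0}ᶜ : Set (RSpace n)), f x ∂((volume : Measure (RSpace n)).comap (↑)) := by
    rw [lintegral_subtype_comap (measurableSet_singleton _).compl, restrict_compl_singleton]
  have h2 : ∫⁻ x : ({0}ᶜ : Set (RSpace n)), f x ∂((volume : Measure (RSpace n)).comap (↑)) =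
      ∫⁻ q, f ((q.2 : ℝ) • (q.1 : RSpace n)) ∂((volume : Measure (RSpace n)).toSphere.prod
        (Measure.volumeIoiPow (n - 1))) := by
    rw [← hmp.lintegral_comp hF]
    refine lintegral_congr fun x => ?_
    have hx : ‖(x : RSpace n)‖ ≠ 0 := norm_ne_zero_iff.2 x.2
    simp [smul_smul, hx]
  rw [h1, h2, lintegral_prod _ hF.aemeasurable]
  refine lintegral_congr fun v => ?_
  have hFv : Measurable fun r : ℝ => f (r • (v : RSpace n)) := by
    apply hf.comp
    fun_prop
  have hFv' : Measurable fun r : Ioi (0 : ℝ) => f ((r : ℝ) • (v : RSpace n)) :=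
    hFv.comp measurable_subtype_coe
  rw [Measure.volumeIoiPow, lintegral_withDensity_eq_lintegral_mul _ (by fun_prop) hFv']
  have := lintegral_subtype_comap (μ := volume) (measurableSet_Ioi (a := (0 : ℝ)))
    (fun r : ℝ => ENNReal.ofReal (r ^ (n - 1)) * f (r • (v : RSpace n)))
  exact this

end Polar

/-! ### Phase measures and truncated cones -/

namespace TransportSetting

open scoped NNReal ENNReal

variable {n : ℕ} (S : TransportSetting n)

theorem continuous_speed : Continuous S.speed := by
  have := S.φ_smooth.continuous
  unfold speed
  fun_prop

theorem measurable_speed : Measurable S.speed := S.continuous_speed.measurable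

/-- The map `(x,v) ↦ (x, p(x)v)`. -/
noncomputable def scale (q : RSpace n × sphere (0 : RSpace n) 1) : RSpace n × RSpace n :=
  (q.1, S.speed q.1 • (q.2 : RSpace n))

theorem continuous_scale : Continuous S.scale := by
  have := S.continuous_speed
  unfold scale
  fun_prop

theorem measurable_scale : Measurable S.scale := S.continuous_scale.measurable

theorem lintegral_phaseMeasure (m : Measure (RSpace n)) {f : RSpace n × RSpace n → ℝ≥0∞}
    (hf : Measurable f) :
    ∫⁻ z, f z ∂S.phaseMeasure m = ∫⁻ x, ENNReal.ofReal (S.speed x ^ (n - 1)) *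
      ∫⁻ v, f (x, S.speed x • (v : RSpace n)) ∂(volume : Measure (RSpace n)).toSphere ∂m := by
  have hp := S.measurable_speed
  have hfs : Measurable fun q => f (S.scale q) := hf.comp S.measurable_scale
  have hd : Measurable fun q : RSpace n × sphere (0 : RSpace n) 1 =>
      ENNReal.ofReal (S.speed q.1 ^ (n - 1)) := by fun_prop
  have h1 : S.phaseMeasure m = ((m.prod (volume : Measure (RSpace n)).toSphere).withDensity
      (fun q => ENNReal.ofReal (S.speed q.1 ^ (n - 1)))).map S.scale := rfl
  rw [h1, lintegral_map hf S.measurable_scale,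
    lintegral_withDensity_eq_lintegral_mul _ hd hfs,
    lintegral_prod _ (hd.mul hfs).aemeasurable]
  refine lintegral_congr fun x => ?_
  rw [← lintegral_const_mul]
  · rfl
  · exact hfs.comp measurable_prodMk_left

theorem phaseMeasure_apply (m : Measure (RSpace n)) {A : Set (RSpace n × RSpace n)}
    (hA : MeasurableSet A) :
    S.phaseMeasure m A = ∫⁻ x, ENNReal.ofReal (S.speed x ^ (n - 1)) *
      (volume : Measure (RSpace n)).toSphere {v | (x, S.speed x • (v : RSpace n)) ∈ A} ∂m := by
  rw [← lintegral_indicator_one hA, S.lintegral_phaseMeasure m (measurable_one.indicator hA)]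
  refine lintegral_congr fun x => ?_
  congr 1
  rw [← lintegral_indicator_one]
  · rfl
  · exact (S.measurable_scale.comp measurable_prodMk_left) hA

/-- The truncated cone over a set of phase points. -/
def cone (A : Set (RSpace n × RSpace n)) : Set (RSpace n × RSpace n) :=
  {z | S.speed z.1 < ‖z.2‖ ∧ ‖z.2‖ < 2 * S.speed z.1 ∧ (z.1, (S.speed z.1 / ‖z.2‖) • z.2) ∈ A}

theorem measurableSet_cone {A : Set (RSpace n × RSpace n)} (hA : MeasurableSet A) :
    MeasurableSet (S.cone A) := by
  have hp := S.measurable_speed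
  have h1 : MeasurableSet {z : RSpace n × RSpace n | S.speed z.1 < ‖z.2‖} :=
    measurableSet_lt (by fun_prop) (by fun_prop)
  have h2 : MeasurableSet {z : RSpace n × RSpace n | ‖z.2‖ < 2 * S.speed z.1} :=
    measurableSet_lt (by fun_prop) (by fun_prop)
  have h3 : Measurable fun z : RSpace n × RSpace n => (z.1, (S.speed z.1 / ‖z.2‖) • z.2) := by
    fun_prop
  exact h1.inter (h2.inter (h3 hA))

/-- The ratio between the volume of a truncated cone and the measure of its base. -/
noncomputable def coneConst (n : ℕ) : ℝ := (2 ^ n - 1) / n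

theorem coneConst_pos (hn : n ≠ 0) : 0 < coneConst n := by
  have h1 : (1 : ℝ) < 2 ^ n := one_lt_pow₀ one_lt_two hn
  have h2 : (0 : ℝ) < n := by positivity
  exact div_pos (by linarith) h2

/-- In polar coordinates the section is a set of directions times the radial interval from `p` to
`2p`, and the integral of `r ^ (n-1)` over that interval is `(2 ^ n - 1) / n * p ^ n`. -/
theorem volume_cone_section (hn : n ≠ 0) {A : Set (RSpace n × RSpace n)} (hA : MeasurableSet A)
    (x : RSpace n) :
    volume {η | (x, η) ∈ S.cone A} = ENNReal.ofReal (coneConst n * S.speed x ^ n) *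
      (volume : Measure (RSpace n)).toSphere {v | (x, S.speed x • (v : RSpace n)) ∈ A} := by
  have hp : 0 ≤ S.speed x := Real.sqrt_nonneg _
  have hmc : MeasurableSet {η | (x, η) ∈ S.cone A} :=
    measurable_prodMk_left (S.measurableSet_cone hA)
  have hmv : MeasurableSet {v : sphere (0 : RSpace n) 1 | (x, S.speed x • (v : RSpace n)) ∈ A} :=
    (S.measurable_scale.comp measurable_prodMk_left) hA
  rw [← lintegral_indicator_one hmc, lintegral_polar hn (measurable_one.indicator hmc)]
  have hr : ∫⁻ r in Ioi (0 : ℝ), ENNReal.ofReal (r ^ (n - 1)) *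
      (Ioo (S.speed x) (2 * S.speed x)).indicator 1 r =
        ENNReal.ofReal (coneConst n * S.speed x ^ n) := by
    have h1 : ∀ r, ENNReal.ofReal (r ^ (n - 1)) * (Ioo (S.speed x) (2 * S.speed x)).indicator 1 r =
        (Ioo (S.speed x) (2 * S.speed x)).indicator (fun r => ENNReal.ofReal (r ^ (n - 1))) r := by
      intro r
      by_cases h : r ∈ Ioo (S.speed x) (2 * S.speed x) <;> simp [h]
    simp_rw [h1]
    rw [setLIntegral_indicator measurableSet_Ioo, inter_eq_left.2
      (show Ioo (S.speed x) (2 * S.speed x) ⊆ Ioi 0 from fun r hr => hp.trans_lt hr.1), Measure.restrict_congr_set Ioo_ae_eq_Ioc,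
      ← ofReal_integral_eq_lintegral_ofReal (intervalIntegral.intervalIntegrable_pow _).1,
      ← intervalIntegral.integral_of_le (by linarith), integral_pow]
    · congr 1
      have : n - 1 + 1 = n := Nat.succ_pred_eq_of_ne_zero hn
      have h2 : ((n - 1 : ℕ) : ℝ) + 1 = n := by exact_mod_cast this
      rw [this, h2, coneConst, mul_pow]
      ring
    · filter_upwards [ae_restrict_mem measurableSet_Ioc] with r hr
      exact pow_nonneg (hp.trans hr.1.le) _
  rw [← hr, ← lintegral_indicator_one hmv, mul_comm, ← lintegral_mul_const _
    (measurable_one.indicator hmv)]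
  refine lintegral_congr fun v => ?_
  rw [mul_comm, ← lintegral_mul_const]
  · refine setLIntegral_congr_fun measurableSet_Ioi fun r hr => ?_
    have hr0 : (0 : ℝ) < r := hr
    have hv : ‖(v : RSpace n)‖ = 1 := norm_eq_of_mem_sphere v
    have hnr : ‖r • (v : RSpace n)‖ = r := by rw [norm_smul, hv, mul_one, Real.norm_of_nonneg hr0.le]
    have hiff : r • (v : RSpace n) ∈ {η | (x, η) ∈ S.cone A} ↔
        r ∈ Ioo (S.speed x) (2 * S.speed x) ∧ (x, S.speed x • (v : RSpace n)) ∈ A := by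
      simp only [cone, mem_ofPred_eq, hnr, smul_smul, div_mul_cancel₀ _ hr0.ne', mem_Ioo, and_assoc]
    rw [mul_assoc]
    congr 1
    by_cases h1 : r ∈ Ioo (S.speed x) (2 * S.speed x) <;>
      by_cases h2 : (x, S.speed x • (v : RSpace n)) ∈ A
    · rw [indicator_of_mem (hiff.2 ⟨h1, h2⟩), indicator_of_mem h1, indicator_of_mem (by exact h2)]
      simp
    · rw [indicator_of_notMem (fun h => h2 (hiff.1 h).2), indicator_of_notMem (s :=
        {v : sphere (0 : RSpace n) 1 | (x, S.speed x • (v : RSpace n)) ∈ A}) (a := v) h2]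
      simp
    · rw [indicator_of_notMem (fun h => h1 (hiff.1 h).1), indicator_of_notMem h1]
      simp
    · rw [indicator_of_notMem (fun h => h1 (hiff.1 h).1), indicator_of_notMem h1]
      simp
  · exact (by fun_prop : Measurable fun r : ℝ => ENNReal.ofReal (r ^ (n - 1))).mul
      (measurable_one.indicator measurableSet_Ioo)

theorem prod_volume_cone (hn : n ≠ 0) (m : Measure (RSpace n)) {A : Set (RSpace n × RSpace n)}
    (hA : MeasurableSet A) :
    (m.prod volume) (S.cone A) = ∫⁻ x, ENNReal.ofReal (coneConst n * S.speed x ^ n) *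
      (volume : Measure (RSpace n)).toSphere {v | (x, S.speed x • (v : RSpace n)) ∈ A} ∂m := by
  rw [Measure.prod_apply (S.measurableSet_cone hA)]
  exact lintegral_congr fun x => S.volume_cone_section hn hA x

end TransportSetting

/-! ### Global flows of bounded Lipschitz fields -/

section GlobalFlow

open scoped NNReal

variable {E : Type*} [NormedAddCommGroup E] [NormedSpace ℝ E]

/-- Two integral curves of an autonomous field that is Lipschitz on a set containing both curves
agree if they agree at time `0`. -/
theorem eqOn_uIcc_of_isIntegralCurveOn {v : E → E} {K : ℝ≥0} {s : Set E} (hv : LipschitzOnWith K v s)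
    {f g : ℝ → E} {t : ℝ} (hf : IsIntegralCurveOn f (fun _ => v) (uIcc 0 t))
    (hg : IsIntegralCurveOn g (fun _ => v) (uIcc 0 t)) (hfs : ∀ r ∈ uIcc 0 t, f r ∈ s)
    (hgs : ∀ r ∈ uIcc 0 t, g r ∈ s) (h0 : f 0 = g 0) : EqOn f g (uIcc 0 t) := by
  rcases le_total 0 t with ht | ht
  · rw [uIcc_of_le ht] at *
    refine ODE_solution_unique_of_mem_Icc_right (v := fun _ => v) (s := fun _ => s) (K := K)
      (fun _ _ => hv) hf.continuousOn (fun r hr => ?_) (fun r hr => hfs r (Ico_subset_Icc_self hr))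
      hg.continuousOn (fun r hr => ?_) (fun r hr => hgs r (Ico_subset_Icc_self hr)) h0
    · exact (hf r (Ico_subset_Icc_self hr)).mono_of_mem_nhdsWithin (Icc_mem_nhdsGE_of_mem hr)
    · exact (hg r (Ico_subset_Icc_self hr)).mono_of_mem_nhdsWithin (Icc_mem_nhdsGE_of_mem hr)
  · rw [uIcc_of_ge ht] at *
    refine ODE_solution_unique_of_mem_Icc_left (v := fun _ => v) (s := fun _ => s) (K := K)
      (fun _ _ => hv) hf.continuousOn (fun r hr => ?_) (fun r hr => hfs r (Ioc_subset_Icc_self hr))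
      hg.continuousOn (fun r hr => ?_) (fun r hr => hgs r (Ioc_subset_Icc_self hr)) h0
    · exact (hf r (Ioc_subset_Icc_self hr)).mono_of_mem_nhdsWithin (Icc_mem_nhdsLE_of_mem hr)
    · exact (hg r (Ioc_subset_Icc_self hr)).mono_of_mem_nhdsWithin (Icc_mem_nhdsLE_of_mem hr)

/-- A bounded Lipschitz vector field has a global flow. -/
theorem exists_globalFlow [CompleteSpace E] {X : E → E} {L M : ℝ≥0} (hL : LipschitzWith L X)
    (hM : ∀ z, ‖X z‖ ≤ M) :
    ∃ Φ : ℝ → E → E, (∀ z, Φ 0 z = z) ∧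
      ∀ z t, HasDerivAt (fun s => Φ s z) (X (Φ t z)) t := by
  have hloc : ∀ (z : E) (k : ℕ), ∃ α : ℝ → E, α 0 = z ∧
      ∀ t ∈ Icc (-(k : ℝ)) k, HasDerivWithinAt α (X (α t)) (Icc (-(k : ℝ)) k) t := by
    intro z k
    have h0 : (0 : ℝ) ∈ Icc (-(k : ℝ)) k := by simp
    -- Since the field is bounded by `M`, solutions on `[-k, k]` stay in the ball of radius `M k`;
    -- no smallness of the time interval is needed.
    have hPL : IsPicardLindelof (fun _ => X) (⟨0, h0⟩ : Icc (-(k : ℝ)) k) z (M * k) 0 M L :=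
      { lipschitzOnWith := fun _ _ => hL.lipschitzOnWith
        continuousOn := fun _ _ => continuousOn_const
        norm_le := fun _ _ x _ => hM x
        mul_max_le := by simp }
    exact hPL.exists_eq_forall_mem_Icc_hasDerivWithinAt₀
  choose α hα0 hα using hloc
  have hagree : ∀ z (k m : ℕ), k ≤ m → EqOn (α z k) (α z m) (Icc (-(k : ℝ)) k) := by
    intro z k m hkm t ht
    have hsub : Icc (-(k : ℝ)) k ⊆ Icc (-(m : ℝ)) m :=
      Icc_subset_Icc (by simpa using hkm) (by simpa using hkm)
    have hu : uIcc 0 t ⊆ Icc (-(k : ℝ)) k := by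
      rw [← uIcc_of_le (by simp)]
      exact uIcc_subset_uIcc (by rw [uIcc_of_le (by simp)]; simp) (by rwa [uIcc_of_le (by simp)])
    refine eqOn_uIcc_of_isIntegralCurveOn (v := X) (s := univ) hL.lipschitzOnWith
      (fun r hr => (hα z k r (hu hr)).mono hu)
      (fun r hr => (hα z m r (hsub (hu hr))).mono (hu.trans hsub))
      (fun _ _ => trivial) (fun _ _ => trivial) (by rw [hα0, hα0]) right_mem_uIcc
  refine ⟨fun t z => α z (⌈|t|⌉₊ + 1) t, fun z => by simp [hα0], fun z t => ?_⟩
  -- One more than the index used at time `t`. For `s` near `t` the ceiling of `|s|` may be larger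
  -- by one, and `k` still dominates the index used at `s`, so all these local solutions agree with
  -- `α z k`.
  set k : ℕ := ⌈|t|⌉₊ + 2 with hk
  have htk : |t| < (k : ℝ) - 1 := by
    rw [hk]; push_cast
    linarith [Nat.le_ceil |t|]
  have hnear : ∀ᶠ s : ℝ in 𝓝 t, α z (⌈|s|⌉₊ + 1) s = α z k s := by
    have h1 : ∀ᶠ s : ℝ in 𝓝 t, |s| < (k : ℝ) - 1 := (continuous_abs.tendsto t).eventually (gt_mem_nhds htk)
    filter_upwards [h1] with s hs
    have h2 : ⌈|s|⌉₊ + 1 ≤ k := by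
      have : ⌈|s|⌉₊ ≤ k - 1 := Nat.ceil_le.2 (by rw [Nat.cast_pred (by omega)]; exact hs.le)
      omega
    refine hagree z _ _ h2 ?_
    rw [mem_Icc, ← abs_le]
    push_cast
    linarith [Nat.le_ceil |s|]
  have hmem : Icc (-(k : ℝ)) k ∈ 𝓝 t := by
    refine Icc_mem_nhds ?_ ?_
    · linarith [neg_abs_le t]
    · linarith [le_abs_self t]
  have h3 := (hα z k t (mem_of_mem_nhds hmem)).hasDerivAt hmem
  rw [← hnear.self_of_nhds] at h3
  exact h3.congr_of_eventuallyEq hnear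

end GlobalFlow

/-! ### The domain, the energy surface and the field -/

namespace TransportSetting

open scoped NNReal ENNReal

variable {n : ℕ} (S : TransportSetting n)

theorem isOpen_Ω : IsOpen S.Ω := by
  rw [S.Ω_eq]
  exact isOpen_lt S.ρ_smooth.continuous continuous_const

theorem hasGradientAt_ρ (x : RSpace n) : HasGradientAt S.ρ (gradient S.ρ x) x :=
  ((S.ρ_smooth.differentiable (by simp)) x).hasGradientAt

theorem hasGradientAt_φ (x : RSpace n) : HasGradientAt S.φ (gradient S.φ x) x :=
  ((S.φ_smooth.differentiable (by simp)) x).hasGradientAt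

theorem hasDerivWithinAt_ρ_comp {γ : ℝ → RSpace n} {v : RSpace n} {s : Set ℝ} {t : ℝ}
    (h : HasDerivWithinAt γ v s t) :
    HasDerivWithinAt (fun r => S.ρ (γ r)) (inner ℝ (gradient S.ρ (γ t)) v) s t := by
  have := ((S.hasGradientAt_ρ (γ t)).hasFDerivAt).comp_hasDerivWithinAt t h
  simpa [Function.comp_def] using this

theorem hasDerivWithinAt_φ_comp {γ : ℝ → RSpace n} {v : RSpace n} {s : Set ℝ} {t : ℝ}
    (h : HasDerivWithinAt γ v s t) :
    HasDerivWithinAt (fun r => S.φ (γ r)) (inner ℝ (gradient S.φ (γ t)) v) s t := by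
  have := ((S.hasGradientAt_φ (γ t)).hasFDerivAt).comp_hasDerivWithinAt t h
  simpa [Function.comp_def] using this

/-- Moving from a boundary point against the nonzero gradient lowers `ρ` to first order, so points
of `Ω` accumulate there. This identifies the topological boundary with the zero set of `ρ`. -/
theorem mem_closure_of_ρ_eq_zero {x : RSpace n} (hx : S.ρ x = 0) : x ∈ closure S.Ω := by
  set g := gradient S.ρ x with hg
  have hg0 : 0 < ‖g‖ := norm_pos_iff.2 (S.ρ_regular x hx)
  have h1 : HasDerivAt (fun t : ℝ => x - t • g) (-g) 0 := by
    have := ((hasDerivAt_id (0 : ℝ)).smul_const g).const_sub x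
    simpa using this
  have h2 : HasDerivAt (fun t : ℝ => S.ρ (x - t • g)) (-‖g‖ ^ 2) 0 := by
    have := S.hasDerivWithinAt_ρ_comp (h1.hasDerivWithinAt (s := univ))
    rw [hasDerivWithinAt_univ] at this
    simpa [inner_neg_right, ← hg, real_inner_self_eq_norm_sq] using this
  have h3 : ∀ᶠ t in 𝓝[>] (0 : ℝ), S.ρ (x - t • g) < 0 := by
    have h4 := h2.hasDerivWithinAt (s := Ioi 0)
    rw [hasDerivWithinAt_iff_tendsto_slope' self_notMem_Ioi] at h4
    have h5 := h4.eventually (gt_mem_nhds (show -‖g‖ ^ 2 < 0 by nlinarith))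
    filter_upwards [h5, self_mem_nhdsWithin] with t ht ht0
    have ht0' : (0 : ℝ) < t := ht0
    rw [slope_def_field] at ht
    simp only [zero_smul, sub_zero, hx] at ht
    by_contra hcon
    exact absurd ht (not_lt.2 (div_nonneg (not_lt.1 hcon) ht0'.le))
  have h6 : Tendsto (fun t : ℝ => x - t • g) (𝓝[>] 0) (𝓝 x) := by
    have := h1.continuousAt.tendsto
    simp only [zero_smul, sub_zero] at this
    exact this.mono_left nhdsWithin_le_nhds
  refine mem_closure_of_tendsto h6 ?_
  filter_upwards [h3] with t ht
  rw [S.Ω_eq]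
  exact ht

theorem closure_Ω : closure S.Ω = {x | S.ρ x ≤ 0} := by
  refine Subset.antisymm ?_ fun x hx => ?_
  · refine closure_minimal ?_ (isClosed_le S.ρ_smooth.continuous continuous_const)
    conv_lhs => rw [S.Ω_eq]
    intro x hx
    exact (show S.ρ x < 0 from hx).le
  · rcases (show S.ρ x ≤ 0 from hx).lt_or_eq with h | h
    · exact subset_closure (by rw [S.Ω_eq]; exact h)
    · exact S.mem_closure_of_ρ_eq_zero h

theorem mem_closure_iff {x : RSpace n} : x ∈ closure S.Ω ↔ S.ρ x ≤ 0 := by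
  rw [S.closure_Ω]; rfl

theorem mem_Ω_iff {x : RSpace n} : x ∈ S.Ω ↔ S.ρ x < 0 := by
  conv_lhs => rw [S.Ω_eq]
  rfl

theorem mem_frontier_iff {x : RSpace n} : x ∈ frontier S.Ω ↔ S.ρ x = 0 := by
  rw [S.isOpen_Ω.frontier_eq, Set.mem_sdiff, S.mem_closure_iff, S.mem_Ω_iff]
  constructor
  · rintro ⟨h1, h2⟩; linarith
  · intro h; constructor <;> linarith

theorem isCompact_closure : IsCompact (closure S.Ω) := S.isBounded.isCompact_closure

theorem speed_pos {x : RSpace n} (hx : x ∈ closure S.Ω) : 0 < S.speed x :=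
  Real.sqrt_pos.2 (by linarith [S.φ_lt x hx])

/-- Over the closure the speed is strictly positive, so the energy equation alone excludes zero
velocity and only the norm of the velocity has to be tested. -/
theorem mem_bundle_iff {A : Set (RSpace n)} (hA : A ⊆ closure S.Ω) {z : RSpace n × RSpace n} :
    z ∈ S.bundle A ↔ z.1 ∈ A ∧ ‖z.2‖ = S.speed z.1 := by
  have key : z.1 ∈ A → (S.energy z = S.τ ↔ ‖z.2‖ = S.speed z.1) := fun hz => by
    have h := S.φ_lt _ (hA hz)
    rw [speed, eq_comm (a := ‖z.2‖), Real.sqrt_eq_iff_mul_self_eq (by linarith) (norm_nonneg _),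
      energy]
    constructor <;> intro h' <;> nlinarith
  constructor
  · rintro ⟨h1, -, h3⟩
    exact ⟨h1, (key h1).1 h3⟩
  · rintro ⟨h1, h2⟩
    refine ⟨h1, ?_, (key h1).2 h2⟩
    rw [← norm_pos_iff, h2]
    exact S.speed_pos (hA h1)

theorem mem_closedBundle_iff {z : RSpace n × RSpace n} :
    z ∈ S.closedBundle ↔ z.1 ∈ closure S.Ω ∧ ‖z.2‖ = S.speed z.1 :=
  S.mem_bundle_iff Subset.rfl

theorem mem_closedBundle_of_energy {z : RSpace n × RSpace n} (h1 : z.1 ∈ closure S.Ω)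
    (h2 : S.energy z = S.τ) : z ∈ S.closedBundle := by
  refine ⟨h1, ?_, h2⟩
  intro h0
  have := S.φ_lt _ h1
  simp [energy, h0] at h2
  linarith

theorem isCompact_closedBundle : IsCompact S.closedBundle := by
  obtain ⟨C, hC⟩ := S.isCompact_closure.exists_bound_of_continuousOn S.continuous_speed.continuousOn
  refine IsCompact.of_isClosed_subset (S.isCompact_closure.prod (isCompact_closedBall 0 C)) ?_ ?_
  · have : S.closedBundle = {z | z.1 ∈ closure S.Ω} ∩ {z | ‖z.2‖ = S.speed z.1} := by
      ext z; exact S.mem_closedBundle_iff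
    rw [this]
    exact (isClosed_closure.preimage continuous_fst).inter
      (isClosed_eq (by fun_prop) (S.continuous_speed.comp continuous_fst))
  · intro z hz
    rw [S.mem_closedBundle_iff] at hz
    refine ⟨hz.1, ?_⟩
    rw [mem_closedBall_zero_iff, hz.2]
    exact (le_abs_self _).trans (hC _ hz.1)

theorem contDiff_field : ContDiff ℝ 1 S.field := by
  have h1 : ContDiff ℝ 1 (gradient S.φ) := by
    have h2 : ContDiff ℝ 1 (fderiv ℝ S.φ) := S.φ_smooth.fderiv_right (by norm_cast)
    exact (InnerProductSpace.toDual ℝ (RSpace n)).symm.contDiff.comp h2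
  have h3 : ContDiff ℝ 1 S.Y := S.Y_smooth.of_le (by norm_cast)
  unfold field force
  exact contDiff_snd.prodMk ((h1.comp contDiff_fst).neg.add
    ((h3.comp contDiff_fst).clm_apply contDiff_snd))

/-- The work of the potential force cancels the change of potential energy, and a skew-symmetric `Y`
does no work. The scalar `a` permits a rescaled field, so the cut-off flow conserves energy too. -/
theorem hasDerivWithinAt_energy_comp {c : ℝ → RSpace n × RSpace n} {a : ℝ} {s : Set ℝ} {t : ℝ}
    (h : HasDerivWithinAt c (a • S.field (c t)) s t) :
    HasDerivWithinAt (fun r => S.energy (c r)) 0 s t := by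
  have h1 : HasDerivWithinAt (fun r => (c r).1) (a • (c t).2) s t := h.fst
  have h2 : HasDerivWithinAt (fun r => (c r).2) (a • S.force (c t)) s t := h.snd
  have h3 := ((h2.norm_sq).div_const 2).add (S.hasDerivWithinAt_φ_comp h1)
  have h4 : 2 * inner ℝ (c t).2 (a • S.force (c t)) / 2 +
      inner ℝ (gradient S.φ (c t).1) (a • (c t).2) = 0 := by
    have h5 : inner ℝ (c t).2 (S.Y (c t).1 (c t).2) = 0 := by
      have := S.Y_skew (c t).1 (c t).2 (c t).2
      rw [real_inner_comm] at this
      linarith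
    rw [force, inner_smul_right, inner_smul_right, inner_add_right, inner_neg_right, h5,
      real_inner_comm (gradient S.φ (c t).1)]
    ring
  rw [h4] at h3
  exact h3

end TransportSetting

/-! ### The cut-off flow -/

namespace TransportSetting

open scoped NNReal ENNReal

variable {n : ℕ} {S : TransportSetting n}

/-- A global flow that agrees with the dynamics in a ball containing all phase points of energy `τ`
over the closure of the domain; it is generated by a cut-off of the field. -/
structure CutoffFlow (S : TransportSetting n) where
  toFun : ℝ → RSpace n × RSpace n → RSpace n × RSpace n
  cutoff : RSpace n × RSpace n → ℝ
  radius : ℝ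
  lip : ℝ≥0
  bound : ℝ≥0
  norm_lt : ∀ z ∈ S.closedBundle, ‖z‖ < radius
  cutoff_eq_one : ∀ z, ‖z‖ ≤ radius → cutoff z = 1
  lipschitz : LipschitzWith lip fun z => cutoff z • S.field z
  norm_le : ∀ z, ‖cutoff z • S.field z‖ ≤ bound
  map_zero : ∀ z, toFun 0 z = z
  hasDerivAt : ∀ z t, HasDerivAt (fun s => toFun s z)
    (cutoff (toFun t z) • S.field (toFun t z)) t

theorem nonempty_cutoffFlow (S : TransportSetting n) : Nonempty S.CutoffFlow := by
  obtain ⟨R, hR0, hR⟩ := S.isCompact_closedBundle.isBounded.exists_pos_norm_lt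
  let χ : ContDiffBump (0 : RSpace n × RSpace n) := ⟨R, R + 1, hR0, by linarith⟩
  have hcd : ContDiff ℝ 1 fun z => χ z • S.field z := χ.contDiff.smul S.contDiff_field
  have hcs : HasCompactSupport fun z => χ z • S.field z := χ.hasCompactSupport.smul_right
  obtain ⟨L, hL⟩ := hcd.lipschitzWith_of_hasCompactSupport hcs one_ne_zero
  obtain ⟨M, hM⟩ := hcs.exists_bound_of_continuous hcd.continuous
  obtain ⟨Φ, h0, hΦ⟩ := exists_globalFlow (M := M.toNNReal) hL
    fun z => (hM z).trans (Real.le_coe_toNNReal M)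
  exact ⟨{ toFun := Φ, cutoff := χ, radius := R, lip := L, bound := M.toNNReal
           norm_lt := hR
           cutoff_eq_one := fun z hz => χ.one_of_mem_closedBall (mem_closedBall_zero_iff.2 hz)
           lipschitz := hL
           norm_le := fun z => (hM z).trans (Real.le_coe_toNNReal M)
           map_zero := h0
           hasDerivAt := hΦ }⟩

namespace CutoffFlow

instance : CoeFun S.CutoffFlow fun _ => ℝ → RSpace n × RSpace n → RSpace n × RSpace n := ⟨toFun⟩

variable (Φ : S.CutoffFlow)

theorem isIntegralCurveOn (z : RSpace n × RSpace n) (s : Set ℝ) :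
    IsIntegralCurveOn (fun t => Φ t z) (fun _ z => Φ.cutoff z • S.field z) s :=
  fun t _ => (Φ.hasDerivAt z t).hasDerivWithinAt

theorem map_add (s t : ℝ) (z : RSpace n × RSpace n) : Φ (s + t) z = Φ s (Φ t z) := by
  have h := eqOn_uIcc_of_isIntegralCurveOn (t := s) (s := univ) (Φ.lipschitz.lipschitzOnWith)
    (f := fun r => Φ (r + t) z) (g := fun r => Φ r (Φ t z))
    (fun r _ => ((Φ.hasDerivAt z (r + t)).comp_add_const r t).hasDerivWithinAt)
    (Φ.isIntegralCurveOn _ _) (fun _ _ => trivial) (fun _ _ => trivial)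
    (by simp [Φ.map_zero])
  exact h right_mem_uIcc

theorem map_neg_map (t : ℝ) (z : RSpace n × RSpace n) : Φ (-t) (Φ t z) = z := by
  rw [← Φ.map_add, neg_add_cancel, Φ.map_zero]

/-- The time-reversed flow satisfies a differential equation with the opposite field. -/
theorem hasDerivAt_neg (z : RSpace n × RSpace n) (t : ℝ) :
    HasDerivAt (fun s => Φ (-s) z) (-(Φ.cutoff (Φ (-t) z) • S.field (Φ (-t) z))) t := by
  have := (Φ.hasDerivAt z (-t)).scomp t (_root_.hasDerivAt_neg t)
  simpa [Function.comp_def] using this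

theorem dist_map_le_of_nonneg {t : ℝ} (ht : 0 ≤ t) (z w : RSpace n × RSpace n) :
    dist (Φ t z) (Φ t w) ≤ dist z w * Real.exp (Φ.lip * t) := by
  have h := dist_le_of_trajectories_ODE (a := 0) (b := t) (fun _ => Φ.lipschitz)
    (Φ.isIntegralCurveOn z _).continuousOn
    (fun r _ => (Φ.hasDerivAt z r).hasDerivWithinAt)
    (Φ.isIntegralCurveOn w _).continuousOn
    (fun r _ => (Φ.hasDerivAt w r).hasDerivWithinAt) (by rw [Φ.map_zero, Φ.map_zero]) t
    (right_mem_Icc.2 ht)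
  simpa using h

theorem dist_map_neg_le_of_nonneg {t : ℝ} (ht : 0 ≤ t) (z w : RSpace n × RSpace n) :
    dist (Φ (-t) z) (Φ (-t) w) ≤ dist z w * Real.exp (Φ.lip * t) := by
  have hc : ∀ z, Continuous fun r => Φ (-r) z := fun z =>
    continuous_iff_continuousAt.2 fun r => (Φ.hasDerivAt_neg z r).continuousAt
  have h := dist_le_of_trajectories_ODE (a := 0) (b := t)
    (v := fun _ z => -(Φ.cutoff z • S.field z)) (fun _ => Φ.lipschitz.neg)
    (hc z).continuousOn
    (fun r _ => (Φ.hasDerivAt_neg z r).hasDerivWithinAt)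
    (hc w).continuousOn
    (fun r _ => (Φ.hasDerivAt_neg w r).hasDerivWithinAt) 
    (le_of_eq (b := dist z w) (by simp [Φ.map_zero])) t (right_mem_Icc.2 ht)
  simpa using h

theorem dist_map_le (t : ℝ) (z w : RSpace n × RSpace n) :
    dist (Φ t z) (Φ t w) ≤ Real.exp (Φ.lip * |t|) * dist z w := by
  rw [mul_comm]
  rcases le_total 0 t with ht | ht
  · rw [abs_of_nonneg ht]; exact Φ.dist_map_le_of_nonneg ht z w
  · rw [abs_of_nonpos ht]
    simpa using Φ.dist_map_neg_le_of_nonneg (neg_nonneg.2 ht) z w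

theorem dist_map_time_le (s t : ℝ) (z : RSpace n × RSpace n) :
    dist (Φ s z) (Φ t z) ≤ Φ.bound * |s - t| := by
  have := Convex.norm_image_sub_le_of_norm_hasDerivWithin_le (s := univ) (x := t) (y := s)
    (fun r _ => (Φ.hasDerivAt z r).hasDerivWithinAt) (fun r _ => Φ.norm_le (Φ r z)) convex_univ
    trivial trivial
  rwa [← dist_eq_norm, Real.norm_eq_abs] at this

theorem continuous_uncurry : Continuous fun q : ℝ × (RSpace n × RSpace n) => Φ q.1 q.2 := by
  rw [continuous_iff_continuousAt]
  rintro ⟨t, z⟩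
  rw [ContinuousAt, tendsto_iff_dist_tendsto_zero]
  have hb : ∀ q : ℝ × (RSpace n × RSpace n), dist (Φ q.1 q.2) (Φ t z) ≤
      Φ.bound * |q.1 - t| + Real.exp (Φ.lip * |t|) * dist q.2 z := fun q =>
    (dist_triangle _ (Φ t q.2) _).trans (add_le_add (Φ.dist_map_time_le _ _ _) (Φ.dist_map_le _ _ _))
  refine squeeze_zero (fun _ => dist_nonneg) hb ?_
  have : Continuous fun q : ℝ × (RSpace n × RSpace n) =>
      (Φ.bound : ℝ) * |q.1 - t| + Real.exp (Φ.lip * |t|) * dist q.2 z := by fun_prop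
  exact this.tendsto' _ _ (by simp)

theorem continuous_map (t : ℝ) : Continuous (Φ t) :=
  Φ.continuous_uncurry.comp (Continuous.prodMk_right t)

theorem continuous_time (z : RSpace n × RSpace n) : Continuous fun t => Φ t z :=
  Φ.continuous_uncurry.comp (Continuous.prodMk_left z)

theorem energy_map (t : ℝ) (z : RSpace n × RSpace n) : S.energy (Φ t z) = S.energy z := by
  have h : ∀ r, HasDerivAt (fun r => S.energy (Φ r z)) 0 r := fun r => by
    have := S.hasDerivWithinAt_energy_comp (Φ.hasDerivAt z r).hasDerivWithinAt (s := univ)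
    rwa [hasDerivWithinAt_univ] at this
  have := is_const_of_deriv_eq_zero (fun r => (h r).differentiableAt) (fun r => (h r).deriv) t 0
  simpa [Φ.map_zero] using this

theorem mem_closedBundle_map {t : ℝ} {z : RSpace n × RSpace n} (hz : z ∈ S.closedBundle)
    (h : (Φ t z).1 ∈ closure S.Ω) : Φ t z ∈ S.closedBundle :=
  S.mem_closedBundle_of_energy h (by rw [Φ.energy_map]; exact hz.2.2)

theorem hasDerivAt_of_mem {t : ℝ} {z : RSpace n × RSpace n} (h : ‖Φ t z‖ ≤ Φ.radius) :
    HasDerivAt (fun s => Φ s z) (S.field (Φ t z)) t := by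
  have := Φ.hasDerivAt z t
  rwa [Φ.cutoff_eq_one _ h, one_smul] at this

/-- While the cut-off flow stays in the region without cut-off, it is the flow. -/
theorem flow_eq {t : ℝ} {z : RSpace n × RSpace n} (h : ∀ s ∈ uIcc 0 t, ‖Φ s z‖ ≤ Φ.radius) :
    S.flow z t = Φ t z := by
  have hΦ : S.IsTrajectory z t fun s => Φ s z :=
    ⟨Φ.map_zero z, fun s hs => (Φ.hasDerivAt_of_mem (h s hs)).hasDerivWithinAt⟩
  have hex : ∃ c, S.IsTrajectory z t c := ⟨_, hΦ⟩
  rw [flow, dif_pos hex]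
  have hc := hex.choose_spec
  set c := hex.choose
  -- Nothing is known about the curve chosen in `flow` except compactness of its image. The uncut
  -- field is Lipschitz on a ball containing both curves, which gives uniqueness.
  obtain ⟨R, hR⟩ := (isCompact_uIcc.image_of_continuousOn hc.2.continuousOn).isBounded.exists_norm_le
  obtain ⟨K, hK⟩ := S.contDiff_field.contDiffOn.exists_lipschitzOnWith one_ne_zero
    (convex_closedBall (0 : RSpace n × RSpace n) (max R Φ.radius)) (isCompact_closedBall _ _)
  exact eqOn_uIcc_of_isIntegralCurveOn hK hc.2 hΦ.2
    (fun r hr => mem_closedBall_zero_iff.2 ((hR _ ⟨r, hr, rfl⟩).trans (le_max_left _ _)))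
    (fun r hr => mem_closedBall_zero_iff.2 ((h r hr).trans (le_max_right _ _)))
    (by rw [hc.1, Φ.map_zero]) right_mem_uIcc

/-- A competing trajectory over the closure keeps the energy `τ`, hence remains in `closedBundle`,
where the cut-off equals 1; by uniqueness it is the cut-off flow. Existence of a trajectory thus
becomes a condition on a globally defined continuous map. -/
theorem mem_residence_iff {t : ℝ} {z : RSpace n × RSpace n} (hz : z ∈ S.closedBundle) :
    t ∈ S.residence z ↔ ∀ s ∈ uIcc 0 t, (Φ s z).1 ∈ closure S.Ω := by
  constructor
  · rintro ⟨c, hc, hcl⟩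
    have hconst : ∀ s ∈ uIcc 0 t, S.energy (c s) = S.τ := by
      intro s hs
      have hd : ∀ r ∈ uIcc 0 t, HasDerivWithinAt (fun r => S.energy (c r)) 0 (uIcc 0 t) r := by
        intro r hr
        refine S.hasDerivWithinAt_energy_comp (a := 1) ?_
        rw [one_smul]
        exact hc.2 r hr
      have := Convex.norm_image_sub_le_of_norm_hasDerivWithin_le (x := 0) (y := s) hd (C := 0)
        (fun _ _ => by simp) (convex_uIcc 0 t) left_mem_uIcc hs
      simp only [zero_mul, norm_le_zero_iff, sub_eq_zero] at this
      rw [this, hc.1]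
      exact hz.2.2
    have hcz : ∀ s ∈ uIcc 0 t, ‖c s‖ ≤ Φ.radius := fun s hs =>
      (Φ.norm_lt _ (S.mem_closedBundle_of_energy (hcl s hs) (hconst s hs))).le
    have heq := eqOn_uIcc_of_isIntegralCurveOn (t := t) (s := univ) (Φ.lipschitz.lipschitzOnWith)
      (f := c) (g := fun r => Φ r z)
      (fun r hr => by
        have : HasDerivWithinAt c (S.field (c r)) (uIcc 0 t) r := hc.2 r hr
        rw [← one_smul ℝ (S.field (c r)), ← Φ.cutoff_eq_one _ (hcz r hr)] at this
        exact this)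
      (Φ.isIntegralCurveOn _ _) (fun _ _ => trivial) (fun _ _ => trivial)
      (by rw [hc.1, Φ.map_zero])
    intro s hs
    have h1 : c s = Φ s z := heq hs
    rw [← h1]
    exact hcl s hs
  · intro h
    refine ⟨fun s => Φ s z, ⟨Φ.map_zero z, fun s hs => ?_⟩, h⟩
    exact (Φ.hasDerivAt_of_mem
      (Φ.norm_lt _ (Φ.mem_closedBundle_map hz (h s hs))).le).hasDerivWithinAt

theorem flow_eq_of_mem_residence {t : ℝ} {z : RSpace n × RSpace n} (hz : z ∈ S.closedBundle)
    (h : t ∈ S.residence z) : S.flow z t = Φ t z :=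
  Φ.flow_eq fun s hs => (Φ.norm_lt _ (Φ.mem_closedBundle_map hz
    ((Φ.mem_residence_iff hz).1 h s hs))).le

theorem zero_mem_residence {z : RSpace n × RSpace n} (hz : z ∈ S.closedBundle) :
    0 ∈ S.residence z := by
  obtain ⟨Φ⟩ := S.nonempty_cutoffFlow
  rw [Φ.mem_residence_iff hz]
  intro s hs
  rw [uIcc_self, mem_singleton_iff] at hs
  rw [hs, Φ.map_zero]
  exact hz.1

/-- Phase points over the closure together with a time in their residence set. -/
theorem isClosed_setOf_mem_residence :
    IsClosed {q : ℝ × (RSpace n × RSpace n) | q.2 ∈ S.closedBundle ∧ q.1 ∈ S.residence q.2} := by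
  obtain ⟨Φ⟩ := S.nonempty_cutoffFlow
  -- Writing the intermediate times as `r * t` with `r` in `[0, 1]` makes the index set independent
  -- of `t`, so the set is an intersection of closed conditions.
  have : {q : ℝ × (RSpace n × RSpace n) | q.2 ∈ S.closedBundle ∧ q.1 ∈ S.residence q.2} =
      {q | q.2 ∈ S.closedBundle} ∩ ⋂ r ∈ Icc (0 : ℝ) 1, {q | (Φ (r * q.1) q.2).1 ∈ closure S.Ω} := by
    ext ⟨t, z⟩
    simp only [mem_ofPred_eq, mem_inter_iff, mem_iInter]
    refine and_congr_right fun hz => ?_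
    rw [Φ.mem_residence_iff hz]
    constructor
    · intro h r hr
      refine h _ ?_
      rcases le_total 0 t with ht | ht
      · rw [uIcc_of_le ht]
        exact ⟨mul_nonneg hr.1 ht, mul_le_of_le_one_left ht hr.2⟩
      · rw [uIcc_of_ge ht]
        exact ⟨by nlinarith [hr.2], by nlinarith [hr.1]⟩
    · intro h s hs
      rcases eq_or_ne t 0 with rfl | ht
      · rw [uIcc_self, mem_singleton_iff] at hs
        have := h 0 (by simp)
        rwa [zero_mul, ← hs] at this
      · have := h (s / t) ?_
        · rwa [div_mul_cancel₀ _ ht] at this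
        · rcases ht.lt_or_gt with h0 | h0
          · rw [uIcc_of_ge h0.le] at hs
            exact ⟨div_nonneg_of_nonpos hs.2 h0.le, (div_le_one_of_neg h0).2 hs.1⟩
          · rw [uIcc_of_le h0.le] at hs
            exact ⟨div_nonneg hs.1 h0.le, (div_le_one h0).2 hs.2⟩
  rw [this]
  refine (S.isCompact_closedBundle.isClosed.preimage continuous_snd).inter
    (isClosed_biInter fun r _ => isClosed_closure.preimage ?_)
  have h1 : Continuous fun q : ℝ × (RSpace n × RSpace n) => (r * q.1, q.2) := by fun_prop
  exact continuous_fst.comp (Φ.continuous_uncurry.comp h1)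

end CutoffFlow

end TransportSetting

/-! ### Residence times and the ends of trajectories -/

theorem eventually_mul_pos_of_hasDerivAt {q : ℝ → ℝ} {d : ℝ} (h : HasDerivAt q d 0) (h0 : q 0 = 0)
    (hd : 0 < d) : ∀ᶠ t in 𝓝[≠] (0 : ℝ), 0 < t * q t := by
  rw [hasDerivAt_iff_tendsto_slope] at h
  filter_upwards [h.eventually (lt_mem_nhds hd), self_mem_nhdsWithin] with t ht ht0
  have ht0' : t ≠ 0 := ht0
  rw [slope_def_field, h0, sub_zero, sub_zero] at ht
  have h2 : t * q t = q t / t * t ^ 2 := by field_simp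
  rw [h2]
  positivity

namespace TransportSetting

open scoped NNReal ENNReal

variable {n : ℕ} {S : TransportSetting n}

theorem bundle_Ω_subset : S.bundle S.Ω ⊆ S.closedBundle := fun _ hz => ⟨subset_closure hz.1, hz.2⟩

theorem bundle_frontier_subset : S.bundle (frontier S.Ω) ⊆ S.closedBundle :=
  fun _ hz => ⟨frontier_subset_closure hz.1, hz.2⟩

theorem outgoingSet_subset : S.outgoingSet ⊆ S.closedBundle :=
  fun _ hz => bundle_frontier_subset hz.1

theorem incomingSet_subset : S.incomingSet ⊆ S.closedBundle :=
  fun _ hz => bundle_frontier_subset hz.1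

variable {z : RSpace n × RSpace n}

theorem mem_bundle_frontier (hz : z ∈ S.closedBundle) (h : z ∉ S.bundle S.Ω) :
    z ∈ S.bundle (frontier S.Ω) := by
  refine ⟨?_, hz.2⟩
  rw [S.isOpen_Ω.frontier_eq]
  exact ⟨hz.1, fun h1 => h ⟨h1, hz.2⟩⟩

theorem inner_normal (x v : RSpace n) :
    inner ℝ (S.normal x) v = ‖gradient S.ρ x‖⁻¹ * inner ℝ (gradient S.ρ x) v := by
  rw [normal, real_inner_smul_left]

theorem inner_normal_pos_iff {x : RSpace n} (hx : x ∈ frontier S.Ω) (v : RSpace n) :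
    0 < inner ℝ (S.normal x) v ↔ 0 < inner ℝ (gradient S.ρ x) v := by
  rw [inner_normal]
  exact mul_pos_iff_of_pos_left
    (inv_pos.2 (norm_pos_iff.2 (S.ρ_regular x (S.mem_frontier_iff.1 hx))))

theorem inner_normal_neg_iff {x : RSpace n} (hx : x ∈ frontier S.Ω) (v : RSpace n) :
    inner ℝ (S.normal x) v < 0 ↔ inner ℝ (gradient S.ρ x) v < 0 := by
  have := inner_normal_pos_iff hx (-v)
  simpa [inner_neg_right] using this

theorem uIcc_zero_subset_residence {t : ℝ} (hz : z ∈ S.closedBundle) (ht : t ∈ S.residence z) :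
    uIcc 0 t ⊆ S.residence z := by
  obtain ⟨Φ⟩ := S.nonempty_cutoffFlow
  intro s hs
  rw [Φ.mem_residence_iff hz] at *
  exact fun r hr => ht r (uIcc_subset_uIcc left_mem_uIcc hs hr)

theorem isClosed_residence (hz : z ∈ S.closedBundle) : IsClosed (S.residence z) := by
  have h := (CutoffFlow.isClosed_setOf_mem_residence (S := S)).preimage
    (Continuous.prodMk_left z : Continuous fun t : ℝ => (t, z))
  convert h using 1
  ext t
  exact ⟨fun ht => ⟨hz, ht⟩, fun ht => ht.2⟩

theorem entryTime_le_zero (hnt : S.NonTrapping) (hz : z ∈ S.closedBundle) : S.entryTime z ≤ 0 :=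
  csInf_le (hnt z hz).2 (CutoffFlow.zero_mem_residence hz)

theorem exitTime_nonneg (hnt : S.NonTrapping) (hz : z ∈ S.closedBundle) : 0 ≤ S.exitTime z :=
  le_csSup (hnt z hz).1 (CutoffFlow.zero_mem_residence hz)

theorem residence_eq (hnt : S.NonTrapping) (hz : z ∈ S.closedBundle) :
    S.residence z = Icc (S.entryTime z) (S.exitTime z) := by
  have hne : (S.residence z).Nonempty := ⟨0, CutoffFlow.zero_mem_residence hz⟩
  refine Subset.antisymm (fun t ht => ⟨csInf_le (hnt z hz).2 ht, le_csSup (hnt z hz).1 ht⟩) ?_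
  intro t ht
  rcases le_total 0 t with h0 | h0
  · refine uIcc_zero_subset_residence hz ((isClosed_residence hz).csSup_mem hne (hnt z hz).1) ?_
    change t ∈ uIcc 0 (S.exitTime z)
    rw [uIcc_of_le (h0.trans ht.2)]
    exact ⟨h0, ht.2⟩
  · refine uIcc_zero_subset_residence hz ((isClosed_residence hz).csInf_mem hne (hnt z hz).2) ?_
    change t ∈ uIcc 0 (S.entryTime z)
    rw [uIcc_of_ge (ht.1.trans h0)]
    exact ⟨ht.1, h0⟩

theorem Ioo_subset_residence (hnt : S.NonTrapping) (hz : z ∈ S.closedBundle) :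
    Ioo (S.entryTime z) (S.exitTime z) ⊆ S.residence z := by
  rw [residence_eq hnt hz]
  exact Ioo_subset_Icc_self

/-- All travel times are uniformly bounded. -/
theorem exists_residence_bound (hnt : S.NonTrapping) :
    ∃ T : ℝ, 0 < T ∧ ∀ z ∈ S.closedBundle, ∀ t ∈ S.residence z, |t| ≤ T := by
  -- The points still resident at time `e * k` form a decreasing sequence of compact sets. If all
  -- were nonempty, a common point would be trapped in the time direction `e`.
  have key : ∀ e : ℝ, (∀ z ∈ S.closedBundle, ∃ k : ℕ, e * k ∉ S.residence z) →
      ∃ k : ℕ, ∀ z ∈ S.closedBundle, e * k ∉ S.residence z := by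
    intro e he
    by_contra! hcon
    have hanti : ∀ k : ℕ, {z | z ∈ S.closedBundle ∧ e * (k + 1 : ℕ) ∈ S.residence z} ⊆
        {z | z ∈ S.closedBundle ∧ e * k ∈ S.residence z} := by
      rintro k z ⟨hz, h⟩
      refine ⟨hz, uIcc_zero_subset_residence hz h ?_⟩
      have hk : (0 : ℝ) ≤ k := k.cast_nonneg
      push_cast
      rcases le_total 0 e with h0 | h0
      · rw [uIcc_of_le (by positivity)]
        exact ⟨by positivity, by nlinarith⟩
      · rw [uIcc_of_ge (by nlinarith)]
        exact ⟨by nlinarith, by nlinarith⟩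
    have hcl : ∀ k : ℕ, IsClosed {z | z ∈ S.closedBundle ∧ e * k ∈ S.residence z} := fun k =>
      (CutoffFlow.isClosed_setOf_mem_residence (S := S)).preimage
        (Continuous.prodMk_right (e * k))
    obtain ⟨z, hz⟩ := IsCompact.nonempty_iInter_of_sequence_nonempty_isCompact_isClosed
      (fun k : ℕ => {z | z ∈ S.closedBundle ∧ e * k ∈ S.residence z}) hanti
      (fun k => (hcon k).imp fun z hz => hz)
      (S.isCompact_closedBundle.of_isClosed_subset (hcl 0) fun z hz => hz.1) hcl
    rw [mem_iInter] at hz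
    obtain ⟨k, hk⟩ := he z (hz 0).1
    exact hk (hz k).2
  obtain ⟨k, hk⟩ := key 1 fun z hz => by
    obtain ⟨B, hB⟩ := (hnt z hz).1
    obtain ⟨k, hk⟩ := exists_nat_gt B
    exact ⟨k, fun h => absurd (hB h) (by rw [one_mul]; exact not_le.2 hk)⟩
  obtain ⟨m, hm⟩ := key (-1) fun z hz => by
    obtain ⟨B, hB⟩ := (hnt z hz).2
    obtain ⟨k, hk⟩ := exists_nat_gt (-B)
    exact ⟨k, fun h => absurd (hB h) (by linarith)⟩
  refine ⟨k + m + 1, by positivity, fun z hz t ht => ?_⟩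
  have hk0 : (0 : ℝ) ≤ k := k.cast_nonneg
  have hm0 : (0 : ℝ) ≤ m := m.cast_nonneg
  rw [abs_le]
  constructor
  · by_contra! hcon
    refine hm z hz (uIcc_zero_subset_residence hz ht ?_)
    rw [uIcc_of_ge (by linarith)]
    constructor <;> linarith
  · by_contra! hcon
    refine hk z hz (uIcc_zero_subset_residence hz ht ?_)
    rw [uIcc_of_le (by linarith)]
    constructor <;> linarith

namespace CutoffFlow

variable (Φ : S.CutoffFlow)

theorem map_mem_closedBundle {t : ℝ} (hz : z ∈ S.closedBundle) (ht : t ∈ S.residence z) :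
    Φ t z ∈ S.closedBundle :=
  Φ.mem_closedBundle_map hz ((Φ.mem_residence_iff hz).1 ht t right_mem_uIcc)

/-- By the group law, residence of `Φ t z` between 0 and `s` is residence of `z` between `t` and `s
+ t`; combined with residence between 0 and `t` this gives both directions, whatever the signs. -/
theorem mem_residence_map_iff {s t : ℝ} (hz : z ∈ S.closedBundle) (ht : t ∈ S.residence z) :
    s ∈ S.residence (Φ t z) ↔ s + t ∈ S.residence z := by
  rw [Φ.mem_residence_iff (Φ.map_mem_closedBundle hz ht), Φ.mem_residence_iff hz]
  rw [Φ.mem_residence_iff hz] at ht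
  have h1 : (∀ r ∈ uIcc 0 s, (Φ r (Φ t z)).1 ∈ closure S.Ω) ↔
      ∀ r ∈ uIcc t (s + t), (Φ r z).1 ∈ closure S.Ω := by
    constructor
    · intro h r hr
      have := h (r - t) (by
        have := mem_image_of_mem (fun x => x - t) hr
        rwa [image_sub_const_uIcc, sub_self, add_sub_cancel_right] at this)
      rwa [← Φ.map_add, sub_add_cancel] at this
    · intro h r hr
      rw [← Φ.map_add]
      refine h _ ?_
      have := mem_image_of_mem (fun x => x + t) hr
      rwa [image_add_const_uIcc, zero_add] at this
  rw [h1]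
  constructor
  · intro h r hr
    rcases uIcc_subset_uIcc_union_uIcc (b := t) hr with h2 | h2
    · exact ht r h2
    · exact h r h2
  · intro h r hr
    rcases uIcc_subset_uIcc_union_uIcc (b := 0) hr with h2 | h2
    · rw [uIcc_comm] at h2; exact ht r h2
    · exact h r h2

theorem residence_map_eq {t : ℝ} (hnt : S.NonTrapping) (hz : z ∈ S.closedBundle)
    (ht : t ∈ S.residence z) :
    S.entryTime (Φ t z) = S.entryTime z - t ∧ S.exitTime (Φ t z) = S.exitTime z - t := by
  have h1 : Icc (S.entryTime (Φ t z)) (S.exitTime (Φ t z)) =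
      Icc (S.entryTime z - t) (S.exitTime z - t) := by
    rw [← residence_eq hnt (Φ.map_mem_closedBundle hz ht)]
    ext s
    rw [Φ.mem_residence_map_iff hz ht, residence_eq hnt hz, mem_Icc, mem_Icc, sub_le_iff_le_add,
      le_sub_iff_add_le]
  have h2 := entryTime_le_zero hnt (Φ.map_mem_closedBundle hz ht)
  have h3 := exitTime_nonneg hnt (Φ.map_mem_closedBundle hz ht)
  exact (Icc_eq_Icc_iff (h2.trans h3)).1 h1

theorem entryTime_map {t : ℝ} (hnt : S.NonTrapping) (hz : z ∈ S.closedBundle)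
    (ht : t ∈ S.residence z) : S.entryTime (Φ t z) = S.entryTime z - t :=
  (Φ.residence_map_eq hnt hz ht).1

theorem exitTime_map {t : ℝ} (hnt : S.NonTrapping) (hz : z ∈ S.closedBundle)
    (ht : t ∈ S.residence z) : S.exitTime (Φ t z) = S.exitTime z - t :=
  (Φ.residence_map_eq hnt hz ht).2

/-- The boundary defining function along a trajectory. -/
theorem hasDerivAt_ρ {t : ℝ} (h : Φ t z ∈ S.closedBundle) :
    HasDerivAt (fun s => S.ρ (Φ s z).1) (inner ℝ (gradient S.ρ (Φ t z).1) (Φ t z).2) t := by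
  have h1 := Φ.hasDerivAt_of_mem (Φ.norm_lt _ h).le
  have := S.hasDerivWithinAt_ρ_comp (h1.hasDerivWithinAt (s := univ)).fst
  rwa [hasDerivWithinAt_univ] at this

theorem hasDerivAt_ρ_zero (h : z ∈ S.closedBundle) :
    HasDerivAt (fun s => S.ρ (Φ s z).1) (inner ℝ (gradient S.ρ z.1) z.2) 0 := by
  have := Φ.hasDerivAt_ρ (z := z) (t := 0) (by rwa [Φ.map_zero])
  rwa [Φ.map_zero] at this

/-- A trajectory cannot stay in the closure of the domain, to one side, after leaving a
tangential boundary point. -/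
theorem not_tangential (hconv : S.StrictlyConvexBoundary) (hz : z ∈ S.bundle (frontier S.Ω))
    {t : ℝ} (ht0 : t ≠ 0) (ht : t ∈ S.residence z) : inner ℝ (gradient S.ρ z.1) z.2 ≠ 0 := by
  obtain ⟨Φ⟩ := S.nonempty_cutoffFlow
  intro h0
  have hcz := bundle_frontier_subset hz
  obtain ⟨δ, hδ, h⟩ := hconv z hz (by rw [inner_normal, h0, mul_zero])
  -- A time between 0 and `t`, nonzero and at most `δ / 2` in absolute value, at which convexity
  -- forbids residence.
  set s := t * min 1 (δ / (2 * |t|)) with hs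
  have hpos : 0 < min 1 (δ / (2 * |t|)) := by positivity
  have hsu : s ∈ uIcc 0 t := by
    rcases ht0.lt_or_gt with h1 | h1
    · rw [uIcc_of_ge h1.le]
      exact ⟨by nlinarith [min_le_left 1 (δ / (2 * |t|))], by nlinarith⟩
    · rw [uIcc_of_le h1.le]
      exact ⟨by positivity, by nlinarith [min_le_left 1 (δ / (2 * |t|))]⟩
  have hsr := uIcc_zero_subset_residence hcz ht hsu
  have habs : |s| < δ := by
    rw [hs, abs_mul, abs_of_pos hpos]
    have h2 : |t| * min 1 (δ / (2 * |t|)) ≤ |t| * (δ / (2 * |t|)) := by gcongr; exact min_le_right _ _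
    have h3 : |t| * (δ / (2 * |t|)) = δ / 2 := by field_simp
    linarith
  refine h s (abs_lt.1 habs) (by positivity) ?_
  rw [Φ.flow_eq_of_mem_residence hcz hsr]
  exact (Φ.map_mem_closedBundle hcz hsr).1

theorem ρ_map_le {t : ℝ} (hz : z ∈ S.closedBundle) (ht : t ∈ S.residence z) :
    S.ρ (Φ t z).1 ≤ 0 := S.mem_closure_iff.1 (Φ.map_mem_closedBundle hz ht).1

theorem Ioo_zero_subset_residence {t : ℝ} (hz : z ∈ S.closedBundle) {b : ℝ}
    (hb : b ∈ S.residence z) (ht : 0 < t * b) (hab : |t| ≤ |b|) : t ∈ S.residence z := by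
  refine uIcc_zero_subset_residence hz hb ?_
  rcases lt_or_gt_of_ne (show b ≠ 0 by rintro rfl; simp at ht) with h | h
  · have h1 : t < 0 := by nlinarith
    rw [abs_of_neg h1, abs_of_neg h] at hab
    rw [uIcc_of_ge h.le]
    exact ⟨by linarith, h1.le⟩
  · have h1 : 0 < t := by nlinarith
    rw [abs_of_pos h1, abs_of_pos h] at hab
    rw [uIcc_of_le h.le]
    exact ⟨h1.le, hab⟩

end CutoffFlow

open CutoffFlow

/-- At a boundary point where the boundary defining function increases (`e = 1`) or decreases
(`e = -1`) along the trajectory, the trajectory leaves in time direction `e`. -/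
theorem not_mem_residence_of_transversal {e : ℝ} (hz : z ∈ S.bundle (frontier S.Ω))
    (h : 0 < e * inner ℝ (gradient S.ρ z.1) z.2) {t : ℝ} (ht : 0 < e * t) : t ∉ S.residence z := by
  obtain ⟨Φ⟩ := S.nonempty_cutoffFlow
  have hcz := bundle_frontier_subset hz
  intro hmem
  have h1 : HasDerivAt (fun s => e * S.ρ (Φ s z).1) (e * inner ℝ (gradient S.ρ z.1) z.2) 0 :=
    (Φ.hasDerivAt_ρ_zero hcz).const_mul e
  have h2 := eventually_mul_pos_of_hasDerivAt h1
    (by simp [Φ.map_zero, S.mem_frontier_iff.1 hz.1]) h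
  have ht0 : t ≠ 0 := by rintro rfl; simp at ht
  have h3 : ∀ᶠ r : ℝ in 𝓝[>] 0, 0 < (r * t) * (e * S.ρ (Φ (r * t) z).1) := by
    have h4 : Tendsto (fun r : ℝ => r * t) (𝓝[>] 0) (𝓝[≠] 0) := by
      refine tendsto_nhdsWithin_iff.2 ⟨?_, ?_⟩
      · have : Continuous fun r : ℝ => r * t := by fun_prop
        exact (this.tendsto' 0 0 (by simp)).mono_left nhdsWithin_le_nhds
      · filter_upwards [self_mem_nhdsWithin] with r hr
        exact mul_ne_zero (ne_of_gt hr) ht0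
    exact h4.eventually h2
  obtain ⟨r, hr, hr1⟩ := (h3.and (Ioo_mem_nhdsGT (zero_lt_one' ℝ))).exists
  have h5 : r * t ∈ S.residence z := by
    refine Ioo_zero_subset_residence hcz hmem ?_ ?_
    · have := sq_nonneg t
      have h6 : 0 < t ^ 2 := by positivity
      nlinarith [hr1.1]
    · rw [abs_mul, abs_of_pos hr1.1]
      exact mul_le_of_le_one_left (abs_nonneg _) hr1.2.le
  have h6 := Φ.ρ_map_le hcz h5
  have h7 : 0 < r * (e * t) := mul_pos hr1.1 ht
  nlinarith

/-- A trajectory through a point of the domain stays in the domain for a while. -/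
theorem entryTime_neg_exitTime_pos (hnt : S.NonTrapping) (hz : z ∈ S.bundle S.Ω) :
    S.entryTime z < 0 ∧ 0 < S.exitTime z := by
  obtain ⟨Φ⟩ := S.nonempty_cutoffFlow
  have hcz := bundle_Ω_subset hz
  have h1 : ∀ᶠ t in 𝓝 (0 : ℝ), (Φ t z).1 ∈ S.Ω := by
    refine (continuous_fst.comp (Φ.continuous_time z)).continuousAt.eventually
      (S.isOpen_Ω.mem_nhds ?_)
    simp only [Function.comp_apply, Φ.map_zero]
    exact hz.1
  obtain ⟨δ, hδ, h⟩ := Metric.eventually_nhds_iff.1 h1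
  have h2 : ∀ t : ℝ, |t| < δ → t ∈ S.residence z := by
    intro t ht
    rw [Φ.mem_residence_iff hcz]
    intro s hs
    refine subset_closure (h ?_)
    have := abs_sub_left_of_mem_uIcc hs
    simp only [sub_zero] at this
    rw [Real.dist_0_eq_abs]
    exact this.trans_lt ht
  rw [residence_eq hnt hcz] at h2
  have h3 := h2 (δ / 2) (by rw [abs_of_pos] <;> linarith)
  have h4 := h2 (-(δ / 2)) (by rw [abs_neg, abs_of_pos] <;> linarith)
  exact ⟨by linarith [h4.1], by linarith [h3.2]⟩

/-- If the point were on the boundary, `ρ` along the trajectory would have a local maximum there, so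
the contact would be tangential, against strict convexity. Trajectories therefore touch the boundary
only at their ends. -/
theorem mem_bundle_Ω_of_lt (hconv : S.StrictlyConvexBoundary) (hnt : S.NonTrapping)
    (hz : z ∈ S.closedBundle) (h1 : S.entryTime z < 0) (h2 : 0 < S.exitTime z) :
    z ∈ S.bundle S.Ω := by
  obtain ⟨Φ⟩ := S.nonempty_cutoffFlow
  by_contra hcon
  have hzf := mem_bundle_frontier hz hcon
  have hmem : S.exitTime z ∈ S.residence z := by
    rw [residence_eq hnt hz]; exact ⟨h1.le.trans h2.le, le_rfl⟩
  refine not_tangential hconv hzf h2.ne' hmem ?_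
  have hmax : IsLocalMax (fun s => S.ρ (Φ s z).1) 0 := by
    filter_upwards [Ioo_mem_nhds h1 h2] with t ht
    simp only [Φ.map_zero, S.mem_frontier_iff.1 hzf.1]
    exact Φ.ρ_map_le hz (Ioo_subset_residence hnt hz ht)
  exact hmax.hasDerivAt_eq_zero (Φ.hasDerivAt_ρ_zero hz)

theorem CutoffFlow.map_mem_bundle_Ω (Φ : S.CutoffFlow) (hconv : S.StrictlyConvexBoundary)
    (hnt : S.NonTrapping) (hz : z ∈ S.closedBundle) {t : ℝ}
    (ht : t ∈ Ioo (S.entryTime z) (S.exitTime z)) : Φ t z ∈ S.bundle S.Ω := by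
  have hr := Ioo_subset_residence hnt hz ht
  refine mem_bundle_Ω_of_lt hconv hnt (Φ.map_mem_closedBundle hz hr) ?_ ?_
  · rw [Φ.entryTime_map hnt hz hr]; linarith [ht.1]
  · rw [Φ.exitTime_map hnt hz hr]; linarith [ht.2]

/-- Tangency is excluded by convexity because the past is nontrivial, and an inward direction is
excluded because the trajectory would then have been outside the closure just before. -/
theorem mem_outgoingSet_of_exitTime_eq_zero (hconv : S.StrictlyConvexBoundary)
    (hnt : S.NonTrapping) (hz : z ∈ S.closedBundle) (h1 : S.entryTime z < 0)
    (h2 : S.exitTime z = 0) : z ∈ S.outgoingSet := by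
  obtain ⟨Φ⟩ := S.nonempty_cutoffFlow
  have hzf := mem_bundle_frontier hz fun h => (entryTime_neg_exitTime_pos hnt h).2.ne' h2
  have hmem : S.entryTime z ∈ S.residence z := by
    rw [residence_eq hnt hz]; exact ⟨le_rfl, by linarith⟩
  refine ⟨hzf, (inner_normal_pos_iff hzf.1 _).2 ?_⟩
  refine lt_of_le_of_ne ?_ (not_tangential hconv hzf h1.ne hmem).symm
  by_contra! hcon
  exact not_mem_residence_of_transversal (e := -1) hzf (by linarith) (by linarith) hmem

theorem mem_incomingSet_of_entryTime_eq_zero (hconv : S.StrictlyConvexBoundary)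
    (hnt : S.NonTrapping) (hz : z ∈ S.closedBundle) (h1 : S.entryTime z = 0)
    (h2 : 0 < S.exitTime z) : z ∈ S.incomingSet := by
  obtain ⟨Φ⟩ := S.nonempty_cutoffFlow
  have hzf := mem_bundle_frontier hz fun h => (entryTime_neg_exitTime_pos hnt h).1.ne h1
  have hmem : S.exitTime z ∈ S.residence z := by
    rw [residence_eq hnt hz]; exact ⟨by linarith, le_rfl⟩
  refine ⟨hzf, (inner_normal_neg_iff hzf.1 _).2 ?_⟩
  refine lt_of_le_of_ne ?_ (not_tangential hconv hzf h2.ne' hmem)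
  by_contra! hcon
  exact not_mem_residence_of_transversal (e := 1) hzf (by linarith) (by linarith) hmem

/-- The trajectory from a transversal boundary point enters the domain. -/
theorem exists_mem_residence_of_transversal {e : ℝ} (he : e ≠ 0)
    (hz : z ∈ S.bundle (frontier S.Ω)) (h : 0 < e * inner ℝ (gradient S.ρ z.1) z.2) :
    ∃ t, e * t < 0 ∧ t ∈ S.residence z := by
  obtain ⟨Φ⟩ := S.nonempty_cutoffFlow
  have hcz := bundle_frontier_subset hz
  have h1 : HasDerivAt (fun s => e * S.ρ (Φ s z).1) (e * inner ℝ (gradient S.ρ z.1) z.2) 0 :=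
    (Φ.hasDerivAt_ρ_zero hcz).const_mul e
  have h2 := eventually_mul_pos_of_hasDerivAt h1
    (by simp [Φ.map_zero, S.mem_frontier_iff.1 hz.1]) h
  rw [eventually_nhdsWithin_iff, Metric.eventually_nhds_iff] at h2
  obtain ⟨δ, hδ, h2⟩ := h2
  -- A step of length `δ / 2` in the time direction opposite to `e`, within which `e * ρ` has the
  -- sign of the time.
  refine ⟨-(δ / 2 * (e / |e|)), ?_, ?_⟩
  · have : e * -(δ / 2 * (e / |e|)) = -(δ / 2 * (e ^ 2 / |e|)) := by ring
    rw [this, neg_neg_iff_pos]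
    positivity
  rw [Φ.mem_residence_iff hcz]
  intro s hs
  rw [S.mem_closure_iff]
  have habs : |s| < δ := by
    have h3 := abs_sub_left_of_mem_uIcc hs
    simp only [sub_zero, abs_neg, abs_mul, abs_div, abs_abs] at h3
    rw [div_self (abs_ne_zero.2 he), abs_of_pos hδ] at h3
    norm_num at h3
    linarith
  have hsign : e * s ≤ 0 := by
    rcases lt_or_gt_of_ne he with h0 | h0
    · rw [abs_of_neg h0, div_neg, div_self he, uIcc_of_le (by linarith)] at hs
      nlinarith [hs.1]
    · rw [abs_of_pos h0, div_self he, uIcc_of_ge (by linarith)] at hs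
      nlinarith [hs.2]
  rcases eq_or_ne s 0 with rfl | hs0
  · rw [Φ.map_zero, S.mem_frontier_iff.1 hz.1]
  · have h4 := h2 (by rwa [Real.dist_0_eq_abs]) hs0
    by_contra! hcon
    nlinarith

theorem exitTime_of_mem_outgoingSet (hnt : S.NonTrapping) (hz : z ∈ S.outgoingSet) :
    S.entryTime z < 0 ∧ S.exitTime z = 0 := by
  have hcz := outgoingSet_subset hz
  have hg := (inner_normal_pos_iff hz.1.1 _).1 hz.2
  constructor
  · obtain ⟨t, ht, hmem⟩ := exists_mem_residence_of_transversal one_ne_zero hz.1 (by linarith)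
    rw [residence_eq hnt hcz] at hmem
    linarith [hmem.1]
  · refine le_antisymm ?_ (exitTime_nonneg hnt hcz)
    by_contra! hcon
    refine not_mem_residence_of_transversal (e := 1) hz.1 (by linarith) (t := S.exitTime z)
      (by linarith) ?_
    rw [residence_eq hnt hcz]
    exact ⟨(entryTime_le_zero hnt hcz).trans hcon.le, le_rfl⟩

theorem exitTime_of_mem_incomingSet (hnt : S.NonTrapping) (hz : z ∈ S.incomingSet) :
    S.entryTime z = 0 ∧ 0 < S.exitTime z := by
  have hcz := incomingSet_subset hz
  have hg := (inner_normal_neg_iff hz.1.1 _).1 hz.2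
  constructor
  · refine le_antisymm (entryTime_le_zero hnt hcz) ?_
    by_contra! hcon
    refine not_mem_residence_of_transversal (e := -1) hz.1 (by linarith)
      (t := S.entryTime z) (by linarith) ?_
    rw [residence_eq hnt hcz]
    exact ⟨le_rfl, hcon.le.trans (exitTime_nonneg hnt hcz)⟩
  · obtain ⟨t, ht, hmem⟩ := exists_mem_residence_of_transversal (e := -1) (by norm_num) hz.1
      (by linarith)
    rw [residence_eq hnt hcz] at hmem
    linarith [hmem.2]

theorem CutoffFlow.map_exitTime_mem (Φ : S.CutoffFlow) (hconv : S.StrictlyConvexBoundary)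
    (hnt : S.NonTrapping) (hz : z ∈ S.closedBundle) (h : S.entryTime z < S.exitTime z) :
    Φ (S.exitTime z) z ∈ S.outgoingSet := by
  have hr : S.exitTime z ∈ S.residence z := by
    rw [residence_eq hnt hz]; exact ⟨h.le, le_rfl⟩
  refine mem_outgoingSet_of_exitTime_eq_zero hconv hnt (Φ.map_mem_closedBundle hz hr) ?_ ?_
  · rw [Φ.entryTime_map hnt hz hr]; linarith
  · rw [Φ.exitTime_map hnt hz hr]; linarith

theorem CutoffFlow.map_entryTime_mem (Φ : S.CutoffFlow) (hconv : S.StrictlyConvexBoundary)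
    (hnt : S.NonTrapping) (hz : z ∈ S.closedBundle) (h : S.entryTime z < S.exitTime z) :
    Φ (S.entryTime z) z ∈ S.incomingSet := by
  have hr : S.entryTime z ∈ S.residence z := by
    rw [residence_eq hnt hz]; exact ⟨le_rfl, h.le⟩
  refine mem_incomingSet_of_entryTime_eq_zero hconv hnt (Φ.map_mem_closedBundle hz hr) ?_ ?_
  · rw [Φ.entryTime_map hnt hz hr]; linarith
  · rw [Φ.exitTime_map hnt hz hr]; linarith

end TransportSetting

namespace TransportSetting

open scoped NNReal ENNReal

variable {n : ℕ} {S : TransportSetting n}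

/-! ### The volume of cones -/

theorem exists_lipschitzOnWith_of_eqOn_comp {X Y Z : Type*} [PseudoEMetricSpace X]
    [PseudoEMetricSpace Y] [PseudoEMetricSpace Z] {K L : ℝ≥0} {g : Y → Z} {f : X → Y} {h : X → Z}
    {s : Set X} {t : Set Y} (hg : LipschitzOnWith K g t) (hf : LipschitzOnWith L f s)
    (hst : MapsTo f s t) (heq : ∀ x ∈ s, h x = g (f x)) : ∃ K, LipschitzOnWith K h s :=
  ⟨K * L, fun x hx y hy => by rw [heq x hx, heq y hy]; exact hg.comp hf hst hx hy⟩

theorem exists_speed_bounds (S : TransportSetting n) :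
    ∃ a b : ℝ, 0 < a ∧ 0 < b ∧ ∀ x ∈ closure S.Ω, a ≤ S.speed x ∧ S.speed x ≤ b := by
  have hne : (closure S.Ω).Nonempty := S.isConnected.nonempty.closure
  obtain ⟨x, hx, hmin⟩ := S.isCompact_closure.exists_isMinOn hne S.continuous_speed.continuousOn
  obtain ⟨y, hy, hmax⟩ := S.isCompact_closure.exists_isMaxOn hne S.continuous_speed.continuousOn
  exact ⟨S.speed x, S.speed y, S.speed_pos hx, S.speed_pos hy, fun w hw => ⟨hmin hw, hmax hw⟩⟩

theorem measurableSet_Ω : MeasurableSet S.Ω := S.isOpen_Ω.measurableSet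

instance isFiniteMeasure_restrict_Ω : IsFiniteMeasure ((volume : Measure (RSpace n)).restrict S.Ω) :=
  ⟨by rw [Measure.restrict_apply_univ]; exact S.isBounded.measure_lt_top⟩

instance isFiniteMeasure_bulk : IsFiniteMeasure S.bulk := by
  obtain ⟨a, b, ha, hb, hab⟩ := S.exists_speed_bounds
  refine ⟨?_⟩
  rw [bulk, phaseMeasure_apply _ _ MeasurableSet.univ]
  calc _ ≤ ∫⁻ _ in S.Ω, ENNReal.ofReal (b ^ (n - 1)) * (volume : Measure (RSpace n)).toSphere univ := by
        refine setLIntegral_mono measurable_const fun x hx => ?_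
        gcongr
        · exact Real.sqrt_nonneg _
        · exact (hab x (subset_closure hx)).2
        · exact subset_univ _
    _ < ⊤ := by
        rw [lintegral_const]
        exact ENNReal.mul_lt_top (ENNReal.mul_lt_top ENNReal.ofReal_lt_top (measure_lt_top _ _))
          (measure_lt_top _ _)

theorem restrict_prod_volume :
    ((volume : Measure (RSpace n)).restrict S.Ω).prod (volume : Measure (RSpace n)) =
      (volume : Measure (RSpace n × RSpace n)).restrict (S.Ω ×ˢ univ) := by
  conv_lhs => rw [← Measure.restrict_univ (μ := (volume : Measure (RSpace n)))]
  rw [Measure.restrict_univ, Measure.volume_eq_prod, ← Measure.prod_restrict, Measure.restrict_univ]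

/-- Both sides integrate the same set of directions, against `p ^ (n-1)` and `coneConst n * p ^ n`
respectively; the ratio is controlled by the lower bound of the speed on the compact closure. -/
theorem exists_bulk_le_volume_cone (hn : n ≠ 0) (S : TransportSetting n) :
    ∃ C : ℝ≥0, ∀ A, MeasurableSet A → S.bulk A ≤ C * volume (S.cone A) := by
  obtain ⟨a, b, ha, hb, hab⟩ := S.exists_speed_bounds
  have hc := coneConst_pos hn
  refine ⟨(1 / (coneConst n * a)).toNNReal, fun A hA => ?_⟩
  have h1 : (((volume : Measure (RSpace n)).restrict S.Ω).prod volume) (S.cone A) ≤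
      volume (S.cone A) := by
    rw [restrict_prod_volume]
    exact Measure.restrict_apply_le _ _
  refine le_trans ?_ (mul_le_mul_right h1 _)
  rw [S.prod_volume_cone hn _ hA, bulk, phaseMeasure_apply _ _ hA,
    ← lintegral_const_mul' _ _ ENNReal.coe_ne_top]
  refine setLIntegral_mono' measurableSet_Ω fun x hx => ?_
  obtain ⟨hax, -⟩ := hab x (subset_closure hx)
  have hp : 0 ≤ S.speed x := ha.le.trans hax
  rw [← mul_assoc]
  gcongr
  change _ ≤ ENNReal.ofReal _ * _
  rw [← ENNReal.ofReal_mul (by positivity)]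
  refine ENNReal.ofReal_le_ofReal ?_
  have h2 : S.speed x ^ n = S.speed x ^ (n - 1) * S.speed x := by
    rw [← pow_succ, Nat.sub_one_add_one hn]
  have h3 : 1 / (coneConst n * a) * (coneConst n * S.speed x ^ n) =
      S.speed x ^ (n - 1) * (S.speed x / a) := by
    rw [h2]; field_simp
  rw [h3]
  exact le_mul_of_one_le_right (by positivity) ((one_le_div ha).2 hax)

theorem exists_volume_cone_le_bulk (hn : n ≠ 0) (S : TransportSetting n) :
    ∃ C : ℝ≥0, ∀ A, MeasurableSet A → A ⊆ S.bundle S.Ω → volume (S.cone A) ≤ C * S.bulk A := by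
  obtain ⟨a, b, ha, hb, hab⟩ := S.exists_speed_bounds
  have hc := coneConst_pos hn
  refine ⟨(coneConst n * b).toNNReal, fun A hA hsub => ?_⟩
  have h1 : (((volume : Measure (RSpace n)).restrict S.Ω).prod volume) (S.cone A) =
      volume (S.cone A) := by
    rw [restrict_prod_volume, Measure.restrict_eq_self]
    exact fun z hz => ⟨(hsub hz.2.2).1, trivial⟩
  rw [← h1, S.prod_volume_cone hn _ hA, bulk, phaseMeasure_apply _ _ hA,
    ← lintegral_const_mul' _ _ ENNReal.coe_ne_top]
  refine setLIntegral_mono' measurableSet_Ω fun x hx => ?_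
  obtain ⟨hax, hbx⟩ := hab x (subset_closure hx)
  have hp : 0 ≤ S.speed x := ha.le.trans hax
  rw [← mul_assoc]
  gcongr
  change _ ≤ ENNReal.ofReal _ * _
  rw [← ENNReal.ofReal_mul (by positivity)]
  refine ENNReal.ofReal_le_ofReal ?_
  have h2 : S.speed x ^ n = S.speed x ^ (n - 1) * S.speed x := by
    rw [← pow_succ, Nat.sub_one_add_one hn]
  rw [h2, mul_assoc]
  have : 0 ≤ S.speed x ^ (n - 1) := by positivity
  nlinarith [mul_le_mul_of_nonneg_left hbx (mul_nonneg hc.le this)]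

/-- The solid shell in which the truncated cones lie. -/
def shell (S : TransportSetting n) : Set (RSpace n × RSpace n) :=
  {z | z.1 ∈ closure S.Ω ∧ S.speed z.1 ≤ ‖z.2‖ ∧ ‖z.2‖ ≤ 2 * S.speed z.1}

theorem isCompact_shell (S : TransportSetting n) : IsCompact S.shell := by
  obtain ⟨a, b, ha, hb, hab⟩ := S.exists_speed_bounds
  have hp := S.continuous_speed
  refine IsCompact.of_isClosed_subset
    (S.isCompact_closure.prod (isCompact_closedBall 0 (2 * b))) ?_ ?_
  · have h1 : IsClosed {z : RSpace n × RSpace n | z.1 ∈ closure S.Ω} :=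
      isClosed_closure.preimage continuous_fst
    have h2 : IsClosed {z : RSpace n × RSpace n | S.speed z.1 ≤ ‖z.2‖} :=
      isClosed_le (by fun_prop) (by fun_prop)
    have h3 : IsClosed {z : RSpace n × RSpace n | ‖z.2‖ ≤ 2 * S.speed z.1} :=
      isClosed_le (by fun_prop) (by fun_prop)
    exact h1.inter (h2.inter h3)
  · rintro z ⟨h1, -, h3⟩
    refine ⟨h1, mem_closedBall_zero_iff.2 (h3.trans ?_)⟩
    linarith [(hab _ h1).2]

/-- The projection of the shell to the bundle. -/
noncomputable def toBundle (S : TransportSetting n) (z : RSpace n × RSpace n) :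
    RSpace n × RSpace n := (z.1, (S.speed z.1 / ‖z.2‖) • z.2)

/-- The radial coordinate in the shell. -/
noncomputable def radial (S : TransportSetting n) (z : RSpace n × RSpace n) : ℝ :=
  ‖z.2‖ / S.speed z.1

theorem contDiffAt_speed {x : RSpace n} (hx : x ∈ closure S.Ω) : ContDiffAt ℝ 1 S.speed x := by
  have h1 : ContDiff ℝ 1 S.φ := S.φ_smooth.of_le (by norm_cast)
  have h2 : ContDiff ℝ 1 fun x => 2 * (S.τ - S.φ x) := contDiff_const.mul (contDiff_const.sub h1)
  exact h2.contDiffAt.sqrt (by linarith [S.φ_lt x hx])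

theorem exists_lipschitzOnWith_shell {G : Type*} [NormedAddCommGroup G] [NormedSpace ℝ G]
    {f : RSpace n × RSpace n → G} (hf : ∀ z ∈ S.shell, ContDiffAt ℝ 1 f z) :
    ∃ K, LipschitzOnWith K f S.shell := by
  refine LocallyLipschitzOn.exists_lipschitzOnWith_of_compact S.isCompact_shell fun z hz => ?_
  obtain ⟨K, t, ht, hK⟩ := (hf z hz).exists_lipschitzOnWith
  exact ⟨K, t, mem_nhdsWithin_of_mem_nhds ht, hK⟩

theorem exists_lipschitzOnWith_toBundle_radial (S : TransportSetting n) :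
    ∃ K, LipschitzOnWith K (fun z => (S.toBundle z, S.radial z)) S.shell := by
  refine exists_lipschitzOnWith_shell fun z hz => ?_
  have hp := S.speed_pos hz.1
  have h2 : z.2 ≠ 0 := by
    rw [← norm_pos_iff]; exact hp.trans_le hz.2.1
  have hs : ContDiffAt ℝ 1 (fun z : RSpace n × RSpace n => S.speed z.1) z :=
    (contDiffAt_speed hz.1).comp z contDiffAt_fst
  have hnm : ContDiffAt ℝ 1 (fun z : RSpace n × RSpace n => ‖z.2‖) z := contDiffAt_snd.norm ℝ h2
  exact (contDiffAt_fst.prodMk ((hs.div hnm (norm_ne_zero_iff.2 h2)).smul contDiffAt_snd)).prodMk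
    (hnm.div hs hp.ne')

namespace CutoffFlow

variable (Φ : S.CutoffFlow)

/-- The flow extended radially to the shell. -/
noncomputable def radialFlow (q : (RSpace n × RSpace n) × ℝ) : RSpace n × RSpace n :=
  ((Φ q.2 (S.toBundle q.1)).1, S.radial q.1 • (Φ q.2 (S.toBundle q.1)).2)

theorem lipschitzOnWith_prod_flow (T : ℝ) :
    LipschitzOnWith (Φ.bound + (Real.exp (Φ.lip * T)).toNNReal + 1)
      (fun q : ((RSpace n × RSpace n) × ℝ) × ℝ => (q.1.2, Φ q.2 q.1.1)) (univ ×ˢ Icc (-T) T) := by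
  refine LipschitzOnWith.of_dist_le_mul ?_
  rintro ⟨⟨z, r⟩, s⟩ hs ⟨⟨w, r'⟩, s'⟩ hs'
  have h4 : dist (Φ s z) (Φ s' w) ≤ Φ.bound * |s - s'| + Real.exp (Φ.lip * T) * dist z w := by
    refine (dist_triangle _ (Φ s' z) _).trans (add_le_add (Φ.dist_map_time_le _ _ _) ?_)
    refine (Φ.dist_map_le _ _ _).trans ?_
    gcongr
    exact abs_le.2 hs'.2
  generalize hd' : dist ((z, r), s) ((w, r'), s') = d
  have h5 : |s - s'| ≤ d := hd' ▸ le_max_right _ _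
  have h6 : dist z w ≤ d := hd' ▸ (le_max_left _ _).trans (le_max_left _ _)
  have h7 : dist r r' ≤ d := hd' ▸ (le_max_right _ _).trans (le_max_left _ _)
  have h8 : (((Real.exp (Φ.lip * T)).toNNReal : ℝ≥0) : ℝ) = Real.exp (Φ.lip * T) :=
    Real.coe_toNNReal _ (Real.exp_pos _).le
  push_cast
  rw [h8]
  have hd : 0 ≤ d := (abs_nonneg _).trans h5
  have hb : (0 : ℝ) ≤ Φ.bound := Φ.bound.2
  have he := (Real.exp_pos (Φ.lip * T)).le
  have h9 : Φ.bound * |s - s'| ≤ Φ.bound * d := by gcongr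
  have h10 : Real.exp (Φ.lip * T) * dist z w ≤ Real.exp (Φ.lip * T) * d := by gcongr
  rw [Prod.dist_eq]
  refine max_le ?_ ?_
  · change dist r r' ≤ _
    nlinarith [mul_nonneg hb hd, mul_nonneg he hd]
  · change dist (Φ s z) (Φ s' w) ≤ _
    nlinarith

theorem exists_lipschitzOnWith_prod_radial (T : ℝ) :
    ∃ K, LipschitzOnWith K (fun q : (RSpace n × RSpace n) × ℝ =>
      (S.radial q.1, Φ q.2 (S.toBundle q.1))) (S.shell ×ˢ Icc (-T) T) := by
  obtain ⟨K, hK⟩ := S.exists_lipschitzOnWith_toBundle_radial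
  have h2 : LipschitzOnWith (K * 1) (fun q : (RSpace n × RSpace n) × ℝ =>
      (S.toBundle q.1, S.radial q.1)) (S.shell ×ˢ Icc (-T) T) :=
    hK.comp LipschitzWith.prod_fst.lipschitzOnWith fun q hq => hq.1
  have h1 : LipschitzOnWith (max (K * 1) 1) (fun q : (RSpace n × RSpace n) × ℝ =>
      ((S.toBundle q.1, S.radial q.1), q.2)) (S.shell ×ˢ Icc (-T) T) :=
    h2.prodMk LipschitzWith.prod_snd.lipschitzOnWith
  exact exists_lipschitzOnWith_of_eqOn_comp (Φ.lipschitzOnWith_prod_flow T) h1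
    (fun q hq => ⟨trivial, hq.2⟩) fun q hq => rfl

theorem exists_lipschitzOnWith_radialFlow (T : ℝ) :
    ∃ K, LipschitzOnWith K Φ.radialFlow (S.shell ×ˢ Icc (-T) T) := by
  obtain ⟨K, hK⟩ := Φ.exists_lipschitzOnWith_prod_radial T
  have hbd := ((S.isCompact_shell.prod (isCompact_Icc (a := -T) (b := T))).image_of_continuousOn
    hK.continuousOn).isBounded
  obtain ⟨R, hR⟩ := hbd.subset_closedBall 0
  have hg : ContDiff ℝ 1 fun w : ℝ × (RSpace n × RSpace n) => (w.2.1, w.1 • w.2.2) := by fun_prop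
  obtain ⟨K', hK'⟩ := hg.contDiffOn.exists_lipschitzOnWith one_ne_zero
    (convex_closedBall (0 : ℝ × (RSpace n × RSpace n)) R) (isCompact_closedBall _ _)
  exact exists_lipschitzOnWith_of_eqOn_comp hK' hK (fun q hq => hR (mem_image_of_mem _ hq))
    fun q hq => rfl

/-- The endpoint has norm of velocity equal to the speed at its new position, so multiplication by
the radial coordinate reproduces the same ratio `‖θ‖ / p`. The radial coordinate is thus conserved,
and the radial flow is invertible. -/
theorem radialFlow_spec {z : RSpace n × RSpace n} {s : ℝ} (hz : z ∈ S.shell)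
    (h : Φ s (S.toBundle z) ∈ S.closedBundle) :
    S.toBundle (Φ.radialFlow (z, s)) = Φ s (S.toBundle z) ∧
      S.radial (Φ.radialFlow (z, s)) = S.radial z := by
  have hp := S.speed_pos hz.1
  have hr : 0 < S.radial z := div_pos (hp.trans_le hz.2.1) hp
  rw [S.mem_closedBundle_iff] at h
  have hp' := S.speed_pos h.1
  have hnorm : ‖(Φ.radialFlow (z, s)).2‖ = S.radial z * S.speed (Φ s (S.toBundle z)).1 := by
    simp only [radialFlow]
    rw [norm_smul, h.2, Real.norm_of_nonneg hr.le]
  constructor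
  · rw [toBundle, hnorm]
    simp only [radialFlow]
    rw [smul_smul]
    have : S.speed (Φ s (S.toBundle z)).1 / (S.radial z * S.speed (Φ s (S.toBundle z)).1) *
        S.radial z = 1 := by field_simp
    rw [this, one_smul]
  · rw [radial, hnorm]
    simp only [radialFlow]
    field_simp

theorem toBundle_radial {z : RSpace n × RSpace n} (hz : z ∈ S.shell) :
    ((S.toBundle z).1, S.radial z • (S.toBundle z).2) = z := by
  have hp := S.speed_pos hz.1
  have h2 : 0 < ‖z.2‖ := hp.trans_le hz.2.1
  refine Prod.ext rfl ?_
  simp only [toBundle, radial, smul_smul]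
  have : ‖z.2‖ / S.speed z.1 * (S.speed z.1 / ‖z.2‖) = 1 := by field_simp
  rw [this, one_smul]

theorem radialFlow_neg {z : RSpace n × RSpace n} {s : ℝ} (hz : z ∈ S.shell)
    (h : Φ s (S.toBundle z) ∈ S.closedBundle) :
    Φ.radialFlow (Φ.radialFlow (z, s), -s) = z := by
  obtain ⟨h1, h2⟩ := Φ.radialFlow_spec hz h
  conv_rhs => rw [← toBundle_radial hz]
  rw [radialFlow]
  simp only [h1, h2, Φ.map_neg_map]

theorem cone_subset_shell {A : Set (RSpace n × RSpace n)} (hA : A ⊆ S.closedBundle) :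
    S.cone A ⊆ S.shell := fun _ hz => ⟨(hA hz.2.2).1, hz.1.le, hz.2.1.le⟩

theorem mem_cone_iff {A : Set (RSpace n × RSpace n)} {z : RSpace n × RSpace n}
    (hz : z.1 ∈ closure S.Ω) :
    z ∈ S.cone A ↔ 1 < S.radial z ∧ S.radial z < 2 ∧ S.toBundle z ∈ A := by
  have hp := S.speed_pos hz
  rw [radial, one_lt_div hp, div_lt_iff₀ hp]
  rfl

theorem radialFlow_mem_cone {A B : Set (RSpace n × RSpace n)} {z : RSpace n × RSpace n} {s : ℝ}
    (hA : A ⊆ S.closedBundle) (hB : B ⊆ S.closedBundle) (hz : z ∈ S.cone A)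
    (h : Φ s (S.toBundle z) ∈ B) : Φ.radialFlow (z, s) ∈ S.cone B := by
  have hzs := cone_subset_shell hA hz
  obtain ⟨h1, h2⟩ := Φ.radialFlow_spec hzs (hB h)
  rw [mem_cone_iff hzs.1] at hz
  rw [mem_cone_iff (show (Φ.radialFlow (z, s)).1 ∈ closure S.Ω from (hB h).1), h1, h2]
  exact ⟨hz.1, hz.2.1, h⟩

end CutoffFlow

/-! ### The orbit measure -/

/-- The pairs of a phase point and a time at which its trajectory is inside the domain. -/
def orbitDomain (S : TransportSetting n) : Set ((RSpace n × RSpace n) × ℝ) :=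
  {q | q.1 ∈ S.closedBundle ∧ q.2 ∈ Ioo (S.entryTime q.1) (S.exitTime q.1)}

/-- Strict membership between the entry and exit times is witnessed by two rational resident times
around `s`, and residence at a fixed time is a closed condition. -/
theorem measurableSet_orbitDomain (hnt : S.NonTrapping) : MeasurableSet S.orbitDomain := by
  have h : S.orbitDomain = ⋃ a : ℚ, ⋃ b : ℚ,
      {q : (RSpace n × RSpace n) × ℝ | q.1 ∈ S.closedBundle ∧ (a : ℝ) ∈ S.residence q.1} ∩
        {q : (RSpace n × RSpace n) × ℝ | q.1 ∈ S.closedBundle ∧ (b : ℝ) ∈ S.residence q.1} ∩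
        {q : (RSpace n × RSpace n) × ℝ | (a : ℝ) < q.2 ∧ q.2 < (b : ℝ)} := by
    ext ⟨z, s⟩
    simp only [orbitDomain, mem_ofPred_eq, mem_iUnion, mem_inter_iff]
    constructor
    · rintro ⟨hz, h1, h2⟩
      obtain ⟨a, ha1, ha2⟩ := exists_rat_btwn h1
      obtain ⟨b, hb1, hb2⟩ := exists_rat_btwn h2
      rw [residence_eq hnt hz]
      exact ⟨a, b, ⟨⟨hz, ha1.le, by linarith⟩, hz, by linarith, hb2.le⟩, ha2, hb1⟩
    · rintro ⟨a, b, ⟨⟨hz, h1⟩, -, h2⟩, h3, h4⟩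
      rw [residence_eq hnt hz] at h1 h2
      exact ⟨hz, h1.1.trans_lt h3, h4.trans_le h2.2⟩
  rw [h]
  have hcl : ∀ a : ℝ, MeasurableSet {q : (RSpace n × RSpace n) × ℝ |
      q.1 ∈ S.closedBundle ∧ a ∈ S.residence q.1} := fun a =>
    ((CutoffFlow.isClosed_setOf_mem_residence (S := S)).preimage
      (by fun_prop : Continuous fun q : (RSpace n × RSpace n) × ℝ => (a, q.1))).measurableSet
  refine MeasurableSet.iUnion fun a => MeasurableSet.iUnion fun b =>
    ((hcl a).inter (hcl b)).inter ?_
  exact (measurableSet_lt measurable_const measurable_snd).inter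
    (measurableSet_lt measurable_snd measurable_const)

namespace CutoffFlow

variable (Φ : S.CutoffFlow)

theorem measurable_flow_swap :
    Measurable fun q : (RSpace n × RSpace n) × ℝ => Φ q.2 q.1 :=
  (Φ.continuous_uncurry.comp continuous_swap).measurable

/-- The flow at a fixed time does not increase the phase measure by more than a constant factor. -/
theorem exists_bulk_preimage_le (hn : n ≠ 0) (hconv : S.StrictlyConvexBoundary)
    (hnt : S.NonTrapping) :
    ∃ C : ℝ≥0, ∀ s : ℝ, ∀ A, MeasurableSet A →
      S.bulk {z | (z, s) ∈ S.orbitDomain ∧ Φ s z ∈ A} ≤ C * S.bulk A := by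
  obtain ⟨T, hT0, hT⟩ := exists_residence_bound hnt
  obtain ⟨C₁, hC₁⟩ := exists_bulk_le_volume_cone hn S
  obtain ⟨C₂, hC₂⟩ := exists_volume_cone_le_bulk hn S
  obtain ⟨K, hK⟩ := Φ.exists_lipschitzOnWith_radialFlow T
  have : (volume : Measure (RSpace n × RSpace n)).IsAddHaarMeasure := by
    rw [Measure.volume_eq_prod]; infer_instance
  obtain ⟨C₃, hC₃⟩ := exists_measure_image_le_of_lipschitzOnWith
    (volume : Measure (RSpace n × RSpace n)) (volume : Measure (RSpace n × RSpace n)) rfl K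
  refine ⟨C₁ * (C₃ * C₂), fun s A hA => ?_⟩
  have hmb : MeasurableSet (S.bundle S.Ω) := by
    have : S.bundle S.Ω = S.closedBundle ∩ {z | z.1 ∈ S.Ω} := by
      ext z
      exact ⟨fun h => ⟨bundle_Ω_subset h, h.1⟩, fun h => ⟨h.2, h.1.2⟩⟩
    rw [this]
    exact S.isCompact_closedBundle.isClosed.measurableSet.inter (measurable_fst measurableSet_Ω)
  have hm : MeasurableSet {z | (z, s) ∈ S.orbitDomain ∧ Φ s z ∈ A} :=
    (measurable_prodMk_right (measurableSet_orbitDomain hnt)).inter ((Φ.continuous_map s).measurable hA)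
  have hsub : {z | (z, s) ∈ S.orbitDomain ∧ Φ s z ∈ A} ⊆ S.closedBundle := fun z hz => hz.1.1
  have hsub' : A ∩ S.bundle S.Ω ⊆ S.closedBundle := fun z hz => bundle_Ω_subset hz.2
  -- The cone over the preimage is contained in the image of the cone over `A` under the radial flow
  -- at time `-s`. Its Lipschitz constant is that for `[-T, T]`, hence uniform in `s`; for larger
  -- times the preimage is empty.
  have hcone : volume (S.cone {z | (z, s) ∈ S.orbitDomain ∧ Φ s z ∈ A}) ≤
      C₃ * volume (S.cone (A ∩ S.bundle S.Ω)) := by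
    rcases (S.cone {z | (z, s) ∈ S.orbitDomain ∧ Φ s z ∈ A}).eq_empty_or_nonempty with h | ⟨w, hw⟩
    · rw [h]; simp
    have hsT : -s ∈ Icc (-T) T := by
      have := hT _ hw.2.2.1.1 s (Ioo_subset_residence hnt hw.2.2.1.1 hw.2.2.1.2)
      rw [abs_le] at this
      constructor <;> linarith [this.1, this.2]
    have hlip : LipschitzOnWith (K * 1) (fun z => Φ.radialFlow (z, -s))
        (S.cone (A ∩ S.bundle S.Ω)) :=
      hK.comp (LipschitzWith.prodMk_right (-s)).lipschitzOnWith
        fun z hz => ⟨cone_subset_shell hsub' hz, hsT⟩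
    rw [mul_one] at hlip
    refine le_trans (measure_mono ?_) (hC₃ _ _ hlip)
    intro z hz
    have hbz := hz.2.2
    have hmem : Φ s (S.toBundle z) ∈ A ∩ S.bundle S.Ω :=
      ⟨hbz.2, Φ.map_mem_bundle_Ω hconv hnt hbz.1.1 hbz.1.2⟩
    exact ⟨Φ.radialFlow (z, s), Φ.radialFlow_mem_cone hsub hsub' hz hmem,
      Φ.radialFlow_neg (cone_subset_shell hsub hz) (hsub' hmem)⟩
  calc _ ≤ C₁ * volume (S.cone {z | (z, s) ∈ S.orbitDomain ∧ Φ s z ∈ A}) := hC₁ _ hm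
    _ ≤ C₁ * (C₃ * (C₂ * S.bulk (A ∩ S.bundle S.Ω))) := by
        gcongr
        exact hcone.trans (by gcongr; exact hC₂ _ (hA.inter hmb) inter_subset_right)
    _ ≤ C₁ * (C₃ * (C₂ * S.bulk A)) := by gcongr; exact inter_subset_left
    _ = _ := by push_cast; ring

/-- The image of the measure `κ dt` under the flow. -/
noncomputable def orbitMeasure (κ : Measure (RSpace n × RSpace n)) :
    Measure (RSpace n × RSpace n) :=
  ((κ.prod volume).restrict S.orbitDomain).map fun q => Φ q.2 q.1

theorem lintegral_orbitMeasure (hnt : S.NonTrapping) (κ : Measure (RSpace n × RSpace n))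
    {g : RSpace n × RSpace n → ℝ≥0∞} (hg : Measurable g) :
    ∫⁻ z, g z ∂Φ.orbitMeasure κ =
      ∫⁻ z, (∫⁻ s : ℝ, S.orbitDomain.indicator (fun q => g (Φ q.2 q.1)) (z, s)) ∂κ := by
  have hD := measurableSet_orbitDomain hnt
  rw [orbitMeasure, lintegral_map hg Φ.measurable_flow_swap, ← lintegral_indicator hD,
    lintegral_prod]
  exact ((hg.comp Φ.measurable_flow_swap).indicator hD).aemeasurable

/-- Integration along the trajectories from `κ` is bounded by integration with respect to the
phase measure. -/
def OrbitBound (κ : Measure (RSpace n × RSpace n)) : Prop :=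
  ∃ C : ℝ≥0, Φ.orbitMeasure κ ≤ C • S.bulk

theorem lintegral_preimage_le {C : ℝ≥0} {s : ℝ} (hnt : S.NonTrapping)
    (hC : ∀ A, MeasurableSet A → S.bulk {z | (z, s) ∈ S.orbitDomain ∧ Φ s z ∈ A} ≤ C * S.bulk A)
    {g : RSpace n × RSpace n → ℝ≥0∞} (hg : Measurable g) :
    ∫⁻ z, S.orbitDomain.indicator (fun q => g (Φ q.2 q.1)) (z, s) ∂S.bulk ≤
      C * ∫⁻ z, g z ∂S.bulk := by
  have hD : MeasurableSet {z | (z, s) ∈ S.orbitDomain} :=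
    measurable_prodMk_right (measurableSet_orbitDomain hnt)
  have hΦ := (Φ.continuous_map s).measurable
  have h1 : ((S.bulk.restrict {z | (z, s) ∈ S.orbitDomain}).map (Φ s)) ≤ C • S.bulk := by
    refine Measure.le_iff.2 fun A hA => ?_
    rw [Measure.map_apply hΦ hA, Measure.restrict_apply (hΦ hA)]
    refine le_trans (measure_mono ?_) (hC A hA)
    exact fun z hz => ⟨hz.2, hz.1⟩
  calc _ = ∫⁻ z, g z ∂((S.bulk.restrict {z | (z, s) ∈ S.orbitDomain}).map (Φ s)) := by
        rw [lintegral_map hg hΦ, ← lintegral_indicator hD]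
        rfl
    _ ≤ ∫⁻ z, g z ∂(C • S.bulk) := lintegral_mono' h1 le_rfl
    _ = _ := by rw [lintegral_smul_measure]; rfl

/-- By Fubini the fixed-time bound is integrated over `[-T, T]`, outside which no trajectory
remains; this yields the factor `2 * T`. -/
theorem orbitBound_bulk (hn : n ≠ 0) (hconv : S.StrictlyConvexBoundary) (hnt : S.NonTrapping) :
    Φ.OrbitBound S.bulk := by
  obtain ⟨T, hT0, hT⟩ := exists_residence_bound hnt
  obtain ⟨C, hC⟩ := Φ.exists_bulk_preimage_le hn hconv hnt
  have hD := measurableSet_orbitDomain hnt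
  refine ⟨C * (2 * T).toNNReal, Measure.le_iff.2 fun A hA => ?_⟩
  rw [orbitMeasure, Measure.map_apply Φ.measurable_flow_swap hA,
    Measure.restrict_apply (Φ.measurable_flow_swap hA),
    Measure.prod_apply_symm ((Φ.measurable_flow_swap hA).inter hD)]
  calc _ ≤ ∫⁻ s, (Icc (-T) T).indicator (fun _ => C * S.bulk A) s := by
        refine lintegral_mono fun s => ?_
        by_cases hs : s ∈ Icc (-T) T
        · rw [indicator_of_mem hs]
          refine le_trans (measure_mono ?_) (hC s A hA)
          exact fun z hz => ⟨hz.2, hz.1⟩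
        · have : (fun z => (z, s)) ⁻¹' ((fun q : (RSpace n × RSpace n) × ℝ => Φ q.2 q.1) ⁻¹' A ∩
              S.orbitDomain) = ∅ := by
            rw [eq_empty_iff_forall_notMem]
            rintro z ⟨-, hz, hz2⟩
            exact hs (abs_le.1 (hT z hz s (Ioo_subset_residence hnt hz hz2)))
          rw [this]
          simp
    _ = (C * (2 * T).toNNReal : ℝ≥0) • S.bulk A := by
        rw [lintegral_indicator measurableSet_Icc, setLIntegral_const, Real.volume_Icc,
          ENNReal.smul_def, smul_eq_mul]
        have : ENNReal.ofReal (T - -T) = ((2 * T).toNNReal : ℝ≥0∞) := by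
          rw [sub_neg_eq_add, two_mul]; rfl
        rw [this]
        push_cast
        ring

end CutoffFlow

end TransportSetting

/-! ### Hausdorff measures and Lipschitz maps -/

section HausdorffLipschitz

open scoped NNReal ENNReal

theorem LipschitzOnWith.euclideanHausdorffMeasure_image_le {X Y : Type*} [EMetricSpace X]
    [MeasurableSpace X] [BorelSpace X] [EMetricSpace Y] [MeasurableSpace Y] [BorelSpace Y]
    {K : ℝ≥0} {f : X → Y} {s : Set X} (hf : LipschitzOnWith K f s) (d : ℕ) :
    Measure.euclideanHausdorffMeasure d (f '' s) ≤
      (K ^ d : ℝ≥0) * Measure.euclideanHausdorffMeasure d s := by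
  have h := hf.hausdorffMeasure_image_le (d := (d : ℝ)) (Nat.cast_nonneg d)
  rw [ENNReal.rpow_natCast] at h
  simp only [Measure.euclideanHausdorffMeasure_def, Measure.smul_apply, ENNReal.smul_def,
    smul_eq_mul]
  push_cast
  calc _ ≤ _ := mul_le_mul_right h _
    _ = _ := by ring

theorem euclideanHausdorffMeasure_inter_preimage_le {X Y : Type*} [MetricSpace X]
    [MeasurableSpace X] [BorelSpace X] [MetricSpace Y] [MeasurableSpace Y] [BorelSpace Y]
    {K : ℝ≥0} {f : X → Y} {s : Set X} (hf : ∀ x ∈ s, ∀ y ∈ s, dist x y ≤ K * dist (f x) (f y))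
    (d : ℕ) (B : Set Y) :
    Measure.euclideanHausdorffMeasure d (s ∩ f ⁻¹' B) ≤
      (K ^ d : ℝ≥0) * Measure.euclideanHausdorffMeasure d (f '' s ∩ B) := by
  rcases isEmpty_or_nonempty X with hX | hX
  · rw [Set.eq_empty_of_isEmpty (s ∩ f ⁻¹' B)]; simp
  have hinj : InjOn f s := fun x hx y hy hxy => by
    have := hf x hx y hy
    rw [hxy, dist_self, mul_zero] at this
    exact dist_le_zero.1 this
  have hg : LipschitzOnWith K (Function.invFunOn f s) (f '' s ∩ B) := by
    refine LipschitzOnWith.of_dist_le_mul ?_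
    rintro _ ⟨⟨x, hx, rfl⟩, -⟩ _ ⟨⟨y, hy, rfl⟩, -⟩
    rw [hinj.leftInvOn_invFunOn hx, hinj.leftInvOn_invFunOn hy]
    exact hf x hx y hy
  refine (measure_mono ?_).trans (hg.euclideanHausdorffMeasure_image_le d)
  exact fun x hx => ⟨f x, ⟨⟨x, hx.1, rfl⟩, hx.2⟩, hinj.leftInvOn_invFunOn hx.1⟩

end HausdorffLipschitz

/-- A nonzero linear functional is the first coordinate of a linear isomorphism. -/
theorem exists_continuousLinearEquiv_fst {n : ℕ} (hn : n ≠ 0) (l : RSpace n →L[ℝ] ℝ) (hl : l ≠ 0) :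
    ∃ L : RSpace n ≃L[ℝ] ℝ × RSpace (n - 1), ∀ x, (L x).1 = l x := by
  have hd : Module.finrank ℝ (LinearMap.ker (l : RSpace n →ₗ[ℝ] ℝ)) =
      Module.finrank ℝ (RSpace (n - 1)) := by
    have h1 := Module.Dual.finrank_ker_add_one_of_ne_zero
      (f := (l : RSpace n →ₗ[ℝ] ℝ)) (fun h => hl (ContinuousLinearMap.coe_injective h))
    rw [finrank_euclideanSpace_fin] at h1
    rw [finrank_euclideanSpace_fin]
    omega
  let e := ContinuousLinearEquiv.ofFinrankEq hd
  -- The functional together with the orthogonal projection to its kernel: a vector killed by both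
  -- lies in the kernel and equals its own projection, hence is zero.
  let A : RSpace n →ₗ[ℝ] ℝ × RSpace (n - 1) := LinearMap.prod (l : RSpace n →ₗ[ℝ] ℝ)
    ((e : LinearMap.ker (l : RSpace n →ₗ[ℝ] ℝ) →ₗ[ℝ] RSpace (n - 1)) ∘ₗ
      ((LinearMap.ker (l : RSpace n →ₗ[ℝ] ℝ)).orthogonalProjectionOnto : RSpace n →ₗ[ℝ] _))
  have hA : Function.Injective A := by
    rw [← LinearMap.ker_eq_bot, LinearMap.ker_eq_bot']
    intro x hx
    have h1 : l x = 0 := congrArg Prod.fst hx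
    have h2 : e ((LinearMap.ker (l : RSpace n →ₗ[ℝ] ℝ)).orthogonalProjectionOnto x) = 0 :=
      congrArg Prod.snd hx
    have h3 := e.injective (h2.trans e.map_zero.symm)
    have h4 : x ∈ LinearMap.ker (l : RSpace n →ₗ[ℝ] ℝ) := h1
    have h5 := Submodule.orthogonalProjectionOnto_mem_subspace_eq_self
      (⟨x, h4⟩ : LinearMap.ker (l : RSpace n →ₗ[ℝ] ℝ))
    rw [h3] at h5
    exact (congrArg Subtype.val h5).symm
  have hd2 : Module.finrank ℝ (RSpace n) = Module.finrank ℝ (ℝ × RSpace (n - 1)) := by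
    rw [Module.finrank_prod, finrank_euclideanSpace_fin, finrank_euclideanSpace_fin,
      Module.finrank_self]
    omega
  exact ⟨(A.linearEquivOfInjective hA hd2).toContinuousLinearEquiv, fun x => rfl⟩

namespace TransportSetting

open scoped NNReal ENNReal

variable {n : ℕ} {S : TransportSetting n}

/-! ### Boundary charts -/

/-- Bi-Lipschitz coordinates near a boundary point, in which `ρ` is the first coordinate. -/
structure BoundaryChart (S : TransportSetting n) where
  toFun : ℝ × RSpace (n - 1) → RSpace n
  radius : ℝ
  radius_pos : 0 < radius
  lip : ℝ≥0
  lipschitz : LipschitzWith lip toFun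
  antilip : ℝ≥0
  antilipschitz : ∀ q ∈ ball (0 : ℝ × RSpace (n - 1)) radius,
    ∀ q' ∈ ball (0 : ℝ × RSpace (n - 1)) radius, dist q q' ≤ antilip * dist (toFun q) (toFun q')
  ρ_apply : ∀ q ∈ ball (0 : ℝ × RSpace (n - 1)) radius, S.ρ (toFun q) = q.1

instance : CoeFun S.BoundaryChart fun _ => ℝ × RSpace (n - 1) → RSpace n := ⟨BoundaryChart.toFun⟩

/-- The map formed by `ρ` and linear coordinates complementary to its differential has invertible
derivative. The chart is its local inverse; strict differentiability makes both the map and the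
inverse Lipschitz near the point. -/
theorem exists_boundaryChart (hn : n ≠ 0) {x₀ : RSpace n} (hx₀ : S.ρ x₀ = 0) :
    ∃ c : S.BoundaryChart, ∀ᶠ x in 𝓝 x₀, S.ρ x = 0 →
      ∃ y ∈ ball (0 : RSpace (n - 1)) c.radius, c (0, y) = x := by
  have hs : HasStrictFDerivAt S.ρ (fderiv ℝ S.ρ x₀) x₀ :=
    S.ρ_smooth.contDiffAt.hasStrictFDerivAt (by simp)
  have hl : fderiv ℝ S.ρ x₀ ≠ 0 := by
    intro h
    apply S.ρ_regular x₀ hx₀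
    rw [gradient, h, map_zero]
  obtain ⟨L, hL⟩ := exists_continuousLinearEquiv_fst hn _ hl
  let Θ : RSpace n → ℝ × RSpace (n - 1) := fun x => (S.ρ x, (L (x - x₀)).2)
  have hΘ : HasStrictFDerivAt Θ (L : RSpace n →L[ℝ] ℝ × RSpace (n - 1)) x₀ := by
    have h2 : HasStrictFDerivAt (fun x => (L (x - x₀)).2)
        ((ContinuousLinearMap.snd ℝ ℝ (RSpace (n - 1))).comp
          (L : RSpace n →L[ℝ] ℝ × RSpace (n - 1))) x₀ := by
      have := ((ContinuousLinearMap.snd ℝ ℝ (RSpace (n - 1))).comp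
          (L : RSpace n →L[ℝ] ℝ × RSpace (n - 1))).hasStrictFDerivAt (x := x₀)
      simpa [map_sub] using this.sub_const ((L x₀).2)
    have h3 := hs.prodMk h2
    have h4 : (L : RSpace n →L[ℝ] ℝ × RSpace (n - 1)) = (fderiv ℝ S.ρ x₀).prod
        ((ContinuousLinearMap.snd ℝ ℝ (RSpace (n - 1))).comp
          (L : RSpace n →L[ℝ] ℝ × RSpace (n - 1))) :=
      ContinuousLinearMap.ext fun x => Prod.ext (hL x) rfl
    rw [h4]
    exact h3
  have h0 : Θ x₀ = 0 := by simp [Θ, hx₀]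
  obtain ⟨K, s, hs1, hK⟩ := hΘ.exists_lipschitzOnWith
  have hΛ := hΘ.to_localInverse
  rw [h0] at hΛ
  obtain ⟨K', t, ht, hK'⟩ := hΛ.exists_lipschitzOnWith
  have hΛ0 : hΘ.localInverse Θ L x₀ 0 = x₀ := by
    rw [← h0]; exact hΘ.localInverse_apply_image
  have hright := hΘ.eventually_right_inverse
  rw [h0] at hright
  have hmaps : ∀ᶠ q in 𝓝 (0 : ℝ × RSpace (n - 1)), hΘ.localInverse Θ L x₀ q ∈ s := by
    have := hΛ.hasFDerivAt.continuousAt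
    rw [ContinuousAt, hΛ0] at this
    exact this hs1
  obtain ⟨r, hr, hball⟩ := Metric.eventually_nhds_iff_ball.1 ((hright.and hmaps).and ht)
  -- Extending the local inverse to a globally Lipschitz map gives continuity and measurability
  -- everywhere; only its values on the ball are meaningful.
  obtain ⟨Λ, hΛlip, hΛeq⟩ := (hK'.mono fun q hq => (hball q hq).2).extend_finite_dimension
  refine ⟨⟨Λ, r, hr, _, hΛlip, K, ?_, ?_⟩, ?_⟩
  · intro q hq q' hq'
    rw [← hΛeq hq, ← hΛeq hq']
    have := hK.dist_le_mul _ (hball q hq).1.2 _ (hball q' hq').1.2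
    rwa [(hball q hq).1.1, (hball q' hq').1.1] at this
  · intro q hq
    rw [← hΛeq hq]
    exact congrArg Prod.fst (hball q hq).1.1
  · have hc : ∀ᶠ x in 𝓝 x₀, Θ x ∈ ball (0 : ℝ × RSpace (n - 1)) r := by
      have := hΘ.hasFDerivAt.continuousAt
      rw [ContinuousAt, h0] at this
      exact this (ball_mem_nhds _ hr)
    filter_upwards [hc, hΘ.eventually_left_inverse] with x hx hleft h0x
    have hx' : ((0 : ℝ), (L (x - x₀)).2) ∈ ball (0 : ℝ × RSpace (n - 1)) r := by
      have : Θ x = ((0 : ℝ), (L (x - x₀)).2) := by simp [Θ, h0x]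
      rwa [← this]
    refine ⟨(L (x - x₀)).2, ?_, ?_⟩
    · rw [mem_ball_zero_iff] at hx' ⊢
      exact lt_of_le_of_lt (le_max_right _ _) hx'
    · rw [← hΛeq hx']
      have : Θ x = ((0 : ℝ), (L (x - x₀)).2) := by simp [Θ, h0x]
      rw [← this]
      exact hleft

namespace BoundaryChart

variable (c : S.BoundaryChart)

theorem mem_ball_iff {q : ℝ × RSpace (n - 1)} :
    q ∈ ball (0 : ℝ × RSpace (n - 1)) c.radius ↔
      q.1 ∈ Ioo (-c.radius) c.radius ∧ q.2 ∈ ball (0 : RSpace (n - 1)) c.radius := by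
  rw [mem_ball_zero_iff, mem_ball_zero_iff, Prod.norm_def, max_lt_iff, Real.norm_eq_abs, abs_lt]
  rfl

theorem mk_zero_mem_ball {y : RSpace (n - 1)} (hy : y ∈ ball (0 : RSpace (n - 1)) c.radius) :
    ((0 : ℝ), y) ∈ ball (0 : ℝ × RSpace (n - 1)) c.radius :=
  c.mem_ball_iff.2 ⟨⟨neg_lt_zero.2 c.radius_pos, c.radius_pos⟩, hy⟩

theorem continuous : Continuous c := c.lipschitz.continuous

theorem apply_zero_mem_frontier {y : RSpace (n - 1)}
    (hy : y ∈ ball (0 : RSpace (n - 1)) c.radius) : c (0, y) ∈ frontier S.Ω := by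
  rw [S.mem_frontier_iff]
  exact c.ρ_apply _ (c.mk_zero_mem_ball hy)

theorem exists_volume_preimage_le (hn : n ≠ 0) : ∃ C : ℝ≥0, ∀ A : Set (RSpace n),
    volume (ball (0 : ℝ × RSpace (n - 1)) c.radius ∩ c ⁻¹' A) ≤ C * volume A := by
  have : (volume : Measure (ℝ × RSpace (n - 1))).IsAddHaarMeasure := by
    rw [Measure.volume_eq_prod]; infer_instance
  have hd : Module.finrank ℝ (ℝ × RSpace (n - 1)) = Module.finrank ℝ (RSpace n) := by
    rw [Module.finrank_prod, finrank_euclideanSpace_fin, finrank_euclideanSpace_fin,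
      Module.finrank_self]
    omega
  obtain ⟨C, hC⟩ := exists_measure_inter_preimage_le_of_antilipschitzOn
    (volume : Measure (ℝ × RSpace (n - 1))) (volume : Measure (RSpace n)) hd c.antilip
  exact ⟨C, fun A => hC c _ c.antilipschitz A⟩

theorem exists_surface_le (c : S.BoundaryChart) : ∃ C : ℝ≥0, ∀ A : Set (RSpace n),
    A ⊆ (fun y => c (0, y)) '' ball (0 : RSpace (n - 1)) c.radius →
    Measure.euclideanHausdorffMeasure (n - 1) A ≤
      C * volume (ball (0 : RSpace (n - 1)) c.radius ∩ (fun y => c (0, y)) ⁻¹' A) := by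
  refine ⟨(c.lip * 1) ^ (n - 1), fun A hA => ?_⟩
  have h : LipschitzWith (c.lip * 1) fun y => c (0, y) :=
    c.lipschitz.comp (LipschitzWith.prodMk_left 0)
  have h2 := (h.lipschitzOnWith (s := ball (0 : RSpace (n - 1)) c.radius ∩
    (fun y => c (0, y)) ⁻¹' A)).euclideanHausdorffMeasure_image_le (n - 1)
  rw [EuclideanSpace.euclideanHausdorffMeasure_eq_volume] at h2
  refine (measure_mono ?_).trans h2
  intro x hx
  obtain ⟨y, hy, rfl⟩ := hA hx
  exact ⟨y, ⟨hy, hx⟩, rfl⟩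

theorem dist_le_apply_zero {y y' : RSpace (n - 1)}
    (hy : y ∈ ball (0 : RSpace (n - 1)) c.radius)
    (hy' : y' ∈ ball (0 : RSpace (n - 1)) c.radius) :
    dist y y' ≤ c.antilip * dist (c (0, y)) (c (0, y')) :=
  le_trans (by rw [Prod.dist_eq]; exact le_max_right _ _)
    (c.antilipschitz _ (c.mk_zero_mem_ball hy) _ (c.mk_zero_mem_ball hy'))

theorem exists_le_surface (c : S.BoundaryChart) : ∃ C : ℝ≥0, ∀ A : Set (RSpace n),
    volume (ball (0 : RSpace (n - 1)) c.radius ∩ (fun y => c (0, y)) ⁻¹' A) ≤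
      C * Measure.euclideanHausdorffMeasure (n - 1) (A ∩ frontier S.Ω) := by
  refine ⟨c.antilip ^ (n - 1), fun A => ?_⟩
  have h2 := euclideanHausdorffMeasure_inter_preimage_le (f := fun y => c (0, y))
    (fun y hy y' hy' => c.dist_le_apply_zero hy hy') (n - 1) A
  rw [EuclideanSpace.euclideanHausdorffMeasure_eq_volume] at h2
  refine h2.trans (mul_le_mul_right (measure_mono ?_) _)
  rintro _ ⟨⟨y, hy, rfl⟩, hA⟩
  exact ⟨hA, c.apply_zero_mem_frontier hy⟩

end BoundaryChart

end TransportSetting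

/-! ### Time spent in a set, near the boundary -/

namespace TransportSetting

open scoped NNReal ENNReal

variable {n : ℕ} {S : TransportSetting n}

/-- The derivative of the boundary defining function along the flow. -/
noncomputable def slope (S : TransportSetting n) (z : RSpace n × RSpace n) : ℝ :=
  inner ℝ (gradient S.ρ z.1) z.2

theorem continuous_gradient_ρ : Continuous (gradient S.ρ) := by
  have h : Continuous (fderiv ℝ S.ρ) := S.ρ_smooth.continuous_fderiv (by simp)
  exact (InnerProductSpace.toDual ℝ (RSpace n)).symm.continuous.comp h

theorem continuous_slope : Continuous S.slope :=
  (continuous_gradient_ρ.comp continuous_fst).inner continuous_snd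

theorem continuous_ρ : Continuous S.ρ := S.ρ_smooth.continuous

/-- The outgoing (`e > 0`) and the incoming (`e < 0`) boundary. -/
def boundarySet (S : TransportSetting n) (e : ℝ) : Set (RSpace n × RSpace n) :=
  {z ∈ S.bundle (frontier S.Ω) | 0 < e * S.slope z}

theorem outgoingSet_eq : S.outgoingSet = S.boundarySet 1 := by
  ext z
  refine and_congr_right fun hz => ?_
  rw [inner_normal_pos_iff hz.1, one_mul]; rfl

theorem incomingSet_eq : S.incomingSet = S.boundarySet (-1) := by
  ext z
  refine and_congr_right fun hz => ?_
  rw [inner_normal_neg_iff hz.1, neg_one_mul, neg_pos]; rfl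

theorem measurableSet_bundle_Ω : MeasurableSet (S.bundle S.Ω) := by
  have : S.bundle S.Ω = S.closedBundle ∩ {z | z.1 ∈ S.Ω} := by
    ext z
    exact ⟨fun h => ⟨bundle_Ω_subset h, h.1⟩, fun h => ⟨h.2, h.1.2⟩⟩
  rw [this]
  exact S.isCompact_closedBundle.isClosed.measurableSet.inter (measurable_fst measurableSet_Ω)

theorem measurableSet_bundle_frontier : MeasurableSet (S.bundle (frontier S.Ω)) := by
  have : S.bundle (frontier S.Ω) = S.closedBundle ∩ {z | z.1 ∈ frontier S.Ω} := by
    ext z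
    exact ⟨fun h => ⟨bundle_frontier_subset h, h.1⟩, fun h => ⟨h.2, h.1.2⟩⟩
  rw [this]
  exact S.isCompact_closedBundle.isClosed.measurableSet.inter
    (measurable_fst isClosed_frontier.measurableSet)

theorem measurableSet_boundarySet (e : ℝ) : MeasurableSet (S.boundarySet e) :=
  measurableSet_bundle_frontier.inter
    (measurableSet_lt measurable_const (continuous_slope.measurable.const_mul e))

theorem measurableSet_residence (t : ℝ) :
    MeasurableSet {z : RSpace n × RSpace n | z ∈ S.closedBundle ∧ t ∈ S.residence z} :=
  ((CutoffFlow.isClosed_setOf_mem_residence (S := S)).preimage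
    (by fun_prop : Continuous fun q : RSpace n × RSpace n => (t, q))).measurableSet

theorem ae_mem_bundle : ∀ᵐ z ∂S.bulk, z ∈ S.bundle S.Ω := by
  rw [ae_iff]
  have hm : MeasurableSet {z | z ∉ S.bundle S.Ω} := measurableSet_bundle_Ω.compl
  rw [bulk, phaseMeasure_apply _ _ hm]
  rw [setLIntegral_congr_fun measurableSet_Ω (g := fun _ => 0) ?_, lintegral_zero]
  intro x hx
  have h : {v : sphere (0 : RSpace n) 1 | (x, S.speed x • (v : RSpace n)) ∈
      {z | z ∉ S.bundle S.Ω}} = ∅ := by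
    rw [eq_empty_iff_forall_notMem]
    intro v hv
    apply hv
    refine (S.mem_bundle_iff subset_closure).2 ⟨hx, ?_⟩
    rw [norm_smul, Real.norm_of_nonneg (S.speed_pos (subset_closure hx)).le,
      norm_eq_of_mem_sphere, mul_one]
  simp only [h, measure_empty, mul_zero]

namespace CutoffFlow

variable (Φ : S.CutoffFlow)

/-- The time that the trajectory of a point spends in a set. -/
noncomputable def orbitTime (A : Set (RSpace n × RSpace n)) (z : RSpace n × RSpace n) : ℝ≥0∞ :=
  volume {s : ℝ | (z, s) ∈ S.orbitDomain ∧ Φ s z ∈ A}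

theorem measurableSet_orbit (hnt : S.NonTrapping) {A : Set (RSpace n × RSpace n)}
    (hA : MeasurableSet A) :
    MeasurableSet {q : (RSpace n × RSpace n) × ℝ | q ∈ S.orbitDomain ∧ Φ q.2 q.1 ∈ A} :=
  (measurableSet_orbitDomain hnt).inter (Φ.measurable_flow_swap hA)

theorem measurable_orbitTime (hnt : S.NonTrapping) {A : Set (RSpace n × RSpace n)}
    (hA : MeasurableSet A) : Measurable (Φ.orbitTime A) :=
  measurable_measure_prodMk_left (Φ.measurableSet_orbit hnt hA)

theorem orbitMeasure_apply (hnt : S.NonTrapping) (κ : Measure (RSpace n × RSpace n))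
    {A : Set (RSpace n × RSpace n)} (hA : MeasurableSet A) :
    Φ.orbitMeasure κ A = ∫⁻ z, Φ.orbitTime A z ∂κ := by
  rw [orbitMeasure, Measure.map_apply Φ.measurable_flow_swap hA,
    Measure.restrict_apply (Φ.measurable_flow_swap hA),
    Measure.prod_apply ((Φ.measurable_flow_swap hA).inter (measurableSet_orbitDomain hnt))]
  refine lintegral_congr fun z => ?_
  rw [orbitTime]
  congr 1
  ext s
  exact and_comm

/-- The points that leave the domain within time `h` in the direction `e` carry trajectories which
are, on average, shorter than a multiple of `h`. -/
theorem exists_lintegral_orbitTime_le (hn : n ≠ 0) (hconv : S.StrictlyConvexBoundary)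
    (hnt : S.NonTrapping) : ∃ C : ℝ≥0, ∀ e : ℝ, |e| = 1 → ∀ h : ℝ, 0 < h → ∀ A, MeasurableSet A →
      ∫⁻ z, {z | z ∈ S.closedBundle ∧ e * h ∈ S.residence z}ᶜ.indicator (Φ.orbitTime A) z ∂S.bulk ≤
        C * ENNReal.ofReal h * S.bulk A := by
  obtain ⟨C, hC⟩ := Φ.exists_bulk_preimage_le hn hconv hnt
  refine ⟨C, fun e he h hh A hA => ?_⟩
  have hR := measurableSet_residence (S := S) (e * h)
  have hQ := (Φ.measurableSet_orbit hnt hA).inter (measurable_fst hR.compl)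
  have hcl : ∀ f : ℝ → ℝ, Continuous f → MeasurableSet {q : (RSpace n × RSpace n) × ℝ |
      q.1 ∈ S.closedBundle ∧ f q.2 ∈ S.residence q.1} := fun f hf =>
    ((CutoffFlow.isClosed_setOf_mem_residence (S := S)).preimage
      (by fun_prop : Continuous fun q : (RSpace n × RSpace n) × ℝ => (f q.2, q.1))).measurableSet
  -- Pairs of a point `w` of `A` and a time `s` such that the point a time `s` earlier on the
  -- trajectory of `w` is resident but leaves within time `h` in direction `e`. Fubini in the
  -- coordinates `(Φ s z, s)` costs only the fixed-time constant `C`.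
  let P : Set ((RSpace n × RSpace n) × ℝ) := {q | q.1 ∈ A} ∩
    ({q | q.1 ∈ S.closedBundle ∧ -q.2 ∈ S.residence q.1} \
      {q | q.1 ∈ S.closedBundle ∧ e * h - q.2 ∈ S.residence q.1})
  have hP : MeasurableSet P := (measurable_fst hA).inter
    ((hcl (fun s => -s) (by fun_prop)).diff (hcl (fun s => e * h - s) (by fun_prop)))
  calc _ = (S.bulk.prod volume) ({q | q ∈ S.orbitDomain ∧ Φ q.2 q.1 ∈ A} ∩
        Prod.fst ⁻¹' {z | z ∈ S.closedBundle ∧ e * h ∈ S.residence z}ᶜ) := by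
        rw [Measure.prod_apply hQ]
        refine lintegral_congr fun z => ?_
        by_cases hz : z ∈ {z | z ∈ S.closedBundle ∧ e * h ∈ S.residence z}ᶜ
        · rw [indicator_of_mem hz, orbitTime]
          congr 1
          ext s
          exact ⟨fun hs => ⟨hs, hz⟩, fun hs => hs.1⟩
        · rw [indicator_of_notMem hz]
          have : Prod.mk z ⁻¹' ({q : (RSpace n × RSpace n) × ℝ | q ∈ S.orbitDomain ∧ Φ q.2 q.1 ∈ A} ∩
              Prod.fst ⁻¹' {z | z ∈ S.closedBundle ∧ e * h ∈ S.residence z}ᶜ) = ∅ := by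
            rw [eq_empty_iff_forall_notMem]
            exact fun s hs => hz hs.2
          rw [this, measure_empty]
    _ ≤ ∫⁻ s, C * S.bulk ((fun z => (z, s)) ⁻¹' P) := by
        rw [Measure.prod_apply_symm hQ]
        refine lintegral_mono fun s => le_trans (measure_mono ?_)
          (hC s _ (measurable_prodMk_right hP))
        rintro z ⟨⟨hD, hmem⟩, hz⟩
        have hzc : z ∈ S.closedBundle := hD.1
        have hs : s ∈ S.residence z := Ioo_subset_residence hnt hD.1 hD.2
        refine ⟨hD, hmem, ⟨Φ.map_mem_closedBundle hzc hs, ?_⟩, ?_⟩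
        · change -s ∈ S.residence (Φ s z)
          rw [Φ.mem_residence_map_iff hzc hs, neg_add_cancel]
          exact zero_mem_residence hzc
        · rintro ⟨-, h2⟩
          change e * h - s ∈ S.residence (Φ s z) at h2
          rw [Φ.mem_residence_map_iff hzc hs, sub_add_cancel] at h2
          exact hz ⟨hzc, h2⟩
    _ = C * ∫⁻ z, volume (Prod.mk z ⁻¹' P) ∂S.bulk := by
        rw [lintegral_const_mul' _ _ ENNReal.coe_ne_top, ← Measure.prod_apply hP,
          Measure.prod_apply_symm hP]
    _ ≤ C * ∫⁻ z, A.indicator (fun _ => ENNReal.ofReal h) z ∂S.bulk := by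
        gcongr with z
        by_cases hz : z ∈ A
        · rw [indicator_of_mem hz]
          by_cases hzc : z ∈ S.closedBundle
          -- On one trajectory the points that leave within time `h` occupy a time interval of
          -- length at most `h` next to the end.
          · obtain ⟨a, ha⟩ : ∃ a : ℝ, Prod.mk z ⁻¹' P ⊆ Icc a (a + h) := by
              rcases (abs_eq zero_le_one).1 he with rfl | rfl
              · refine ⟨-S.exitTime z, ?_⟩
                rintro s ⟨-, ⟨-, h1⟩, h2⟩
                have h3 : ¬ (1 * h - s ∈ S.residence z) := fun h' => h2 ⟨hzc, h'⟩
                change -s ∈ S.residence z at h1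
                rw [residence_eq hnt hzc, mem_Icc] at h1 h3
                constructor
                · linarith [h1.2]
                · by_contra! hcon
                  exact h3 ⟨by linarith [h1.1], by linarith⟩
              · refine ⟨-S.entryTime z - h, ?_⟩
                rintro s ⟨-, ⟨-, h1⟩, h2⟩
                have h3 : ¬ (-1 * h - s ∈ S.residence z) := fun h' => h2 ⟨hzc, h'⟩
                change -s ∈ S.residence z at h1
                rw [residence_eq hnt hzc, mem_Icc] at h1 h3
                constructor
                · by_contra! hcon
                  exact h3 ⟨by linarith, by linarith [h1.2]⟩
                · linarith [h1.1]
            refine (measure_mono ha).trans ?_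
            rw [Real.volume_Icc, add_sub_cancel_left]
          · have : Prod.mk z ⁻¹' P = ∅ := by
              rw [eq_empty_iff_forall_notMem]
              exact fun s hs => hzc hs.2.1.1
            rw [this, measure_empty]
            exact zero_le
        · have : Prod.mk z ⁻¹' P = ∅ := by
            rw [eq_empty_iff_forall_notMem]
            exact fun s hs => hz hs.1
          rw [this, measure_empty]
          exact zero_le
    _ = _ := by rw [lintegral_indicator hA, setLIntegral_const, mul_assoc]

/-- Near a transversal boundary point, trajectories inside the domain visit an open set at the
times at which the trajectory of the boundary point does. -/
theorem eventually_mem_orbit (hconv : S.StrictlyConvexBoundary) (hnt : S.NonTrapping) {e : ℝ}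
    (he : |e| = 1) {z : RSpace n × RSpace n} (hz : z ∈ S.boundarySet e) {s : ℝ}
    (hs : s ∈ Ioo (S.entryTime z) (S.exitTime z)) :
    ∀ᶠ z' in 𝓝[S.bundle S.Ω] z, (z', s) ∈ S.orbitDomain := by
  obtain ⟨Φ⟩ := S.nonempty_cutoffFlow
  have hzc := bundle_frontier_subset hz.1
  -- From an outgoing point the trajectory runs only into the past, from an incoming one only into
  -- the future.
  have hes : e * s < 0 := by
    by_contra! hcon
    have hsr := Ioo_subset_residence hnt hzc hs
    rcases hcon.eq_or_lt with h0 | h0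
    · have : s = 0 := by
        rcases mul_eq_zero.1 h0.symm with h | h
        · rw [h] at he; simp at he
        · exact h
      rcases (abs_eq zero_le_one).1 he with rfl | rfl
      · rw [← outgoingSet_eq] at hz
        linarith [(exitTime_of_mem_outgoingSet hnt hz).2, hs.2]
      · rw [← incomingSet_eq] at hz
        linarith [(exitTime_of_mem_incomingSet hnt hz).1, hs.1]
    · exact not_mem_residence_of_transversal hz.1 hz.2 h0 hsr
  -- This open condition persists, by compactness, for nearby trajectories. It stops them from
  -- ending between 0 and `s`: at an end in that direction `ρ` vanishes and the slope has the sign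
  -- opposite to `e`.
  have key : ∀ᶠ z' in 𝓝 z, ∀ r ∈ uIcc 0 s,
      S.ρ (Φ r z').1 ≠ 0 ∨ 0 < e * S.slope (Φ r z') := by
    refine isCompact_uIcc.eventually_forall_of_forall_eventually fun r hr => ?_
    have hc : Continuous fun q : (RSpace n × RSpace n) × ℝ => Φ q.2 q.1 :=
      Φ.continuous_uncurry.comp continuous_swap
    have ho : IsOpen {w : RSpace n × RSpace n | S.ρ w.1 ≠ 0 ∨ 0 < e * S.slope w} :=
      (isOpen_ne_fun (continuous_ρ.comp continuous_fst) continuous_const).union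
        (isOpen_lt continuous_const (continuous_const.mul continuous_slope))
    refine (ho.preimage hc).mem_nhds ?_
    change S.ρ (Φ r z).1 ≠ 0 ∨ 0 < e * S.slope (Φ r z)
    by_cases hr0 : r = 0
    · right
      rw [hr0, Φ.map_zero]
      exact hz.2
    · left
      have hmem : r ∈ Ioo (S.entryTime z) (S.exitTime z) := by
        rcases (abs_eq zero_le_one).1 he with rfl | rfl
        · have h1 : s < 0 := by linarith
          rw [uIcc_of_ge h1.le] at hr
          rw [← outgoingSet_eq] at hz
          exact ⟨hs.1.trans_le hr.1, by
            rw [(exitTime_of_mem_outgoingSet hnt hz).2]; exact lt_of_le_of_ne hr.2 hr0⟩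
        · have h1 : 0 < s := by linarith
          rw [uIcc_of_le h1.le] at hr
          rw [← incomingSet_eq] at hz
          exact ⟨by
            rw [(exitTime_of_mem_incomingSet hnt hz).1]; exact lt_of_le_of_ne hr.1 (Ne.symm hr0),
            hr.2.trans_lt hs.2⟩
      exact (S.mem_Ω_iff.1 (Φ.map_mem_bundle_Ω hconv hnt hzc hmem).1).ne
  rw [eventually_nhdsWithin_iff]
  filter_upwards [key] with z' hz' hz'Ω
  have hz'c := bundle_Ω_subset hz'Ω
  obtain ⟨h1, h2⟩ := entryTime_neg_exitTime_pos hnt hz'Ω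
  refine ⟨hz'c, ?_⟩
  rcases (abs_eq zero_le_one).1 he with rfl | rfl
  · have h3 : s < 0 := by linarith
    refine ⟨?_, h3.trans h2⟩
    by_contra! hcon
    have h4 := Φ.map_entryTime_mem hconv hnt hz'c (h1.trans h2)
    have h5 := hz' (S.entryTime z') (by rw [uIcc_of_ge h3.le]; exact ⟨hcon, h1.le⟩)
    rw [incomingSet_eq] at h4
    rcases h5 with h5 | h5
    · exact h5 (S.mem_frontier_iff.1 h4.1.1)
    · linarith [h4.2]
  · have h3 : 0 < s := by linarith
    refine ⟨h1.trans h3, ?_⟩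
    by_contra! hcon
    have h4 := Φ.map_exitTime_mem hconv hnt hz'c (h1.trans h2)
    have h5 := hz' (S.exitTime z') (by rw [uIcc_of_le h3.le]; exact ⟨h2.le, hcon⟩)
    rw [outgoingSet_eq] at h4
    rcases h5 with h5 | h5
    · exact h5 (S.mem_frontier_iff.1 h4.1.1)
    · linarith [h4.2]

/-- Lower semicontinuity from inside: each time at which the boundary trajectory visits the open set
is also a visiting time for nearby interior points, and Fatou's lemma passes this to the measure of
visiting times. -/
theorem eventually_lt_orbitTime (hconv : S.StrictlyConvexBoundary) (hnt : S.NonTrapping) {e : ℝ}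
    (he : |e| = 1) {z : RSpace n × RSpace n} (hz : z ∈ S.boundarySet e)
    {O : Set (RSpace n × RSpace n)} (hO : IsOpen O) {a : ℝ≥0∞} (ha : a < Φ.orbitTime O z) :
    ∀ᶠ z' in 𝓝[S.bundle S.Ω] z, a < Φ.orbitTime O z' := by
  have hm : ∀ z', MeasurableSet {s : ℝ | (z', s) ∈ S.orbitDomain ∧ Φ s z' ∈ O} := fun z' =>
    measurable_prodMk_left (Φ.measurableSet_orbit hnt hO.measurableSet)
  have heq : ∀ z', Φ.orbitTime O z' = ∫⁻ s : ℝ,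
      {s : ℝ | (z', s) ∈ S.orbitDomain ∧ Φ s z' ∈ O}.indicator (fun _ => (1 : ℝ≥0∞)) s := by
    intro z'
    rw [lintegral_indicator (hm z'), setLIntegral_const, one_mul]
    rfl
  refine eventually_lt_of_lt_liminf (ha.trans_le ?_)
  rw [show Φ.orbitTime O = _ from funext heq]
  refine le_trans (lintegral_mono fun s => ?_)
    (lintegral_liminf_le fun z' => measurable_const.indicator (hm z'))
  by_cases hs : s ∈ {s : ℝ | (z, s) ∈ S.orbitDomain ∧ Φ s z ∈ O}
  · rw [indicator_of_mem hs]
    refine le_liminf_of_le (by isBoundedDefault) ?_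
    have h2 : ∀ᶠ z' in 𝓝[S.bundle S.Ω] z, Φ s z' ∈ O :=
      mem_nhdsWithin_of_mem_nhds ((hO.preimage (Φ.continuous_map s)).mem_nhds hs.2)
    filter_upwards [eventually_mem_orbit hconv hnt he hz hs.1.2, h2] with z' h3 h4
    rw [indicator_of_mem (show s ∈ {s : ℝ | (z', s) ∈ S.orbitDomain ∧ Φ s z' ∈ O} from ⟨h3, h4⟩)]
  · rw [indicator_of_notMem hs]
    exact zero_le

/-- Near a transversal boundary point, trajectories leave the domain at once. -/
theorem eventually_not_mem_residence {e : ℝ} (he : |e| = 1) {z : RSpace n × RSpace n}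
    {m : ℝ} (hm : m < e * S.slope z) :
    ∀ᶠ q in 𝓝 z ×ˢ 𝓝[>] (0 : ℝ), q.1 ∈ S.closedBundle → -(m * q.2) < S.ρ q.1.1 →
      e * q.2 ∉ S.residence q.1 := by
  obtain ⟨Φ⟩ := S.nonempty_cutoffFlow
  have hc : Continuous fun q : (RSpace n × RSpace n) × ℝ => e * S.slope (Φ (e * q.2) q.1) :=
    continuous_const.mul (continuous_slope.comp (Φ.continuous_uncurry.comp
      ((continuous_const.mul continuous_snd).prodMk continuous_fst)))
  have h1 : ∀ᶠ q in 𝓝 z ×ˢ 𝓝 (0 : ℝ), m < e * S.slope (Φ (e * q.2) q.1) := by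
    rw [← nhds_prod_eq]
    refine hc.continuousAt.eventually (lt_mem_nhds ?_)
    simp only [mul_zero, Φ.map_zero]
    exact hm
  obtain ⟨p, hp, q, hq, hpq⟩ := Filter.eventually_prod_iff.1 h1
  obtain ⟨δ, hδ, hball⟩ := Metric.eventually_nhds_iff_ball.1 hq
  have hIoo : ∀ᶠ h in 𝓝[>] (0 : ℝ), h ∈ Ioo 0 δ := Ioo_mem_nhdsGT hδ
  refine (hp.prod_mk hIoo).mono ?_
  rintro ⟨z', h⟩ ⟨hz', hh⟩ hz'c hρ hmem
  simp only at hz' hh hz'c hρ hmem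
  have hres : ∀ r ∈ Icc 0 h, e * r ∈ S.residence z' := by
    intro r hr
    refine uIcc_zero_subset_residence hz'c hmem ?_
    rcases (abs_eq zero_le_one).1 he with rfl | rfl
    · rw [one_mul, one_mul, uIcc_of_le hh.1.le]; exact hr
    · rw [uIcc_of_ge (by linarith [hh.1])]
      constructor <;> linarith [hr.1, hr.2]
  have hder : ∀ r ∈ Icc 0 h, HasDerivAt (fun r => S.ρ (Φ (e * r) z').1)
      (e * S.slope (Φ (e * r) z')) r := by
    intro r hr
    have := (Φ.hasDerivAt_ρ (Φ.map_mem_closedBundle hz'c (hres r hr))).scomp r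
      ((hasDerivAt_id r).const_mul e)
    simpa [slope, Function.comp_def] using this
  -- In time direction `e` the function `ρ` increases at rate at least `m`, so starting above `-(m
  -- h)` it would become positive by time `h`, against residence.
  have hmvt := (convex_Icc 0 h).mul_sub_le_image_sub_of_le_deriv
    (fun r hr => (hder r hr).continuousAt.continuousWithinAt)
    (fun r hr => (hder r (interior_subset hr)).differentiableAt.differentiableWithinAt)
    (C := m) (fun r hr => by
      rw [(hder r (interior_subset hr)).deriv]
      have hr' := interior_subset hr
      refine (hpq hz' (hball r ?_)).le
      rw [mem_ball_zero_iff, Real.norm_eq_abs, abs_of_nonneg hr'.1]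
      exact hr'.2.trans_lt hh.2) 0 (left_mem_Icc.2 hh.1.le) h (right_mem_Icc.2 hh.1.le) hh.1.le
  have h3 := Φ.ρ_map_le hz'c hmem
  simp only [mul_zero, Φ.map_zero, sub_zero] at hmvt
  linarith

end CutoffFlow

end TransportSetting

/-! ### Interior and boundary measures in chart coordinates -/

namespace TransportSetting

open scoped NNReal ENNReal

variable {n : ℕ} {S : TransportSetting n}

theorem exists_gradient_bound (S : TransportSetting n) :
    ∃ g : ℝ, 0 < g ∧ ∀ x ∈ frontier S.Ω, g ≤ ‖gradient S.ρ x‖ := by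
  have hc : IsCompact (frontier S.Ω) :=
    S.isCompact_closure.of_isClosed_subset isClosed_frontier frontier_subset_closure
  obtain ⟨g, hg, h⟩ := hc.exists_forall_le' continuous_gradient_ρ.norm.continuousOn (a := 0)
    fun x hx => norm_pos_iff.2 (S.ρ_regular x (S.mem_frontier_iff.1 hx))
  exact ⟨g, hg, h⟩

theorem isCompact_frontier : IsCompact (frontier S.Ω) :=
  S.isCompact_closure.of_isClosed_subset isClosed_frontier frontier_subset_closure

theorem measurable_normal_inner :
    Measurable fun z : RSpace n × RSpace n => ENNReal.ofReal |inner ℝ (S.normal z.1) z.2| := by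
  have h : Measurable (gradient S.ρ) := continuous_gradient_ρ.measurable
  have h1 : Measurable S.normal := h.norm.inv.smul h
  fun_prop

namespace BoundaryChart

variable (c : S.BoundaryChart)

/-- The phase point with given coordinates. -/
noncomputable def point (t : ℝ) (q : RSpace (n - 1) × sphere (0 : RSpace n) 1) :
    RSpace n × RSpace n := S.scale (c (t, q.1), q.2)

/-- The measure on the coordinates of the boundary phase points. -/
noncomputable def coordMeasure : Measure (RSpace (n - 1) × sphere (0 : RSpace n) 1) :=
  (volume.restrict (ball (0 : RSpace (n - 1)) c.radius)).prod (volume : Measure (RSpace n)).toSphere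

instance : IsFiniteMeasure (volume.restrict (ball (0 : RSpace (n - 1)) c.radius)) :=
  ⟨by rw [Measure.restrict_apply_univ]; exact measure_ball_lt_top⟩

instance : IsFiniteMeasure c.coordMeasure := by
  unfold coordMeasure; infer_instance

theorem continuous_point :
    Continuous fun p : ℝ × (RSpace (n - 1) × sphere (0 : RSpace n) 1) => c.point p.1 p.2 := by
  have h := c.continuous
  exact S.continuous_scale.comp ((h.comp (by fun_prop)).prodMk (by fun_prop))

theorem ae_coordMeasure : ∀ᵐ q ∂c.coordMeasure, q.1 ∈ ball (0 : RSpace (n - 1)) c.radius := by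
  have h : ∀ᵐ y ∂(volume.restrict (ball (0 : RSpace (n - 1)) c.radius)),
      y ∈ ball (0 : RSpace (n - 1)) c.radius := ae_restrict_mem measurableSet_ball
  exact Measure.quasiMeasurePreserving_fst.ae h

theorem point_mem {t : ℝ} {q : RSpace (n - 1) × sphere (0 : RSpace n) 1}
    (hq : q.1 ∈ ball (0 : RSpace (n - 1)) c.radius) (ht : t ∈ Ioc (-c.radius) 0) :
    c.point t q ∈ S.closedBundle ∧ S.ρ (c.point t q).1 = t := by
  have hb : (t, q.1) ∈ ball (0 : ℝ × RSpace (n - 1)) c.radius :=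
    c.mem_ball_iff.2 ⟨⟨ht.1, ht.2.trans_lt c.radius_pos⟩, hq⟩
  have h1 : S.ρ (c (t, q.1)) = t := c.ρ_apply _ hb
  refine ⟨S.mem_closedBundle_iff.2 ⟨?_, ?_⟩, h1⟩
  · exact S.mem_closure_iff.2 (h1.trans_le ht.2)
  · change ‖S.speed (c (t, q.1)) • (q.2 : RSpace n)‖ = S.speed (c (t, q.1))
    rw [norm_smul, norm_eq_of_mem_sphere, mul_one]
    exact Real.norm_of_nonneg (Real.sqrt_nonneg _)

/-- The Lipschitz inverse of the chart controls Lebesgue measure, and the density `p ^ (n-1)` of the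
phase measure is bounded below on the closure. -/
theorem exists_lintegral_point_le (hn : n ≠ 0) : ∃ C : ℝ≥0, ∀ G : RSpace n × RSpace n → ℝ≥0∞,
    Measurable G → ∫⁻ t in Ioo (-c.radius) 0, (∫⁻ q, G (c.point t q) ∂c.coordMeasure) ≤
      C * ∫⁻ z, G z ∂S.bulk := by
  obtain ⟨C, hC⟩ := c.exists_volume_preimage_le hn
  obtain ⟨a, b, ha, hb, hab⟩ := S.exists_speed_bounds
  refine ⟨C * (a ^ (n - 1))⁻¹.toNNReal, fun G hG => ?_⟩
  let F : RSpace n → ℝ≥0∞ := fun x => ∫⁻ v, G (S.scale (x, v)) ∂(volume : Measure (RSpace n)).toSphere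
  have hF : Measurable F := (hG.comp S.measurable_scale).lintegral_prod_right'
  have hc := c.continuous
  have hle : ((volume.restrict (Ioo (-c.radius) 0)).prod
      (volume.restrict (ball (0 : RSpace (n - 1)) c.radius))).map c ≤ C • volume.restrict S.Ω := by
    refine Measure.le_iff.2 fun A hA => ?_
    rw [Measure.map_apply hc.measurable hA, Measure.prod_restrict, ← Measure.volume_eq_prod,
      Measure.restrict_apply (hc.measurable hA), Measure.smul_apply, Measure.restrict_apply hA]
    refine (measure_mono ?_).trans (hC (A ∩ S.Ω))
    rintro q ⟨hqA, hq1, hq2⟩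
    have hb : q ∈ ball (0 : ℝ × RSpace (n - 1)) c.radius :=
      c.mem_ball_iff.2 ⟨⟨hq1.1, hq1.2.trans c.radius_pos⟩, hq2⟩
    exact ⟨hb, hqA, S.mem_Ω_iff.2 ((c.ρ_apply q hb).trans_lt hq1.2)⟩
  calc _ = ∫⁻ t in Ioo (-c.radius) 0, (∫⁻ y in ball (0 : RSpace (n - 1)) c.radius, F (c (t, y))) := by
        refine lintegral_congr fun t => ?_
        rw [coordMeasure, lintegral_prod]
        · rfl
        · exact (hG.comp (c.continuous_point.measurable.comp measurable_prodMk_left)).aemeasurable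
    _ = ∫⁻ x, F x ∂((volume.restrict (Ioo (-c.radius) 0)).prod
      (volume.restrict (ball (0 : RSpace (n - 1)) c.radius))).map c := by
        rw [lintegral_map hF hc.measurable, lintegral_prod]
        exact (hF.comp hc.measurable).aemeasurable
    _ ≤ ∫⁻ x, F x ∂(C • volume.restrict S.Ω) := lintegral_mono' hle le_rfl
    _ = C * ∫⁻ x in S.Ω, F x := by rw [lintegral_smul_measure]; rfl
    _ ≤ C * ((a ^ (n - 1))⁻¹.toNNReal * ∫⁻ z, G z ∂S.bulk) := by
        gcongr
        rw [bulk, S.lintegral_phaseMeasure _ hG, ← lintegral_const_mul' _ _ ENNReal.coe_ne_top]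
        refine setLIntegral_mono' measurableSet_Ω fun x hx => ?_
        rw [← mul_assoc]
        refine le_mul_of_one_le_left zero_le ?_
        change 1 ≤ ENNReal.ofReal _ * _
        rw [← ENNReal.ofReal_mul (by positivity), ← ENNReal.ofReal_one]
        refine ENNReal.ofReal_le_ofReal ?_
        rw [inv_mul_eq_div, one_le_div (by positivity)]
        exact pow_le_pow_left₀ ha.le (hab x (subset_closure hx)).1 _
    _ = _ := by push_cast; ring

/-- The Lipschitz chart controls surface measure. The flux density `|n·θ|` is `|slope| / ‖∇ρ‖`, and
the gradient is bounded away from zero on the compact boundary. -/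
theorem exists_lintegral_ξ_le (c : S.BoundaryChart) : ∃ C : ℝ≥0, ∀ N, MeasurableSet N →
    (∀ x ∈ N, S.ρ x = 0 → ∃ y ∈ ball (0 : RSpace (n - 1)) c.radius, c (0, y) = x) →
    ∀ G : RSpace n × RSpace n → ℝ≥0∞, Measurable G →
      ∫⁻ z in Prod.fst ⁻¹' N, G z ∂S.ξ ≤
        C * ∫⁻ q, ENNReal.ofReal |S.slope (c.point 0 q)| * G (c.point 0 q) ∂c.coordMeasure := by
  obtain ⟨C, hC⟩ := c.exists_surface_le
  obtain ⟨a, b, ha, hb, hab⟩ := S.exists_speed_bounds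
  obtain ⟨g, hg, hgle⟩ := S.exists_gradient_bound
  refine ⟨(b ^ (n - 1) * g⁻¹).toNNReal * C, fun N hN hNc G hG => ?_⟩
  let F : RSpace n → ℝ≥0∞ := fun x => ∫⁻ v, ENNReal.ofReal |S.slope (S.scale (x, v))| *
    G (S.scale (x, v)) ∂(volume : Measure (RSpace n)).toSphere
  have hsl : Measurable fun z => ENNReal.ofReal |S.slope z| * G z :=
    (continuous_slope.measurable.abs.ennreal_ofReal).mul hG
  have hF : Measurable F := (hsl.comp S.measurable_scale).lintegral_prod_right'
  have hc0 : Continuous fun y => c (0, y) := c.continuous.comp (by fun_prop)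
  have hle : (Measure.euclideanHausdorffMeasure (n - 1)).restrict (N ∩ frontier S.Ω) ≤
      C • (volume.restrict (ball (0 : RSpace (n - 1)) c.radius)).map fun y => c (0, y) := by
    refine Measure.le_iff.2 fun A hA => ?_
    rw [Measure.smul_apply, Measure.map_apply hc0.measurable hA,
      Measure.restrict_apply (hc0.measurable hA), Measure.restrict_apply hA]
    refine (hC _ ?_).trans ?_
    · exact fun x hx => hNc x hx.2.1 (S.mem_frontier_iff.1 hx.2.2)
    · refine mul_le_mul_right (measure_mono ?_) _
      exact fun y hy => ⟨hy.2.1, hy.1⟩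
  have hind : Measurable ((Prod.fst ⁻¹' N : Set (RSpace n × RSpace n)).indicator G) :=
    hG.indicator (measurable_fst hN)
  calc _ = ∫⁻ z, ENNReal.ofReal |inner ℝ (S.normal z.1) z.2| *
        (Prod.fst ⁻¹' N : Set (RSpace n × RSpace n)).indicator G z
          ∂S.phaseMeasure ((Measure.euclideanHausdorffMeasure (n - 1)).restrict (frontier S.Ω)) := by
        rw [← lintegral_indicator (measurable_fst hN), ξ,
          lintegral_withDensity_eq_lintegral_mul _ measurable_normal_inner hind]
        rfl
    _ ≤ ∫⁻ x in frontier S.Ω, (b ^ (n - 1) * g⁻¹).toNNReal * N.indicator F x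
          ∂Measure.euclideanHausdorffMeasure (n - 1) := by
        have hmul : Measurable fun z : RSpace n × RSpace n =>
            ENNReal.ofReal |inner ℝ (S.normal z.1) z.2| * (Prod.fst ⁻¹' N).indicator G z :=
          measurable_normal_inner.mul hind
        rw [S.lintegral_phaseMeasure _ hmul]
        refine setLIntegral_mono' isClosed_frontier.measurableSet fun x hx => ?_
        have hxc := frontier_subset_closure hx
        by_cases hxN : x ∈ N
        · rw [indicator_of_mem hxN]
          have h1 : ∀ v : sphere (0 : RSpace n) 1,
              ENNReal.ofReal |inner ℝ (S.normal x) (S.speed x • (v : RSpace n))| *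
                (Prod.fst ⁻¹' N : Set (RSpace n × RSpace n)).indicator G
                  (x, S.speed x • (v : RSpace n)) ≤
              ENNReal.ofReal g⁻¹ * (ENNReal.ofReal |S.slope (S.scale (x, v))| *
                G (S.scale (x, v))) := by
            intro v
            rw [indicator_of_mem (show (x, S.speed x • (v : RSpace n)) ∈
              (Prod.fst ⁻¹' N : Set (RSpace n × RSpace n)) from hxN), ← mul_assoc,
              ← ENNReal.ofReal_mul (by positivity), inner_normal, abs_mul,
              abs_of_nonneg (inv_nonneg.2 (norm_nonneg _))]
            refine mul_le_mul_left (ENNReal.ofReal_le_ofReal ?_) _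
            exact mul_le_mul_of_nonneg_right (inv_anti₀ hg (hgle x hx)) (abs_nonneg _)
          calc _ ≤ ENNReal.ofReal (b ^ (n - 1)) * (ENNReal.ofReal g⁻¹ * F x) := by
                gcongr
                · exact Real.sqrt_nonneg _
                · exact (hab x hxc).2
                · rw [← lintegral_const_mul' _ _ ENNReal.ofReal_ne_top]
                  exact lintegral_mono h1
            _ = _ := by
                rw [← mul_assoc, ← ENNReal.ofReal_mul (by positivity)]
                rfl
        · have h1 : ∀ v : sphere (0 : RSpace n) 1,
              ENNReal.ofReal |inner ℝ (S.normal x) (S.speed x • (v : RSpace n))| *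
                (Prod.fst ⁻¹' N : Set (RSpace n × RSpace n)).indicator G
                  (x, S.speed x • (v : RSpace n)) = 0 := by
            intro v
            rw [indicator_of_notMem (show (x, S.speed x • (v : RSpace n)) ∉
              (Prod.fst ⁻¹' N : Set (RSpace n × RSpace n)) from hxN), mul_zero]
          simp only [h1, lintegral_zero, mul_zero, zero_le]
    _ = (b ^ (n - 1) * g⁻¹).toNNReal * ∫⁻ x, F x
          ∂(Measure.euclideanHausdorffMeasure (n - 1)).restrict (N ∩ frontier S.Ω) := by
        rw [lintegral_const_mul' _ _ ENNReal.coe_ne_top, lintegral_indicator hN,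
          Measure.restrict_restrict hN]
    _ ≤ (b ^ (n - 1) * g⁻¹).toNNReal * ∫⁻ x, F x
          ∂(C • (volume.restrict (ball (0 : RSpace (n - 1)) c.radius)).map fun y => c (0, y)) := by
        gcongr
    _ = (b ^ (n - 1) * g⁻¹).toNNReal * (C *
          ∫⁻ y in ball (0 : RSpace (n - 1)) c.radius, F (c (0, y))) := by
        rw [lintegral_smul_measure, lintegral_map hF hc0.measurable]
        rfl
    _ = _ := by
        rw [coordMeasure, lintegral_prod]
        · push_cast
          rw [mul_assoc]
          rfl
        · exact (hsl.comp (c.continuous_point.measurable.comp measurable_prodMk_left)).aemeasurable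

end BoundaryChart

end TransportSetting

/-! ### Orbit bounds for the boundary measures -/

namespace TransportSetting

open scoped NNReal ENNReal

variable {n : ℕ} {S : TransportSetting n}

namespace CutoffFlow

variable (Φ : S.CutoffFlow) (c : S.BoundaryChart)

/-- The time spent in an open set by the trajectory of a transversal boundary point is controlled by
the mean over nearby points inside the domain. -/
theorem le_liminf_orbitTime (hconv : S.StrictlyConvexBoundary) (hnt : S.NonTrapping) {e : ℝ}
    (he : |e| = 1) {O : Set (RSpace n × RSpace n)} (hO : IsOpen O)
    {q : RSpace (n - 1) × sphere (0 : RSpace n) 1}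
    (hq : q.1 ∈ ball (0 : RSpace (n - 1)) c.radius) :
    ENNReal.ofReal (e * S.slope (c.point 0 q)) * Φ.orbitTime O (c.point 0 q) ≤
      2 * liminf (fun h => (ENNReal.ofReal h)⁻¹ * ∫⁻ t in Ioo (-c.radius) 0,
        {z | z ∈ S.closedBundle ∧ e * h ∈ S.residence z}ᶜ.indicator (Φ.orbitTime O)
          (c.point t q)) (𝓝[>] (0 : ℝ)) := by
  have hr := c.radius_pos
  set z := c.point 0 q with hz
  set m := e * S.slope z with hm
  rcases le_or_gt m 0 with hm0 | hm0
  · rw [ENNReal.ofReal_of_nonpos hm0, zero_mul]; exact zero_le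
  have hzc : z ∈ S.closedBundle ∧ S.ρ z.1 = 0 := c.point_mem hq ⟨neg_lt_zero.2 hr, le_rfl⟩
  have hzb : z ∈ S.boundarySet e := ⟨⟨S.mem_frontier_iff.2 hzc.2, hzc.1.2⟩, hm0⟩
  -- The exit criterion needs a rate strictly below the slope `m`; the choice `m / 2` is the source
  -- of the factor 2.
  have h2 : ENNReal.ofReal m = 2 * ENNReal.ofReal (m / 2) := by
    rw [show (2 : ℝ≥0∞) = ENNReal.ofReal 2 by simp, ← ENNReal.ofReal_mul zero_le_two]
    congr 1
    ring
  rw [h2, mul_assoc]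
  gcongr
  refine ENNReal.mul_le_of_forall_lt fun a' ha' a ha => ?_
  refine le_liminf_of_le (by isBoundedDefault) ?_
  have hp : Tendsto (fun t => c.point t q) (𝓝[<] 0) (𝓝[S.bundle S.Ω] z) := by
    refine tendsto_nhdsWithin_iff.2 ⟨?_, ?_⟩
    · have hcont : Continuous fun t => c.point t q :=
        c.continuous_point.comp (by fun_prop : Continuous fun t : ℝ => (t, q))
      exact (hcont.tendsto 0).mono_left nhdsWithin_le_nhds
    · filter_upwards [Ioo_mem_nhdsLT (neg_lt_zero.2 hr)] with t ht
      obtain ⟨h3, h4⟩ := c.point_mem hq ⟨ht.1, ht.2.le⟩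
      exact ⟨S.mem_Ω_iff.2 (h4.trans_lt ht.2), h3.2⟩
  obtain ⟨P, hP, Q, hQ, hPQ⟩ := Filter.eventually_prod_iff.1
    (eventually_not_mem_residence he (show m / 2 < e * S.slope z by rw [← hm]; linarith))
  have hev : ∀ᶠ t in 𝓝[<] (0 : ℝ), P (c.point t q) ∧ a < Φ.orbitTime O (c.point t q) :=
    hp.eventually ((eventually_nhdsWithin_of_eventually_nhds hP).and
      (Φ.eventually_lt_orbitTime hconv hnt he hzb hO ha))
  obtain ⟨δ, hδ, hδm⟩ := (mem_nhdsLT_iff_exists_Ioo_subset (a := (0 : ℝ))).1 hev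
  rw [mem_Iio] at hδ
  have hh : ∀ᶠ h in 𝓝[>] (0 : ℝ), h ∈ Ioo 0 (min (-δ) c.radius / m) :=
    Ioo_mem_nhdsGT (div_pos (lt_min (by linarith) hr) hm0)
  filter_upwards [hQ, hh] with h hQh hh
  have hhm : h * m < min (-δ) c.radius := (lt_div_iff₀ hm0).1 hh.2
  have hhm0 : 0 < h * m := mul_pos hh.1 hm0
  have h5 := hhm.trans_le (min_le_left _ _)
  have h6 := hhm.trans_le (min_le_right _ _)
  -- Every point at depth `t` between `-(m/2) h` and 0 leaves within time `h`, and its orbit time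
  -- exceeds `a`; the layer has thickness `(m/2) h`.
  have hle : ENNReal.ofReal (m / 2 * h) * a ≤ ∫⁻ t in Ioo (-c.radius) 0,
        {z | z ∈ S.closedBundle ∧ e * h ∈ S.residence z}ᶜ.indicator (Φ.orbitTime O)
          (c.point t q) := by
    calc _ = ∫⁻ _ in Ioo (-(m / 2 * h)) 0, a := by
          rw [setLIntegral_const, Real.volume_Ioo, zero_sub, neg_neg, mul_comm]
      _ ≤ ∫⁻ t in Ioo (-(m / 2 * h)) 0,
        {z | z ∈ S.closedBundle ∧ e * h ∈ S.residence z}ᶜ.indicator (Φ.orbitTime O)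
          (c.point t q) := by
          refine setLIntegral_mono' measurableSet_Ioo fun t ht => ?_
          have ht1 : t ∈ Ioo δ 0 := ⟨by linarith [ht.1], ht.2⟩
          have ht2 : t ∈ Ioc (-c.radius) 0 := ⟨by linarith [ht.1], ht.2.le⟩
          obtain ⟨h7, h8⟩ := hδm ht1
          obtain ⟨h9, h10⟩ := c.point_mem hq ht2
          have h11 := hPQ h7 hQh h9 (by simp only [h10]; exact ht.1)
          rw [indicator_of_mem (show c.point t q ∈ {z | z ∈ S.closedBundle ∧ e * h ∈ S.residence z}ᶜ
            from fun hmem => h11 hmem.2)]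
          exact h8.le
      _ ≤ _ := by
          refine lintegral_mono_set (Ioo_subset_Ioo_left ?_)
          linarith
  calc a' * a ≤ ENNReal.ofReal (m / 2) * a := by gcongr
    _ = (ENNReal.ofReal h)⁻¹ * (ENNReal.ofReal (m / 2 * h) * a) := by
        have h12 : (ENNReal.ofReal h)⁻¹ * ENNReal.ofReal h = 1 :=
          ENNReal.inv_mul_cancel (by simpa using hh.1) ENNReal.ofReal_ne_top
        rw [ENNReal.ofReal_mul (by positivity)]
        calc _ = ((ENNReal.ofReal h)⁻¹ * ENNReal.ofReal h) * (ENNReal.ofReal (m / 2) * a) := by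
              rw [h12, one_mul]
          _ = _ := by ring
    _ ≤ _ := by gcongr

/-- The pointwise estimate bounds the boundary orbit time by a lower limit of averages over thin
layers. Fatou moves the limit outside the integral, and by `exists_lintegral_orbitTime_le` each
layer contributes at most a multiple of `h`, which cancels the normalization. -/
theorem exists_lintegral_slope_orbitTime_le (hn : n ≠ 0) (hconv : S.StrictlyConvexBoundary)
    (hnt : S.NonTrapping) {e : ℝ} (he : |e| = 1) :
    ∃ C : ℝ≥0, ∀ O, IsOpen O → ∫⁻ q, ENNReal.ofReal (e * S.slope (c.point 0 q)) *
      Φ.orbitTime O (c.point 0 q) ∂c.coordMeasure ≤ C * S.bulk O := by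
  obtain ⟨C₁, hC₁⟩ := c.exists_lintegral_point_le hn
  obtain ⟨C₂, hC₂⟩ := Φ.exists_lintegral_orbitTime_le hn hconv hnt
  refine ⟨2 * (C₁ * C₂), fun O hO => ?_⟩
  have hG : ∀ h, Measurable ({z | z ∈ S.closedBundle ∧ e * h ∈ S.residence z}ᶜ.indicator
      (Φ.orbitTime O)) := fun h =>
    (Φ.measurable_orbitTime hnt hO.measurableSet).indicator (measurableSet_residence _).compl
  have hpt := c.continuous_point.measurable
  have hGp : ∀ h, Measurable fun p : (RSpace (n - 1) × sphere (0 : RSpace n) 1) × ℝ =>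
      {z | z ∈ S.closedBundle ∧ e * h ∈ S.residence z}ᶜ.indicator (Φ.orbitTime O)
        (c.point p.2 p.1) := fun h => (hG h).comp (hpt.comp measurable_swap)
  have hGi : ∀ h, Measurable fun q => ∫⁻ t in Ioo (-c.radius) 0,
      {z | z ∈ S.closedBundle ∧ e * h ∈ S.residence z}ᶜ.indicator (Φ.orbitTime O)
        (c.point t q) := fun h => (hGp h).lintegral_prod_right'
  calc _ ≤ ∫⁻ q, 2 * liminf (fun h => (ENNReal.ofReal h)⁻¹ * ∫⁻ t in Ioo (-c.radius) 0,
        {z | z ∈ S.closedBundle ∧ e * h ∈ S.residence z}ᶜ.indicator (Φ.orbitTime O)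
          (c.point t q)) (𝓝[>] (0 : ℝ)) ∂c.coordMeasure := by
        refine lintegral_mono_ae ?_
        filter_upwards [c.ae_coordMeasure] with q hq
        exact Φ.le_liminf_orbitTime c hconv hnt he hO hq
    _ ≤ 2 * liminf (fun h => ∫⁻ q, (ENNReal.ofReal h)⁻¹ * (∫⁻ t in Ioo (-c.radius) 0,
        {z | z ∈ S.closedBundle ∧ e * h ∈ S.residence z}ᶜ.indicator (Φ.orbitTime O)
          (c.point t q)) ∂c.coordMeasure) (𝓝[>] (0 : ℝ)) := by
        rw [lintegral_const_mul' _ _ (by simp)]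
        gcongr
        exact lintegral_liminf_le fun h => (hGi h).const_mul _
    _ ≤ 2 * (C₁ * C₂ * S.bulk O) := by
        gcongr
        refine liminf_le_of_frequently_le' (Eventually.frequently ?_)
        filter_upwards [self_mem_nhdsWithin] with h hh
        rw [mem_Ioi] at hh
        have hne : ENNReal.ofReal h ≠ 0 := by simpa using hh
        rw [lintegral_const_mul _ (hGi h), lintegral_lintegral_swap (hGp h).aemeasurable]
        calc _ ≤ (ENNReal.ofReal h)⁻¹ * (C₁ * (C₂ * ENNReal.ofReal h * S.bulk O)) := by
              gcongr
              exact (hC₁ _ (hG h)).trans (by gcongr; exact hC₂ e he h hh O hO.measurableSet)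
          _ = ((ENNReal.ofReal h)⁻¹ * ENNReal.ofReal h) * (C₁ * C₂ * S.bulk O) := by ring
          _ = _ := by rw [ENNReal.inv_mul_cancel hne ENNReal.ofReal_ne_top, one_mul]
    _ = _ := by push_cast; ring

/-- Compactness of the boundary reduces the estimate to finitely many charts, and constants add
under unions. -/
theorem exists_lintegral_boundarySet_le (hn : n ≠ 0) (hconv : S.StrictlyConvexBoundary)
    (hnt : S.NonTrapping) {e : ℝ} (he : |e| = 1) :
    ∃ C : ℝ≥0, ∀ O, IsOpen O →
      ∫⁻ z in Prod.fst ⁻¹' frontier S.Ω, (S.boundarySet e).indicator (Φ.orbitTime O) z ∂S.ξ ≤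
        C * S.bulk O := by
  refine isCompact_frontier.induction_on
    (p := fun s => ∃ C : ℝ≥0, ∀ O, IsOpen O →
      ∫⁻ z in Prod.fst ⁻¹' s, (S.boundarySet e).indicator (Φ.orbitTime O) z ∂S.ξ ≤
        C * S.bulk O) ⟨0, fun O _ => by simp⟩ ?_ ?_ ?_
  · rintro s t hst ⟨C, hC⟩
    exact ⟨C, fun O hO => (lintegral_mono_set (preimage_mono hst)).trans (hC O hO)⟩
  · rintro s t ⟨C, hC⟩ ⟨D, hD⟩
    refine ⟨C + D, fun O hO => ?_⟩
    rw [preimage_union]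
    refine (lintegral_union_le _ _ _).trans ?_
    push_cast
    rw [add_mul]
    exact add_le_add (hC O hO) (hD O hO)
  · intro x hx
    obtain ⟨c, hc⟩ := exists_boundaryChart hn (S.mem_frontier_iff.1 hx)
    obtain ⟨N, hNsub, hN, hxN⟩ := _root_.mem_nhds_iff.1 hc
    obtain ⟨C₁, hC₁⟩ := c.exists_lintegral_ξ_le
    obtain ⟨C₂, hC₂⟩ := Φ.exists_lintegral_slope_orbitTime_le c hn hconv hnt he
    refine ⟨N, mem_nhdsWithin_of_mem_nhds (hN.mem_nhds hxN), C₁ * C₂, fun O hO => ?_⟩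
    refine (hC₁ N hN.measurableSet (fun x hx => hNsub hx) _
      ((Φ.measurable_orbitTime hnt hO.measurableSet).indicator (measurableSet_boundarySet e))).trans ?_
    push_cast
    rw [mul_assoc]
    gcongr
    refine le_trans (lintegral_mono fun q => ?_) (hC₂ O hO)
    by_cases hq : c.point 0 q ∈ S.boundarySet e
    · rw [indicator_of_mem hq]
      have : |S.slope (c.point 0 q)| = e * S.slope (c.point 0 q) := by
        rw [← abs_of_pos hq.2, abs_mul, he, one_mul]
      rw [this]
    · rw [indicator_of_notMem hq, mul_zero]
      exact zero_le

/-- The estimate for open sets passes to Borel sets by outer regularity of the finite measure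
`bulk`. It is one half of Santaló's formula, with an unspecified constant. -/
theorem orbitBound_boundary (hn : n ≠ 0) (hconv : S.StrictlyConvexBoundary)
    (hnt : S.NonTrapping) {e : ℝ} (he : |e| = 1) : Φ.OrbitBound (S.ξ.restrict (S.boundarySet e)) := by
  obtain ⟨C, hC⟩ := Φ.exists_lintegral_boundarySet_le hn hconv hnt he
  refine ⟨C, ?_⟩
  have hopen : ∀ O, IsOpen O → Φ.orbitMeasure (S.ξ.restrict (S.boundarySet e)) O ≤ C * S.bulk O := by
    intro O hO
    rw [Φ.orbitMeasure_apply hnt _ hO.measurableSet, ← lintegral_indicator (measurableSet_boundarySet e)]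
    refine le_trans (le_of_eq ?_) (hC O hO)
    rw [← lintegral_indicator (measurable_fst isClosed_frontier.measurableSet)]
    refine lintegral_congr fun z => ?_
    rw [indicator_indicator]
    congr 1
    exact (inter_eq_right.2 fun z hz => hz.1.1).symm
  refine Measure.le_iff.2 fun A hA => ?_
  rw [Measure.smul_apply, ENNReal.smul_def, smul_eq_mul]
  refine ENNReal.le_of_forall_pos_le_add fun ε hε _ => ?_
  -- The denominator is `C + 1` because `C` may be zero.
  obtain ⟨O, hAO, hO, hlt⟩ := A.exists_isOpen_lt_add (μ := S.bulk) (measure_ne_top _ _)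
    (ε := ε / (C + 1)) (by
      refine (ENNReal.div_pos (by simpa using hε.ne') (by finiteness)).ne')
  calc _ ≤ C * S.bulk O := (measure_mono hAO).trans (hopen O hO)
    _ ≤ C * (S.bulk A + ε / (C + 1)) := by gcongr
    _ = C * S.bulk A + C * (ε / (C + 1)) := mul_add _ _ _
    _ ≤ C * S.bulk A + (C + 1) * (ε / (C + 1)) := by gcongr; exact le_self_add
    _ = _ := by
        congr 1
        exact ENNReal.mul_div_cancel (by simp) (by finiteness)

theorem orbitBound_ξOut (hn : n ≠ 0) (hconv : S.StrictlyConvexBoundary)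
    (hnt : S.NonTrapping) : Φ.OrbitBound S.ξOut := by
  rw [ξOut, outgoingSet_eq]
  exact Φ.orbitBound_boundary hn hconv hnt (by simp)

theorem orbitBound_ξIn (hn : n ≠ 0) (hconv : S.StrictlyConvexBoundary)
    (hnt : S.NonTrapping) : Φ.OrbitBound S.ξIn := by
  rw [ξIn, incomingSet_eq]
  exact Φ.orbitBound_boundary hn hconv hnt (by simp)

end CutoffFlow

end TransportSetting

/-! ### Null sets of entry points -/

namespace TransportSetting

open scoped NNReal ENNReal

variable {n : ℕ} {S : TransportSetting n}

/-- For `t < 0` the entry time is at most `t` exactly when the point is resident at time `t`, a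
closed condition. The indicator discards points outside the bundle, where nothing is known about the
infimum. -/
theorem measurable_indicator_entryTime (hnt : S.NonTrapping) :
    Measurable (S.closedBundle.indicator S.entryTime) := by
  have hcl := S.isCompact_closedBundle.isClosed.measurableSet
  refine measurable_of_Iic fun t => ?_
  rcases lt_or_ge t 0 with ht | ht
  · convert measurableSet_residence (S := S) t using 1
    ext z
    simp only [mem_preimage, mem_Iic, mem_ofPred_eq]
    by_cases hz : z ∈ S.closedBundle
    · rw [indicator_of_mem hz, residence_eq hnt hz]
      exact ⟨fun h => ⟨hz, h, ht.le.trans (exitTime_nonneg hnt hz)⟩, fun h => h.2.1⟩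
    · rw [indicator_of_notMem hz]
      exact ⟨fun h => absurd ht (not_lt.2 h), fun h => absurd h.1 hz⟩
  · convert MeasurableSet.univ (α := RSpace n × RSpace n) using 1
    refine eq_univ_of_forall fun z => ?_
    rw [mem_preimage, mem_Iic]
    by_cases hz : z ∈ S.closedBundle
    · rw [indicator_of_mem hz]
      exact (entryTime_le_zero hnt hz).trans ht
    · rw [indicator_of_notMem hz]
      exact ht

/-- A null set of incoming boundary points spans null cones over the boundary. -/
theorem prod_cone_eq_zero (hn : n ≠ 0) {N : Set (RSpace n × RSpace n)} (hN : MeasurableSet N)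
    (hsub : N ⊆ S.incomingSet) (h0 : S.ξ N = 0) :
    (((Measure.euclideanHausdorffMeasure (n - 1)).restrict (frontier S.Ω)).prod volume)
      (S.cone N) = 0 := by
  have hp := S.measurable_speed
  rw [ξ, withDensity_apply_eq_zero measurable_normal_inner] at h0
  -- The flux density does not vanish on incoming points, so a `ξ`-null set of them is null for the
  -- phase measure over the boundary.
  have h1 : {z : RSpace n × RSpace n | ENNReal.ofReal |inner ℝ (S.normal z.1) z.2| ≠ 0} ∩ N = N := by
    refine inter_eq_right.2 fun z hz => ?_
    have := (hsub hz).2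
    simpa using this.ne
  rw [h1, phaseMeasure_apply _ _ hN] at h0
  rw [S.prod_volume_cone hn _ hN]
  have hm : Measurable fun x => (volume : Measure (RSpace n)).toSphere
      {v | (x, S.speed x • (v : RSpace n)) ∈ N} :=
    measurable_measure_prodMk_left (S.measurable_scale hN)
  rw [lintegral_eq_zero_iff (by fun_prop)] at h0 ⊢
  filter_upwards [h0, ae_restrict_mem isClosed_frontier.measurableSet] with x hx hxf
  have hpos := S.speed_pos (frontier_subset_closure hxf)
  rw [Pi.zero_apply, mul_eq_zero] at hx ⊢
  right
  refine hx.resolve_left ?_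
  simpa using pow_pos hpos (n - 1)

/-- By Fubini almost every boundary point has a null section of the cone. Surface measure dominates
Lebesgue measure in the chart, so the same holds for almost every chart coordinate. -/
theorem BoundaryChart.volume_chart_cone_eq_zero (hn : n ≠ 0) (c : S.BoundaryChart)
    {N : Set (RSpace n × RSpace n)} (hN : MeasurableSet N)
    (hsub : N ⊆ S.incomingSet) (h0 : S.ξ N = 0) :
    volume {q : RSpace (n - 1) × RSpace n | q.1 ∈ ball (0 : RSpace (n - 1)) c.radius ∧
      (c (0, q.1), q.2) ∈ S.cone N} = 0 := by
  obtain ⟨C, hC⟩ := c.exists_le_surface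
  have hcone := S.measurableSet_cone hN
  have hc0 : Continuous fun y => c (0, y) := c.continuous.comp (by fun_prop)
  have h1 := Measure.measure_ae_null_of_prod_null (prod_cone_eq_zero hn hN hsub h0)
  rw [EventuallyEq, ae_iff, Measure.restrict_apply' isClosed_frontier.measurableSet] at h1
  have h2 := hC {x | ¬ volume (Prod.mk x ⁻¹' S.cone N) = (0 : RSpace n → ℝ≥0∞) x}
  rw [h1, mul_zero, nonpos_iff_eq_zero] at h2
  have hm : MeasurableSet {q : RSpace (n - 1) × RSpace n |
      q.1 ∈ ball (0 : RSpace (n - 1)) c.radius ∧ (c (0, q.1), q.2) ∈ S.cone N} :=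
    (measurable_fst measurableSet_ball).inter
      (((hc0.comp continuous_fst).prodMk continuous_snd).measurable hcone)
  rw [Measure.volume_eq_prod, Measure.measure_prod_null hm, EventuallyEq, ae_iff]
  refine measure_mono_null ?_ h2
  intro y hy
  have hyb : y ∈ ball (0 : RSpace (n - 1)) c.radius := by
    by_contra hcon
    apply hy
    have : Prod.mk y ⁻¹' {q : RSpace (n - 1) × RSpace n |
      q.1 ∈ ball (0 : RSpace (n - 1)) c.radius ∧ (c (0, q.1), q.2) ∈ S.cone N} = ∅ := by
      rw [eq_empty_iff_forall_notMem]
      exact fun η hη => hcon hη.1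
    rw [this, measure_empty]
    rfl
  refine ⟨hyb, fun h => hy ?_⟩
  refine measure_mono_null ?_ h
  exact fun η hη => hη.2

namespace CutoffFlow

variable (Φ : S.CutoffFlow)

theorem exists_lipschitzOnWith_chart_radialFlow (c : S.BoundaryChart)
    {N : Set (RSpace n × RSpace n)} (hsub : N ⊆ S.incomingSet) (T : ℝ) :
    ∃ K, LipschitzOnWith K (fun q : (RSpace (n - 1) × RSpace n) × ℝ =>
      Φ.radialFlow ((c (0, q.1.1), q.1.2), q.2))
      ({q : RSpace (n - 1) × RSpace n | q.1 ∈ ball (0 : RSpace (n - 1)) c.radius ∧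
      (c (0, q.1), q.2) ∈ S.cone N} ×ˢ Icc (-T) T) := by
  obtain ⟨K, hK⟩ := Φ.exists_lipschitzOnWith_radialFlow T
  have hc : LipschitzWith (c.lip * 1) fun y => c (0, y) :=
    c.lipschitz.comp (LipschitzWith.prodMk_left 0)
  have h1 : LipschitzWith (c.lip * 1 * (1 * 1)) fun q : (RSpace (n - 1) × RSpace n) × ℝ =>
      c (0, q.1.1) := hc.comp (LipschitzWith.prod_fst.comp LipschitzWith.prod_fst)
  have h2 : LipschitzWith (1 * 1) fun q : (RSpace (n - 1) × RSpace n) × ℝ => q.1.2 :=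
    LipschitzWith.prod_snd.comp LipschitzWith.prod_fst
  have h3 := (h1.prodMk h2).prodMk
    (LipschitzWith.prod_snd : LipschitzWith 1 fun q : (RSpace (n - 1) × RSpace n) × ℝ => q.2)
  exact exists_lipschitzOnWith_of_eqOn_comp hK h3.lipschitzOnWith
    (fun q hq => ⟨cone_subset_shell (hsub.trans incomingSet_subset) hq.1.2, hq.2⟩) fun q _ => rfl

/-- A point of the cone is recovered from its entry point by chart coordinates, velocity and travel
time, that is `(n-1) + n + 1 = 2n` parameters. This map is Lipschitz and the parameter set is a null
set times `[-T, T]`, so the image is null; compactness of the boundary reduces to one chart. -/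
theorem volume_cone_entry_eq_zero (hn : n ≠ 0) (hnt : S.NonTrapping)
    {N : Set (RSpace n × RSpace n)} (hN : MeasurableSet N)
    (hsub : N ⊆ S.incomingSet) (h0 : S.ξ N = 0) :
    volume (S.cone {z | z ∈ S.closedBundle ∧ Φ (S.entryTime z) z ∈ N}) = 0 := by
  obtain ⟨T, hT0, hT⟩ := exists_residence_bound hnt
  have hind : volume (S.cone {z | z ∈ S.closedBundle ∧ Φ (S.entryTime z) z ∈ N ∧
      (Φ (S.entryTime z) z).1 ∈ frontier S.Ω}) = 0 := by
    refine isCompact_frontier.induction_on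
      (p := fun s => volume (S.cone {z | z ∈ S.closedBundle ∧ Φ (S.entryTime z) z ∈ N ∧
        (Φ (S.entryTime z) z).1 ∈ s}) = 0) ?_ ?_ ?_ ?_
    · convert measure_empty (μ := (volume : Measure (RSpace n × RSpace n)))
      rw [eq_empty_iff_forall_notMem]
      exact fun z hz => hz.2.2.2.2
    · intro s t hst ht
      refine measure_mono_null ?_ ht
      rintro z ⟨h1, h2, h3, h4, h5⟩
      exact ⟨h1, h2, h3, h4, hst h5⟩
    · intro s t hs ht
      refine measure_mono_null ?_ (measure_union_null hs ht)
      rintro z ⟨h1, h2, h3, h4, h5 | h5⟩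
      · exact Or.inl ⟨h1, h2, h3, h4, h5⟩
      · exact Or.inr ⟨h1, h2, h3, h4, h5⟩
    · intro x hx
      obtain ⟨c, hc⟩ := exists_boundaryChart hn (S.mem_frontier_iff.1 hx)
      refine ⟨_, mem_nhdsWithin_of_mem_nhds hc, ?_⟩
      obtain ⟨K, hK⟩ := Φ.exists_lipschitzOnWith_chart_radialFlow c hsub T
      have i1 : (volume : Measure (RSpace n × RSpace n)).IsAddHaarMeasure := by
        rw [Measure.volume_eq_prod]; infer_instance
      have i2 : (volume : Measure (RSpace (n - 1) × RSpace n)).IsAddHaarMeasure := by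
        rw [Measure.volume_eq_prod]; infer_instance
      have i3 : ((volume : Measure (RSpace (n - 1) × RSpace n)).prod
          (volume : Measure ℝ)).IsAddHaarMeasure := Measure.prod.instIsAddHaarMeasure _ _
      have hd : Module.finrank ℝ ((RSpace (n - 1) × RSpace n) × ℝ) =
          Module.finrank ℝ (RSpace n × RSpace n) := by
        simp only [Module.finrank_prod, finrank_euclideanSpace_fin, Module.finrank_self]
        omega
      obtain ⟨C, hC⟩ := exists_measure_image_le_of_lipschitzOnWith
        ((volume : Measure (RSpace (n - 1) × RSpace n)).prod (volume : Measure ℝ))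
        (volume : Measure (RSpace n × RSpace n)) hd K
      have h1 := hC _ _ hK
      rw [Measure.prod_prod, c.volume_chart_cone_eq_zero hn hN hsub h0, zero_mul, mul_zero,
        nonpos_iff_eq_zero] at h1
      refine measure_mono_null ?_ h1
      intro z hz
      have hzb : S.toBundle z ∈ {z | z ∈ S.closedBundle ∧ Φ (S.entryTime z) z ∈ N ∧
        (Φ (S.entryTime z) z).1 ∈ {x | S.ρ x = 0 →
          ∃ y ∈ ball (0 : RSpace (n - 1)) c.radius, c (0, y) = x}} := hz.2.2
      have hr : S.entryTime (S.toBundle z) ∈ S.residence (S.toBundle z) := by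
        rw [residence_eq hnt hzb.1]
        exact left_mem_Icc.2 ((entryTime_le_zero hnt hzb.1).trans (exitTime_nonneg hnt hzb.1))
      have hs1 : {z | z ∈ S.closedBundle ∧ Φ (S.entryTime z) z ∈ N ∧
        (Φ (S.entryTime z) z).1 ∈ {x | S.ρ x = 0 →
          ∃ y ∈ ball (0 : RSpace (n - 1)) c.radius, c (0, y) = x}} ⊆ S.closedBundle :=
        fun z hz => hz.1
      have hs2 : N ⊆ S.closedBundle := hsub.trans incomingSet_subset
      have hshell := cone_subset_shell hs1 hz
      have hcone := Φ.radialFlow_mem_cone hs1 hs2 hz hzb.2.1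
      obtain ⟨y, hy, hyx⟩ := hzb.2.2 (S.mem_frontier_iff.1 (hsub hzb.2.1).1.1)
      have hw : (c (0, y), (Φ.radialFlow (z, S.entryTime (S.toBundle z))).2) =
          Φ.radialFlow (z, S.entryTime (S.toBundle z)) := Prod.ext hyx rfl
      refine ⟨((y, (Φ.radialFlow (z, S.entryTime (S.toBundle z))).2),
        -S.entryTime (S.toBundle z)), ⟨⟨hy, ?_⟩, ?_⟩, ?_⟩
      · simp only [hw]
        exact hcone
      · have := hT _ hzb.1 _ hr
        rw [abs_le] at this
        constructor <;> linarith [this.1, this.2]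
      · simp only [hw]
        exact Φ.radialFlow_neg hshell (hs2 hzb.2.1)
  refine measure_mono_null ?_ hind
  exact fun z hz => ⟨hz.1, hz.2.1, hz.2.2.1, hz.2.2.2, (hsub hz.2.2.2).1.1⟩

/-- A property of almost every incoming boundary point holds at the entry point of almost every
trajectory. -/
theorem ae_entry (hn : n ≠ 0) (hconv : S.StrictlyConvexBoundary) (hnt : S.NonTrapping)
    {p : RSpace n × RSpace n → Prop} (hp : ∀ᵐ z ∂S.ξIn, p z) :
    ∀ᵐ z ∂S.bulk, p (Φ (S.entryTime z) z) := by
  have hinc : MeasurableSet S.incomingSet := by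
    rw [incomingSet_eq]; exact measurableSet_boundarySet _
  rw [ae_iff, ← measure_toMeasurable] at hp
  set N := toMeasurable S.ξIn {z | ¬ p z} ∩ S.incomingSet with hNdef
  have hN : MeasurableSet N := (measurableSet_toMeasurable _ _).inter hinc
  have h0 : S.ξ N = 0 := by
    rw [ξIn, Measure.restrict_apply (measurableSet_toMeasurable _ _)] at hp
    exact hp
  have h1 := Φ.volume_cone_entry_eq_zero hn hnt hN inter_subset_right h0
  obtain ⟨C, hC⟩ := exists_bulk_le_volume_cone hn S
  have hm : MeasurableSet {z | z ∈ S.closedBundle ∧ Φ (S.entryTime z) z ∈ N} := by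
    have h2 : {z | z ∈ S.closedBundle ∧ Φ (S.entryTime z) z ∈ N} = S.closedBundle ∩
        (fun z => Φ (S.closedBundle.indicator S.entryTime z) z) ⁻¹' N := by
      ext z
      refine and_congr_right fun hz => ?_
      rw [mem_preimage, indicator_of_mem hz]
    rw [h2]
    exact S.isCompact_closedBundle.isClosed.measurableSet.inter
      ((Φ.continuous_uncurry.measurable.comp
        ((measurable_indicator_entryTime hnt).prodMk measurable_id)) hN)
  have h3 := hC _ hm
  rw [h1, mul_zero, nonpos_iff_eq_zero, measure_eq_zero_iff_ae_notMem] at h3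
  filter_upwards [h3, ae_mem_bundle (S := S)] with z hz hzb
  by_contra hcon
  obtain ⟨h4, h5⟩ := entryTime_neg_exitTime_pos hnt hzb
  exact hz ⟨bundle_Ω_subset hzb, subset_toMeasurable _ _ hcon,
    Φ.map_entryTime_mem hconv hnt (bundle_Ω_subset hzb) (h4.trans h5)⟩

end CutoffFlow

end TransportSetting

/-! ### Weighted Cauchy–Schwarz inequalities -/

section WeightedCauchySchwarz

open scoped ENNReal

variable {X : Type*} [MeasurableSpace X] {ν : Measure X}

theorem lintegral_sq_le {a : X → ℝ≥0∞} (ha : AEMeasurable a ν) :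
    (∫⁻ x, a x ∂ν) ^ 2 ≤ ν univ * ∫⁻ x, a x ^ 2 ∂ν := by
  have h := ENNReal.lintegral_mul_le_Lp_mul_Lq ν Real.HolderConjugate.two_two ha
    (aemeasurable_const (b := (1 : ℝ≥0∞)))
  simp only [Pi.mul_apply, mul_one, ENNReal.one_rpow, lintegral_one] at h
  calc _ ≤ ((∫⁻ x, a x ^ (2 : ℝ) ∂ν) ^ (1 / 2 : ℝ) * ν univ ^ (1 / 2 : ℝ)) ^ 2 := by gcongr
    _ = _ := by
        rw [mul_pow, ← ENNReal.rpow_natCast, ← ENNReal.rpow_natCast, ← ENNReal.rpow_mul,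
          ← ENNReal.rpow_mul]
        norm_num
        rw [mul_comm]

theorem lintegral_mul_sq_le {w a : X → ℝ≥0∞} (hw : Measurable w) (ha : Measurable a) :
    (∫⁻ x, w x * a x ∂ν) ^ 2 ≤ (∫⁻ x, w x ∂ν) * ∫⁻ x, w x * a x ^ 2 ∂ν := by
  have h := lintegral_sq_le (ν := ν.withDensity w) ha.aemeasurable
  rw [lintegral_withDensity_eq_lintegral_mul _ hw ha,
    lintegral_withDensity_eq_lintegral_mul _ hw (ha.pow_const 2),
    withDensity_apply _ MeasurableSet.univ, Measure.restrict_univ] at h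
  exact h

end WeightedCauchySchwarz

namespace TransportSetting

open scoped NNReal ENNReal

variable {n : ℕ} {S : TransportSetting n} {𝕜 : Type*} [RCLike 𝕜]

namespace CutoffFlow

variable (Φ : S.CutoffFlow) {κ : Measure (RSpace n × RSpace n)}

/-! ### Integration along trajectories -/

/-- A property of almost every phase point holds along almost every trajectory. -/
theorem OrbitBound.ae_orbit (h : Φ.OrbitBound κ) (hnt : S.NonTrapping)
    {p : RSpace n × RSpace n → Prop}
    (hp : ∀ᵐ z ∂S.bulk, p z) : ∀ᵐ z ∂κ, ∀ᵐ s : ℝ, (z, s) ∈ S.orbitDomain → p (Φ s z) := by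
  obtain ⟨C, hC⟩ := h
  have h1 : ∀ᵐ z ∂Φ.orbitMeasure κ, p z :=
    (Measure.absolutelyContinuous_of_le_smul hC).ae_le hp
  have h2 := ae_of_ae_map Φ.measurable_flow_swap.aemeasurable h1
  rw [ae_restrict_iff' (measurableSet_orbitDomain hnt)] at h2
  exact Measure.ae_ae_of_ae_prod h2

/-- The integrand along a trajectory, with a weight in the time variable. -/
noncomputable def orbitTerm (w : ℝ → ℝ) (g : RSpace n × RSpace n → 𝕜)
    (q : (RSpace n × RSpace n) × ℝ) : 𝕜 :=
  S.orbitDomain.indicator (fun q => w q.2 • g (Φ q.2 q.1)) q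

/-- The integral along the trajectory of a point, with a weight in the time variable. -/
noncomputable def orbitIntegral (w : ℝ → ℝ) (g : RSpace n × RSpace n → 𝕜)
    (z : RSpace n × RSpace n) : 𝕜 := ∫ s, Φ.orbitTerm w g (z, s)

variable {w : ℝ → ℝ} {g g' : RSpace n × RSpace n → 𝕜}

theorem stronglyMeasurable_orbitTerm (hnt : S.NonTrapping) (hw : Measurable w)
    (hg : StronglyMeasurable g) : StronglyMeasurable (Φ.orbitTerm w g) :=
  ((hw.comp measurable_snd).stronglyMeasurable.smul
    (hg.comp_measurable Φ.measurable_flow_swap)).indicator (measurableSet_orbitDomain hnt)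

theorem stronglyMeasurable_orbitIntegral (hnt : S.NonTrapping) (hw : Measurable w)
    (hg : StronglyMeasurable g) : StronglyMeasurable (Φ.orbitIntegral w g) :=
  (Φ.stronglyMeasurable_orbitTerm hnt hw hg).integral_prod_right'

/-- A null set of phase points meets almost every trajectory in a null set of times. Orbit integrals
therefore act on L² classes, also at boundary points, where `κ` and `bulk` are unrelated as
measures. -/
theorem orbitIntegral_congr (hΦ : Φ.OrbitBound κ) (hnt : S.NonTrapping) (h : g =ᵐ[S.bulk] g') :
    Φ.orbitIntegral w g =ᵐ[κ] Φ.orbitIntegral w g' := by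
  filter_upwards [OrbitBound.ae_orbit Φ hΦ hnt h] with z hz
  refine integral_congr_ae ?_
  filter_upwards [hz] with s hs
  by_cases hD : (z, s) ∈ S.orbitDomain
  · simp only [orbitTerm, indicator_of_mem hD, hs hD]
  · simp only [orbitTerm, indicator_of_notMem hD]

theorem lintegral_orbit_le {C : ℝ≥0} (hC : Φ.orbitMeasure κ ≤ C • S.bulk) (hnt : S.NonTrapping)
    {g : RSpace n × RSpace n → ℝ≥0∞} (hg : Measurable g) :
    ∫⁻ z, (∫⁻ s : ℝ, S.orbitDomain.indicator (fun q => g (Φ q.2 q.1)) (z, s)) ∂κ ≤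
      C * ∫⁻ z, g z ∂S.bulk := by
  rw [← Φ.lintegral_orbitMeasure hnt κ hg]
  refine (lintegral_mono' hC le_rfl).trans_eq ?_
  rw [lintegral_smul_measure]
  rfl

/-- A square integrable function is square integrable along almost every trajectory. -/
theorem OrbitBound.ae_memLp (hΦ : Φ.OrbitBound κ) (hnt : S.NonTrapping)
    (hg : MemLp g 2 S.bulk) :
    ∀ᵐ z ∂κ, MemLp (fun s : ℝ => S.orbitDomain.indicator (fun q => g (Φ q.2 q.1)) (z, s)) 2
      (volume.restrict {s : ℝ | (z, s) ∈ S.orbitDomain}) := by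
  obtain ⟨g₀, hg₀, hgg⟩ := hg.1
  have hg₀m : MemLp g₀ 2 S.bulk := hg.ae_eq hgg
  obtain ⟨C, hC⟩ := id hΦ
  have hm : Measurable fun z => ‖g₀ z‖ₑ ^ 2 := hg₀.measurable.enorm.pow_const 2
  have h1 := Φ.lintegral_orbit_le hC hnt hm
  rw [← eLpNorm_two_sq] at h1
  have h2 : ∫⁻ z, (∫⁻ s : ℝ, S.orbitDomain.indicator (fun q => ‖g₀ (Φ q.2 q.1)‖ₑ ^ 2) (z, s)) ∂κ
      ≠ ⊤ := by
    refine ne_top_of_le_ne_top ?_ h1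
    have := hg₀m.2.ne
    finiteness
  have hm2 : Measurable (S.orbitDomain.indicator fun q => ‖g₀ (Φ q.2 q.1)‖ₑ ^ 2) :=
    (hm.comp Φ.measurable_flow_swap).indicator (measurableSet_orbitDomain hnt)
  filter_upwards [ae_lt_top hm2.lintegral_prod_right' h2, OrbitBound.ae_orbit Φ hΦ hnt hgg]
    with z hz hgz
  have h3 : MemLp (fun s : ℝ => S.orbitDomain.indicator (fun q => g₀ (Φ q.2 q.1)) (z, s)) 2
      (volume.restrict {s : ℝ | (z, s) ∈ S.orbitDomain}) := by
    refine ⟨(((hg₀.comp_measurable Φ.measurable_flow_swap).indicator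
      (measurableSet_orbitDomain hnt)).comp_measurable measurable_prodMk_left).aestronglyMeasurable, ?_⟩
    refine (ENNReal.pow_lt_top_iff.1 (lt_of_le_of_lt ?_ hz)).resolve_right (two_ne_zero)
    rw [eLpNorm_two_sq]
    refine (lintegral_mono' Measure.restrict_le_self le_rfl).trans (lintegral_mono fun s => ?_)
    by_cases hD : (z, s) ∈ S.orbitDomain
    · simp only [indicator_of_mem hD]; exact le_rfl
    · simp only [indicator_of_notMem hD]; simp
  refine h3.ae_eq ?_
  filter_upwards [ae_restrict_of_ae hgz] with s hs
  by_cases hD : (z, s) ∈ S.orbitDomain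
  · simp only [indicator_of_mem hD, hs hD]
  · simp only [indicator_of_notMem hD]

theorem volume_orbit_section_lt_top (z : RSpace n × RSpace n) :
    volume {s : ℝ | (z, s) ∈ S.orbitDomain} < ⊤ := by
  refine (measure_mono (t := Ioo (S.entryTime z) (S.exitTime z)) fun s hs => hs.2).trans_lt ?_
  rw [Real.volume_Ioo]
  exact ENNReal.ofReal_lt_top

theorem OrbitBound.ae_integrable (hΦ : Φ.OrbitBound κ) (hnt : S.NonTrapping)
    (hg : MemLp g 2 S.bulk) :
    ∀ᵐ z ∂κ, Integrable fun s : ℝ => S.orbitDomain.indicator (fun q => g (Φ q.2 q.1)) (z, s) := by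
  filter_upwards [OrbitBound.ae_memLp Φ hΦ hnt hg] with z hz
  have : IsFiniteMeasure (volume.restrict {s : ℝ | (z, s) ∈ S.orbitDomain}) :=
    ⟨by rw [Measure.restrict_apply_univ]; exact volume_orbit_section_lt_top z⟩
  have h1 : IntegrableOn _ {s : ℝ | (z, s) ∈ S.orbitDomain} := hz.integrable one_le_two
  refine (integrableOn_iff_integrable_of_support_subset ?_).1 h1
  intro s hs
  by_contra hcon
  exact hs (indicator_of_notMem (s := S.orbitDomain) (a := (z, s)) hcon _)

/-- A bounded measurable nonnegative weight. -/
structure IsWeight (w : ℝ → ℝ) : Prop where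
  measurable : Measurable w
  nonneg : ∀ s, 0 ≤ w s
  bounded : ∃ M, ∀ s, w s ≤ M

theorem OrbitBound.ae_integrable_orbitTerm (hΦ : Φ.OrbitBound κ) (hnt : S.NonTrapping)
    (hw : IsWeight w) (hg : MemLp g 2 S.bulk) :
    ∀ᵐ z ∂κ, Integrable fun s : ℝ => Φ.orbitTerm w g (z, s) := by
  obtain ⟨M, hM⟩ := hw.bounded
  filter_upwards [OrbitBound.ae_integrable Φ hΦ hnt hg] with z hz
  have h1 := hz.bdd_smul (φ := w) M hw.measurable.aestronglyMeasurable
    (Eventually.of_forall fun s => by rw [Real.norm_of_nonneg (hw.nonneg s)]; exact hM s)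
  refine h1.congr (Eventually.of_forall fun s => ?_)
  simp only [orbitTerm, Pi.smul_apply']
  by_cases hD : (z, s) ∈ S.orbitDomain
  · simp only [indicator_of_mem hD]
  · simp only [indicator_of_notMem hD, smul_zero]

theorem enorm_orbitTerm (hw : IsWeight w) (q : (RSpace n × RSpace n) × ℝ) :
    ‖Φ.orbitTerm w g q‖ₑ = ENNReal.ofReal (w q.2) *
      S.orbitDomain.indicator (fun q => ‖g (Φ q.2 q.1)‖ₑ) q := by
  rw [orbitTerm]
  by_cases hD : q ∈ S.orbitDomain
  · rw [indicator_of_mem hD, indicator_of_mem hD, enorm_smul, Real.enorm_eq_ofReal (hw.nonneg _)]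
  · rw [indicator_of_notMem hD, indicator_of_notMem hD, enorm_zero, mul_zero]

theorem enorm_orbitIntegral_sq_le (hnt : S.NonTrapping) (hw : IsWeight w)
    (hg : StronglyMeasurable g) (z : RSpace n × RSpace n) :
    ‖Φ.orbitIntegral w g z‖ₑ ^ 2 ≤ (∫⁻ s, ENNReal.ofReal (w s)) *
      ∫⁻ s, ENNReal.ofReal (w s) *
        S.orbitDomain.indicator (fun q => ‖g (Φ q.2 q.1)‖ₑ ^ 2) (z, s) := by
  have h1 : ‖Φ.orbitIntegral w g z‖ₑ ≤ ∫⁻ s, ENNReal.ofReal (w s) *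
      S.orbitDomain.indicator (fun q => ‖g (Φ q.2 q.1)‖ₑ) (z, s) := by
    refine (enorm_integral_le_lintegral_enorm _).trans_eq ?_
    simp only [Φ.enorm_orbitTerm hw]
  have h2 : Measurable fun s => S.orbitDomain.indicator (fun q => ‖g (Φ q.2 q.1)‖ₑ) (z, s) :=
    ((hg.measurable.enorm.comp Φ.measurable_flow_swap).indicator
      (measurableSet_orbitDomain hnt)).comp measurable_prodMk_left
  refine (pow_le_pow_left' h1 2).trans ((lintegral_mul_sq_le hw.measurable.ennreal_ofReal h2).trans_eq ?_)
  congr 1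
  refine lintegral_congr fun s => ?_
  by_cases hD : (z, s) ∈ S.orbitDomain
  · simp only [indicator_of_mem hD]
  · simp only [indicator_of_notMem hD]; simp

theorem orbitIntegral_add (hΦ : Φ.OrbitBound κ) (hnt : S.NonTrapping) (hw : IsWeight w)
    (u v : Lp 𝕜 2 S.bulk) :
    Φ.orbitIntegral w ⇑(u + v) =ᵐ[κ] Φ.orbitIntegral w u + Φ.orbitIntegral w v := by
  filter_upwards [Φ.orbitIntegral_congr (w := w) hΦ hnt (Lp.coeFn_add u v),
    OrbitBound.ae_integrable_orbitTerm Φ hΦ hnt hw (Lp.memLp u),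
    OrbitBound.ae_integrable_orbitTerm Φ hΦ hnt hw (Lp.memLp v)] with z h1 h2 h3
  rw [h1, Pi.add_apply, orbitIntegral, orbitIntegral, orbitIntegral, ← integral_add h2 h3]
  refine integral_congr_ae (Eventually.of_forall fun s => ?_)
  simp only [orbitTerm]
  by_cases hD : (z, s) ∈ S.orbitDomain
  · simp only [indicator_of_mem hD, Pi.add_apply, smul_add]
  · simp only [indicator_of_notMem hD, add_zero]

theorem orbitIntegral_smul (hΦ : Φ.OrbitBound κ) (hnt : S.NonTrapping) (a : 𝕜)
    (u : Lp 𝕜 2 S.bulk) :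
    Φ.orbitIntegral w ⇑(a • u) =ᵐ[κ] a • Φ.orbitIntegral w u := by
  filter_upwards [Φ.orbitIntegral_congr (w := w) hΦ hnt (Lp.coeFn_smul a u)] with z h1
  rw [h1, Pi.smul_apply, orbitIntegral, orbitIntegral, ← integral_smul]
  refine integral_congr_ae (Eventually.of_forall fun s => ?_)
  simp only [orbitTerm]
  by_cases hD : (z, s) ∈ S.orbitDomain
  · simp only [indicator_of_mem hD, Pi.smul_apply]
    rw [smul_comm]
  · simp only [indicator_of_notMem hD, smul_zero]

/-- Integration along trajectories as an operator on `L²` of the bundle. -/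
theorem exists_orbitOp (hn : n ≠ 0) (hconv : S.StrictlyConvexBoundary) (hnt : S.NonTrapping) :
    ∃ C : ℝ, 0 ≤ C ∧ ∀ w : ℝ → ℝ, IsWeight w → Integrable w →
      ∃ R : Lp 𝕜 2 S.bulk →L[𝕜] Lp 𝕜 2 S.bulk,
        (∀ u, R u =ᵐ[S.bulk] Φ.orbitIntegral w u) ∧ ‖R‖ ≤ C * ∫ s, w s := by
  obtain ⟨C, hC⟩ := Φ.exists_bulk_preimage_le hn hconv hnt
  have hOB := Φ.orbitBound_bulk hn hconv hnt
  refine ⟨Real.sqrt C, Real.sqrt_nonneg _, fun w hw hwi => ?_⟩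
  have hW : 0 ≤ ∫ s, w s := integral_nonneg hw.nonneg
  have hWe : ∫⁻ s, ENNReal.ofReal (w s) = ENNReal.ofReal (∫ s, w s) :=
    (ofReal_integral_eq_lintegral_ofReal hwi (Eventually.of_forall hw.nonneg)).symm
  refine exists_clm_of_eLpNorm_le (fun u => Φ.orbitIntegral w u)
    (fun u => (Φ.stronglyMeasurable_orbitIntegral hnt hw.measurable
      (Lp.stronglyMeasurable u)).aestronglyMeasurable) ?_ ?_ (by positivity) ?_
  · exact fun u v => Φ.orbitIntegral_add hOB hnt hw u v
  · exact fun a u => Φ.orbitIntegral_smul hOB hnt a u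
  · intro u
    have hu := Lp.stronglyMeasurable u
    rw [← ENNReal.pow_le_pow_left_iff two_ne_zero, eLpNorm_two_sq, mul_pow, eLpNorm_two_sq]
    have hm : Measurable fun z => ‖u z‖ₑ ^ 2 := hu.measurable.enorm.pow_const 2
    have hm2 : Measurable fun q : (RSpace n × RSpace n) × ℝ => ENNReal.ofReal (w q.2) *
        S.orbitDomain.indicator (fun q => ‖u (Φ q.2 q.1)‖ₑ ^ 2) q :=
      (hw.measurable.ennreal_ofReal.comp measurable_snd).mul
        ((hm.comp Φ.measurable_flow_swap).indicator (measurableSet_orbitDomain hnt))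
    -- Cauchy–Schwarz with weight `w`, Fubini and the bound for the flow at each fixed time give `C
    -- (∫ w)²`. Linearity of the operator norm in `∫ w` is used for short windows and for damped
    -- weights.
    calc _ ≤ ∫⁻ z, (∫⁻ s, ENNReal.ofReal (w s)) * (∫⁻ s, ENNReal.ofReal (w s) *
          S.orbitDomain.indicator (fun q => ‖u (Φ q.2 q.1)‖ₑ ^ 2) (z, s)) ∂S.bulk :=
          lintegral_mono fun z => Φ.enorm_orbitIntegral_sq_le hnt hw hu z
      _ = (∫⁻ s, ENNReal.ofReal (w s)) * ∫⁻ s, ENNReal.ofReal (w s) *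
          ∫⁻ z, S.orbitDomain.indicator (fun q => ‖u (Φ q.2 q.1)‖ₑ ^ 2) (z, s) ∂S.bulk := by
          rw [lintegral_const_mul _ hm2.lintegral_prod_right', lintegral_lintegral_swap hm2.aemeasurable]
          congr 1
          refine lintegral_congr fun s => ?_
          exact lintegral_const_mul' (ENNReal.ofReal (w s)) _ ENNReal.ofReal_ne_top
      _ ≤ (∫⁻ s, ENNReal.ofReal (w s)) * ∫⁻ s, ENNReal.ofReal (w s) *
          (C * ∫⁻ z, ‖u z‖ₑ ^ 2 ∂S.bulk) := by
          gcongr with s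
          exact Φ.lintegral_preimage_le hnt (hC s) hm
      _ = _ := by
          rw [lintegral_mul_const _ hw.measurable.ennreal_ofReal, hWe,
            ENNReal.ofReal_mul (Real.sqrt_nonneg _), mul_pow, ← ENNReal.ofReal_pow (Real.sqrt_nonneg _),
            Real.sq_sqrt (NNReal.coe_nonneg C), ENNReal.ofReal_coe_nnreal]
          ring

/-- Integration along trajectories, with values in `L²` of a set of end points. -/
theorem exists_orbitOp_of_orbitBound (hΦ : Φ.OrbitBound κ) (hnt : S.NonTrapping)
    (hw : IsWeight w) (hwi : Integrable w) :
      ∃ R : Lp 𝕜 2 S.bulk →L[𝕜] Lp 𝕜 2 κ, ∀ u, R u =ᵐ[κ] Φ.orbitIntegral w u := by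
  obtain ⟨C, hC⟩ := id hΦ
  obtain ⟨M, hM⟩ := hw.bounded
  have hM0 : 0 ≤ M := (hw.nonneg 0).trans (hM 0)
  have hW : 0 ≤ ∫ s, w s := integral_nonneg hw.nonneg
  have hWe : ∫⁻ s, ENNReal.ofReal (w s) = ENNReal.ofReal (∫ s, w s) :=
    (ofReal_integral_eq_lintegral_ofReal hwi (Eventually.of_forall hw.nonneg)).symm
  refine (exists_clm_of_eLpNorm_le (ν := κ) (C := Real.sqrt ((∫ s, w s) * (M * C)))
    (fun u : Lp 𝕜 2 S.bulk => Φ.orbitIntegral w u)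
    (fun u => (Φ.stronglyMeasurable_orbitIntegral hnt hw.measurable
      (Lp.stronglyMeasurable u)).aestronglyMeasurable) (fun u v => Φ.orbitIntegral_add hΦ hnt hw u v)
    (fun a u => Φ.orbitIntegral_smul hΦ hnt a u)
    (Real.sqrt_nonneg _) (fun u => ?_)).imp fun R hR => hR.1
  have hu := Lp.stronglyMeasurable u
  rw [← ENNReal.pow_le_pow_left_iff two_ne_zero, eLpNorm_two_sq, mul_pow, eLpNorm_two_sq]
  have hm : Measurable fun z => ‖u z‖ₑ ^ 2 := hu.measurable.enorm.pow_const 2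
  have hm2 : Measurable (S.orbitDomain.indicator fun q => ‖u (Φ q.2 q.1)‖ₑ ^ 2) :=
    (hm.comp Φ.measurable_flow_swap).indicator (measurableSet_orbitDomain hnt)
  -- Over `κ` only the time-integrated bound is available, so one factor of the weight is replaced
  -- by its supremum `M`.
  calc _ ≤ ∫⁻ z, (∫⁻ s, ENNReal.ofReal (w s)) * (ENNReal.ofReal M * (∫⁻ s,
        S.orbitDomain.indicator (fun q => ‖u (Φ q.2 q.1)‖ₑ ^ 2) (z, s))) ∂κ := by
        refine lintegral_mono fun z => (Φ.enorm_orbitIntegral_sq_le hnt hw hu z).trans ?_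
        rw [← lintegral_const_mul' _ _ ENNReal.ofReal_ne_top]
        gcongr with s
        exact hM s
    _ ≤ (∫⁻ s, ENNReal.ofReal (w s)) * (ENNReal.ofReal M * (C * ∫⁻ z, ‖u z‖ₑ ^ 2 ∂S.bulk)) := by
        rw [lintegral_const_mul _ (hm2.lintegral_prod_right'.const_mul _),
          lintegral_const_mul _ hm2.lintegral_prod_right']
        gcongr
        exact Φ.lintegral_orbit_le hC hnt hm
    _ = _ := by
        rw [hWe, ← ENNReal.ofReal_pow (Real.sqrt_nonneg _), Real.sq_sqrt (by positivity),
          ENNReal.ofReal_mul hW, ENNReal.ofReal_mul hM0, ENNReal.ofReal_coe_nnreal]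
        ring

end CutoffFlow

end TransportSetting

/-! ### Coefficients extended by zero -/

section ExtendByZero

variable {X R : Type*} [Zero R] {s : Set X} (c : s → R)

theorem extendByZero_of_mem {x : X} (hx : x ∈ s) : extendByZero c x = c ⟨x, hx⟩ :=
  Subtype.val_injective.extend_apply c 0 ⟨x, hx⟩

theorem extendByZero_of_notMem {x : X} (hx : x ∉ s) : extendByZero c x = 0 := by
  refine Function.extend_apply' _ _ _ ?_
  rintro ⟨y, rfl⟩
  exact hx y.2

theorem measurable_extendByZero [TopologicalSpace X] [MeasurableSpace X] [BorelSpace X]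
    [TopologicalSpace R] [MeasurableSpace R] [BorelSpace R] (hs : IsClosed s) {c : s → R}
    (hc : Continuous c) : Measurable (extendByZero c) :=
  (MeasurableEmbedding.subtype_coe hs.measurableSet).measurable_extend hc.measurable
    measurable_const

end ExtendByZero

theorem norm_extendByZero_le {X E : Type*} [TopologicalSpace X] [NormedAddCommGroup E] {s : Set X}
    [CompactSpace s] (c : C(s, E)) (x : X) : ‖extendByZero c x‖ ≤ ‖c‖ := by
  by_cases hx : x ∈ s
  · rw [extendByZero_of_mem _ hx]; exact c.norm_coe_le_norm _
  · rw [extendByZero_of_notMem _ hx, norm_zero]; exact norm_nonneg _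

theorem extendByZero_add {X E : Type*} [TopologicalSpace X] [NormedAddCommGroup E] {s : Set X}
    (c d : C(s, E)) (x : X) : extendByZero (c + d) x = extendByZero c x + extendByZero d x := by
  by_cases hx : x ∈ s
  · simp only [extendByZero_of_mem _ hx]; rfl
  · simp only [extendByZero_of_notMem _ hx, add_zero]

theorem extendByZero_smul {X 𝕜 : Type*} [TopologicalSpace X] [RCLike 𝕜] {s : Set X} (a : 𝕜)
    (c : C(s, 𝕜)) (x : X) : extendByZero (a • c) x = a * extendByZero c x := by
  by_cases hx : x ∈ s
  · simp only [extendByZero_of_mem _ hx]; rfl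
  · simp only [extendByZero_of_notMem _ hx, mul_zero]

namespace TransportSetting

open scoped NNReal ENNReal

variable {n : ℕ} {S : TransportSetting n} {𝕜 : Type*} [RCLike 𝕜]

instance compactSpace_closedBundle : CompactSpace S.closedBundle :=
  isCompact_iff_compactSpace.1 S.isCompact_closedBundle

theorem isClosed_closedBundle₂ : IsClosed S.closedBundle₂ :=
  (S.isCompact_closedBundle.isClosed.preimage (by fun_prop :
    Continuous fun q : RSpace n × RSpace n × RSpace n => (q.1, q.2.1))).inter
  (S.isCompact_closedBundle.isClosed.preimage (by fun_prop :
    Continuous fun q : RSpace n × RSpace n × RSpace n => (q.1, q.2.2)))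

instance compactSpace_closedBundle₂ : CompactSpace S.closedBundle₂ := by
  refine isCompact_iff_compactSpace.1 (IsCompact.of_isClosed_subset
    ((S.isCompact_closedBundle.image continuous_fst).prod
      ((S.isCompact_closedBundle.image continuous_snd).prod
        (S.isCompact_closedBundle.image continuous_snd))) isClosed_closedBundle₂ ?_)
  exact fun q hq => ⟨⟨_, hq.1, rfl⟩, ⟨_, hq.1, rfl⟩, ⟨_, hq.2, rfl⟩⟩

/-! ### Fibre integrals -/

theorem lintegral_fiberMeasure (x : RSpace n) {f : RSpace n → ℝ≥0∞} (hf : Measurable f) :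
    ∫⁻ η, f η ∂S.fiberMeasure x = ENNReal.ofReal (S.speed x ^ (n - 1)) *
      ∫⁻ v, f (S.speed x • (v : RSpace n)) ∂(volume : Measure (RSpace n)).toSphere := by
  rw [fiberMeasure, lintegral_smul_measure, lintegral_map hf (by fun_prop), smul_eq_mul]

theorem lintegral_bulk {f : RSpace n × RSpace n → ℝ≥0∞} (hf : Measurable f) :
    ∫⁻ z, f z ∂S.bulk = ∫⁻ x in S.Ω, (∫⁻ η, f (x, η) ∂S.fiberMeasure x) := by
  rw [bulk, S.lintegral_phaseMeasure _ hf]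
  refine lintegral_congr fun x => ?_
  exact (lintegral_fiberMeasure x (hf.comp measurable_prodMk_left)).symm

theorem exists_fiberMeasure_le (S : TransportSetting n) :
    ∃ M : ℝ≥0, ∀ x ∈ closure S.Ω, S.fiberMeasure x univ ≤ M := by
  obtain ⟨a, b, ha, hb, hab⟩ := S.exists_speed_bounds
  refine ⟨(b ^ (n - 1)).toNNReal * ((volume : Measure (RSpace n)).toSphere univ).toNNReal,
    fun x hx => ?_⟩
  rw [← lintegral_one, lintegral_fiberMeasure x measurable_const]
  simp only [lintegral_one]
  push_cast
  rw [ENNReal.coe_toNNReal (measure_ne_top _ _)]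
  refine mul_le_mul_left (ENNReal.ofReal_le_ofReal ?_) _
  exact pow_le_pow_left₀ (Real.sqrt_nonneg _) (hab x hx).2 _

/-- The integral over the fibre. -/
noncomputable def fiberInt (S : TransportSetting n) (f : RSpace n × RSpace n → ℝ≥0∞)
    (x : RSpace n) : ℝ≥0∞ := ∫⁻ η, f (x, η) ∂S.fiberMeasure x

theorem measurable_fiberInt {f : RSpace n × RSpace n → ℝ≥0∞} (hf : Measurable f) :
    Measurable (S.fiberInt f) := by
  have hp := S.measurable_speed
  have h : S.fiberInt f = fun x => ENNReal.ofReal (S.speed x ^ (n - 1)) *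
      ∫⁻ v, f (S.scale (x, v)) ∂(volume : Measure (RSpace n)).toSphere := by
    funext x
    exact lintegral_fiberMeasure x (hf.comp measurable_prodMk_left)
  rw [h]
  have h2 : Measurable fun x => ∫⁻ v, f (S.scale (x, v)) ∂(volume : Measure (RSpace n)).toSphere :=
    (hf.comp S.measurable_scale).lintegral_prod_right'
  fun_prop

theorem lintegral_fst_bulk {f : RSpace n → ℝ≥0∞} (hf : Measurable f) :
    ∫⁻ z, f z.1 ∂S.bulk = ∫⁻ x in S.Ω, f x * S.fiberMeasure x univ := by
  refine (lintegral_bulk (hf.comp measurable_fst)).trans ?_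
  exact lintegral_congr fun x => lintegral_const (f x)

theorem ae_bulk_fst {p : RSpace n → Prop}
    (hp : ∀ᵐ x ∂(volume : Measure (RSpace n)).restrict S.Ω, p x) :
    ∀ᵐ z ∂S.bulk, p z.1 := by
  rw [ae_iff, ← measure_toMeasurable] at hp
  set N := toMeasurable (volume.restrict S.Ω) {x | ¬ p x}
  have hN : MeasurableSet N := measurableSet_toMeasurable _ _
  have h1 : S.bulk (Prod.fst ⁻¹' N) = 0 := by
    have h2 := lintegral_fst_bulk (S := S) (f := N.indicator 1) (measurable_one.indicator hN)
    have h3 : ∫⁻ z : RSpace n × RSpace n, N.indicator 1 z.1 ∂S.bulk = S.bulk (Prod.fst ⁻¹' N) := by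
      rw [← lintegral_indicator_one (measurable_fst hN)]
      rfl
    rw [← h3, h2]
    refine lintegral_eq_zero_of_ae_eq_zero ?_
    filter_upwards [measure_eq_zero_iff_ae_notMem.1 hp] with x hx
    rw [indicator_of_notMem hx, zero_mul]
    rfl
  filter_upwards [measure_eq_zero_iff_ae_notMem.1 h1] with z hz
  by_contra hcon
  exact hz (subset_toMeasurable _ _ hcon)

/-- Scattering evaluates a function on the whole fibre of a point; Fubini for the fibred measure
ensures that a null set of phase points is invisible there. -/
theorem ae_fiber {p : RSpace n × RSpace n → Prop} (hp : ∀ᵐ z ∂S.bulk, p z) :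
    ∀ᵐ z ∂S.bulk, ∀ᵐ η ∂S.fiberMeasure z.1, p (z.1, η) := by
  refine ae_bulk_fst (p := fun x => ∀ᵐ η ∂S.fiberMeasure x, p (x, η)) ?_
  rw [ae_iff, ← measure_toMeasurable] at hp
  set N := toMeasurable S.bulk {x | ¬ p x}
  have hN : MeasurableSet N := measurableSet_toMeasurable _ _
  rw [← lintegral_indicator_one hN, lintegral_bulk (measurable_one.indicator hN)] at hp
  filter_upwards [(lintegral_eq_zero_iff (measurable_fiberInt (measurable_one.indicator hN))).1 hp] with x hx
  have h1 : S.fiberMeasure x (Prod.mk x ⁻¹' N) = 0 := by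
    rw [← lintegral_indicator_one (measurable_prodMk_left hN)]
    exact hx
  filter_upwards [measure_eq_zero_iff_ae_notMem.1 h1] with η hη
  by_contra hcon
  exact hη (subset_toMeasurable _ _ hcon)

theorem ae_integrable_fiber {u : RSpace n × RSpace n → 𝕜} (hu : StronglyMeasurable u)
    (h2 : MemLp u 2 S.bulk) :
    ∀ᵐ z ∂S.bulk, Integrable (fun η => u (z.1, η)) (S.fiberMeasure z.1) := by
  refine ae_bulk_fst (p := fun x => Integrable (fun η => u (x, η)) (S.fiberMeasure x)) ?_
  have h1 : Integrable u S.bulk := h2.integrable one_le_two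
  have h3 := h1.2
  rw [hasFiniteIntegral_iff_enorm, lintegral_bulk hu.measurable.enorm] at h3
  filter_upwards [ae_lt_top (measurable_fiberInt hu.measurable.enorm) h3.ne] with x hx
  exact ⟨(hu.comp_measurable measurable_prodMk_left).aestronglyMeasurable, hx⟩

/-! ### Scattering and absorption as operators -/

theorem measurable_extendByZero_kernel (k : C(S.closedBundle₂, 𝕜)) :
    StronglyMeasurable (extendByZero k : RSpace n × RSpace n × RSpace n → 𝕜) :=
  (measurable_extendByZero isClosed_closedBundle₂ k.continuous).stronglyMeasurable

theorem scattering_congr (k : C(S.closedBundle₂, 𝕜)) {u v : RSpace n × RSpace n → 𝕜}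
    (h : u =ᵐ[S.bulk] v) : S.scattering k u =ᵐ[S.bulk] S.scattering k v := by
  filter_upwards [ae_fiber h] with z hz
  refine integral_congr_ae ?_
  filter_upwards [hz] with η hη
  rw [hη]

/-- The fibre measure varies with the point, so the integral is pulled back to the fixed unit
sphere, where measurability in a parameter is available. -/
theorem stronglyMeasurable_scattering (k : C(S.closedBundle₂, 𝕜)) {u : RSpace n × RSpace n → 𝕜}
    (hu : StronglyMeasurable u) : StronglyMeasurable (S.scattering k u) := by
  have hp := S.measurable_speed
  have hk := measurable_extendByZero_kernel k
  have h : S.scattering k u = fun z => S.speed z.1 ^ (n - 1) •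
      ∫ v : sphere (0 : RSpace n) 1, extendByZero k (z.1, z.2, S.speed z.1 • (v : RSpace n)) *
        u (z.1, S.speed z.1 • (v : RSpace n)) ∂(volume : Measure (RSpace n)).toSphere := by
    funext z
    rw [scattering, fiberMeasure, integral_smul_measure, integral_map]
    · have h0 : 0 ≤ S.speed z.1 := Real.sqrt_nonneg _
      rw [ENNReal.toReal_ofReal (pow_nonneg h0 _)]
    · fun_prop
    · exact ((hk.comp_measurable (by fun_prop)).mul
        (hu.comp_measurable (by fun_prop))).aestronglyMeasurable
  rw [h]
  have h2 : StronglyMeasurable fun q : (RSpace n × RSpace n) × sphere (0 : RSpace n) 1 =>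
      extendByZero k (q.1.1, q.1.2, S.speed q.1.1 • (q.2 : RSpace n)) *
        u (q.1.1, S.speed q.1.1 • (q.2 : RSpace n)) :=
    (hk.comp_measurable (by fun_prop)).mul (hu.comp_measurable (by fun_prop))
  exact (by fun_prop : Measurable fun z : RSpace n × RSpace n =>
    S.speed z.1 ^ (n - 1)).stronglyMeasurable.smul h2.integral_prod_right'

theorem enorm_scattering_le (k : C(S.closedBundle₂, 𝕜)) (u : RSpace n × RSpace n → 𝕜)
    (z : RSpace n × RSpace n) :
    ‖S.scattering k u z‖ₑ ≤ ‖k‖ₑ * S.fiberInt (fun z => ‖u z‖ₑ) z.1 := by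
  refine (enorm_integral_le_lintegral_enorm _).trans ?_
  rw [fiberInt, ← lintegral_const_mul' _ _ enorm_ne_top]
  refine lintegral_mono fun η => ?_
  rw [enorm_mul]
  gcongr
  rw [enorm_le_iff_norm_le]
  exact norm_extendByZero_le k _

/-- Cauchy–Schwarz on fibres of uniformly bounded mass bounds the operator by a multiple of the
supremum of the kernel. Boundedness in k as well makes the set of good coefficients open. -/
theorem exists_scatteringOp (S : TransportSetting n) :
    ∃ K : C(S.closedBundle₂, 𝕜) →L[𝕜] Lp 𝕜 2 S.bulk →L[𝕜] Lp 𝕜 2 S.bulk,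
      ∀ k u, K k u =ᵐ[S.bulk] S.scattering k u := by
  obtain ⟨M, hM⟩ := S.exists_fiberMeasure_le
  have key : ∀ k : C(S.closedBundle₂, 𝕜), ∃ A : Lp 𝕜 2 S.bulk →L[𝕜] Lp 𝕜 2 S.bulk,
      (∀ u, A u =ᵐ[S.bulk] S.scattering k u) ∧ ‖A‖ ≤ M * ‖k‖ := by
    intro k
    have hk := measurable_extendByZero_kernel k
    refine exists_clm_of_eLpNorm_le (fun u => S.scattering k u)
      (fun u => (stronglyMeasurable_scattering k (Lp.stronglyMeasurable u)).aestronglyMeasurable)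
      ?_ ?_ (by positivity) ?_
    · intro u v
      filter_upwards [scattering_congr k (Lp.coeFn_add u v),
        ae_integrable_fiber (Lp.stronglyMeasurable u) (Lp.memLp u),
        ae_integrable_fiber (Lp.stronglyMeasurable v) (Lp.memLp v)] with z h1 h2 h3
      have hb : ∀ f : RSpace n × RSpace n → 𝕜,
          Integrable (fun η => f (z.1, η)) (S.fiberMeasure z.1) →
          Integrable (fun η => extendByZero k (z.1, z.2, η) * f (z.1, η)) (S.fiberMeasure z.1) :=
        fun f hf => hf.bdd_mul (c := ‖k‖) (hk.comp_measurable (by fun_prop)).aestronglyMeasurable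
          (Eventually.of_forall fun η => norm_extendByZero_le k _)
      rw [h1, Pi.add_apply, scattering, scattering, scattering, ← integral_add (hb _ h2) (hb _ h3)]
      simp only [Pi.add_apply, mul_add]
    · intro a u
      filter_upwards [scattering_congr k (Lp.coeFn_smul a u)] with z h1
      rw [h1, Pi.smul_apply, scattering, scattering, ← integral_smul]
      refine integral_congr_ae (Eventually.of_forall fun η => ?_)
      simp only [Pi.smul_apply, smul_eq_mul]
      ring
    · intro u
      have hu := Lp.stronglyMeasurable u
      have hm : Measurable fun z => ‖u z‖ₑ ^ 2 := hu.measurable.enorm.pow_const 2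
      rw [← ENNReal.pow_le_pow_left_iff two_ne_zero, eLpNorm_two_sq, mul_pow, eLpNorm_two_sq]
      calc _ ≤ ∫⁻ z, ‖k‖ₑ ^ 2 * (M * S.fiberInt (fun z => ‖u z‖ₑ ^ 2) z.1) ∂S.bulk := by
            refine lintegral_mono_ae ?_
            filter_upwards [ae_mem_bundle (S := S)] with z hz
            refine (pow_le_pow_left' (enorm_scattering_le k u z) 2).trans ?_
            rw [mul_pow]
            gcongr
            refine (lintegral_sq_le (hu.measurable.enorm.comp
              measurable_prodMk_left).aemeasurable).trans ?_
            refine mul_le_mul_left (hM z.1 (subset_closure hz.1)) _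
        _ = ‖k‖ₑ ^ 2 * (M * ∫⁻ x in S.Ω, S.fiberInt (fun z => ‖u z‖ₑ ^ 2) x *
              S.fiberMeasure x univ) := by
            rw [lintegral_const_mul' _ _ (by simp), lintegral_const_mul' _ _ ENNReal.coe_ne_top,
              lintegral_fst_bulk (measurable_fiberInt hm)]
        _ ≤ ‖k‖ₑ ^ 2 * (M * ∫⁻ x in S.Ω, S.fiberInt (fun z => ‖u z‖ₑ ^ 2) x * M) := by
            gcongr ‖k‖ₑ ^ 2 * (M * ?_)
            refine setLIntegral_mono' measurableSet_Ω fun x hx => ?_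
            gcongr
            exact hM x (subset_closure hx)
        _ = ‖k‖ₑ ^ 2 * (M * ((∫⁻ z, ‖u z‖ₑ ^ 2 ∂S.bulk) * M)) := by
            rw [lintegral_mul_const' _ _ ENNReal.coe_ne_top, lintegral_bulk hm]
            rfl
        _ = _ := by
            rw [ENNReal.ofReal_mul (NNReal.coe_nonneg M), ENNReal.ofReal_coe_nnreal,
              ofReal_norm]
            ring
  choose A hA hAn using key
  refine ⟨LinearMap.mkContinuous
    { toFun := A, map_add' := fun k l => ?_, map_smul' := fun a k => ?_ } M hAn, hA⟩
  · ext1 u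
    refine Lp.ext ?_
    have hu := Lp.stronglyMeasurable u
    filter_upwards [hA (k + l) u, hA k u, hA l u, Lp.coeFn_add (A k u) (A l u),
      ae_integrable_fiber hu (Lp.memLp u)] with z h1 h2 h3 h4 h5
    have hb : ∀ k : C(S.closedBundle₂, 𝕜),
        Integrable (fun η => extendByZero k (z.1, z.2, η) * u (z.1, η)) (S.fiberMeasure z.1) :=
      fun k => h5.bdd_mul (c := ‖k‖) ((measurable_extendByZero_kernel k).comp_measurable
        (by fun_prop)).aestronglyMeasurable
        (Eventually.of_forall fun η => norm_extendByZero_le k _)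
    rw [add_apply, h4, Pi.add_apply, h1, h2, h3, scattering, scattering,
      scattering, ← integral_add (hb k) (hb l)]
    simp only [extendByZero_add, add_mul]
  · ext1 u
    refine Lp.ext ?_
    filter_upwards [hA (a • k) u, hA k u, Lp.coeFn_smul a (A k u)] with z h1 h2 h3
    rw [RingHom.id_apply, smul_apply, h3, Pi.smul_apply, h1, h2, scattering,
      scattering, ← integral_smul]
    simp only [extendByZero_smul, mul_assoc, smul_eq_mul]

/-- Multiplication by a bounded function. -/
theorem exists_mulOp {b : RSpace n × RSpace n → 𝕜} (hb : StronglyMeasurable b) {C : ℝ}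
    (hC : 0 ≤ C) (hbC : ∀ᵐ z ∂S.bulk, ‖b z‖ ≤ C) :
    ∃ A : Lp 𝕜 2 S.bulk →L[𝕜] Lp 𝕜 2 S.bulk,
      (∀ u, A u =ᵐ[S.bulk] fun z => b z * u z) ∧ ‖A‖ ≤ C := by
  refine exists_clm_of_eLpNorm_le (fun u z => b z * u z)
    (fun u => (hb.mul (Lp.stronglyMeasurable u)).aestronglyMeasurable) ?_ ?_ hC ?_
  · intro u v
    filter_upwards [Lp.coeFn_add u v] with z hz
    rw [hz, Pi.add_apply, Pi.add_apply, mul_add]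
  · intro a u
    filter_upwards [Lp.coeFn_smul a u] with z hz
    rw [hz, Pi.smul_apply, Pi.smul_apply, smul_eq_mul, smul_eq_mul, mul_left_comm]
  · intro u
    refine eLpNorm_le_mul_eLpNorm_of_ae_le_mul ?_ 2
    filter_upwards [hbC] with z hz
    rw [norm_mul]
    gcongr

theorem exists_absorptionOp (S : TransportSetting n) :
    ∃ M : C(S.closedBundle, 𝕜) →L[𝕜] Lp 𝕜 2 S.bulk →L[𝕜] Lp 𝕜 2 S.bulk,
      (∀ σ u, M σ u =ᵐ[S.bulk] fun z => extendByZero σ z * u z) ∧ ∀ σ, ‖M σ‖ ≤ ‖σ‖ := by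
  have key : ∀ σ : C(S.closedBundle, 𝕜), ∃ A : Lp 𝕜 2 S.bulk →L[𝕜] Lp 𝕜 2 S.bulk,
      (∀ u, A u =ᵐ[S.bulk] fun z => extendByZero σ z * u z) ∧ ‖A‖ ≤ ‖σ‖ := fun σ =>
    exists_mulOp (measurable_extendByZero S.isCompact_closedBundle.isClosed
      σ.continuous).stronglyMeasurable (norm_nonneg _)
      (Eventually.of_forall fun z => norm_extendByZero_le σ z)
  choose A hA hAn using key
  refine ⟨LinearMap.mkContinuous
    { toFun := A, map_add' := fun k l => ?_, map_smul' := fun a k => ?_ } 1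
      (fun k => by rw [one_mul]; exact hAn k), hA, hAn⟩
  · ext1 u
    refine Lp.ext ?_
    filter_upwards [hA (k + l) u, hA k u, hA l u, Lp.coeFn_add (A k u) (A l u)] with z h1 h2 h3 h4
    rw [add_apply, h4, Pi.add_apply, h1, h2, h3, extendByZero_add, add_mul]
  · ext1 u
    refine Lp.ext ?_
    filter_upwards [hA (a • k) u, hA k u, Lp.coeFn_smul a (A k u)] with z h1 h2 h3
    rw [RingHom.id_apply, smul_apply, h3, Pi.smul_apply, h1, h2,
      extendByZero_smul, smul_eq_mul, mul_assoc]

end TransportSetting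

namespace TransportSetting

open scoped NNReal ENNReal

variable {n : ℕ} {S : TransportSetting n}

namespace CutoffFlow

variable (Φ : S.CutoffFlow)

/-! ### Short trajectories -/

/-- The compact bundle has positive distance from the region where the cut-off acts. For short times
velocity is thus the derivative of position even if the trajectory leaves the closure of the domain,
where no residence argument applies. -/
theorem exists_short_time : ∃ ε : ℝ, 0 < ε ∧ ∀ z ∈ S.closedBundle, ∀ t : ℝ, |t| ≤ ε →
    ‖Φ t z‖ ≤ Φ.radius := by
  obtain ⟨m, hm, h⟩ := S.isCompact_closedBundle.exists_forall_le' (a := 0)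
    (f := fun z => Φ.radius - ‖z‖) (by fun_prop) (fun z hz => sub_pos.2 (Φ.norm_lt z hz))
  have hb : (0 : ℝ) ≤ Φ.bound := Φ.bound.2
  refine ⟨m / (Φ.bound + 1), div_pos hm (by linarith), fun z hz t ht => ?_⟩
  have h1 := Φ.dist_map_time_le t 0 z
  rw [Φ.map_zero, dist_eq_norm, sub_zero] at h1
  have h2 : (Φ.bound : ℝ) * |t| ≤ m := by
    calc (Φ.bound : ℝ) * |t| ≤ (Φ.bound + 1) * (m / (Φ.bound + 1)) := by
          gcongr
          linarith
      _ = _ := by field_simp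
  have h3 : ‖Φ t z‖ ≤ ‖Φ t z - z‖ + ‖z‖ := norm_le_norm_sub_add _ _
  linarith [h z hz]

/-- The flow minus the identity has Lipschitz constant O(|t|), by integrating the Grönwall bound for
the difference of the fields. -/
theorem norm_map_sub_sub_le {t : ℝ} (ht : |t| ≤ 1) (z w : RSpace n × RSpace n) :
    ‖Φ t z - Φ t w - (z - w)‖ ≤ Φ.lip * Real.exp Φ.lip * ‖z - w‖ * |t| := by
  have hmvt := (convex_uIcc (0 : ℝ) t).norm_image_sub_le_of_norm_hasDerivWithin_le
    (f := fun s => Φ s z - Φ s w) (C := Φ.lip * Real.exp Φ.lip * ‖z - w‖)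
    (fun s _ => ((Φ.hasDerivAt z s).sub (Φ.hasDerivAt w s)).hasDerivWithinAt) (fun s hs => ?_)
    left_mem_uIcc right_mem_uIcc
  · simpa only [Φ.map_zero, sub_zero, Real.norm_eq_abs] using hmvt
  · have hs1 : |s| ≤ 1 := by
      have := abs_sub_left_of_mem_uIcc hs
      simp only [sub_zero] at this
      exact this.trans ht
    have h1 := Φ.lipschitz.dist_le_mul (Φ s z) (Φ s w)
    rw [dist_eq_norm] at h1
    refine h1.trans ?_
    rw [mul_assoc]
    refine mul_le_mul_of_nonneg_left ((Φ.dist_map_le s z w).trans ?_) Φ.lip.2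
    rw [dist_eq_norm]
    gcongr
    have : (Φ.lip : ℝ) * |s| ≤ Φ.lip * 1 := mul_le_mul_of_nonneg_left hs1 Φ.lip.2
    linarith

/-- One more integration, of velocity to position, improves the error to second order in time:
positions separate like those of free motion. -/
theorem norm_position_sub_le {ε : ℝ} (hε : ∀ z ∈ S.closedBundle, ∀ t : ℝ, |t| ≤ ε →
    ‖Φ t z‖ ≤ Φ.radius) (hε1 : ε ≤ 1) {x θ₁ θ₂ : RSpace n} (h₁ : (x, θ₁) ∈ S.closedBundle)
    (h₂ : (x, θ₂) ∈ S.closedBundle) {t : ℝ} (ht : |t| ≤ ε) :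
    ‖(Φ t (x, θ₁)).1 - (Φ t (x, θ₂)).1 - t • (θ₁ - θ₂)‖ ≤
      Φ.lip * Real.exp Φ.lip * ‖θ₁ - θ₂‖ * |t| * |t| := by
  have hd : ∀ θ, (x, θ) ∈ S.closedBundle → ∀ s ∈ uIcc 0 t,
      HasDerivAt (fun s => (Φ s (x, θ)).1) (Φ s (x, θ)).2 s := by
    intro θ hθ s hs
    have hs1 : |s| ≤ ε := by
      have := abs_sub_left_of_mem_uIcc hs
      simp only [sub_zero] at this
      exact this.trans ht
    exact (hasFDerivAt_fst (p := Φ s (x, θ))).comp_hasDerivAt s (Φ.hasDerivAt_of_mem (hε _ hθ s hs1))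
  have hmvt := (convex_uIcc (0 : ℝ) t).norm_image_sub_le_of_norm_hasDerivWithin_le
    (f := fun s => (Φ s (x, θ₁)).1 - (Φ s (x, θ₂)).1 - s • (θ₁ - θ₂))
    (C := Φ.lip * Real.exp Φ.lip * ‖θ₁ - θ₂‖ * |t|)
    (fun s hs => (((hd θ₁ h₁ s hs).sub (hd θ₂ h₂ s hs)).sub
      ((hasDerivAt_id s).smul_const (θ₁ - θ₂))).hasDerivWithinAt) (fun s hs => ?_)
    left_mem_uIcc right_mem_uIcc
  · simpa only [Φ.map_zero, sub_self, zero_smul, sub_zero, Real.norm_eq_abs] using hmvt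
  · have hst : |s| ≤ |t| := by
      have := abs_sub_left_of_mem_uIcc hs
      simpa only [sub_zero] using this
    have h1 := Φ.norm_map_sub_sub_le (hst.trans (ht.trans hε1)) (x, θ₁) (x, θ₂)
    have h2 : ‖(x, θ₁) - (x, θ₂)‖ = ‖θ₁ - θ₂‖ := by
      rw [Prod.mk_sub_mk, sub_self, Prod.norm_mk, norm_zero, max_eq_right (norm_nonneg _)]
    rw [h2] at h1
    refine (le_trans ?_ h1).trans ?_
    · rw [one_smul]
      exact norm_snd_le (Φ s (x, θ₁) - Φ s (x, θ₂) - ((x, θ₁) - (x, θ₂)))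
    · gcongr

theorem norm_position_time_sub_le {ε : ℝ} (hε : ∀ z ∈ S.closedBundle, ∀ t : ℝ, |t| ≤ ε →
    ‖Φ t z‖ ≤ Φ.radius) {z : RSpace n × RSpace n} (hz : z ∈ S.closedBundle) {s t r : ℝ}
    (hr : r ≤ ε) (hs : |s| ≤ r) (ht : |t| ≤ r) :
    ‖(Φ t z).1 - (Φ s z).1 - (t - s) • z.2‖ ≤ Φ.bound * r * |t - s| := by
  have hmvt := (convex_Icc (-r) r).norm_image_sub_le_of_norm_hasDerivWithin_le
    (f := fun s => (Φ s z).1 - s • z.2) (C := Φ.bound * r)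
    (fun q hq => (((hasFDerivAt_fst (p := Φ q z)).comp_hasDerivAt q
      (Φ.hasDerivAt_of_mem (hε _ hz q ((abs_le.2 hq).trans hr)))).sub
      ((hasDerivAt_id q).smul_const z.2)).hasDerivWithinAt) (fun q hq => ?_)
    (abs_le.1 hs) (abs_le.1 ht)
  · rw [Real.norm_eq_abs] at hmvt
    refine le_trans (le_of_eq ?_) hmvt
    congr 1
    rw [sub_smul]
    abel
  · have h1 := Φ.dist_map_time_le q 0 z
    rw [Φ.map_zero, sub_zero, dist_eq_norm] at h1
    rw [one_smul]
    refine (norm_snd_le (Φ q z - z)).trans (h1.trans ?_)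
    exact mul_le_mul_of_nonneg_left (abs_le.2 hq) Φ.bound.2

/-- The position reached from `x` in the direction of `w` after time `|w| / p(x)`, forwards or
backwards. -/
noncomputable def expMap (e : ℝ) (x w : RSpace n) : RSpace n :=
  (Φ (e * (‖w‖ / S.speed x)) (x, (S.speed x / ‖w‖) • w)).1

theorem measurable_expMap (e : ℝ) (x : RSpace n) : Measurable (Φ.expMap e x) := by
  have h : Measurable fun w : RSpace n =>
      (e * (‖w‖ / S.speed x), ((x, (S.speed x / ‖w‖) • w) : RSpace n × RSpace n)) := by fun_prop
  exact measurable_fst.comp (Φ.continuous_uncurry.measurable.comp h)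

/-- For short times the map `expMap` is expanding up to a factor, since it is a small perturbation of
a translation or a reflection. -/
theorem exists_expMap_antilipschitz (S : TransportSetting n) (Φ : S.CutoffFlow) :
    ∃ r : ℝ, 0 < r ∧ ∀ e : ℝ, |e| = 1 → ∀ x ∈ closure S.Ω,
      ∀ w ∈ {w : RSpace n | 0 < ‖w‖ ∧ ‖w‖ < S.speed x * r},
      ∀ w' ∈ {w : RSpace n | 0 < ‖w‖ ∧ ‖w‖ < S.speed x * r},
      dist w w' ≤ (2 : ℝ≥0) * dist (Φ.expMap e x w) (Φ.expMap e x w') := by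
  obtain ⟨ε, hε0, hε⟩ := Φ.exists_short_time
  obtain ⟨a, b, ha, hb, hab⟩ := S.exists_speed_bounds
  set L : ℝ := Φ.lip * Real.exp Φ.lip with hL
  have hL0 : 0 ≤ L := mul_nonneg Φ.lip.2 (Real.exp_pos _).le
  have hB0 : (0 : ℝ) ≤ Φ.bound := Φ.bound.2
  set M : ℝ := 2 * L + Φ.bound / a with hM
  have hM0 : 0 ≤ M := by positivity
  -- With this `r` one has `M * r ≤ 1/2`, so `expMap` differs from `w ↦ x + e w` by a map of
  -- Lipschitz constant 1/2; this gives the factor 2. In `M`, the term `2 * L` accounts for a change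
  -- of direction and `bound / a` for a change of time.
  refine ⟨min (min ε 1) (1 / (2 * (M + 1))), by positivity, fun e he x hx w hw w' hw' => ?_⟩
  set r := min (min ε 1) (1 / (2 * (M + 1))) with hr
  have hr0 : 0 < r := by positivity
  have hrε : r ≤ ε := (min_le_left _ _).trans (min_le_left _ _)
  have hr1 : r ≤ 1 := (min_le_left _ _).trans (min_le_right _ _)
  have hrM : M * r ≤ 1 / 2 := by
    calc M * r ≤ (M + 1) * (1 / (2 * (M + 1))) := by
          gcongr
          · linarith
          · exact min_le_right _ _
      _ = 1 / 2 := by field_simp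
  have hp := S.speed_pos hx
  set p := S.speed x with hpdef
  set t := ‖w‖ / p with htdef
  set t' := ‖w'‖ / p with htdef'
  set θ := (p / ‖w‖) • w with hθ
  set θ' := (p / ‖w'‖) • w' with hθ'
  have hw1 := hw.1
  have hw1' := hw'.1
  have hwt : t • θ = w := by
    rw [hθ, smul_smul, htdef]
    have : ‖w‖ / p * (p / ‖w‖) = 1 := by field_simp
    rw [this, one_smul]
  have hwt' : t' • θ' = w' := by
    rw [hθ', smul_smul, htdef']
    have : ‖w'‖ / p * (p / ‖w'‖) = 1 := by field_simp
    rw [this, one_smul]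
  have hnθ : ‖θ‖ = p := by
    rw [hθ, norm_smul, norm_div, norm_norm, Real.norm_of_nonneg hp.le]; field_simp
  have hnθ' : ‖θ'‖ = p := by
    rw [hθ', norm_smul, norm_div, norm_norm, Real.norm_of_nonneg hp.le]; field_simp
  have hcb : (x, θ) ∈ S.closedBundle := S.mem_closedBundle_iff.2 ⟨hx, hnθ⟩
  have hcb' : (x, θ') ∈ S.closedBundle := S.mem_closedBundle_iff.2 ⟨hx, hnθ'⟩
  have ht0 : 0 ≤ t := by positivity
  have ht0' : 0 ≤ t' := by positivity
  have htr : t ≤ r := by rw [htdef, div_le_iff₀ hp, mul_comm]; exact hw.2.le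
  have htr' : t' ≤ r := by rw [htdef', div_le_iff₀ hp, mul_comm]; exact hw'.2.le
  have het : |e * t| = t := by rw [abs_mul, he, one_mul, abs_of_nonneg ht0]
  have het' : |e * t'| = t' := by rw [abs_mul, he, one_mul, abs_of_nonneg ht0']
  have hd : |t - t'| * p ≤ ‖w - w'‖ := by
    rw [htdef, htdef', ← sub_div, abs_div, abs_of_pos hp, div_mul_cancel₀ _ hp.ne']
    exact abs_norm_sub_norm_le _ _
  have hθθ : t * ‖θ - θ'‖ ≤ 2 * ‖w - w'‖ := by
    have h1 : t • (θ - θ') = (w - w') - (t - t') • θ' := by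
      rw [smul_sub, hwt, sub_smul, hwt']; abel
    have h2 : t * ‖θ - θ'‖ = ‖t • (θ - θ')‖ := by rw [norm_smul, Real.norm_of_nonneg ht0]
    rw [h2, h1]
    refine (norm_sub_le _ _).trans ?_
    rw [norm_smul, hnθ', Real.norm_eq_abs]
    linarith
  have h1 := Φ.norm_position_sub_le (fun z hz t ht => hε z hz t (ht.trans hrε)) hr1 hcb hcb'
    (t := e * t) (by rw [het]; exact htr)
  have h2 := Φ.norm_position_time_sub_le hε hcb' hrε (s := e * t') (t := e * t)
    (by rw [het']; exact htr') (by rw [het]; exact htr)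
  have hett : |e * t - e * t'| = |t - t'| := by rw [← mul_sub, abs_mul, he, one_mul]
  rw [het] at h1
  rw [hett] at h2
  -- The direction is changed first at fixed time, then the time at fixed direction; each bracket is
  -- an error relative to straight motion.
  have h3 : Φ.expMap e x w - Φ.expMap e x w' - e • (w - w') =
      ((Φ (e * t) (x, θ)).1 - (Φ (e * t) (x, θ')).1 - (e * t) • (θ - θ')) +
      ((Φ (e * t) (x, θ')).1 - (Φ (e * t') (x, θ')).1 - (e * t - e * t') • θ') := by
    have h4 : e • (w - w') = (e * t) • (θ - θ') + (e * t - e * t') • θ' := by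
      rw [mul_smul, ← mul_sub, mul_smul, ← smul_add, smul_sub t, hwt, sub_smul, hwt']
      congr 1
      abel
    rw [h4]
    simp only [expMap]
    abel
  have h5 : ‖Φ.expMap e x w - Φ.expMap e x w' - e • (w - w')‖ ≤ 1 / 2 * ‖w - w'‖ := by
    rw [h3]
    refine (norm_add_le _ _).trans ((add_le_add h1 h2).trans ?_)
    have h6 : L * ‖θ - θ'‖ * t * t ≤ L * (2 * ‖w - w'‖) * r := by
      calc _ = L * (t * ‖θ - θ'‖) * t := by ring
        _ ≤ _ := by gcongr
    have h7 : (Φ.bound : ℝ) * r * |t - t'| ≤ Φ.bound * r * (‖w - w'‖ / a) := by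
      gcongr
      rw [le_div_iff₀ ha]
      exact (mul_le_mul_of_nonneg_left (hab x hx).1 (abs_nonneg _)).trans hd
    calc _ ≤ L * (2 * ‖w - w'‖) * r + Φ.bound * r * (‖w - w'‖ / a) := add_le_add h6 h7
      _ = M * r * ‖w - w'‖ := by rw [hM]; ring
      _ ≤ _ := by gcongr
  have h8 : ‖e • (w - w')‖ = ‖w - w'‖ := by rw [norm_smul, Real.norm_eq_abs, he, one_mul]
  have h9 : ‖e • (w - w')‖ ≤ ‖Φ.expMap e x w - Φ.expMap e x w'‖ +
      ‖Φ.expMap e x w - Φ.expMap e x w' - e • (w - w')‖ := by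
    have := norm_sub_le (Φ.expMap e x w - Φ.expMap e x w')
      (Φ.expMap e x w - Φ.expMap e x w' - e • (w - w'))
    rwa [sub_sub_cancel] at this
  rw [dist_eq_norm, dist_eq_norm]
  rw [h8] at h9
  push_cast
  linarith

/-- Mean values over short trajectories issued from a point are bounded by mean values over
space. -/
theorem exists_lintegral_short_le (hn : n ≠ 0) : ∃ r : ℝ, 0 < r ∧ ∀ δ : ℝ, 0 < δ →
    ∃ C : ℝ≥0, ∀ e : ℝ, |e| = 1 → ∀ x ∈ closure S.Ω, ∀ ψ : RSpace n → ℝ≥0∞, Measurable ψ →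
      ∫⁻ θ, (∫⁻ t in Ioo δ r, ψ (Φ (e * t) (x, θ)).1) ∂S.fiberMeasure x ≤ C * ∫⁻ y, ψ y := by
  obtain ⟨r, hr, hanti⟩ := exists_expMap_antilipschitz S Φ
  obtain ⟨a, b, ha, hb, hab⟩ := S.exists_speed_bounds
  obtain ⟨C, hC⟩ := exists_measure_inter_preimage_le_of_antilipschitzOn
    (volume : Measure (RSpace n)) (volume : Measure (RSpace n)) rfl 2
  refine ⟨r, hr, fun δ hδ => ⟨(b ^ (n - 1)).toNNReal * (a⁻¹.toNNReal *
    (((a * δ) ^ (n - 1))⁻¹.toNNReal * C)), fun e he x hx ψ hψ => ?_⟩⟩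
  have hp := S.speed_pos hx
  obtain ⟨hpa, hpb⟩ := hab x hx
  set p := S.speed x with hpdef
  have hG := Φ.measurable_expMap e x
  -- The annulus traversed at times between `δ` and `r`. Its inner radius bounds the polar density
  -- `s ^ (n-1)` from below by `(a * δ) ^ (n-1)`, so the constant depends on `δ`.
  let A : Set (RSpace n) := {w | p * δ < ‖w‖ ∧ ‖w‖ < p * r}
  have hA : MeasurableSet A := (measurableSet_lt measurable_const measurable_norm).inter
    (measurableSet_lt measurable_norm measurable_const)
  have hpδ : 0 < p * δ := mul_pos hp hδ
  have hle : ((volume : Measure (RSpace n)).restrict A).map (Φ.expMap e x) ≤ C • volume := by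
    refine Measure.le_iff.2 fun B hB => ?_
    rw [Measure.map_apply hG hB, Measure.restrict_apply (hG hB), inter_comm]
    refine le_trans (measure_mono ?_) (hC _ _ (hanti e he x hx) B)
    exact inter_subset_inter_left _ fun w hw => ⟨hpδ.trans hw.1, hw.2⟩
  have h1 : ∫⁻ w, A.indicator (fun w => ψ (Φ.expMap e x w)) w ≤ C * ∫⁻ y, ψ y := by
    rw [lintegral_indicator hA, ← lintegral_map hψ hG]
    refine (lintegral_mono' hle le_rfl).trans_eq ?_
    rw [lintegral_smul_measure]
    rfl
  have hψG : Measurable fun w => ψ (Φ.expMap e x w) := hψ.comp hG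
  rw [lintegral_polar hn (hψG.indicator hA)] at h1
  have hflow : Measurable fun q : RSpace n × ℝ => ψ (Φ (e * q.2) (x, q.1)).1 := by
    have h : Measurable fun q : RSpace n × ℝ =>
        (e * q.2, ((x, q.1) : RSpace n × RSpace n)) := by fun_prop
    exact hψ.comp (measurable_fst.comp (Φ.continuous_uncurry.measurable.comp h))
  have hmeas : Measurable fun θ => ∫⁻ t in Ioo δ r, ψ (Φ (e * t) (x, θ)).1 :=
    hflow.lintegral_prod_right'
  rw [lintegral_fiberMeasure x hmeas]
  have h2 : ∀ v : sphere (0 : RSpace n) 1,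
      ∫⁻ t in Ioo δ r, ψ (Φ (e * t) (x, p • (v : RSpace n))).1 ≤
        a⁻¹.toNNReal * (((a * δ) ^ (n - 1))⁻¹.toNNReal * ∫⁻ s in Ioi (0 : ℝ),
          ENNReal.ofReal (s ^ (n - 1)) *
            A.indicator (fun w => ψ (Φ.expMap e x w)) (s • (v : RSpace n))) := by
    intro v
    have hnv : ‖(v : RSpace n)‖ = 1 := norm_eq_of_mem_sphere v
    let F : ℝ → ℝ≥0∞ := fun s => ENNReal.ofReal (s ^ (n - 1)) *
            A.indicator (fun w => ψ (Φ.expMap e x w)) (s • (v : RSpace n))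
    have hF : Measurable F := by
      have h3 : Measurable fun s : ℝ => s • (v : RSpace n) := by fun_prop
      have h4 : Measurable fun s : ℝ => A.indicator (fun w => ψ (Φ.expMap e x w))
          (s • (v : RSpace n)) := (hψG.indicator hA).comp h3
      fun_prop
    have h3 : ∀ t ∈ Ioo δ r, ψ (Φ (e * t) (x, p • (v : RSpace n))).1 ≤
        ((a * δ) ^ (n - 1))⁻¹.toNNReal * (Ioi (0 : ℝ)).indicator F (p * t) := by
      intro t ht
      have ht0 : 0 < t := hδ.trans ht.1
      have hpt : 0 < p * t := mul_pos hp ht0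
      have hnorm : ‖(p * t) • (v : RSpace n)‖ = p * t := by
        rw [norm_smul, hnv, mul_one, Real.norm_of_nonneg hpt.le]
      have hmem : (p * t) • (v : RSpace n) ∈ A := by
        refine ⟨?_, ?_⟩
        · rw [hnorm]; exact mul_lt_mul_of_pos_left ht.1 hp
        · rw [hnorm]; exact mul_lt_mul_of_pos_left ht.2 hp
      have hexp : Φ.expMap e x ((p * t) • (v : RSpace n)) =
          (Φ (e * t) (x, p • (v : RSpace n))).1 := by
        rw [expMap, hnorm, ← hpdef, smul_smul]
        have h4 : p * t / p = t := by field_simp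
        have h5 : p / (p * t) * (p * t) = p := by field_simp
        rw [h4, h5]
      rw [indicator_of_mem (mem_Ioi.2 hpt)]
      simp only [F]
      rw [indicator_of_mem hmem, hexp, ← mul_assoc]
      refine le_mul_of_one_le_left zero_le ?_
      change 1 ≤ ENNReal.ofReal _ * _
      rw [← ENNReal.ofReal_mul (by positivity), ← ENNReal.ofReal_one]
      refine ENNReal.ofReal_le_ofReal ?_
      rw [inv_mul_eq_div, one_le_div (by positivity)]
      refine pow_le_pow_left₀ (by positivity) ?_ _
      exact mul_le_mul hpa ht.1.le hδ.le hp.le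
    have h4 : ∫⁻ t, (Ioi (0 : ℝ)).indicator F (p * t) ≤
        a⁻¹.toNNReal * ∫⁻ s in Ioi (0 : ℝ), F s := by
      have h5 := lintegral_map (μ := volume) (hF.indicator (measurableSet_Ioi (a := (0 : ℝ))))
        (measurable_const_mul p)
      rw [Real.map_volume_mul_left hp.ne', lintegral_smul_measure,
        lintegral_indicator measurableSet_Ioi] at h5
      rw [← h5, smul_eq_mul]
      refine mul_le_mul_left (ENNReal.ofReal_le_ofReal ?_) _
      rw [abs_of_pos (inv_pos.2 hp)]
      exact inv_anti₀ ha hpa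
    calc _ ≤ ∫⁻ t in Ioo δ r, ((a * δ) ^ (n - 1))⁻¹.toNNReal * (Ioi (0 : ℝ)).indicator F (p * t) :=
          setLIntegral_mono' measurableSet_Ioo h3
      _ ≤ ∫⁻ t, ((a * δ) ^ (n - 1))⁻¹.toNNReal * (Ioi (0 : ℝ)).indicator F (p * t) :=
          lintegral_mono' Measure.restrict_le_self le_rfl
      _ = ((a * δ) ^ (n - 1))⁻¹.toNNReal * ∫⁻ t, (Ioi (0 : ℝ)).indicator F (p * t) :=
          lintegral_const_mul' _ _ ENNReal.coe_ne_top
      _ ≤ ((a * δ) ^ (n - 1))⁻¹.toNNReal * (a⁻¹.toNNReal * ∫⁻ s in Ioi (0 : ℝ), F s) := by gcongr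
      _ = _ := by ring
  calc _ ≤ ENNReal.ofReal (b ^ (n - 1)) * ∫⁻ v : sphere (0 : RSpace n) 1, a⁻¹.toNNReal *
        (((a * δ) ^ (n - 1))⁻¹.toNNReal * ∫⁻ s in Ioi (0 : ℝ), ENNReal.ofReal (s ^ (n - 1)) *
            A.indicator (fun w => ψ (Φ.expMap e x w)) (s • (v : RSpace n)))
          ∂(volume : Measure (RSpace n)).toSphere := by
        gcongr with v
        exact h2 v
    _ ≤ ENNReal.ofReal (b ^ (n - 1)) * (a⁻¹.toNNReal * (((a * δ) ^ (n - 1))⁻¹.toNNReal *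
          (C * ∫⁻ y, ψ y))) := by
        rw [lintegral_const_mul' _ _ ENNReal.coe_ne_top, lintegral_const_mul' _ _ ENNReal.coe_ne_top]
        gcongr
    _ = _ := by
        push_cast
        rw [ENNReal.ofReal]
        ring

end CutoffFlow

end TransportSetting

/-! ### Pairs of times and time windows -/

namespace TransportSetting

open scoped NNReal ENNReal

variable {n : ℕ} {S : TransportSetting n} {𝕜 : Type*} [RCLike 𝕜]

namespace CutoffFlow

variable (Φ : S.CutoffFlow)

theorem mem_orbitDomain_map_iff (hnt : S.NonTrapping) {z : RSpace n × RSpace n} {s t : ℝ}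
    (hz : z ∈ S.closedBundle) (ht : t ∈ S.residence z) :
    (Φ t z, s) ∈ S.orbitDomain ↔ (z, s + t) ∈ S.orbitDomain := by
  simp only [orbitDomain, mem_ofPred_eq, mem_Ioo, Φ.entryTime_map hnt hz ht,
    Φ.exitTime_map hnt hz ht, hz, Φ.map_mem_closedBundle hz ht, true_and]
  constructor <;> rintro ⟨h1, h2⟩ <;> constructor <;> linarith

/-- The double integral along trajectories of two functions of position, over pairs of times with
difference in a short interval away from zero. -/
theorem exists_lintegral_pair_le (hn : n ≠ 0) (hconv : S.StrictlyConvexBoundary)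
    (hnt : S.NonTrapping) : ∃ r > 0, ∀ δ > 0, ∃ C : ℝ≥0, ∀ e : ℝ, |e| = 1 →
      ∀ I J : Set ℝ, MeasurableSet I → MeasurableSet J →
      (∀ t ∈ I, ∀ s ∈ J, e * (t - s) ∈ Ioo δ r) →
      ∀ f g : RSpace n × RSpace n → ℝ≥0∞, Measurable f → Measurable g →
      ∫⁻ z, (∫⁻ s in J, S.orbitDomain.indicator (fun q => S.fiberInt f (Φ q.2 q.1).1) (z, s)) *
        (∫⁻ t in I, S.orbitDomain.indicator (fun q => S.fiberInt g (Φ q.2 q.1).1) (z, t)) ∂S.bulk ≤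
      C * volume J * (∫⁻ z, f z ∂S.bulk) * ∫⁻ z, g z ∂S.bulk := by
  obtain ⟨r, hr, hshort⟩ := Φ.exists_lintegral_short_le hn
  obtain ⟨C₁, hC₁⟩ := Φ.exists_bulk_preimage_le hn hconv hnt
  refine ⟨r, hr, fun δ hδ => ?_⟩
  obtain ⟨C₂, hC₂⟩ := hshort δ hδ
  refine ⟨C₁ * C₂, fun e he I J hI hJ hIJ f g hf hg => ?_⟩
  have hD := measurableSet_orbitDomain hnt
  have hF := measurable_fiberInt (S := S) hf
  have hG := measurable_fiberInt (S := S) hg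
  set F := S.fiberInt f
  set G := S.fiberInt g
  let ψ : RSpace n → ℝ≥0∞ := S.Ω.indicator G
  have hψ : Measurable ψ := hG.indicator measurableSet_Ω
  have hψint : ∫⁻ y, ψ y = ∫⁻ z, g z ∂S.bulk := by
    rw [lintegral_indicator measurableSet_Ω, lintegral_bulk hg]
    rfl
  have hFint : ∫⁻ x in S.Ω, F x = ∫⁻ z, f z ∂S.bulk := (lintegral_bulk hf).symm
  have hFm : Measurable (S.orbitDomain.indicator fun q => F (Φ q.2 q.1).1) :=
    (hF.comp (measurable_fst.comp Φ.measurable_flow_swap)).indicator hD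
  have hψm : Measurable fun q : (RSpace n × RSpace n) × ℝ => ψ (Φ (e * q.2) q.1).1 := by
    have h : Measurable fun q : (RSpace n × RSpace n) × ℝ => (e * q.2, q.1) := by fun_prop
    exact hψ.comp (measurable_fst.comp (Φ.continuous_uncurry.measurable.comp h))
  -- the pairing with the first time moved to zero
  let P : RSpace n × RSpace n → ℝ≥0∞ := fun w => F w.1 * ∫⁻ t in Ioo δ r, ψ (Φ (e * t) w).1
  have hP : Measurable P := (hF.comp measurable_fst).mul hψm.lintegral_prod_right'
  -- `F` depends on position only, so the fibre integral falls on the second factor alone, where the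
  -- short-time change of variables turns directions and times into positions.
  have hPint : ∫⁻ w, P w ∂S.bulk ≤ C₂ * (∫⁻ z, f z ∂S.bulk) * ∫⁻ z, g z ∂S.bulk := by
    rw [lintegral_bulk hP]
    calc _ ≤ ∫⁻ x in S.Ω, F x * (C₂ * ∫⁻ y, ψ y) := by
          refine setLIntegral_mono' measurableSet_Ω fun x hx => ?_
          have hm : Measurable fun η : RSpace n => ∫⁻ t in Ioo δ r, ψ (Φ (e * t) (x, η)).1 :=
            hψm.lintegral_prod_right'.comp measurable_prodMk_left
          change ∫⁻ η, F x * (∫⁻ t in Ioo δ r, ψ (Φ (e * t) (x, η)).1) ∂S.fiberMeasure x ≤ _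
          rw [lintegral_const_mul _ hm]
          exact mul_le_mul_right (hC₂ e he x (subset_closure hx) ψ hψ) _
      _ = _ := by
          rw [lintegral_mul_const _ hF, hFint, hψint]
          ring
  -- Seen from the point at time `s`, the other time differs by `e` times an element of `(δ, r)`.
  -- Enlarging the inner integral to all such times leaves a function of `Φ s z` alone.
  have key : ∀ s ∈ J, ∀ z, S.orbitDomain.indicator (fun q => F (Φ q.2 q.1).1) (z, s) *
      (∫⁻ t in I, S.orbitDomain.indicator (fun q => G (Φ q.2 q.1).1) (z, t)) ≤
      S.orbitDomain.indicator (fun q => P (Φ q.2 q.1)) (z, s) := by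
    intro s hs z
    by_cases hzs : (z, s) ∈ S.orbitDomain
    swap
    · simp only [indicator_of_notMem hzs, zero_mul, le_refl]
    rw [indicator_of_mem hzs, indicator_of_mem hzs]
    refine mul_le_mul_right ?_ _
    have he2 : e * e = 1 := by
      have := abs_mul_abs_self e
      rw [he] at this; linarith
    calc _ ≤ ∫⁻ t in I, ψ (Φ t z).1 := by
          refine lintegral_mono fun t => ?_
          by_cases hzt : (z, t) ∈ S.orbitDomain
          swap
          · rw [indicator_of_notMem hzt]; exact zero_le
          rw [indicator_of_mem hzt]
          have h1 := Φ.map_mem_bundle_Ω hconv hnt hzt.1 hzt.2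
          simp only [ψ, indicator_of_mem h1.1, le_refl]
      _ ≤ ∫⁻ t, (Ioo δ r).indicator (fun t => ψ (Φ (e * t) (Φ s z)).1) (e * (t - s)) := by
          rw [← lintegral_indicator hI]
          refine lintegral_mono fun t => ?_
          by_cases ht : t ∈ I
          swap
          · rw [indicator_of_notMem ht]; exact zero_le
          rw [indicator_of_mem ht, indicator_of_mem (hIJ t ht s hs), ← mul_assoc, he2, one_mul,
            ← Φ.map_add, sub_add_cancel]
      _ = ∫⁻ t, (Ioo δ r).indicator (fun t => ψ (Φ (e * t) (Φ s z)).1) t := by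
          rw [lintegral_sub_right_eq_self
            (fun t => (Ioo δ r).indicator (fun t => ψ (Φ (e * t) (Φ s z)).1) (e * t)) s]
          rcases eq_or_eq_neg_of_abs_eq he with h1 | h1
          · simp only [h1, one_mul]
          · simp only [h1, neg_mul, one_mul]
            exact lintegral_neg_eq_self
              (fun t => (Ioo δ r).indicator (fun t => ψ (Φ (-t) (Φ s z)).1) t)
      _ = _ := lintegral_indicator measurableSet_Ioo _
  calc _ = ∫⁻ z, (∫⁻ s in J, S.orbitDomain.indicator (fun q => F (Φ q.2 q.1).1) (z, s) *
        (∫⁻ t in I, S.orbitDomain.indicator (fun q => G (Φ q.2 q.1).1) (z, t))) ∂S.bulk := by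
        refine lintegral_congr fun z => ?_
        exact (lintegral_mul_const _ (hFm.comp measurable_prodMk_left)).symm
    _ ≤ ∫⁻ z, (∫⁻ s in J, S.orbitDomain.indicator (fun q => P (Φ q.2 q.1)) (z, s)) ∂S.bulk := by
        refine lintegral_mono fun z => setLIntegral_mono' hJ fun s hs => key s hs z
    _ = ∫⁻ s in J, (∫⁻ z, S.orbitDomain.indicator (fun q => P (Φ q.2 q.1)) (z, s) ∂S.bulk) := by
        refine lintegral_lintegral_swap (Measurable.aemeasurable ?_)
        exact (hP.comp Φ.measurable_flow_swap).indicator hD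
    _ ≤ ∫⁻ s in J, C₁ * (C₂ * (∫⁻ z, f z ∂S.bulk) * ∫⁻ z, g z ∂S.bulk) := by
        refine lintegral_mono fun s => (Φ.lintegral_preimage_le hnt (hC₁ s) hP).trans ?_
        gcongr
    _ = _ := by
        rw [setLIntegral_const]
        push_cast
        ring

/-- The indicator of the times between `-b` and `-a`. -/
noncomputable def pastWeight (a b : ℝ) : ℝ → ℝ := (Ico (-b) (-a)).indicator 1

theorem isWeight_pastWeight (a b : ℝ) : IsWeight (pastWeight a b) where
  measurable := measurable_one.indicator measurableSet_Ico
  nonneg := fun s => indicator_nonneg (fun _ _ => zero_le_one) s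
  bounded := ⟨1, fun s => indicator_le_self' (fun _ _ => zero_le_one) s⟩

theorem integrable_pastWeight (a b : ℝ) : Integrable (pastWeight a b) :=
  (integrable_indicator_iff measurableSet_Ico).2 (integrableOn_const (by simp))

theorem integral_pastWeight {a b : ℝ} (h : a ≤ b) : ∫ s, pastWeight a b s = b - a := by
  rw [pastWeight, integral_indicator_one measurableSet_Ico, Real.volume_real_Ico_of_le (by linarith)]
  ring

theorem pastWeight_add {a b c : ℝ} (hab : a ≤ b) (hbc : b ≤ c) (s : ℝ) :
    pastWeight a c s = pastWeight a b s + pastWeight b c s := by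
  have h : Ico (-c) (-a) = Ico (-b) (-a) ∪ Ico (-c) (-b) := by
    rw [union_comm, Ico_union_Ico_eq_Ico (by linarith) (by linarith)]
  have hd : Disjoint (Ico (-b) (-a)) (Ico (-c) (-b)) := by
    rw [disjoint_left]
    exact fun x hx hy => absurd hx.1 (not_le.2 hy.2)
  rw [pastWeight, h, indicator_union_of_disjoint hd]
  rfl

theorem orbitIntegral_pastWeight_add {κ : Measure (RSpace n × RSpace n)} (hΦ : Φ.OrbitBound κ)
    (hnt : S.NonTrapping) {a b c : ℝ} (hab : a ≤ b) (hbc : b ≤ c) (u : Lp 𝕜 2 S.bulk) :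
    Φ.orbitIntegral (pastWeight a c) u =ᵐ[κ]
      Φ.orbitIntegral (pastWeight a b) u + Φ.orbitIntegral (pastWeight b c) u := by
  filter_upwards [OrbitBound.ae_integrable_orbitTerm Φ hΦ hnt (isWeight_pastWeight a b) (Lp.memLp u),
    OrbitBound.ae_integrable_orbitTerm Φ hΦ hnt (isWeight_pastWeight b c) (Lp.memLp u)] with z h2 h3
  rw [Pi.add_apply, orbitIntegral, orbitIntegral, orbitIntegral, ← integral_add h2 h3]
  refine integral_congr_ae (Eventually.of_forall fun s => ?_)
  simp only [orbitTerm]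
  by_cases hD : (z, s) ∈ S.orbitDomain
  · simp only [indicator_of_mem hD, ← add_smul, pastWeight_add hab hbc]
  · simp only [indicator_of_notMem hD, add_zero]

theorem enorm_orbitIntegral_pastWeight_le (a b : ℝ) (g : RSpace n × RSpace n → 𝕜)
    (z : RSpace n × RSpace n) : ‖Φ.orbitIntegral (pastWeight a b) g z‖ₑ ≤
      ∫⁻ s in Ico (-b) (-a), S.orbitDomain.indicator (fun q => ‖g (Φ q.2 q.1)‖ₑ) (z, s) := by
  refine (enorm_integral_le_lintegral_enorm _).trans ?_
  rw [← lintegral_indicator measurableSet_Ico]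
  refine lintegral_mono fun s => ?_
  rw [Φ.enorm_orbitTerm (isWeight_pastWeight a b)]
  simp only [pastWeight]
  by_cases hs : s ∈ Ico (-b) (-a)
  · simp only [indicator_of_mem hs, Pi.one_apply, ENNReal.ofReal_one, one_mul, le_refl]
  · simp only [indicator_of_notMem hs, ENNReal.ofReal_zero, zero_mul, le_refl]

/-- Shifting the time window along the flow. -/
theorem orbitIntegral_pastWeight_shift (hnt : S.NonTrapping) {c d : ℝ} (hc : 0 ≤ c)
    (g : RSpace n × RSpace n → 𝕜) {z : RSpace n × RSpace n} (hz : z ∈ S.bundle S.Ω) :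
    Φ.orbitIntegral (pastWeight c (d + c)) g z =
      S.orbitDomain.indicator (fun q => Φ.orbitIntegral (pastWeight 0 d) g (Φ q.2 q.1)) (z, -c) := by
  have hneg := entryTime_neg_exitTime_pos hnt hz
  have hterm : ∀ s, Φ.orbitTerm (pastWeight c (d + c)) g (z, s + -c) =
      S.orbitDomain.indicator (fun q => Φ.orbitTerm (pastWeight 0 d) g (Φ q.2 q.1, s)) (z, -c) := by
    intro s
    have hw : pastWeight c (d + c) (s + -c) = pastWeight 0 d s := by
      have h1 : s + -c ∈ Ico (-(d + c)) (-c) ↔ s ∈ Ico (-d) (-0) := by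
        simp only [mem_Ico, neg_zero]
        constructor <;> rintro ⟨h1, h2⟩ <;> constructor <;> linarith
      simp only [pastWeight, indicator_apply, h1, Pi.one_apply]
    by_cases hzc : (z, -c) ∈ S.orbitDomain
    · have hiff := Φ.mem_orbitDomain_map_iff (s := s) hnt hzc.1
        (Ioo_subset_residence hnt hzc.1 hzc.2)
      rw [indicator_of_mem hzc]
      simp only [orbitTerm]
      by_cases hs : (z, s + -c) ∈ S.orbitDomain
      · rw [indicator_of_mem hs, indicator_of_mem (hiff.2 hs)]
        simp only [hw, Φ.map_add]
      · rw [indicator_of_notMem hs, indicator_of_notMem (mt hiff.1 hs)]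
    · rw [indicator_of_notMem hzc, orbitTerm]
      by_cases hs : (z, s + -c) ∈ S.orbitDomain
      · rw [indicator_of_mem hs]
        simp only [pastWeight]
        rw [indicator_of_notMem, zero_smul]
        rintro ⟨h1, h2⟩
        refine hzc ⟨hs.1, ?_, ?_⟩
        · have h3 : S.entryTime z < s + -c := hs.2.1
          change S.entryTime z < -c
          linarith
        · change -c < S.exitTime z
          linarith [hneg.2]
      · rw [indicator_of_notMem hs]
  rw [orbitIntegral, ← integral_add_right_eq_self _ (-c)]
  simp only [hterm]
  by_cases hzc : (z, -c) ∈ S.orbitDomain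
  · simp only [indicator_of_mem hzc]
    rfl
  · simp only [indicator_of_notMem hzc, integral_zero]

end CutoffFlow

end TransportSetting

/-! ### Almost orthogonal sums -/

section AlmostOrthogonal

variable {𝕜 H : Type*} [RCLike 𝕜] [NormedAddCommGroup H] [InnerProductSpace 𝕜 H]

theorem norm_sum_sq_le_sum_norm_inner (N : ℕ) (v : ℕ → H) :
    ‖∑ a ∈ Finset.range N, v a‖ ^ 2 ≤
      ∑ a ∈ Finset.range N, ∑ b ∈ Finset.range N, ‖inner 𝕜 (v a) (v b)‖ := by
  rw [← inner_self_eq_norm_sq (𝕜 := 𝕜), sum_inner]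
  simp only [inner_sum]
  refine (RCLike.re_le_norm _).trans ((norm_sum_le _ _).trans (Finset.sum_le_sum fun a _ => ?_))
  exact norm_sum_le _ _

theorem card_filter_near_le (N a : ℕ) :
    ((Finset.range N).filter fun b => ¬(a + 2 ≤ b ∨ b + 2 ≤ a)).card ≤ 3 := by
  have h : ((Finset.range N).filter fun b => ¬(a + 2 ≤ b ∨ b + 2 ≤ a)) ⊆ {a - 1, a, a + 1} := by
    intro b hb
    simp only [Finset.mem_filter, Finset.mem_insert, Finset.mem_singleton] at hb ⊢
    omega
  exact (Finset.card_le_card h).trans Finset.card_le_three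

/-- Sums of vectors with asymptotically orthogonal distant terms. -/
theorem eventually_norm_sum_sq_le (N : ℕ) (v : ℕ → ℕ → H) {c ε : ℝ} (hε : 0 < ε)
    (hc : ∀ a < N, ∀ i, ‖v a i‖ ≤ c)
    (hv : ∀ a < N, ∀ b < N, a + 2 ≤ b ∨ b + 2 ≤ a →
      Tendsto (fun i => inner 𝕜 (v a i) (v b i)) atTop (𝓝 0)) :
    ∀ᶠ i in atTop, ‖∑ a ∈ Finset.range N, v a i‖ ^ 2 ≤ 3 * N * c ^ 2 + ε := by
  -- Distant pairs disappear in the limit; each index has at most three neighbours, including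
  -- itself, and those pairs are bounded by `c ^ 2`.
  have h1 : Tendsto (fun i => ∑ a ∈ Finset.range N, ∑ b ∈ Finset.range N,
      if a + 2 ≤ b ∨ b + 2 ≤ a then ‖inner 𝕜 (v a i) (v b i)‖ else c ^ 2) atTop
      (𝓝 (∑ a ∈ Finset.range N, ∑ b ∈ Finset.range N,
        if a + 2 ≤ b ∨ b + 2 ≤ a then 0 else c ^ 2)) := by
    refine tendsto_finsetSum _ fun a ha => tendsto_finsetSum _ fun b hb => ?_
    split_ifs with h
    · have := (hv a (Finset.mem_range.1 ha) b (Finset.mem_range.1 hb) h).norm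
      rwa [norm_zero] at this
    · exact tendsto_const_nhds
  have h2 : ∑ a ∈ Finset.range N, ∑ b ∈ Finset.range N,
        (if a + 2 ≤ b ∨ b + 2 ≤ a then 0 else c ^ 2) ≤ 3 * N * c ^ 2 := by
    calc _ ≤ ∑ a ∈ Finset.range N, 3 * c ^ 2 := by
          refine Finset.sum_le_sum fun a _ => ?_
          rw [Finset.sum_ite, Finset.sum_const_zero, zero_add, Finset.sum_const, nsmul_eq_mul]
          gcongr
          exact_mod_cast card_filter_near_le N a
      _ = _ := by
          rw [Finset.sum_const, Finset.card_range, nsmul_eq_mul]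
          ring
  filter_upwards [h1.eventually (gt_mem_nhds (lt_of_le_of_lt h2 (lt_add_of_pos_right _ hε)))] with i hi
  refine (norm_sum_sq_le_sum_norm_inner (𝕜 := 𝕜) N fun a => v a i).trans (le_trans ?_ hi.le)
  refine Finset.sum_le_sum fun a ha => Finset.sum_le_sum fun b hb => ?_
  split_ifs with h
  · exact le_rfl
  · have h3 := hc a (Finset.mem_range.1 ha) i
    have h4 := hc b (Finset.mem_range.1 hb) i
    calc _ ≤ ‖v a i‖ * ‖v b i‖ := norm_inner_le_norm _ _
      _ ≤ c * c := mul_le_mul h3 h4 (norm_nonneg _) ((norm_nonneg _).trans h3)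
      _ = _ := (sq c).symm

end AlmostOrthogonal

theorem exists_integral_norm_le {X 𝕜 : Type*} [RCLike 𝕜] [MeasurableSpace X] (μ : Measure X)
    [IsFiniteMeasure μ] : ∃ M : ℝ, 0 ≤ M ∧ ∀ u : Lp 𝕜 2 μ, ∫ x, ‖u x‖ ∂μ ≤ M * ‖u‖ := by
  refine ⟨((μ univ) ^ (1 / 2 : ℝ)).toReal, ENNReal.toReal_nonneg, fun u => ?_⟩
  have h := eLpNorm_le_eLpNorm_mul_rpow_measure_univ (μ := μ) (p := 1) (q := 2) one_le_two
    (Lp.aestronglyMeasurable u)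
  have h1 : (1 / (1 : ENNReal).toReal - 1 / (2 : ENNReal).toReal) = (1 / 2 : ℝ) := by norm_num
  rw [h1] at h
  have hfin : (μ univ) ^ (1 / 2 : ℝ) ≠ ⊤ := by finiteness
  have h2 := ENNReal.toReal_mono (ENNReal.mul_ne_top (Lp.eLpNorm_ne_top u) hfin) h
  rw [ENNReal.toReal_mul, eLpNorm_one_eq_lintegral_enorm,
    ← integral_norm_eq_lintegral_enorm (Lp.aestronglyMeasurable u)] at h2
  rw [Lp.norm_def, mul_comm]
  exact h2

/-- By duality the estimate says that the adjoint of `B` composed with `A` maps L² into bounded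
functions. It therefore tends to zero in norm along orthonormal sequences, and so does its pairing
with the unit vectors `x i`. -/
theorem tendsto_inner_of_norm_inner_le {X 𝕜 : Type*} [RCLike 𝕜] [MeasurableSpace X]
    {μ : Measure X} [IsFiniteMeasure μ] (A B : Lp 𝕜 2 μ →L[𝕜] Lp 𝕜 2 μ) {C : ℝ} (hC : 0 ≤ C)
    (h : ∀ u h, ‖inner 𝕜 (B h) (A u)‖ ≤ C * (∫ z, ‖u z‖ ∂μ) * ∫ z, ‖h z‖ ∂μ)
    (x : ℕ → Lp 𝕜 2 μ) (hx : Orthonormal 𝕜 x) :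
    Tendsto (fun i => inner 𝕜 (B (x i)) (A (x i))) atTop (𝓝 0) := by
  obtain ⟨M, -, hM⟩ := exists_integral_norm_le (𝕜 := 𝕜) μ
  obtain ⟨T, hT⟩ : ∃ T : Lp 𝕜 2 μ →L[𝕜] Lp 𝕜 2 μ, ∀ h u, inner 𝕜 h (T u) = inner 𝕜 (B h) (A u) :=
    ⟨(ContinuousLinearMap.adjoint B) ∘L A,
      fun h u => ContinuousLinearMap.adjoint_inner_right B h (A u)⟩
  have hTx := tendsto_orthonormal_of_ae_bound T (C := C * M) (fun u => ?_) x hx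
  · refine squeeze_zero_norm (fun i => ?_) (tendsto_zero_iff_norm_tendsto_zero.1 hTx)
    rw [← hT]
    refine (norm_inner_le_norm _ _).trans_eq ?_
    rw [hx.1, one_mul]
  · have h1 := ae_norm_le_of_norm_inner_le (T u) (C := C * ∫ z, ‖u z‖ ∂μ) fun v => by
      rw [hT]
      exact h u v
    filter_upwards [h1] with z hz
    refine hz.trans ?_
    rw [mul_assoc]
    exact mul_le_mul_of_nonneg_left (hM u) hC

/-! ### Compactness of integration after scattering -/

namespace TransportSetting

open scoped NNReal ENNReal

variable {n : ℕ} {S : TransportSetting n} {𝕜 : Type*} [RCLike 𝕜]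

namespace CutoffFlow

variable (Φ : S.CutoffFlow)

theorem enorm_orbitIntegral_scattering_le (a b : ℝ) (k : C(S.closedBundle₂, 𝕜))
    {u : RSpace n × RSpace n → 𝕜} (z : RSpace n × RSpace n) :
    ‖Φ.orbitIntegral (pastWeight a b) (S.scattering k u) z‖ₑ ≤
      ‖k‖ₑ * ∫⁻ s in Ico (-b) (-a), S.orbitDomain.indicator
        (fun q => S.fiberInt (fun z => ‖u z‖ₑ) (Φ q.2 q.1).1) (z, s) := by
  refine (Φ.enorm_orbitIntegral_pastWeight_le a b _ z).trans ?_
  rw [← lintegral_const_mul' _ _ enorm_ne_top]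
  refine lintegral_mono fun s => ?_
  by_cases hD : (z, s) ∈ S.orbitDomain
  · simp only [indicator_of_mem hD]
    exact enorm_scattering_le k u _
  · simp only [indicator_of_notMem hD, zero_le]

/-- Contributions of two short and separated time windows pair like an operator with a bounded
kernel. -/
theorem exists_norm_inner_le (hn : n ≠ 0) (hconv : S.StrictlyConvexBoundary)
    (hnt : S.NonTrapping) : ∃ r > 0, ∀ δ > 0, ∀ k : C(S.closedBundle₂, 𝕜), ∀ a b a' b' e : ℝ,
      |e| = 1 → (∀ t ∈ Ico (-b) (-a), ∀ s ∈ Ico (-b') (-a'), e * (t - s) ∈ Ioo δ r) →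
      ∃ C : ℝ, 0 ≤ C ∧ ∀ u h U H : Lp 𝕜 2 S.bulk,
        U =ᵐ[S.bulk] Φ.orbitIntegral (pastWeight a b) (S.scattering k u) →
        H =ᵐ[S.bulk] Φ.orbitIntegral (pastWeight a' b') (S.scattering k h) →
        ‖inner 𝕜 H U‖ ≤ C * (∫ z, ‖u z‖ ∂S.bulk) * ∫ z, ‖h z‖ ∂S.bulk := by
  obtain ⟨r, hr, hpair⟩ := Φ.exists_lintegral_pair_le hn hconv hnt
  refine ⟨r, hr, fun δ hδ k a b a' b' e he hI => ?_⟩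
  obtain ⟨C, hC⟩ := hpair δ hδ
  have hV : volume (Ico (-b') (-a')) ≠ ⊤ := by simp
  refine ⟨(‖k‖ₑ ^ 2 * (C * volume (Ico (-b') (-a')))).toReal, ENNReal.toReal_nonneg,
    fun u h U H hU hH => ?_⟩
  have hD := measurableSet_orbitDomain hnt
  have hum : Measurable fun z => ‖u z‖ₑ := (Lp.stronglyMeasurable u).measurable.enorm
  have hhm : Measurable fun z => ‖h z‖ₑ := (Lp.stronglyMeasurable h).measurable.enorm
  have hui : Integrable u S.bulk := (Lp.memLp u).integrable one_le_two
  have hhi : Integrable h S.bulk := (Lp.memLp h).integrable one_le_two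
  have key : ‖inner 𝕜 H U‖ₑ ≤ ‖k‖ₑ ^ 2 * (C * volume (Ico (-b') (-a'))) *
      (∫⁻ z, ‖u z‖ₑ ∂S.bulk) * ∫⁻ z, ‖h z‖ₑ ∂S.bulk := by
    rw [L2.inner_def]
    refine (enorm_integral_le_lintegral_enorm _).trans ?_
    calc _ ≤ ∫⁻ z, ‖k‖ₑ ^ 2 * ((∫⁻ s in Ico (-b') (-a'), S.orbitDomain.indicator
            (fun q => S.fiberInt (fun z => ‖h z‖ₑ) (Φ q.2 q.1).1) (z, s)) *
          (∫⁻ s in Ico (-b) (-a), S.orbitDomain.indicator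
            (fun q => S.fiberInt (fun z => ‖u z‖ₑ) (Φ q.2 q.1).1) (z, s))) ∂S.bulk := by
          refine lintegral_mono_ae ?_
          filter_upwards [hU, hH] with z hUz hHz
          have h1 : ‖inner 𝕜 (H z) (U z)‖ₑ ≤ ‖H z‖ₑ * ‖U z‖ₑ := by
            rw [← ofReal_norm, ← ofReal_norm, ← ofReal_norm, ← ENNReal.ofReal_mul (norm_nonneg _)]
            exact ENNReal.ofReal_le_ofReal (norm_inner_le_norm _ _)
          refine h1.trans ?_
          rw [hUz, hHz]
          refine (mul_le_mul' (Φ.enorm_orbitIntegral_scattering_le a' b' k z)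
            (Φ.enorm_orbitIntegral_scattering_le a b k z)).trans_eq ?_
          ring
      _ ≤ _ := by
          rw [lintegral_const_mul' _ _ (by simp)]
          refine (mul_le_mul_right (hC e he _ _ measurableSet_Ico measurableSet_Ico hI _ _ hhm hum)
            _).trans_eq ?_
          ring
  have h3 := ENNReal.toReal_mono (b := ‖k‖ₑ ^ 2 * (C * volume (Ico (-b') (-a'))) *
      (∫⁻ z, ‖u z‖ₑ ∂S.bulk) * ∫⁻ z, ‖h z‖ₑ ∂S.bulk) (by
        have h1 : ∫⁻ z, ‖u z‖ₑ ∂S.bulk ≠ ⊤ := hui.2.ne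
        have h2 : ∫⁻ z, ‖h z‖ₑ ∂S.bulk ≠ ⊤ := hhi.2.ne
        finiteness) key
  rw [toReal_enorm, ENNReal.toReal_mul, ENNReal.toReal_mul,
    ← integral_norm_eq_lintegral_enorm (Lp.aestronglyMeasurable u),
    ← integral_norm_eq_lintegral_enorm (Lp.aestronglyMeasurable h)] at h3
  exact h3

variable {R : ℝ → ℝ → Lp 𝕜 2 S.bulk →L[𝕜] Lp 𝕜 2 S.bulk} {k : C(S.closedBundle₂, 𝕜)}
  {K : Lp 𝕜 2 S.bulk →L[𝕜] Lp 𝕜 2 S.bulk}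

theorem orbitOp_scattering (hn : n ≠ 0) (hconv : S.StrictlyConvexBoundary)
    (hnt : S.NonTrapping) (hR : ∀ a b u, R a b u =ᵐ[S.bulk] Φ.orbitIntegral (pastWeight a b) u)
    (hK : ∀ u, K u =ᵐ[S.bulk] S.scattering k u) (a b : ℝ) (u : Lp 𝕜 2 S.bulk) :
    R a b (K u) =ᵐ[S.bulk] Φ.orbitIntegral (pastWeight a b) (S.scattering k u) :=
  (hR a b _).trans (Φ.orbitIntegral_congr (Φ.orbitBound_bulk hn hconv hnt) hnt (hK u))

theorem exists_tendsto_inner (hn : n ≠ 0) (hconv : S.StrictlyConvexBoundary)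
    (hnt : S.NonTrapping) (hR : ∀ a b u, R a b u =ᵐ[S.bulk] Φ.orbitIntegral (pastWeight a b) u) :
    ∃ r > 0, ∀ k : C(S.closedBundle₂, 𝕜), ∀ K : Lp 𝕜 2 S.bulk →L[𝕜] Lp 𝕜 2 S.bulk,
      (∀ u, K u =ᵐ[S.bulk] S.scattering k u) → ∀ x : ℕ → Lp 𝕜 2 S.bulk, Orthonormal 𝕜 x →
      ∀ δ > 0, ∀ a b a' b' e : ℝ, |e| = 1 →
      (∀ t ∈ Ico (-b) (-a), ∀ s ∈ Ico (-b') (-a'), e * (t - s) ∈ Ioo δ r) →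
      Tendsto (fun i => inner 𝕜 (R a' b' (K (x i))) (R a b (K (x i)))) atTop (𝓝 0) := by
  obtain ⟨r, hr, hinner⟩ := Φ.exists_norm_inner_le (𝕜 := 𝕜) hn hconv hnt
  refine ⟨r, hr, fun k K hK x hx δ hδ a b a' b' e he hI => ?_⟩
  obtain ⟨C, hC0, hC⟩ := hinner δ hδ k a b a' b' e he hI
  refine tendsto_inner_of_norm_inner_le (R a b ∘L K) (R a' b' ∘L K) hC0 (fun u h => ?_) x hx
  exact hC u h _ _ (Φ.orbitOp_scattering hn hconv hnt hR hK a b u)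
    (Φ.orbitOp_scattering hn hconv hnt hR hK a' b' h)

theorem orbitOp_add (hn : n ≠ 0) (hconv : S.StrictlyConvexBoundary)
    (hnt : S.NonTrapping) (hR : ∀ a b u, R a b u =ᵐ[S.bulk] Φ.orbitIntegral (pastWeight a b) u)
    {a b c : ℝ} (hab : a ≤ b) (hbc : b ≤ c) (u : Lp 𝕜 2 S.bulk) :
    R a c u = R a b u + R b c u := by
  refine Lp.ext ?_
  filter_upwards [hR a c u, hR a b u, hR b c u, Lp.coeFn_add (R a b u) (R b c u),
    Φ.orbitIntegral_pastWeight_add (Φ.orbitBound_bulk hn hconv hnt) hnt hab hbc u]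
    with z h1 h2 h3 h4 h5
  rw [h4, Pi.add_apply, h2, h3, h1, h5, Pi.add_apply]

theorem orbitOp_sum (hn : n ≠ 0) (hconv : S.StrictlyConvexBoundary)
    (hnt : S.NonTrapping) (hR : ∀ a b u, R a b u =ᵐ[S.bulk] Φ.orbitIntegral (pastWeight a b) u)
    {η : ℝ} (hη : 0 ≤ η) (N : ℕ) (u : Lp 𝕜 2 S.bulk) :
    R 0 (N * η) u = ∑ a ∈ Finset.range N, R (a * η) (η + a * η) u := by
  induction N with
  | zero =>
    have h := Φ.orbitOp_add hn hconv hnt hR (le_refl (0 : ℝ)) (le_refl (0 : ℝ)) u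
    simpa using h
  | succ N ih =>
    rw [Finset.sum_range_succ, ← ih]
    have h := Φ.orbitOp_add hn hconv hnt hR (a := 0) (b := N * η) (c := η + N * η)
      (by positivity) (by linarith) u
    rw [← h]
    congr 2
    push_cast
    ring

/-- On the image of the scattering operator, integration over a short time is compact. -/
theorem exists_tendsto_short (hn : n ≠ 0) (hconv : S.StrictlyConvexBoundary)
    (hnt : S.NonTrapping) (hR : ∀ a b u, R a b u =ᵐ[S.bulk] Φ.orbitIntegral (pastWeight a b) u)
    {C : ℝ} (hC : 0 ≤ C) (hRC : ∀ a b, a ≤ b → ‖R a b‖ ≤ C * (b - a)) :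
    ∃ r > 0, ∀ k : C(S.closedBundle₂, 𝕜), ∀ K : Lp 𝕜 2 S.bulk →L[𝕜] Lp 𝕜 2 S.bulk,
      (∀ u, K u =ᵐ[S.bulk] S.scattering k u) → ∀ x : ℕ → Lp 𝕜 2 S.bulk, Orthonormal 𝕜 x →
      Tendsto (fun i => R 0 r (K (x i))) atTop (𝓝 0) := by
  obtain ⟨r, hr, hinner⟩ := Φ.exists_tendsto_inner hn hconv hnt hR
  refine ⟨r, hr, fun k K hK x hx => ?_⟩
  have hsq : Tendsto (fun i => ‖R 0 r (K (x i))‖ ^ 2) atTop (𝓝 0) := by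
    refine tendsto_order.2 ⟨fun ε hε => Eventually.of_forall fun i => hε.trans_le (sq_nonneg _),
      fun ε hε => ?_⟩
    -- Each of the N windows has norm O(r/N), so the neighbouring pairs contribute at most `3 * (C *
    -- r * ‖K‖) ^ 2 / N`, made smaller than `ε / 2`.
    obtain ⟨N, hN⟩ := exists_nat_gt (3 * (C * r * ‖K‖) ^ 2 / (ε / 2))
    have hNpos : (0 : ℝ) < N := lt_of_le_of_lt (by positivity) hN
    have hη : 0 < r / N := by positivity
    set η := r / N with hηdef
    have hNη : N * η = r := by rw [hηdef]; field_simp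
    have hev := eventually_norm_sum_sq_le (𝕜 := 𝕜) N (fun a i => R (a * η) (η + a * η) (K (x i)))
      (c := C * η * ‖K‖) (half_pos (half_pos hε)) (fun a _ i => ?_) (fun a ha b hb hab => ?_)
    · filter_upwards [hev] with i hi
      rw [← Φ.orbitOp_sum hn hconv hnt hR hη.le, hNη] at hi
      refine lt_of_le_of_lt hi ?_
      have h1 : 3 * (N : ℝ) * (C * η * ‖K‖) ^ 2 = 3 * (C * r * ‖K‖) ^ 2 / N := by
        rw [hηdef]; field_simp
      have h2 : 3 * (C * r * ‖K‖) ^ 2 / N < ε / 2 := by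
        rw [div_lt_iff₀ (by positivity)] at hN ⊢
        linarith
      linarith
    · have h1 := hRC (a * η) (η + a * η) (by linarith)
      rw [add_sub_cancel_right] at h1
      have h2 : ‖K (x i)‖ ≤ ‖K‖ := by
        have := K.le_opNorm (x i)
        rwa [hx.1, mul_one] at this
      exact ((R _ _).le_opNorm _).trans (mul_le_mul h1 h2 (norm_nonneg _) (by positivity))
    -- Windows whose indices differ by at least 2 are separated in time by at least one full window
    -- `η`, and all time differences stay below `r`; `e` records which window is earlier.
    · have ha' : (a : ℝ) + 1 ≤ N := by exact_mod_cast ha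
      have hb' : (b : ℝ) + 1 ≤ N := by exact_mod_cast hb
      have ha'' := mul_le_mul_of_nonneg_right ha' hη.le
      have hb'' := mul_le_mul_of_nonneg_right hb' hη.le
      have ha0 : 0 ≤ a * η := by positivity
      have hb0 : 0 ≤ b * η := by positivity
      rcases hab with hab | hab
      · have h3 : (a : ℝ) + 2 ≤ b := by exact_mod_cast hab
        have h4 := mul_le_mul_of_nonneg_right h3 hη.le
        refine hinner k K hK x hx η hη _ _ _ _ (-1) (by simp) fun t ht s hs => ?_
        constructor
        · linarith [ht.1, ht.2, hs.1, hs.2]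
        · linarith [ht.1, ht.2, hs.1, hs.2]
      · have h3 : (b : ℝ) + 2 ≤ a := by exact_mod_cast hab
        have h4 := mul_le_mul_of_nonneg_right h3 hη.le
        refine hinner k K hK x hx η hη _ _ _ _ 1 (by simp) fun t ht s hs => ?_
        constructor
        · linarith [ht.1, ht.2, hs.1, hs.2]
        · linarith [ht.1, ht.2, hs.1, hs.2]
  rw [tendsto_zero_iff_norm_tendsto_zero]
  have := (Real.continuous_sqrt.tendsto 0).comp hsq
  simpa [Function.comp_def, Real.sqrt_sq (norm_nonneg _)] using this

/-- Integration over the shifted window is the unshifted integral evaluated at `Φ (-c) z`, or zero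
if the trajectory does not reach back so far. Composition with the flow at a fixed time is bounded
in L². -/
theorem exists_norm_shift_le (hn : n ≠ 0) (hconv : S.StrictlyConvexBoundary)
    (hnt : S.NonTrapping) (hR : ∀ a b u, R a b u =ᵐ[S.bulk] Φ.orbitIntegral (pastWeight a b) u) :
    ∃ M : ℝ, ∀ c ≥ 0, ∀ d u, ‖R c (d + c) u‖ ≤ M * ‖R 0 d u‖ := by
  obtain ⟨C, hC⟩ := Φ.exists_bulk_preimage_le hn hconv hnt
  refine ⟨Real.sqrt C, fun c hc d u => ?_⟩
  have hu := Lp.stronglyMeasurable u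
  have hm : Measurable fun z => ‖Φ.orbitIntegral (pastWeight 0 d) u z‖ₑ ^ 2 :=
    (Φ.stronglyMeasurable_orbitIntegral hnt (isWeight_pastWeight 0 d).measurable
      hu).measurable.enorm.pow_const 2
  have h1 : eLpNorm (R c (d + c) u) 2 S.bulk ^ 2 ≤ C * eLpNorm (R 0 d u) 2 S.bulk ^ 2 := by
    rw [eLpNorm_congr_ae (hR c (d + c) u), eLpNorm_congr_ae (hR 0 d u), eLpNorm_two_sq,
      eLpNorm_two_sq]
    refine le_trans (lintegral_mono_ae ?_) (Φ.lintegral_preimage_le hnt (hC (-c)) hm)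
    filter_upwards [ae_mem_bundle (S := S)] with z hz
    rw [Φ.orbitIntegral_pastWeight_shift hnt hc _ hz]
    by_cases hD : (z, -c) ∈ S.orbitDomain
    · simp only [indicator_of_mem hD, le_refl]
    · simp only [indicator_of_notMem hD, enorm_zero]
      simp
  have h2 : ‖R c (d + c) u‖ ^ 2 ≤ C * ‖R 0 d u‖ ^ 2 := by
    rw [Lp.norm_def, Lp.norm_def, ← ENNReal.toReal_pow, ← ENNReal.toReal_pow,
      ← ENNReal.coe_toReal C, ← ENNReal.toReal_mul]
    exact ENNReal.toReal_mono (by have := Lp.eLpNorm_ne_top (R 0 d u); finiteness) h1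
  have h3 := Real.sqrt_le_sqrt h2
  rwa [Real.sqrt_sq (norm_nonneg _), Real.sqrt_mul (NNReal.coe_nonneg C),
    Real.sqrt_sq (norm_nonneg _)] at h3

/-- Integration along trajectories is compact on the image of the scattering operator. -/
theorem exists_tendsto_orbitOp_scattering (hn : n ≠ 0) (hconv : S.StrictlyConvexBoundary)
    (hnt : S.NonTrapping) (hR : ∀ a b u, R a b u =ᵐ[S.bulk] Φ.orbitIntegral (pastWeight a b) u)
    {C : ℝ} (hC : 0 ≤ C) (hRC : ∀ a b, a ≤ b → ‖R a b‖ ≤ C * (b - a)) (T : ℝ) :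
    ∃ T' ≥ T, 0 ≤ T' ∧ ∀ k : C(S.closedBundle₂, 𝕜), ∀ K : Lp 𝕜 2 S.bulk →L[𝕜] Lp 𝕜 2 S.bulk,
      (∀ u, K u =ᵐ[S.bulk] S.scattering k u) → ∀ x : ℕ → Lp 𝕜 2 S.bulk, Orthonormal 𝕜 x →
      Tendsto (fun i => R 0 T' (K (x i))) atTop (𝓝 0) := by
  obtain ⟨r, hr, hshort⟩ := Φ.exists_tendsto_short hn hconv hnt hR hC hRC
  obtain ⟨M, hM⟩ := Φ.exists_norm_shift_le hn hconv hnt hR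
  obtain ⟨N, hN⟩ := exists_nat_ge (T / r)
  refine ⟨N * r, (div_le_iff₀ hr).1 hN, by positivity, fun k K hK x hx => ?_⟩
  simp only [Φ.orbitOp_sum hn hconv hnt hR hr.le]
  have h0 : (0 : Lp 𝕜 2 S.bulk) = ∑ _j ∈ Finset.range N, 0 := Finset.sum_const_zero.symm
  rw [h0]
  refine tendsto_finsetSum _ fun j _ => ?_
  refine squeeze_zero_norm (fun i => hM (j * r) (by positivity) r (K (x i))) ?_
  have h1 := ((hshort k K hK x hx).norm).const_mul M
  rwa [norm_zero, mul_zero] at h1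

end CutoffFlow

end TransportSetting

/-! ### Orbit integrals as primitives along trajectories -/

namespace TransportSetting

open scoped NNReal ENNReal

variable {n : ℕ} {S : TransportSetting n} {𝕜 : Type*} [RCLike 𝕜]

namespace CutoffFlow

variable (Φ : S.CutoffFlow)

/-- A function along the trajectory of a point, extended by zero. -/
noncomputable def alongOrbit (h : RSpace n × RSpace n → 𝕜) (z : RSpace n × RSpace n) (t : ℝ) : 𝕜 :=
  S.orbitDomain.indicator (fun q => h (Φ q.2 q.1)) (z, t)

variable {T : ℝ} {h g w : RSpace n × RSpace n → 𝕜} {z : RSpace n × RSpace n}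

/-- The orbit integral along a trajectory is a primitive that starts at the entry point. -/
theorem orbitIntegral_map (hnt : S.NonTrapping)
    (hT : ∀ z ∈ S.closedBundle, ∀ t ∈ S.residence z, |t| ≤ T) {b : ℝ} (hz : z ∈ S.closedBundle)
    (hb : b ∈ S.residence z) :
    Φ.orbitIntegral (pastWeight 0 T) h (Φ b z) = ∫ t in S.entryTime z..b, Φ.alongOrbit h z t := by
  -- Since `T` bounds all travel times, the window starting at `-T` loses nothing: the weight only
  -- selects the part of the trajectory before time `b`.
  have hterm : ∀ t, Φ.orbitTerm (pastWeight 0 T) h (Φ b z, t - b) =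
      (Ioo (S.entryTime z) b).indicator (Φ.alongOrbit h z) t := by
    intro t
    have hiff := Φ.mem_orbitDomain_map_iff (s := t - b) hnt hz hb
    rw [sub_add_cancel] at hiff
    by_cases hD : (z, t) ∈ S.orbitDomain
    · have hD' := hiff.2 hD
      have habs := hT _ hD'.1 _ (Ioo_subset_residence hnt hD'.1 hD'.2)
      rw [orbitTerm, indicator_of_mem hD']
      simp only [← Φ.map_add, sub_add_cancel]
      rcases lt_or_ge t b with htb | htb
      · have h1 : t - b ∈ Ico (-T) (-0) := ⟨(abs_le.1 habs).1, by rw [neg_zero]; linarith⟩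
        have h2 : t ∈ Ioo (S.entryTime z) b := ⟨hD.2.1, htb⟩
        rw [indicator_of_mem h2, alongOrbit,
          indicator_of_mem hD, pastWeight, indicator_of_mem h1, Pi.one_apply, one_smul]
      · have h1 : t - b ∉ Ico (-T) (-0) := fun h => by
          have := h.2
          rw [neg_zero] at this
          linarith
        have h2 : t ∉ Ioo (S.entryTime z) b := fun h => not_lt.2 htb h.2
        rw [indicator_of_notMem h2,
          pastWeight, indicator_of_notMem h1, zero_smul]
    · rw [orbitTerm, indicator_of_notMem (mt hiff.1 hD)]
      have h1 : Φ.alongOrbit h z t = 0 := indicator_of_notMem hD _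
      rw [indicator_apply, h1, ite_self]
  have hle : S.entryTime z ≤ b := csInf_le (hnt z hz).2 hb
  rw [orbitIntegral, ← integral_sub_right_eq_self _ b]
  simp only [hterm]
  rw [integral_indicator measurableSet_Ioo, intervalIntegral.integral_of_le hle,
    integral_Ioc_eq_integral_Ioo]

theorem orbitIntegral_eq (hnt : S.NonTrapping)
    (hT : ∀ z ∈ S.closedBundle, ∀ t ∈ S.residence z, |t| ≤ T) (hz : z ∈ S.closedBundle) :
    Φ.orbitIntegral (pastWeight 0 T) h z = ∫ t in S.entryTime z..0, Φ.alongOrbit h z t := by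
  have h1 := Φ.orbitIntegral_map (h := h) hnt hT hz (zero_mem_residence hz)
  rwa [Φ.map_zero] at h1

theorem alongOrbit_of_mem (hz : z ∈ S.closedBundle) {t : ℝ}
    (ht : t ∈ Ioo (S.entryTime z) (S.exitTime z)) : Φ.alongOrbit h z t = h (Φ t z) :=
  indicator_of_mem (s := S.orbitDomain) (a := (z, t)) ⟨hz, ht⟩ _

/-- Along a trajectory on which it is integrable, an orbit integral is a primitive. -/
theorem orbitIntegral_sub (hnt : S.NonTrapping)
    (hT : ∀ z ∈ S.closedBundle, ∀ t ∈ S.residence z, |t| ≤ T) (hz : z ∈ S.closedBundle)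
    (hi : Integrable (Φ.alongOrbit h z))
    (hg : ∀ᵐ s : ℝ, (z, s) ∈ S.orbitDomain → g (Φ s z) = h (Φ s z)) {a b : ℝ}
    (ha : a ∈ Ioo (S.entryTime z) (S.exitTime z)) (hb : b ∈ Ioo (S.entryTime z) (S.exitTime z)) :
    IntervalIntegrable (fun t => g (S.flow z t)) volume a b ∧
      Φ.orbitIntegral (pastWeight 0 T) h (Φ b z) - Φ.orbitIntegral (pastWeight 0 T) h (Φ a z) =
        ∫ t in a..b, g (S.flow z t) := by
  have hae : ∀ᵐ t : ℝ, t ∈ uIoc a b → Φ.alongOrbit h z t = g (S.flow z t) := by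
    filter_upwards [hg] with t ht hmem
    have h1 : t ∈ Ioo (S.entryTime z) (S.exitTime z) :=
      ordConnected_Ioo.uIcc_subset ha hb (uIoc_subset_uIcc hmem)
    rw [Φ.alongOrbit_of_mem hz h1, Φ.flow_eq_of_mem_residence hz (Ioo_subset_residence hnt hz h1),
      ht ⟨hz, h1⟩]
  refine ⟨?_, ?_⟩
  · exact (hi.intervalIntegrable (a := a) (b := b)).congr_ae
      ((ae_restrict_iff' measurableSet_uIoc).2 hae)
  · rw [Φ.orbitIntegral_map hnt hT hz (Ioo_subset_residence hnt hz hb),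
      Φ.orbitIntegral_map hnt hT hz (Ioo_subset_residence hnt hz ha),
      intervalIntegral.integral_interval_sub_left hi.intervalIntegrable hi.intervalIntegrable]
    exact intervalIntegral.integral_congr_ae hae

theorem tendsto_primitive {f : ℝ → 𝕜} (hf : Integrable f) (a b : ℝ) :
    Tendsto (fun t => ∫ s in a..t, f s) (𝓝 b) (𝓝 (∫ s in a..b, f s)) :=
  (intervalIntegral.continuous_primitive (fun _ _ => hf.intervalIntegrable) a).tendsto b

/-- The orbit integral vanishes at the incoming boundary. -/
theorem tendsto_orbitIntegral_incoming (hnt : S.NonTrapping)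
    (hT : ∀ z ∈ S.closedBundle, ∀ t ∈ S.residence z, |t| ≤ T) (hz : z ∈ S.incomingSet)
    (hi : Integrable (Φ.alongOrbit h z)) :
    Tendsto (fun t => Φ.orbitIntegral (pastWeight 0 T) h (S.flow z t)) (𝓝[>] 0) (𝓝 0) := by
  have hcz := incomingSet_subset hz
  have hen := exitTime_of_mem_incomingSet hnt hz
  have h1 := (tendsto_primitive hi 0 0).mono_left (nhdsWithin_le_nhds (s := Ioi 0))
  rw [intervalIntegral.integral_same] at h1
  refine h1.congr' ?_
  filter_upwards [Ioo_mem_nhdsGT hen.2] with t ht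
  have hmem : t ∈ S.residence z :=
    Ioo_subset_residence hnt hcz ⟨by rw [hen.1]; exact ht.1, ht.2⟩
  rw [Φ.flow_eq_of_mem_residence hcz hmem, Φ.orbitIntegral_map hnt hT hcz hmem, hen.1]

/-- The orbit integral extends to the outgoing boundary. -/
theorem tendsto_orbitIntegral_outgoing (hnt : S.NonTrapping)
    (hT : ∀ z ∈ S.closedBundle, ∀ t ∈ S.residence z, |t| ≤ T) (hz : z ∈ S.outgoingSet)
    (hi : Integrable (Φ.alongOrbit h z)) :
    Tendsto (fun t => Φ.orbitIntegral (pastWeight 0 T) h (Φ t z)) (𝓝[<] 0)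
      (𝓝 (Φ.orbitIntegral (pastWeight 0 T) h z)) := by
  have hcz := outgoingSet_subset hz
  have hex := exitTime_of_mem_outgoingSet hnt hz
  have h1 := (tendsto_primitive hi (S.entryTime z) 0).mono_left (nhdsWithin_le_nhds (s := Iio 0))
  rw [Φ.orbitIntegral_eq hnt hT hcz]
  refine h1.congr' ?_
  filter_upwards [Ioo_mem_nhdsLT hex.1] with t ht
  have hmem : t ∈ S.residence z :=
    Ioo_subset_residence hnt hcz ⟨ht.1, by rw [hex.2]; exact ht.2⟩
  rw [Φ.orbitIntegral_map hnt hT hcz hmem]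

/-- A function with a given transport derivative that vanishes at the incoming boundary is an
orbit integral. -/
theorem ae_eq_orbitIntegral (hn : n ≠ 0) (hconv : S.StrictlyConvexBoundary) (hnt : S.NonTrapping)
    (hT : ∀ z ∈ S.closedBundle, ∀ t ∈ S.residence z, |t| ≤ T) (hh : MemLp h 2 S.bulk)
    (hgh : g =ᵐ[S.bulk] h) (hw : S.HasTransportDeriv w g) (hin : S.HasIncomingTrace w 0) :
    ∀ᵐ z ∂S.bulk, ∀ b ∈ Ioo (S.entryTime z) (S.exitTime z),
      w (Φ b z) = Φ.orbitIntegral (pastWeight 0 T) h (Φ b z) := by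
  have hOB := Φ.orbitBound_bulk hn hconv hnt
  filter_upwards [ae_mem_bundle (S := S), hw, Φ.ae_entry hn hconv hnt hin,
    OrbitBound.ae_integrable Φ hOB hnt hh, OrbitBound.ae_orbit Φ hOB hnt hgh]
    with z hz hwz hinz hiz hgz b hb
  replace hiz : Integrable (Φ.alongOrbit h z) := hiz
  have hcz := bundle_Ω_subset hz
  have hlt := entryTime_neg_exitTime_pos hnt hz
  have hres : S.residence z = Icc (S.entryTime z) (S.exitTime z) := residence_eq hnt hcz
  have hen : S.entryTime z ∈ S.residence z := by
    rw [hres]; exact ⟨le_rfl, (hlt.1.trans hlt.2).le⟩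
  have hcen := Φ.map_mem_closedBundle hcz hen
  -- both functions have the same increments
  have h1 : ∀ a ∈ Ioo (S.entryTime z) (S.exitTime z), w (Φ b z) - w (Φ a z) =
      ∫ t in a..b, Φ.alongOrbit h z t := by
    intro a ha
    have h2 := Φ.orbitIntegral_sub hnt hT hcz hiz hgz ha hb
    have h3 := (hwz a ha b hb).2
    rw [Φ.flow_eq_of_mem_residence hcz (Ioo_subset_residence hnt hcz ha),
      Φ.flow_eq_of_mem_residence hcz (Ioo_subset_residence hnt hcz hb), ← h2.2,
      Φ.orbitIntegral_map hnt hT hcz (Ioo_subset_residence hnt hcz hb),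
      Φ.orbitIntegral_map hnt hT hcz (Ioo_subset_residence hnt hcz ha),
      intervalIntegral.integral_interval_sub_left hiz.intervalIntegrable
        hiz.intervalIntegrable] at h3
    exact h3
  have hshift : Tendsto (fun t => t + S.entryTime z) (𝓝[>] 0) (𝓝 (S.entryTime z)) := by
    have h2 : Tendsto (fun t : ℝ => t + S.entryTime z) (𝓝 0) (𝓝 (0 + S.entryTime z)) :=
      tendsto_id.add_const _
    rw [zero_add] at h2
    exact h2.mono_left nhdsWithin_le_nhds
  have hpos : 0 < S.exitTime z - S.entryTime z := by linarith [hlt.1, hlt.2]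
  -- Letting the lower end tend to the entry point, where `w` tends to zero for almost every
  -- trajectory by `ae_entry`, fixes the constant of integration.
  have h4 : Tendsto (fun t => w (Φ b z) - w (S.flow (Φ (S.entryTime z) z) t)) (𝓝[>] 0)
      (𝓝 (w (Φ b z) - 0)) := tendsto_const_nhds.sub hinz
  have h5 : Tendsto (fun t => ∫ s in (t + S.entryTime z)..b, Φ.alongOrbit h z s) (𝓝[>] 0)
      (𝓝 (∫ s in S.entryTime z..b, Φ.alongOrbit h z s)) := by
    have h6 := ((tendsto_primitive hiz b (S.entryTime z)).comp hshift).neg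
    rw [← intervalIntegral.integral_symm] at h6
    refine h6.congr fun t => ?_
    exact (intervalIntegral.integral_symm _ _).symm
  have h7 : (fun t => w (Φ b z) - w (S.flow (Φ (S.entryTime z) z) t)) =ᶠ[𝓝[>] 0]
      fun t => ∫ s in (t + S.entryTime z)..b, Φ.alongOrbit h z s := by
    filter_upwards [Ioo_mem_nhdsGT hpos] with t ht
    have h8 : t + S.entryTime z ∈ Ioo (S.entryTime z) (S.exitTime z) :=
      ⟨by linarith [ht.1], by linarith [ht.2]⟩
    rw [Φ.flow_eq_of_mem_residence hcen ((Φ.mem_residence_map_iff hcz hen).2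
      (Ioo_subset_residence hnt hcz h8)), ← Φ.map_add, h1 _ h8]
  have h9 := tendsto_nhds_unique (h4.congr' h7) h5
  rw [sub_zero] at h9
  rw [h9, Φ.orbitIntegral_map hnt hT hcz (Ioo_subset_residence hnt hcz hb)]

end CutoffFlow

end TransportSetting

/-! ### Invertibility with absorption -/

theorem isUnit_one_add_mul_of_conj {A : Type*} [Ring A] {a b r r' m : A} (hab : a * b = 1)
    (hba : b * a = 1) (hr : a * r = r' * a) (hm : a * m = m * a) (h : IsUnit (1 + r' * m)) :
    IsUnit (1 + r * m) := by
  have h1 : 1 + r * m = b * (1 + r' * m) * a := by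
    have h2 : b * (r' * m) * a = r * m := by
      calc b * (r' * m) * a = b * r' * (m * a) := by noncomm_ring
        _ = b * (r' * a) * m := by rw [← hm]; noncomm_ring
        _ = b * a * (r * m) := by rw [← hr]; noncomm_ring
        _ = r * m := by rw [hba, one_mul]
    rw [mul_add, add_mul, mul_one, hba, h2]
  rw [h1]
  exact ((⟨b, a, hba, hab⟩ : Aˣ).isUnit.mul h).mul (⟨a, b, hab, hba⟩ : Aˣ).isUnit

namespace TransportSetting

open scoped NNReal ENNReal

variable {n : ℕ} {S : TransportSetting n} {𝕜 : Type*} [RCLike 𝕜]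

namespace CutoffFlow

variable (Φ : S.CutoffFlow)

/-- An exponentially damped weight on the past. -/
noncomputable def expWeight (l T : ℝ) (s : ℝ) : ℝ := Real.exp (l * s) * pastWeight 0 T s

theorem expWeight_eq (l T : ℝ) :
    expWeight l T = (Ico (-T) 0).indicator fun s => Real.exp (l * s) := by
  funext s
  rw [expWeight, pastWeight, neg_zero]
  by_cases hs : s ∈ Ico (-T) 0
  · rw [indicator_of_mem hs, indicator_of_mem hs, Pi.one_apply, mul_one]
  · rw [indicator_of_notMem hs, indicator_of_notMem hs, mul_zero]

theorem isWeight_expWeight {l : ℝ} (hl : 0 < l) (T : ℝ) : IsWeight (expWeight l T) := by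
  rw [expWeight_eq]
  refine ⟨(by fun_prop : Measurable fun s => Real.exp (l * s)).indicator measurableSet_Ico,
    fun s => indicator_nonneg (fun _ _ => (Real.exp_pos _).le) s, 1, fun s => ?_⟩
  refine indicator_le' (fun s hs => ?_) (fun _ _ => zero_le_one) s
  exact Real.exp_le_one_iff.2 (mul_nonpos_of_nonneg_of_nonpos hl.le hs.2.le)

theorem integrable_expWeight {l : ℝ} (hl : 0 < l) (T : ℝ) : Integrable (expWeight l T) := by
  rw [expWeight_eq, integrable_indicator_iff measurableSet_Ico]
  exact (integrableOn_exp_mul_Iic hl 0).mono_set fun s hs => hs.2.le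

theorem integral_expWeight_le {l : ℝ} (hl : 0 < l) (T : ℝ) : ∫ s, expWeight l T s ≤ 1 / l := by
  rw [expWeight_eq, integral_indicator measurableSet_Ico]
  have h1 := integral_exp_mul_Iic hl 0
  rw [mul_zero, Real.exp_zero] at h1
  rw [← h1]
  exact setIntegral_mono_set (integrableOn_exp_mul_Iic hl 0)
    (Eventually.of_forall fun s => (Real.exp_pos _).le)
    (Eventually.of_forall fun s (hs : s ∈ Ico (-T) 0) => hs.2.le)

/-- The exponential of a multiple of the entry time. -/
noncomputable def entryFactor (S : TransportSetting n) (l : ℝ) (z : RSpace n × RSpace n) : ℝ :=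
  Real.exp (l * S.closedBundle.indicator S.entryTime z)

/-- The entry time drops by `s` when the point moves by time `s`, so `exp (l s)` times the factor at
the moved point is the factor at the original one. Conjugating `R` by `entryFactor` thus merely
damps the weight. -/
theorem orbitIntegral_expWeight (hnt : S.NonTrapping) (l T : ℝ) (u : RSpace n × RSpace n → 𝕜)
    (z : RSpace n × RSpace n) :
    Φ.orbitIntegral (expWeight l T) (fun z => (entryFactor S l z : 𝕜) * u z) z =
      (entryFactor S l z : 𝕜) * Φ.orbitIntegral (pastWeight 0 T) u z := by
  rw [orbitIntegral, orbitIntegral, ← integral_const_mul]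
  refine integral_congr_ae (Eventually.of_forall fun s => ?_)
  simp only [orbitTerm]
  by_cases hD : (z, s) ∈ S.orbitDomain
  · have hs := Ioo_subset_residence hnt hD.1 hD.2
    have h1 : Real.exp (l * s) * entryFactor S l (Φ s z) = entryFactor S l z := by
      rw [entryFactor, entryFactor, indicator_of_mem hD.1,
        indicator_of_mem (Φ.map_mem_closedBundle hD.1 hs), Φ.entryTime_map hnt hD.1 hs,
        ← Real.exp_add]
      congr 1
      simp only
      ring
    rw [indicator_of_mem hD, indicator_of_mem hD]
    simp only [expWeight, ← h1, RCLike.real_smul_eq_coe_mul]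
    push_cast
    ring
  · rw [indicator_of_notMem hD, indicator_of_notMem hD, mul_zero]

/-- The transport operator with absorption is invertible. -/
theorem isUnit_one_add_orbitOp_mul (hn : n ≠ 0) (hconv : S.StrictlyConvexBoundary)
    (hnt : S.NonTrapping) {T : ℝ} (R M : Lp 𝕜 2 S.bulk →L[𝕜] Lp 𝕜 2 S.bulk)
    (hR : ∀ u, R u =ᵐ[S.bulk] Φ.orbitIntegral (pastWeight 0 T) u)
    {b : RSpace n × RSpace n → 𝕜} (hM : ∀ u, M u =ᵐ[S.bulk] fun z => b z * u z) :
    IsUnit (1 + R * M) := by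
  obtain ⟨C, hC0, hC⟩ := Φ.exists_orbitOp (𝕜 := 𝕜) hn hconv hnt
  obtain ⟨T₀, -, hT₀⟩ := exists_residence_bound hnt
  have hOB := Φ.orbitBound_bulk hn hconv hnt
  -- The damped weight has integral at most `1 / l`, so the conjugated operator times `M` has norm
  -- at most `C * ‖M‖ / l < 1` and a Neumann series applies.
  obtain ⟨l, hl, hlC⟩ : ∃ l : ℝ, 0 < l ∧ C * ‖M‖ < l :=
    ⟨C * ‖M‖ + 1, by positivity, lt_add_one _⟩
  obtain ⟨R', hR', hR'n⟩ := hC (expWeight l T) (isWeight_expWeight hl T) (integrable_expWeight hl T)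
  have hmeas : Measurable (S.closedBundle.indicator S.entryTime) := measurable_indicator_entryTime hnt
  have hbd : ∀ z, |S.closedBundle.indicator S.entryTime z| ≤ |T₀| := by
    intro z
    by_cases hz : z ∈ S.closedBundle
    · rw [indicator_of_mem hz]
      refine (hT₀ z hz _ ?_).trans (le_abs_self _)
      rw [residence_eq hnt hz]
      exact ⟨le_rfl, (entryTime_le_zero hnt hz).trans (exitTime_nonneg hnt hz)⟩
    · rw [indicator_of_notMem hz, abs_zero]; exact abs_nonneg _
  have hop : ∀ l : ℝ, ∃ A : Lp 𝕜 2 S.bulk →L[𝕜] Lp 𝕜 2 S.bulk,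
      ∀ u, A u =ᵐ[S.bulk] fun z => (entryFactor S l z : 𝕜) * u z := by
    intro l
    have hm : StronglyMeasurable fun z => (entryFactor S l z : 𝕜) :=
      (RCLike.measurable_ofReal.comp (Real.measurable_exp.comp
        (hmeas.const_mul l))).stronglyMeasurable
    refine (exists_mulOp (S := S) hm (Real.exp_pos (|l| * |T₀|)).le
      (Eventually.of_forall fun z => ?_)).imp fun A hA => hA.1
    rw [entryFactor, RCLike.norm_ofReal, abs_of_pos (Real.exp_pos _), Real.exp_le_exp]
    refine (le_abs_self _).trans ?_
    rw [abs_mul]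
    exact mul_le_mul_of_nonneg_left (hbd z) (abs_nonneg l)
  obtain ⟨A, hA⟩ := hop l
  obtain ⟨B, hB⟩ := hop (-l)
  have hone : ∀ z, (entryFactor S l z : 𝕜) * (entryFactor S (-l) z : 𝕜) = 1 := by
    intro z
    rw [← RCLike.ofReal_mul, entryFactor, entryFactor, ← Real.exp_add, neg_mul, add_neg_cancel,
      Real.exp_zero, RCLike.ofReal_one]
  have hAB : A * B = 1 := by
    ext1 u
    refine Lp.ext ?_
    filter_upwards [hA (B u), hB u] with z h1 h2
    change A (B u) z = u z
    rw [h1, h2, ← mul_assoc, hone, one_mul]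
  have hBA : B * A = 1 := by
    ext1 u
    refine Lp.ext ?_
    filter_upwards [hB (A u), hA u] with z h1 h2
    change B (A u) z = u z
    rw [h1, h2, mul_left_comm, ← mul_assoc, hone, one_mul]
  have hAR : A * R = R' * A := by
    ext1 u
    refine Lp.ext ?_
    filter_upwards [hA (R u), hR u, hR' (A u), Φ.orbitIntegral_congr (w := expWeight l T) hOB hnt
      (hA u)] with z h1 h2 h3 h4
    change A (R u) z = R' (A u) z
    rw [h1, h2, h3, h4, Φ.orbitIntegral_expWeight hnt]
  have hAM : A * M = M * A := by
    ext1 u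
    refine Lp.ext ?_
    filter_upwards [hA (M u), hM u, hM (A u), hA u] with z h1 h2 h3 h4
    change A (M u) z = M (A u) z
    rw [h1, h2, h3, h4, mul_left_comm]
  refine isUnit_one_add_mul_of_conj hAB hBA hAR hAM ?_
  have hlt : ‖-(R' * M)‖ < 1 := by
    rw [norm_neg]
    calc ‖R' * M‖ ≤ ‖R'‖ * ‖M‖ := norm_mul_le _ _
      _ ≤ C * (1 / l) * ‖M‖ := by
          gcongr
          exact hR'n.trans (mul_le_mul_of_nonneg_left (integral_expWeight_le hl T) hC0)
      _ = C * ‖M‖ / l := by ring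
      _ < 1 := (div_lt_one hl).2 hlC
  have h5 := isUnit_one_sub_of_norm_lt_one hlt
  rwa [sub_neg_eq_add] at h5

/-! ### Solutions and measurements -/

variable {σ : C(S.closedBundle, 𝕜)} {k : C(S.closedBundle₂, 𝕜)} {T : ℝ}
  {R M K : Lp 𝕜 2 S.bulk →L[𝕜] Lp 𝕜 2 S.bulk}

theorem transport_rhs_ae_eq (hM : ∀ u, M u =ᵐ[S.bulk] fun z => extendByZero σ z * u z)
    (hK : ∀ u, K u =ᵐ[S.bulk] S.scattering k u) {w : RSpace n × RSpace n → 𝕜}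
    {u f : Lp 𝕜 2 S.bulk} (hw : w =ᵐ[S.bulk] u) :
    (fun z => S.scattering k w z + f z - extendByZero σ z * w z) =ᵐ[S.bulk]
      ⇑(K u - M u + f) := by
  filter_upwards [hM u, hK u, hw, scattering_congr k hw, Lp.coeFn_add (K u - M u) f,
    Lp.coeFn_sub (K u) (M u)] with z h1 h2 h3 h4 h5 h6
  rw [h5, Pi.add_apply, h6, Pi.sub_apply, h1, h2, h3, h4]
  ring

/-- A square integrable solution is a fixed point. -/
theorem eq_orbitOp_of_solvesTransport (hn : n ≠ 0) (hconv : S.StrictlyConvexBoundary)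
    (hnt : S.NonTrapping) (hT : ∀ z ∈ S.closedBundle, ∀ t ∈ S.residence z, |t| ≤ T)
    (hR : ∀ u, R u =ᵐ[S.bulk] Φ.orbitIntegral (pastWeight 0 T) u)
    (hM : ∀ u, M u =ᵐ[S.bulk] fun z => extendByZero σ z * u z)
    (hK : ∀ u, K u =ᵐ[S.bulk] S.scattering k u) {w : RSpace n × RSpace n → 𝕜}
    {u f : Lp 𝕜 2 S.bulk} (hw : w =ᵐ[S.bulk] u) (hs : S.SolvesTransport σ k f w) :
    u = R (K u - M u + f) := by
  refine Lp.ext ?_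
  filter_upwards [Φ.ae_eq_orbitIntegral hn hconv hnt hT (Lp.memLp (K u - M u + f))
    (transport_rhs_ae_eq hM hK hw) hs.equation hs.incoming, hR (K u - M u + f), hw,
    ae_mem_bundle (S := S)] with z h1 h2 h3 h4
  have h5 := h1 0 (entryTime_neg_exitTime_pos hnt h4)
  rw [Φ.map_zero] at h5
  rw [h2, ← h5, h3]

/-- An arbitrary representative of `u` need not be regular along any trajectory; the orbit integral
is the right one, being a primitive on every trajectory where the integrand is integrable and
tending to zero at the entry point. -/
theorem exists_solvesTransport (hn : n ≠ 0) (hconv : S.StrictlyConvexBoundary)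
    (hnt : S.NonTrapping) (hT : ∀ z ∈ S.closedBundle, ∀ t ∈ S.residence z, |t| ≤ T)
    (hR : ∀ u, R u =ᵐ[S.bulk] Φ.orbitIntegral (pastWeight 0 T) u)
    (hM : ∀ u, M u =ᵐ[S.bulk] fun z => extendByZero σ z * u z)
    (hK : ∀ u, K u =ᵐ[S.bulk] S.scattering k u) {u f : Lp 𝕜 2 S.bulk}
    (hu : u = R (K u - M u + f)) :
    ∃ w : RSpace n × RSpace n → 𝕜, w =ᵐ[S.bulk] u ∧ S.SolvesTransport σ k f w := by
  set h := K u - M u + f with hh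
  have hw : Φ.orbitIntegral (pastWeight 0 T) h =ᵐ[S.bulk] u := by
    have h1 := hR h
    rw [← hu] at h1
    exact h1.symm
  have hg := transport_rhs_ae_eq (f := f) hM hK hw
  have hOB := Φ.orbitBound_bulk hn hconv hnt
  refine ⟨Φ.orbitIntegral (pastWeight 0 T) h, hw, ?_, ?_⟩
  · filter_upwards [ae_mem_bundle (S := S), OrbitBound.ae_integrable Φ hOB hnt (Lp.memLp h),
      OrbitBound.ae_orbit Φ hOB hnt hg] with z hz hi hgz a ha b hb
    have hcz := bundle_Ω_subset hz
    have h1 := Φ.orbitIntegral_sub (g := fun z => S.scattering k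
      (Φ.orbitIntegral (pastWeight 0 T) h) z + f z - extendByZero σ z *
      Φ.orbitIntegral (pastWeight 0 T) h z) hnt hT hcz hi hgz ha hb
    rwa [Φ.flow_eq_of_mem_residence hcz (Ioo_subset_residence hnt hcz ha),
      Φ.flow_eq_of_mem_residence hcz (Ioo_subset_residence hnt hcz hb)]
  · have hmem : ∀ᵐ z ∂S.ξIn, z ∈ S.incomingSet := ae_restrict_mem (by
      rw [incomingSet_eq]; exact measurableSet_boundarySet _)
    filter_upwards [hmem, OrbitBound.ae_integrable Φ (Φ.orbitBound_ξIn hn hconv hnt) hnt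
      (Lp.memLp h)] with z hz hi
    exact Φ.tendsto_orbitIntegral_incoming hnt hT hz hi

/-- The outgoing boundary value of a solution is an orbit integral. -/
theorem hasOutgoingTrace (hn : n ≠ 0) (hconv : S.StrictlyConvexBoundary)
    (hnt : S.NonTrapping) (hT : ∀ z ∈ S.closedBundle, ∀ t ∈ S.residence z, |t| ≤ T)
    (hM : ∀ u, M u =ᵐ[S.bulk] fun z => extendByZero σ z * u z)
    (hK : ∀ u, K u =ᵐ[S.bulk] S.scattering k u) {w : RSpace n × RSpace n → 𝕜}
    {u f : Lp 𝕜 2 S.bulk} (hw : w =ᵐ[S.bulk] u) (hs : S.SolvesTransport σ k f w) :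
    S.HasOutgoingTrace w (Φ.orbitIntegral (pastWeight 0 T) ⇑(K u - M u + f)) := by
  have hOB := Φ.orbitBound_ξOut hn hconv hnt
  have h1 := Φ.ae_eq_orbitIntegral hn hconv hnt hT (Lp.memLp (K u - M u + f))
    (transport_rhs_ae_eq hM hK hw) hs.equation hs.incoming
  have hmem : ∀ᵐ z ∂S.ξOut, z ∈ S.outgoingSet := ae_restrict_mem (by
      rw [outgoingSet_eq]; exact measurableSet_boundarySet _)
  filter_upwards [hmem, OrbitBound.ae_integrable Φ hOB hnt (Lp.memLp (K u - M u + f)),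
    OrbitBound.ae_orbit Φ hOB hnt h1] with z hz hi hz1
  have hcz := outgoingSet_subset hz
  have hex := exitTime_of_mem_outgoingSet hnt hz
  -- The identity between `w` and the orbit integral is known along trajectories of almost every
  -- interior point. The orbit bound for `ξOut` supplies one such point on almost every trajectory
  -- ending at the outgoing boundary, and one point suffices for the whole trajectory.
  obtain ⟨s, hs, hs1⟩ : ∃ s ∈ Ioo (S.entryTime z) 0, (z, s) ∈ S.orbitDomain →
      ∀ b ∈ Ioo (S.entryTime (Φ s z)) (S.exitTime (Φ s z)), w (Φ b (Φ s z)) =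
        Φ.orbitIntegral (pastWeight 0 T) ⇑(K u - M u + f) (Φ b (Φ s z)) := by
    have hpos : volume (Ioo (S.entryTime z) 0) ≠ 0 := by
      rw [Real.volume_Ioo]
      simpa using hex.1
    obtain ⟨s, hs, hs'⟩ := ((frequently_ae_mem_iff.2 hpos).and_eventually hz1).exists
    exact ⟨s, hs, hs'⟩
  have hsD : s ∈ Ioo (S.entryTime z) (S.exitTime z) := by rw [hex.2]; exact hs
  have hsr := Ioo_subset_residence hnt hcz hsD
  refine (Φ.tendsto_orbitIntegral_outgoing hnt hT hz hi).congr' ?_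
  filter_upwards [Ioo_mem_nhdsLT hex.1] with t ht
  have htD : t ∈ Ioo (S.entryTime z) (S.exitTime z) := by rw [hex.2]; exact ht
  have h2 := hs1 ⟨hcz, hsD⟩ (t - s) (by
    rw [Φ.entryTime_map hnt hcz hsr, Φ.exitTime_map hnt hcz hsr]
    exact ⟨by linarith [htD.1], by linarith [htD.2]⟩)
  rw [← Φ.map_add, sub_add_cancel] at h2
  rw [Φ.flow_eq_of_mem_residence hcz (Ioo_subset_residence hnt hcz htD), h2]

end CutoffFlow

end TransportSetting

/-! ### Well-posedness and measurement -/

namespace TransportSetting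

open scoped NNReal ENNReal

variable {n : ℕ} {S : TransportSetting n} {𝕜 : Type*} [RCLike 𝕜]

namespace CutoffFlow

variable (Φ : S.CutoffFlow) {σ : C(S.closedBundle, 𝕜)} {k : C(S.closedBundle₂, 𝕜)} {T : ℝ}
  {R M K : Lp 𝕜 2 S.bulk →L[𝕜] Lp 𝕜 2 S.bulk}

theorem isSolution_iff (hn : n ≠ 0) (hconv : S.StrictlyConvexBoundary)
    (hnt : S.NonTrapping) (hT : ∀ z ∈ S.closedBundle, ∀ t ∈ S.residence z, |t| ≤ T)
    (hR : ∀ u, R u =ᵐ[S.bulk] Φ.orbitIntegral (pastWeight 0 T) u)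
    (hM : ∀ u, M u =ᵐ[S.bulk] fun z => extendByZero σ z * u z)
    (hK : ∀ u, K u =ᵐ[S.bulk] S.scattering k u) (f u : Lp 𝕜 2 S.bulk) :
    S.IsSolution σ k f u ↔ (1 - R * (K - M)) u = R f := by
  have h1 : (1 - R * (K - M)) u = R f ↔ u = R (K u - M u + f) := by
    change u - R (K u - M u) = R f ↔ _
    rw [_root_.map_add, sub_eq_iff_eq_add, add_comm]
  rw [h1]
  exact ⟨fun ⟨w, hw, hs⟩ => Φ.eq_orbitOp_of_solvesTransport hn hconv hnt hT hR hM hK hw hs,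
    fun hu => Φ.exists_solvesTransport hn hconv hnt hT hR hM hK hu⟩

/-- The measurement operator, given the solution operator. -/
theorem exists_measurementOp (hn : n ≠ 0) (hconv : S.StrictlyConvexBoundary)
    (hnt : S.NonTrapping) (hT : ∀ z ∈ S.closedBundle, ∀ t ∈ S.residence z, |t| ≤ T)
    (hM : ∀ u, M u =ᵐ[S.bulk] fun z => extendByZero σ z * u z)
    (hK : ∀ u, K u =ᵐ[S.bulk] S.scattering k u) (V : Lp 𝕜 2 S.bulk →L[𝕜] Lp 𝕜 2 S.bulk)
    (hV : ∀ f u, S.IsSolution σ k f u ↔ u = V f) :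
    ∃ A : Lp 𝕜 2 S.bulk →L[𝕜] Lp 𝕜 2 S.ξOut, ∀ f g, S.IsMeasurement σ k f g ↔ A f = g := by
  obtain ⟨Φ⟩ := S.nonempty_cutoffFlow
  obtain ⟨Q, hQ⟩ := Φ.exists_orbitOp_of_orbitBound (𝕜 := 𝕜) (Φ.orbitBound_ξOut hn hconv hnt) hnt
    (isWeight_pastWeight 0 T) (integrable_pastWeight 0 T)
  have htrace : ∀ f (w : RSpace n × RSpace n → 𝕜), w =ᵐ[S.bulk] V f → S.SolvesTransport σ k f w →
      S.HasOutgoingTrace w (Q (K (V f) - M (V f) + f)) := by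
    intro f w hw hs
    filter_upwards [Φ.hasOutgoingTrace hn hconv hnt hT hM hK hw hs,
      hQ (K (V f) - M (V f) + f)] with z h1 h2
    rwa [h2]
  -- The boundary value is the orbit integral of the full right-hand side, with the solution
  -- operator `V` inserted for the unknown.
  refine ⟨Q ∘L ((K - M) ∘L V + ContinuousLinearMap.id 𝕜 _), fun f g => ?_⟩
  change _ ↔ Q (K (V f) - M (V f) + f) = g
  constructor
  · rintro ⟨w, hw, hs, hg⟩
    have hwu : w =ᵐ[S.bulk] hw.toLp w := hw.coeFn_toLp.symm
    have hu := (hV f (hw.toLp w)).1 ⟨w, hwu, hs⟩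
    rw [hu] at hwu
    refine Lp.ext ?_
    filter_upwards [htrace f w hwu hs, hg, ae_restrict_mem (μ := S.ξ) (s := S.outgoingSet)
      (by rw [outgoingSet_eq]; exact measurableSet_boundarySet _)] with z h1 h2 _
    exact tendsto_nhds_unique h1 h2
  · rintro rfl
    obtain ⟨w, hw, hs⟩ := (hV f (V f)).2 rfl
    exact ⟨w, (Lp.memLp (V f)).ae_eq hw.symm, hs, htrace f w hw hs⟩

end CutoffFlow

end TransportSetting

theorem mainTheorem2 {𝕜 : Type*} [RCLike 𝕜] {n : ℕ} (hn : 2 ≤ n) (S : TransportSetting n)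
    (hconv : S.StrictlyConvexBoundary) (hnt : S.NonTrapping) :
    ∃ U : Set (C(S.closedBundle, 𝕜) × C(S.closedBundle₂, 𝕜)),
      IsOpen U ∧ Dense U ∧ U ∈ 𝓝 0 ∧
      ∀ σ k, (σ, k) ∈ U →
        (∀ f : Lp 𝕜 2 S.bulk, ∃! u : Lp 𝕜 2 S.bulk, S.IsSolution σ k f u) ∧
        ∃ A : Lp 𝕜 2 S.bulk →L[𝕜] Lp 𝕜 2 S.ξOut,
          ∀ f g, S.IsMeasurement σ k f g ↔ A f = g := by
  have hn0 : n ≠ 0 := by omega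
  obtain ⟨Φ⟩ := S.nonempty_cutoffFlow
  obtain ⟨C, hC0, hC⟩ := Φ.exists_orbitOp (𝕜 := 𝕜) hn0 hconv hnt
  obtain ⟨T₀, -, hT₀⟩ := TransportSetting.exists_residence_bound hnt
  obtain ⟨K, hK⟩ := TransportSetting.exists_scatteringOp (𝕜 := 𝕜) S
  obtain ⟨M, hM, -⟩ := TransportSetting.exists_absorptionOp (𝕜 := 𝕜) S
  choose Rw hRw hRn using hC
  let Rab : ℝ → ℝ → Lp 𝕜 2 S.bulk →L[𝕜] Lp 𝕜 2 S.bulk := fun a b =>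
    Rw _ (TransportSetting.CutoffFlow.isWeight_pastWeight a b)
      (TransportSetting.CutoffFlow.integrable_pastWeight a b)
  have hRab : ∀ a b u, Rab a b u =ᵐ[S.bulk]
      Φ.orbitIntegral (TransportSetting.CutoffFlow.pastWeight a b) u := fun a b u => hRw _ _ _ u
  have hRabC : ∀ a b, a ≤ b → ‖Rab a b‖ ≤ C * (b - a) := fun a b hab => by
    rw [← TransportSetting.CutoffFlow.integral_pastWeight hab]
    exact hRn _ _ _
  obtain ⟨T, hT₀T, -, hcpt⟩ := Φ.exists_tendsto_orbitOp_scattering hn0 hconv hnt hRab hC0 hRabC T₀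
  have hT : ∀ z ∈ S.closedBundle, ∀ t ∈ S.residence z, |t| ≤ T := fun z hz t ht =>
    (hT₀ z hz t ht).trans hT₀T
  set R := Rab 0 T
  have hR : ∀ u, R u =ᵐ[S.bulk]
      Φ.orbitIntegral (TransportSetting.CutoffFlow.pastWeight 0 T) u := hRab 0 T
  let L : C(S.closedBundle, 𝕜) × C(S.closedBundle₂, 𝕜) → Lp 𝕜 2 S.bulk →L[𝕜] Lp 𝕜 2 S.bulk :=
    fun p => 1 - R * (K p.2 - M p.1)
  have hL : Continuous L := continuous_const.sub (continuous_const.mul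
    ((K.continuous.comp continuous_snd).sub (M.continuous.comp continuous_fst)))
  have hopen : IsOpen (L ⁻¹' {x | IsUnit x}) := Units.isOpen.preimage hL
  refine ⟨L ⁻¹' {x | IsUnit x}, hopen, ?_, ?_, ?_⟩
  -- Only the scattering kernel is perturbed, by a real factor close to 1; σ is kept, since
  -- absorption alone is never an obstruction.
  · refine Metric.dense_iff.2 fun p r hr => ?_
    obtain ⟨σ, k⟩ := p
    obtain ⟨W, hW⟩ := Φ.isUnit_one_add_orbitOp_mul hn0 hconv hnt R (M σ) hR (hM σ)
    let G : Lp 𝕜 2 S.bulk →L[𝕜] Lp 𝕜 2 S.bulk := ↑W⁻¹ * (R * K k)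
    have hG : ∀ e : ℕ → Lp 𝕜 2 S.bulk, Orthonormal 𝕜 e →
        Tendsto (fun i => G (e i)) atTop (𝓝 0) := by
      intro e he
      have h1 := ((↑W⁻¹ : Lp 𝕜 2 S.bulk →L[𝕜] Lp 𝕜 2 S.bulk).continuous.tendsto 0).comp
        (hcpt k (K k) (hK k) e he)
      rwa [map_zero] at h1
    obtain ⟨l, hl, hunit⟩ := exists_isUnit_one_sub_smul G hG
      -- The added 1 covers `k = 0`.
      (show 0 < r / (‖k‖ + 1) by positivity)
    refine ⟨(σ, (l : 𝕜) • k), ?_, ?_⟩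
    · rw [Metric.mem_ball, Prod.dist_eq, dist_self, max_lt_iff]
      refine ⟨hr, ?_⟩
      have h1 : (l : 𝕜) • k - k = ((l - 1 : ℝ) : 𝕜) • k := by
        push_cast
        rw [sub_smul, one_smul]
      rw [dist_eq_norm, h1, norm_smul, RCLike.norm_ofReal]
      calc |l - 1| * ‖k‖ ≤ |l - 1| * (‖k‖ + 1) := by gcongr; linarith
        _ < r / (‖k‖ + 1) * (‖k‖ + 1) := by gcongr
        _ = r := by field_simp
    -- Factoring out the invertible absorption part leaves `1 - l G`, with `G` tending to zero along
    -- orthonormal sequences because `R K` does.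
    · have h2 : L (σ, (l : 𝕜) • k) = (1 + R * M σ) * (1 - (l : 𝕜) • G) := by
        have hWG : (1 + R * M σ) * G = R * K k := by
          rw [← hW]
          exact W.mul_inv_cancel_left _
        simp only [L]
        rw [mul_sub (1 + R * M σ), mul_one, mul_smul_comm, hWG, map_smul, mul_sub, mul_smul_comm]
        abel
      change IsUnit _
      rw [h2, ← hW]
      exact W.isUnit.mul hunit
  · refine hopen.mem_nhds ?_
    change IsUnit (L 0)
    simp only [L, Prod.fst_zero, Prod.snd_zero, map_zero, sub_zero, mul_zero]
    exact isUnit_one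
  · rintro σ k ⟨W, hW⟩
    have hsol : ∀ f u, S.IsSolution σ k f u ↔
        u = ((↑W⁻¹ : Lp 𝕜 2 S.bulk →L[𝕜] Lp 𝕜 2 S.bulk) ∘L R) f := by
      intro f u
      rw [Φ.isSolution_iff hn0 hconv hnt hT hR (hM σ) (hK k)]
      change L (σ, k) u = R f ↔ u = (↑W⁻¹ : Lp 𝕜 2 S.bulk →L[𝕜] Lp 𝕜 2 S.bulk) (R f)
      rw [← hW]
      constructor
      · intro h
        rw [← h]
        exact (congrArg (fun A : Lp 𝕜 2 S.bulk →L[𝕜] Lp 𝕜 2 S.bulk => A u) W.inv_mul).symm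
      · rintro rfl
        exact congrArg (fun A : Lp 𝕜 2 S.bulk →L[𝕜] Lp 𝕜 2 S.bulk => A (R f)) W.mul_inv
    exact ⟨fun f => ⟨_, (hsol f _).2 rfl, fun u hu => (hsol f u).1 hu⟩,
      TransportSetting.CutoffFlow.exists_measurementOp hn0 hconv hnt hT (hM σ) (hK k) _ hsol⟩
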